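/- Let $L\ge 1$ be a fixed integer, let $(M(N))_{N\ge1}$ be positive integers such that $c_N=\frac{M(N)L}{N}\to c_*$ as $N\to\infty$ for some $c_*>0$, and let $R_N$ be Hermitian $M(N)\times M(N)$ matrices such that $a I\le R_N<b I$ for all $N\ge1$, where $a,b>0$ do not depend on $N$. On a probability space let, for each $N\ge1$, $(\xi_{n})_{n\ge1}=(\xi_{n,N})_{n\ge 1}$ be random vectors in $\mathbb{C}^{M(N)}$ all of whose components are i.i.d. standard complex Gaussian variables (the real and imaginary parts are i.i.d. $\mathcal N(0,1/2)$); nothing is assumed on the joint law for different values of $N$. Put $y_n=R_N^{1/2}\xi_n$, and let $W_{p,N}$ and $W_{f,N}$ be the $ML\times N$ block-Hankel matrices whose $M\times1$ blocks at position $(i,j)$, $1\le i\le L$, $1\le j\le N$, are $\frac1{\sqrt N}y_{i+j-1}$ and $\frac1{\sqrt N}y_{L+i+j-1}$ respectively. Let $\hat\nu_N=\frac1{ML}\sum_{k=1}^{ML}\delta_{\hat\lambda_{k,N}}$ be the empirical eigenvalue distribution of the $ML\times ML$ matrix $W_{f,N}W_{p,N}^*W_{p,N}W_{f,N}^*$.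 Then the following holds. (i) For every $N\ge1$ and every $z$ in the open upper half-plane $\mathbb{C}^+$ there is a unique $t=t_N(z)\in\mathbb{C}^+$ with $zt\in\mathbb{C}^+$ and $$t=\frac1M\mathrm{Tr}\,R_N\Big(-zI_M-\frac{zc_Nt}{1-zc_N^2t^2}R_N\Big)^{-1};$$ there is a unique positive finite $M\times M$ matrix-valued measure $\nu_N^T$ carried by $\mathbb{R}^+=[0,\infty)$ such that $$T_N(z):=-\Big(zI_M+\frac{zc_Nt_N(z)}{1-zc_N^2t_N(z)^2}R_N\Big)^{-1}=\int_{\mathbb{R}^+}\frac{d\nu_N^T(\lambda)}{\lambda-z},\qquad z\in\mathbb{C}^+;$$ and $\nu_N:=\frac1M\mathrm{Tr}\,\nu_N^T$ is a probability measure. (ii) Almost surely, $\hat\nu_N-\nu_N\to0$ weakly as $N\to\infty$, that is, almost surely, $\int f\,d\hat\nu_N-\int f\,d\nu_N\to0$ for every bounded continuous $f:\mathbb{R}\to\mathbb{R}$. -/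

import Mathlib

open MeasureTheory ProbabilityTheory Filter Topology Matrix
open scoped BoundedContinuousFunction MatrixOrder ComplexOrder

namespace PastFuture

/-! ### The random matrices -/

/-- `(ζ k)` is an i.i.d. family of standard complex Gaussian variables: all the real and imaginary
parts together form a family of independent `𝒩(0, 1/2)` real variables. -/
def IsStdComplexGaussianFamily {Ω ι : Type*} [MeasurableSpace Ω] (P : Measure Ω)
    (ζ : ι → Ω → ℂ) : Prop :=
  (∀ k, HasLaw (fun ω => (ζ k ω).re) (gaussianReal 0 (1 / 2)) P) ∧
  (∀ k, HasLaw (fun ω => (ζ k ω).im) (gaussianReal 0 (1 / 2)) P) ∧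
  iIndepFun (Sum.elim (fun k ω => (ζ k ω).re) (fun k ω => (ζ k ω).im) : ι ⊕ ι → Ω → ℝ) P

/-- `y = R^{1/2} ξ`, with the positive semidefinite square root of `R`. -/
noncomputable def colored {M : ℕ} (R : Matrix (Fin M) (Fin M) ℂ) (ξ : Fin M → ℂ) : Fin M → ℂ :=
  CFC.sqrt R *ᵥ ξ

/-- The `ML × N` block-Hankel matrix `W_p`: block `(i, j)` is `y_{i+j} / √N`. Everything is indexed
from `0`, so that `y 0` is the first vector of the sequence. -/
noncomputable def Wp {M : ℕ} (L N : ℕ) (y : ℕ → Fin M → ℂ) : Matrix (Fin L × Fin M) (Fin N) ℂ :=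
  Matrix.of fun im j => ((√(N : ℝ) : ℝ) : ℂ)⁻¹ * y ((im.1 : ℕ) + (j : ℕ)) im.2

/-- The `ML × N` block-Hankel matrix `W_f`: block `(i, j)` is `y_{L+i+j} / √N`. -/
noncomputable def Wf {M : ℕ} (L N : ℕ) (y : ℕ → Fin M → ℂ) : Matrix (Fin L × Fin M) (Fin N) ℂ :=
  Matrix.of fun im j => ((√(N : ℝ) : ℝ) : ℂ)⁻¹ * y (L + (im.1 : ℕ) + (j : ℕ)) im.2

/-- The `ML × ML` matrix `W_f W_p^* W_p W_f^*`. -/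
noncomputable def gram {M : ℕ} (L N : ℕ) (y : ℕ → Fin M → ℂ) :
    Matrix (Fin L × Fin M) (Fin L × Fin M) ℂ :=
  Wf L N y * (Wp L N y)ᴴ * Wp L N y * (Wf L N y)ᴴ

theorem gram_isHermitian {M : ℕ} (L N : ℕ) (y : ℕ → Fin M → ℂ) : (gram L N y).IsHermitian := by
  unfold gram Matrix.IsHermitian
  simp [Matrix.conjTranspose_mul, Matrix.mul_assoc]

/-- Empirical eigenvalue distribution of a Hermitian matrix (eigenvalues with multiplicity). -/
noncomputable def empiricalEigDist {n : Type*} [Fintype n] [DecidableEq n] {A : Matrix n n ℂ}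
    (hA : A.IsHermitian) : Measure ℝ :=
  (Fintype.card n : ENNReal)⁻¹ • ∑ i, Measure.dirac (hA.eigenvalues i)

/-- `ν̂_N`, as a function of the sequence `y`. -/
noncomputable def nuHat {M : ℕ} (L N : ℕ) (y : ℕ → Fin M → ℂ) : Measure ℝ :=
  empiricalEigDist (gram_isHermitian L N y)

/-! ### Positive matrix-valued measures and their Stieltjes transforms -/

/-- A finite positive `M × M` matrix-valued Borel measure on `ℝ`. -/
@[ext]
structure PosMatrixMeasure (M : ℕ) where
  /-- the underlying countably additive set function -/
  val : VectorMeasure ℝ (Matrix (Fin M) (Fin M) ℂ)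
  posSemidef : ∀ s, MeasurableSet s → (val s).PosSemidef

instance (M : ℕ) : Nonempty (PosMatrixMeasure M) :=
  ⟨⟨0, fun _ _ => by simpa using Matrix.PosSemidef.zero⟩⟩

namespace PosMatrixMeasure

variable {M : ℕ}

/-- The positive measure `s ↦ φ (μ s)`, where `φ` is a continuous additive functional that is
nonnegative on positive semidefinite matrices. -/
noncomputable def scalarize (μ : PosMatrixMeasure M) (φ : Matrix (Fin M) (Fin M) ℂ →+ ℝ)
    (hφ : Continuous φ) (hpos : ∀ A : Matrix (Fin M) (Fin M) ℂ, A.PosSemidef → 0 ≤ φ A) :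
    Measure ℝ :=
  SignedMeasure.toMeasureOfZeroLE (μ.val.mapRange φ hφ) Set.univ MeasurableSet.univ
    ((VectorMeasure.le_restrict_univ_iff_le _ _).2 fun s hs => by
      simpa using hpos _ (μ.posSemidef s hs))

/-- The functional `A ↦ x^* A x` (which is real on Hermitian matrices). -/
noncomputable def quadForm (x : Fin M → ℂ) : Matrix (Fin M) (Fin M) ℂ →+ ℝ where
  toFun A := (star x ⬝ᵥ A *ᵥ x).re
  map_zero' := by simp
  map_add' A B := by simp [Matrix.add_mulVec, dotProduct_add]

/-- The positive scalar measure `x^* μ x`. -/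
noncomputable def quad (μ : PosMatrixMeasure M) (x : Fin M → ℂ) : Measure ℝ :=
  μ.scalarize (quadForm x)
    (by
      change Continuous fun A : Matrix (Fin M) (Fin M) ℂ => (star x ⬝ᵥ A *ᵥ x).re
      fun_prop)
    fun A hA => by
      have h := hA.dotProduct_mulVec_nonneg x
      exact (Complex.le_def.1 h).1

/-- The functional `A ↦ (1/M) Tr A` (which is real on Hermitian matrices). -/
noncomputable def ntrForm : Matrix (Fin M) (Fin M) ℂ →+ ℝ where
  toFun A := (M : ℝ)⁻¹ * (A.trace).re
  map_zero' := by simp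
  map_add' A B := by simp [mul_add]

/-- The positive scalar measure `(1/M) Tr μ`. -/
noncomputable def ntr (μ : PosMatrixMeasure M) : Measure ℝ :=
  μ.scalarize ntrForm
    (by
      change Continuous fun A : Matrix (Fin M) (Fin M) ℂ => (M : ℝ)⁻¹ * (A.trace).re
      fun_prop)
    fun A hA => by
      have h := hA.trace_nonneg
      exact mul_nonneg (by positivity) (Complex.le_def.1 h).1

/-- `μ` is carried by `ℝ⁺ = [0, ∞)` and `F` is its Stieltjes transform on the upper half-plane:
`F z = ∫ (λ - z)⁻¹ dμ(λ)`, an identity of matrices which is expressed through its quadratic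
forms. -/
def HasStieltjesTransform (μ : PosMatrixMeasure M) (F : ℂ → Matrix (Fin M) (Fin M) ℂ) : Prop :=
  μ.val (Set.Iio 0) = 0 ∧
  ∀ z : ℂ, 0 < z.im → ∀ x : Fin M → ℂ,
    star x ⬝ᵥ F z *ᵥ x = ∫ l : ℝ, ((l : ℂ) - z)⁻¹ ∂(μ.quad x)

end PosMatrixMeasure

/-! ### The deterministic equivalent -/

/-- `(-z I - (z c t / (1 - z c² t²)) R)⁻¹`. -/
noncomputable def resolventOf {M : ℕ} (R : Matrix (Fin M) (Fin M) ℂ) (c : ℝ) (z t : ℂ) :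
    Matrix (Fin M) (Fin M) ℂ :=
  (-(z • (1 : Matrix (Fin M) (Fin M) ℂ)) - (z * c * t / (1 - z * (c : ℂ) ^ 2 * t ^ 2)) • R)⁻¹

/-- `t` solves the canonical equation at `z`, with `t` and `z t` in the upper half-plane. -/
def IsCanonicalSolution {M : ℕ} (R : Matrix (Fin M) (Fin M) ℂ) (c : ℝ) (z t : ℂ) : Prop :=
  0 < t.im ∧ 0 < (z * t).im ∧ t = (M : ℂ)⁻¹ * (R * resolventOf R c z t).trace

/-- `t_N(z)`: the solution of the canonical equation. -/
noncomputable def tSol {M : ℕ} (R : Matrix (Fin M) (Fin M) ℂ) (c : ℝ) (z : ℂ) : ℂ :=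
  Classical.epsilon (IsCanonicalSolution R c z)

/-- `T_N(z)`. -/
noncomputable def TMat {M : ℕ} (R : Matrix (Fin M) (Fin M) ℂ) (c : ℝ) (z : ℂ) :
    Matrix (Fin M) (Fin M) ℂ :=
  resolventOf R c z (tSol R c z)

/-- `ν_N^T`: the positive matrix-valued measure whose Stieltjes transform is `T_N`. -/
noncomputable def nuT {M : ℕ} (R : Matrix (Fin M) (Fin M) ℂ) (c : ℝ) : PosMatrixMeasure M :=
  Classical.epsilon fun μ => μ.HasStieltjesTransform (TMat R c)

/-- `ν_N = (1/M) Tr ν_N^T`. -/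
noncomputable def nu {M : ℕ} (R : Matrix (Fin M) (Fin M) ℂ) (c : ℝ) : Measure ℝ :=
  (nuT R c).ntr

/-- `c_N = M L / N`. -/
noncomputable def ratio (M L N : ℕ) : ℝ := (M : ℝ) * L / N

end PastFuture

/-! Put K = W_f W_p^*. The Hermitian matrix H with off-diagonal blocks K and K^* has, at a point w
of the open first quadrant with w² = z, a resolvent whose future-future block is w (K K^* - z)⁻¹, so
it suffices to study resolvents of H (`inv_submatrix_inl_eq`). H is quadratic in the Gaussian
vectors, but H - w is the Schur complement of a matrix that is affine in them: its diagonal blocks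
are -w and a 2×2 flip tensored with the identity, and its off-diagonal block is the block-diagonal
matrix W made of W_p and W_f (`hankelPencil`). Putting -iη on the diagonal of the flip makes this
matrix dissipative, so its inverse G is bounded by 1/η without any control of the norm of W.

Gaussian integration by parts gives base · E G = 1 + E[Σ(G) G] with a linear positive map Σ
(`Pencil.base_mul_meanRes`). Σ sees G only through finitely many traces. Changing one observation is
a perturbation of bounded rank, so these traces concentrate by bounded differences and Σ(G) can be
replaced by Σ(E G) at a cost O(N^{-1/2}) (`Pencil.norm_meanRes_sub_le`). The correlations created by
the Hankel structure disappear through symmetry: the law is invariant under y_t ↦ u^t y_t with |u| =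
1, which kills the entries of E G between indices of different weights, and time reversal exchanges
past and future. Hence Σ(E G) depends on two scalars κ and τ only (`hankelPencil_selfEnergy`), and
with s = iη + τ the Dyson equation reads κ ≈ h(s) = s/(1 - s²), τ ≈ φ(κ) = (L/N) Tr R(-w - κR)⁻¹.
Letting η be small costs only second moments of the data. The limiting equation s = φ(h(s)) is the
canonical equation in the variable s = c_N w t (`isCanonicalSolution_sq_iff`).

The equation is stable. On the upper half-plane h satisfies a Schwarz–Pick inequality, φ satisfies a
matching Cauchy–Schwarz bound, and the term Im w in Im φ leaves a definite gap, so φ∘h contracts the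
distance between an approximate and an exact fixed point, uniformly in the dimension
(`fixedPoint_stability`). This gives uniqueness and the transfer from approximate to exact
solutions. Existence comes from the random matrices themselves: replacing R by k copies of its
spectrum and N by kN does not change the equation, so approximate solutions of any accuracy exist,
and compactness provides an exact one. The same blow-up shows that each (-z - w h(s) λ_j)⁻¹, λ_j an
eigenvalue of R, is a limit of Stieltjes transforms of probability measures on [0, ∞), hence is one
itself (`exists_scalar_measure`). Assembled along an eigenbasis of R these measures form ν_N^T.

Finally, exponential concentration and Borel–Cantelli give almost sure convergence of the
differences of Stieltjes transforms on a countable dense set of z, and tightness of ν_N upgrades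
this to weak convergence (`tendsto_integral_sub_of_stieltjes`). -/

namespace PastFuture

section

/-! ### The scalar fixed point equation -/

/-- The map `s ↦ s / (1 - s²)`. -/
noncomputable def hFun (s : ℂ) : ℂ := s / (1 - s ^ 2)

/-- The map `κ ↦ r ∑ λ_k / (-w - κ λ_k)`. -/
noncomputable def phi {ι : Type*} [Fintype ι] (lam : ι → ℝ) (r : ℝ) (w κ : ℂ) : ℂ :=
  r * ∑ k, (lam k : ℂ) / (-w - κ * lam k)

/-- The quantity `r ∑ λ_k ^ j / |w + κ λ_k|²`. -/
noncomputable def absSum {ι : Type*} [Fintype ι] (lam : ι → ℝ) (r : ℝ) (w κ : ℂ) (j : ℕ) : ℝ :=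
  r * ∑ k, lam k ^ j / Complex.normSq (-w - κ * lam k)

theorem one_sub_sq_ne_zero {s : ℂ} (hs : 0 < s.im) : 1 - s ^ 2 ≠ 0 := by
  intro h
  have h' : (1 - s) * (1 + s) = 0 := by rw [← h]; ring
  rcases mul_eq_zero.1 h' with h1 | h1
  · have := congrArg Complex.im h1; simp at this; linarith
  · have := congrArg Complex.im h1; simp at this; linarith

/-- Multiply numerator and denominator by the conjugate of 1 - s². The weight v stays free because
the sector argument below needs v = w and v = w̄ besides v = 1. -/
theorem im_mul_hFun (v s : ℂ) :
    (v * hFun s).im = ((v * s).im - Complex.normSq s * (v * starRingEnd ℂ s).im) /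
      Complex.normSq (1 - s ^ 2) := by
  have : v * hFun s = (v * s - Complex.normSq s * (v * starRingEnd ℂ s)) /
      ((Complex.normSq (1 - s ^ 2) : ℝ) : ℂ) := by
    rw [hFun, div_eq_mul_inv, Complex.inv_def, Complex.normSq_eq_conj_mul_self, div_eq_mul_inv]
    simp only [map_sub, map_one, map_pow, Complex.ofReal_inv]
    ring
  rw [this, Complex.div_ofReal_im, Complex.sub_im, Complex.im_ofReal_mul]

theorem im_hFun (s : ℂ) :
    (hFun s).im = s.im * (1 + Complex.normSq s) / Complex.normSq (1 - s ^ 2) := by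
  have := im_mul_hFun 1 s
  simp only [one_mul, Complex.conj_im] at this
  rw [this]; ring

theorem im_hFun_pos {s : ℂ} (hs : 0 < s.im) : 0 < (hFun s).im := by
  rw [im_hFun]
  have := Complex.normSq_pos.2 (one_sub_sq_ne_zero hs)
  have := Complex.normSq_nonneg s
  positivity

theorem normSq_one_add_mul_le (s t : ℂ) :
    Complex.normSq (1 + s * t) ≤ (1 + Complex.normSq s) * (1 + Complex.normSq t) := by
  simp only [Complex.normSq_apply, Complex.add_re, Complex.add_im, Complex.mul_re, Complex.mul_im,
    Complex.one_re, Complex.one_im]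
  nlinarith [sq_nonneg (s.re - t.re), sq_nonneg (s.im + t.im)]

/-- The difference quotient of h is (1 + st)/((1 - s²)(1 - t²)), and |1 + st|² ≤ (1 + |s|²)(1 +
|t|²) produces exactly the factors that occur in Im h(s) and Im h(t). -/
theorem hFun_schwarzPick {s t : ℂ} (hs : 0 < s.im) (ht : 0 < t.im) :
    Complex.normSq (hFun s - hFun t) * (s.im * t.im) ≤
      Complex.normSq (s - t) * ((hFun s).im * (hFun t).im) := by
  have h1 := one_sub_sq_ne_zero hs
  have h2 := one_sub_sq_ne_zero ht
  have e : hFun s - hFun t = (s - t) * (1 + s * t) / ((1 - s ^ 2) * (1 - t ^ 2)) := by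
    rw [hFun, hFun]; field_simp; ring
  have p1 := Complex.normSq_pos.2 h1
  have p2 := Complex.normSq_pos.2 h2
  rw [e, im_hFun, im_hFun, map_div₀, map_mul, map_mul, div_mul_eq_mul_div, div_mul_div_comm,
    mul_div_assoc']
  gcongr ?_ / _
  have h3 := normSq_one_add_mul_le s t
  have h4 := Complex.normSq_nonneg (s - t)
  calc _ = Complex.normSq (s - t) * (s.im * t.im) * Complex.normSq (1 + s * t) := by ring
    _ ≤ Complex.normSq (s - t) * (s.im * t.im) *
        ((1 + Complex.normSq s) * (1 + Complex.normSq t)) := by gcongr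
    _ = _ := by ring

section

variable {ι : Type*} [Fintype ι] {lam : ι → ℝ} {r : ℝ} {w κ κ' : ℂ}

theorem neg_sub_mul_im_le (hκ : 0 ≤ κ.im) {l : ℝ} (hl : 0 ≤ l) :
    w.im ≤ -(-w - κ * l).im := by
  simp only [Complex.sub_im, Complex.neg_im, Complex.im_mul_ofReal]
  nlinarith [mul_nonneg hκ hl]

theorem neg_sub_mul_ne_zero (hw : 0 < w.im) (hκ : 0 ≤ κ.im) {l : ℝ} (hl : 0 ≤ l) :
    -w - κ * l ≠ 0 := by
  intro h
  have := neg_sub_mul_im_le (w := w) hκ hl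
  rw [h] at this; simp at this; linarith

theorem norm_inv_neg_sub_mul_le (hw : 0 < w.im) (hκ : 0 ≤ κ.im) {l : ℝ} (hl : 0 ≤ l) :
    ‖(-w - κ * l)⁻¹‖ ≤ w.im⁻¹ := by
  rw [norm_inv]
  refine inv_anti₀ hw ?_
  have h1 := neg_sub_mul_im_le (w := w) hκ hl
  have h2 := Complex.abs_im_le_norm (-w - κ * l)
  have h3 := neg_le_abs (-w - κ * l).im
  linarith

/-- Termwise, 1/x = x̄/|x|² with x = -w - κλ. The case v = 1 yields the positive decomposition of Im
φ on which stability rests. -/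
theorem im_mul_phi (v : ℂ) : (v * phi lam r w κ).im =
    -(v * starRingEnd ℂ w).im * absSum lam r w κ 1
      - (v * starRingEnd ℂ κ).im * absSum lam r w κ 2 := by
  have h : ∀ k, (v * ((lam k : ℂ) / (-w - κ * lam k))).im =
      -(v * starRingEnd ℂ w).im * (lam k ^ 1 / Complex.normSq (-w - κ * lam k)) -
      (v * starRingEnd ℂ κ).im * (lam k ^ 2 / Complex.normSq (-w - κ * lam k)) := by
    intro k
    have e : v * ((lam k : ℂ) / (-w - κ * lam k)) =
        ((lam k / Complex.normSq (-w - κ * lam k) : ℝ) : ℂ) *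
          (-(v * starRingEnd ℂ w) - (lam k : ℝ) * (v * starRingEnd ℂ κ)) := by
      rw [div_eq_mul_inv, Complex.inv_def]
      simp only [map_sub, map_neg, map_mul, Complex.conj_ofReal, Complex.ofReal_inv,
        Complex.ofReal_div]
      ring
    rw [e, Complex.im_ofReal_mul, Complex.sub_im, Complex.neg_im, Complex.im_ofReal_mul]
    ring
  rw [phi, mul_left_comm, Complex.im_ofReal_mul, Finset.mul_sum, Complex.im_sum,
    Finset.sum_congr rfl fun k _ => h k, Finset.sum_sub_distrib, ← Finset.mul_sum, ← Finset.mul_sum,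
    absSum, absSum]
  ring

theorem im_phi : (phi lam r w κ).im = w.im * absSum lam r w κ 1 + κ.im * absSum lam r w κ 2 := by
  have := im_mul_phi (lam := lam) (r := r) (w := w) (κ := κ) 1
  simp only [one_mul, Complex.conj_im] at this
  rw [this]; ring

theorem absSum_nonneg (hr : 0 ≤ r) (hl : ∀ k, 0 ≤ lam k) (j : ℕ) : 0 ≤ absSum lam r w κ j := by
  refine mul_nonneg hr (Finset.sum_nonneg fun k _ => ?_)
  have := hl k
  exact div_nonneg (by positivity) (Complex.normSq_nonneg _)

theorem absSum_two_le {b : ℝ} (hr : 0 ≤ r) (hl : ∀ k, 0 ≤ lam k) (hb : ∀ k, lam k ≤ b) :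
    absSum lam r w κ 2 ≤ b * absSum lam r w κ 1 := by
  rw [absSum, absSum, mul_left_comm]
  refine mul_le_mul_of_nonneg_left ?_ hr
  rw [Finset.mul_sum]
  refine Finset.sum_le_sum fun k _ => ?_
  rw [mul_div_assoc']
  refine div_le_div_of_nonneg_right ?_ (Complex.normSq_nonneg _)
  nlinarith [hl k, hb k]

theorem phi_sub (hw : 0 < w.im) (hκ : 0 ≤ κ.im) (hκ' : 0 ≤ κ'.im) (hl : ∀ k, 0 ≤ lam k) :
    phi lam r w κ - phi lam r w κ' = (κ - κ') * (r * ∑ k,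
      ((lam k : ℂ) / (-w - κ * lam k)) * ((lam k : ℂ) / (-w - κ' * lam k))) := by
  rw [mul_left_comm, Finset.mul_sum, phi, phi, ← mul_sub, ← Finset.sum_sub_distrib]
  congr 1
  refine Finset.sum_congr rfl fun k _ => ?_
  have h1 := neg_sub_mul_ne_zero hw hκ (hl k)
  have h2 := neg_sub_mul_ne_zero hw hκ' (hl k)
  rw [div_sub_div _ _ h1 h2, div_mul_div_comm, mul_div_assoc']
  congr 1
  ring

/-- The resolvent identity gives a bilinear sum, and Cauchy–Schwarz separates it into one factor for
κ and one for κ'. Each factor is then controlled by the imaginary part at its own point, which is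
what makes the bound compatible with Schwarz–Pick. -/
theorem norm_phi_sub_sq_le (hw : 0 < w.im) (hκ : 0 ≤ κ.im) (hκ' : 0 ≤ κ'.im)
    (hl : ∀ k, 0 ≤ lam k) (hr : 0 ≤ r) :
    ‖phi lam r w κ - phi lam r w κ'‖ ^ 2 ≤
      ‖κ - κ'‖ ^ 2 * (absSum lam r w κ 2 * absSum lam r w κ' 2) := by
  rw [phi_sub hw hκ hκ' hl, norm_mul, mul_pow]
  refine mul_le_mul_of_nonneg_left ?_ (by positivity)
  rw [norm_mul, mul_pow]
  have hc : ‖∑ k, ((lam k : ℂ) / (-w - κ * lam k)) * ((lam k : ℂ) / (-w - κ' * lam k))‖ ^ 2 ≤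
      (∑ k, lam k ^ 2 / Complex.normSq (-w - κ * lam k)) *
        ∑ k, lam k ^ 2 / Complex.normSq (-w - κ' * lam k) := by
    have h0 : ‖∑ k, ((lam k : ℂ) / (-w - κ * lam k)) * ((lam k : ℂ) / (-w - κ' * lam k))‖ ≤
        ∑ k, ‖(lam k : ℂ) / (-w - κ * lam k)‖ * ‖(lam k : ℂ) / (-w - κ' * lam k)‖ := by
      refine (norm_sum_le _ _).trans (le_of_eq ?_)
      simp
    refine (pow_le_pow_left₀ (norm_nonneg _) h0 2).trans ?_
    refine (Finset.sum_mul_sq_le_sq_mul_sq _ _ _).trans (le_of_eq ?_)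
    congr 1 <;> refine Finset.sum_congr rfl fun k _ => ?_ <;>
    rw [← Complex.normSq_eq_norm_sq, map_div₀, Complex.normSq_ofReal] <;> ring
  calc _ ≤ ‖(r : ℂ)‖ ^ 2 * _ := mul_le_mul_of_nonneg_left hc (by positivity)
    _ = _ := by rw [absSum, absSum, Complex.norm_real, Real.norm_of_nonneg hr]; ring

/-- A crude Lipschitz bound, enough to replace κ by h(s) inside φ when the two are already known to
be close. -/
theorem norm_phi_sub_le {b : ℝ} (hw : 0 < w.im) (hκ : 0 ≤ κ.im) (hκ' : 0 ≤ κ'.im)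
    (hl : ∀ k, 0 ≤ lam k) (hb : ∀ k, lam k ≤ b) (hr : 0 ≤ r) :
    ‖phi lam r w κ - phi lam r w κ'‖ ≤
      r * Fintype.card ι * b ^ 2 * (w.im⁻¹) ^ 2 * ‖κ - κ'‖ := by
  rw [phi_sub hw hκ hκ' hl, norm_mul, mul_comm]
  refine mul_le_mul_of_nonneg_right ?_ (by positivity)
  rw [norm_mul, Complex.norm_real, Real.norm_of_nonneg hr, mul_assoc, mul_assoc]
  refine mul_le_mul_of_nonneg_left ?_ hr
  refine (norm_sum_le _ _).trans ?_
  rw [← nsmul_eq_mul, ← Finset.card_univ]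
  refine Finset.sum_le_card_nsmul _ _ _ fun k _ => ?_
  rw [div_eq_mul_inv, div_eq_mul_inv, norm_mul, norm_mul, norm_mul, Complex.norm_real,
    Real.norm_of_nonneg (hl k)]
  have h1 := norm_inv_neg_sub_mul_le hw hκ (hl k)
  have h2 := norm_inv_neg_sub_mul_le hw hκ' (hl k)
  have := hl k
  have := (hl k).trans (hb k)
  calc _ ≤ b * w.im⁻¹ * (b * w.im⁻¹) := by
        gcongr
        exacts [hb k, hb k]
    _ = _ := by ring

/-- Every fixed point in the upper half-plane lies in the sector where `w s` and `w̄ s` are in the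
upper half-plane. -/
theorem im_mul_pos_of_fixedPoint [Nonempty ι] {s : ℂ} (hw : 0 < w.im) (hw' : 0 < w.re)
    (hl : ∀ k, 0 < lam k) (hr : 0 < r) (hs : 0 < s.im) (h : s = phi lam r w (hFun s)) :
    0 < (starRingEnd ℂ w * s).im ∧ 0 < (w * s).im := by
  have hh := (im_hFun_pos hs).le
  have hpos : ∀ j, 0 < absSum lam r w (hFun s) j := fun j => by
    refine mul_pos hr (Finset.sum_pos (fun k _ => ?_) Finset.univ_nonempty)
    have := hl k
    exact div_pos (by positivity)
      (Complex.normSq_pos.2 (neg_sub_mul_ne_zero hw hh (hl k).le))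
  have e1 := im_mul_phi (lam := lam) (r := r) (w := w) (κ := hFun s) (starRingEnd ℂ w)
  have e2 := im_mul_phi (lam := lam) (r := r) (w := w) (κ := hFun s) w
  have e3 := im_phi (lam := lam) (r := r) (w := w) (κ := hFun s)
  rw [← h] at e1 e2 e3
  have g1 : (starRingEnd ℂ w * starRingEnd ℂ (hFun s)).im = -(w * hFun s).im := by
    rw [← map_mul, Complex.conj_im]
  have g2 : (w * starRingEnd ℂ (hFun s)).im = -(starRingEnd ℂ w * hFun s).im := by
    rw [← Complex.conj_im, map_mul, Complex.conj_conj]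
  have g3 : (starRingEnd ℂ w * starRingEnd ℂ s).im = -(w * s).im := by
    rw [← map_mul, Complex.conj_im]
  have g4 : (w * starRingEnd ℂ s).im = -(starRingEnd ℂ w * s).im := by
    rw [← Complex.conj_im, map_mul, Complex.conj_conj]
  have g5 : (w * starRingEnd ℂ w).im = 0 := by
    rw [Complex.mul_conj, Complex.ofReal_im]
  have g6 : 0 < -(starRingEnd ℂ w * starRingEnd ℂ w).im := by
    simp only [Complex.mul_im, Complex.conj_re, Complex.conj_im]; nlinarith
  have g7 : 0 < (starRingEnd ℂ w * s).im + (w * s).im := by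
    simp only [Complex.mul_im, Complex.conj_re, Complex.conj_im]; nlinarith
  rw [g1, im_mul_hFun, g4] at e1
  rw [g2, g5, im_mul_hFun, g3] at e2
  rw [im_hFun] at e3
  set p := (starRingEnd ℂ w * s).im
  set q := (w * s).im
  set X := absSum lam r w (hFun s) 1
  set Y := absSum lam r w (hFun s) 2
  have hX : 0 < X := hpos 1
  have hY : 0 < Y := hpos 2
  set d := Complex.normSq (1 - s ^ 2)
  have hd : 0 < d := Complex.normSq_pos.2 (one_sub_sq_ne_zero hs)
  set n := Complex.normSq s
  have hn : 0 ≤ n := Complex.normSq_nonneg s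
  set y := Y / d
  have hy : 0 < y := div_pos hY hd
  -- With p = Im(w̄s), q = Im(ws), n = |s|² and y the second sum divided by |1 - s²|², the fixed
  -- point equation becomes a real linear system in p and q.
  have e1' : p = -(starRingEnd ℂ w * starRingEnd ℂ w).im * X + y * (q + n * p) := by
    exact e1.trans (by simp only [y]; ring)
  have e2' : q = y * (p + n * q) := by
    exact e2.trans (by simp only [y]; ring)
  have e3' : s.im = w.im * X + y * (s.im * (1 + n)) := by
    exact e3.trans (by simp only [y]; ring)
  -- Otherwise the equation for Im s would fail, since Im w · X is strictly positive. Then q(1 - yn)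
  -- = yp forces p and q to have the same sign, and p + q > 0 makes both positive.
  have hlt : y * (1 + n) < 1 := by
    by_contra hcon
    push Not at hcon
    nlinarith [mul_pos hw hX, mul_le_mul_of_nonneg_left hcon hs.le]
  have hyn : 0 < 1 - y * n := by nlinarith
  have e2'' : q * (1 - y * n) = y * p := by linarith
  have hq : 0 < q := by
    by_contra hq
    push Not at hq
    have : 0 < p := by linarith
    nlinarith [mul_pos hy this, mul_nonneg (neg_nonneg.2 hq) hyn.le]
  refine ⟨?_, hq⟩
  by_contra hp
  push Not at hp
  nlinarith [mul_pos hq hyn, mul_nonneg hy.le (neg_nonneg.2 hp)]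

end

end

end PastFuture

namespace PastFuture

/-! ### Boundedness, stability and existence for the fixed point equation -/

section

section

variable {ι : Type*} [Fintype ι] {lam : ι → ℝ} {w κ κ' : ℂ} {r : ℝ}

/-- At an approximate fixed point `s`, the quantity `s / (1 - s²)` is bounded. -/
theorem norm_hFun_le_of_approx {a b c s} {ε : ℝ} (ha : 0 < a) (hla : ∀ k, a ≤ lam k)
    (hlb : ∀ k, lam k ≤ b) (hb : 0 < b) (hr : 0 ≤ r) (hc : r * Fintype.card ι ≤ c)
    (h : ‖s - phi lam r w (hFun s)‖ ≤ ε) (hε : ε ≤ 1 / 4) :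
    ‖hFun s‖ ≤ 1 + (4 * c * b + ‖w‖) / a := by
  have hc0 : 0 ≤ c := le_trans (by positivity) hc
  have hquot : 0 ≤ (4 * c * b + ‖w‖) / a := by positivity
  -- For small s the value h(s) is bounded directly. Otherwise |φ(h(s))| ≥ 1/4, whereas |φ(κ)|
  -- decays like 1/|κ| because every λ_k is at least a; so |h(s)| cannot be large.
  by_cases hs : ‖s‖ ≤ 1 / 2
  · have h1 : 3 / 4 ≤ ‖1 - s ^ 2‖ := by
      have := norm_sub_norm_le (1 : ℂ) (s ^ 2)
      rw [norm_one, norm_pow] at this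
      nlinarith [norm_nonneg s]
    have : ‖hFun s‖ ≤ 1 := by
      rw [hFun, norm_div, div_le_one (by linarith)]
      linarith
    linarith
  · push Not at hs
    have h1 : 1 / 4 ≤ ‖phi lam r w (hFun s)‖ := by
      have := norm_sub_norm_le s (phi lam r w (hFun s))
      linarith
    suffices ‖hFun s‖ * a - ‖w‖ ≤ 4 * c * b by
      have : ‖hFun s‖ ≤ (4 * c * b + ‖w‖) / a := by
        rw [le_div_iff₀ ha]; linarith
      linarith
    by_contra hcon
    push Not at hcon
    have hpos : 0 < ‖hFun s‖ * a - ‖w‖ := lt_of_le_of_lt (by positivity) hcon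
    have hterm : ∀ k, ‖(lam k : ℂ) / (-w - hFun s * lam k)‖ ≤ b / (‖hFun s‖ * a - ‖w‖) := by
      intro k
      have hk : 0 ≤ lam k := ha.le.trans (hla k)
      rw [norm_div, Complex.norm_real, Real.norm_of_nonneg hk]
      refine div_le_div₀ hb.le (hlb k) hpos ?_
      have h2 := norm_sub_norm_le (hFun s * lam k) (-w)
      rw [norm_neg, norm_mul, Complex.norm_real, Real.norm_of_nonneg hk, sub_neg_eq_add] at h2
      have h5 : ‖-w - hFun s * lam k‖ = ‖hFun s * lam k + w‖ := by
        rw [← norm_neg]; congr 1; ring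
      rw [h5]
      nlinarith [hla k, norm_nonneg (hFun s)]
    have h3 : ‖phi lam r w (hFun s)‖ ≤ c * b / (‖hFun s‖ * a - ‖w‖) := by
      rw [phi, norm_mul, Complex.norm_real, Real.norm_of_nonneg hr]
      calc _ ≤ r * (Fintype.card ι • (b / (‖hFun s‖ * a - ‖w‖))) := by
            refine mul_le_mul_of_nonneg_left ((norm_sum_le _ _).trans ?_) hr
            rw [← Finset.card_univ]
            exact Finset.sum_le_card_nsmul _ _ _ fun k _ => hterm k
        _ = (r * Fintype.card ι) * (b / (‖hFun s‖ * a - ‖w‖)) := by rw [nsmul_eq_mul]; ring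
        _ ≤ c * (b / (‖hFun s‖ * a - ‖w‖)) := by gcongr
        _ = _ := by ring
    have h4 := h1.trans h3
    rw [le_div_iff₀ hpos] at h4
    linarith

/-- Keeps only the term Im w · X₁ of Im φ, with each denominator bounded through |κ| ≤ H. It keeps
approximate fixed points away from the real axis. -/
theorem im_phi_ge {a b c H : ℝ} (ha : 0 < a) (hla : ∀ k, a ≤ lam k) (hlb : ∀ k, lam k ≤ b)
    (hr : 0 ≤ r) (hc : c ≤ r * Fintype.card ι) (hw : 0 < w.im) (hκ : 0 ≤ κ.im)
    (hH : ‖κ‖ ≤ H) : w.im * (c * (a / (‖w‖ + H * b) ^ 2)) ≤ (phi lam r w κ).im := by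
  have hw0 : 0 < ‖w‖ := by
    refine lt_of_lt_of_le hw ((le_abs_self _).trans (Complex.abs_im_le_norm w))
  rw [im_phi]
  have h2 := absSum_nonneg (w := w) (κ := κ) hr (fun k => ha.le.trans (hla k)) 2
  have h1 : c * (a / (‖w‖ + H * b) ^ 2) ≤ absSum lam r w κ 1 := by
    calc _ ≤ (r * Fintype.card ι) * (a / (‖w‖ + H * b) ^ 2) := by gcongr
      _ = r * (Fintype.card ι • (a / (‖w‖ + H * b) ^ 2)) := by rw [nsmul_eq_mul]; ring
      _ ≤ _ := by
        rw [absSum]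
        refine mul_le_mul_of_nonneg_left ?_ hr
        rw [← Finset.card_univ]
        refine Finset.card_nsmul_le_sum _ _ _ fun k _ => ?_
        have hk : 0 < lam k := ha.trans_le (hla k)
        rw [pow_one]
        refine div_le_div₀ hk.le (hla k)
          (Complex.normSq_pos.2 (neg_sub_mul_ne_zero hw hκ hk.le)) ?_
        rw [Complex.normSq_eq_norm_sq]
        refine pow_le_pow_left₀ (norm_nonneg _) ?_ 2
        refine (norm_sub_le _ _).trans ?_
        rw [norm_neg, norm_mul, Complex.norm_real, Real.norm_of_nonneg hk.le]
        have := hlb k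
        have := (norm_nonneg κ).trans hH
        gcongr
  have := mul_le_mul_of_nonneg_left h1 hw.le
  have := mul_nonneg hκ h2
  linarith

/-- Since X₂ ≤ b X₁, the part Im w · X₁ is a fixed proportion of Im φ = Im w · X₁ + Im κ · X₂. This
proportion is the gap δ of the contraction. -/
theorem im_mul_absSum_two_le {b H : ℝ} (hl : ∀ k, 0 ≤ lam k) (hb0 : 0 < b)
    (hlb : ∀ k, lam k ≤ b) (hr : 0 ≤ r) (hw : 0 < w.im) (hκ : 0 ≤ κ.im) (hH : κ.im ≤ H) :
    κ.im * absSum lam r w κ 2 ≤ (1 - w.im / (w.im + b * H)) * (phi lam r w κ).im := by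
  have h1 := absSum_nonneg (w := w) (κ := κ) hr hl 1
  have h2 := absSum_two_le (w := w) (κ := κ) hr hl hlb
  have hH0 : 0 ≤ H := hκ.trans hH
  have hpos : 0 < w.im + b * H := by positivity
  have e : 1 - w.im / (w.im + b * H) = b * H / (w.im + b * H) := by
    rw [eq_div_iff hpos.ne', sub_mul, div_mul_cancel₀ _ hpos.ne']; ring
  rw [e, div_mul_eq_mul_div, le_div_iff₀ hpos, im_phi]
  have h3 := absSum_nonneg (w := w) (κ := κ) hr hl 2
  set X := absSum lam r w κ 1
  set Y := absSum lam r w κ 2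
  have : κ.im * Y * w.im ≤ b * H * (w.im * X) := by
    calc _ ≤ H * (b * X) * w.im := by gcongr
      _ = _ := by ring
  nlinarith [mul_nonneg hκ h3, mul_nonneg hb0.le hH0]

end

/-- The contraction estimate behind the stability of the fixed point equation. -/
theorem contraction_of_schwarzPick {δ p d e x y u v Y Y' : ℝ} (hδ : 0 < δ) (hδ1 : δ ≤ 1)
    (hx : 0 < x) (hy : 0 < y) (hv : 0 ≤ v) (hY : 0 ≤ Y) (hY' : 0 ≤ Y') (hd : 0 ≤ d)
    (hp : p ^ 2 ≤ e ^ 2 * (Y * Y')) (he : e ^ 2 * (x * y) ≤ d ^ 2 * (u * v))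
    (h1 : u * Y ≤ (1 - δ) * ((1 + δ) * x)) (h2 : v * Y' ≤ y) :
    p ≤ (1 - δ ^ 2 / 2) * d := by
  have hδ2 : δ ^ 2 ≤ 1 := pow_le_one₀ hδ.le hδ1
  have h1δ : 0 ≤ 1 - δ := by linarith
  refine le_of_sq_le_sq ?_ (mul_nonneg (by linarith) hd)
  have hst : 0 < x * y := mul_pos hx hy
  refine le_of_mul_le_mul_right ?_ hst
  -- The squared contraction factor is (1 - δ)(1 + δ) = 1 - δ², whose square root is at most 1 -
  -- δ²/2.
  calc p ^ 2 * (x * y) ≤ e ^ 2 * (Y * Y') * (x * y) := by gcongr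
    _ = e ^ 2 * (x * y) * (Y * Y') := by ring
    _ ≤ d ^ 2 * (u * v) * (Y * Y') := by gcongr
    _ = d ^ 2 * ((u * Y) * (v * Y')) := by ring
    _ ≤ d ^ 2 * (((1 - δ) * ((1 + δ) * x)) * y) := by gcongr
    _ = (1 - δ ^ 2) * (d ^ 2 * (x * y)) := by ring
    _ ≤ (1 - δ ^ 2 / 2) ^ 2 * (d ^ 2 * (x * y)) := by
      refine mul_le_mul_of_nonneg_right ?_ (by positivity)
      nlinarith [sq_nonneg (δ ^ 2)]
    _ = _ := by ring

/-- Approximate fixed points are close to exact ones, uniformly in the parameters. -/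
theorem fixedPoint_stability {a b c₁ c₂ : ℝ} {w : ℂ} (ha : 0 < a) (hb : 0 < b) (hc₁ : 0 < c₁)
    (hc₂ : 0 < c₂) (hw : 0 < w.im) :
    ∃ C > 0, ∃ ε₀ > 0, ∃ σ > 0, ∃ H > 0, ∀ {ι : Type} [Fintype ι] (lam : ι → ℝ) (r : ℝ),
      (∀ k, a ≤ lam k) → (∀ k, lam k ≤ b) → 0 ≤ r → c₁ ≤ r * Fintype.card ι →
      r * Fintype.card ι ≤ c₂ → ∀ (s : ℂ) (ε : ℝ), 0 < s.im → ε ≤ ε₀ →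
      ‖s - phi lam r w (hFun s)‖ ≤ ε → σ ≤ s.im ∧ ‖hFun s‖ ≤ H ∧
      ∀ t : ℂ, 0 < t.im → t = phi lam r w (hFun t) → ‖s - t‖ ≤ C * ε := by
  set H := 1 + (4 * c₂ * b + ‖w‖) / a with hHdef
  have hH : 0 < H := by positivity
  have hw0 : 0 < ‖w‖ := lt_of_lt_of_le hw ((le_abs_self _).trans (Complex.abs_im_le_norm w))
  set σ₂ := w.im * (c₁ * (a / (‖w‖ + H * b) ^ 2)) with hσ₂
  have hσ₂pos : 0 < σ₂ := by positivity
  set δ := w.im / (w.im + b * H) with hδdef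
  have hδ : 0 < δ := by positivity
  have hδ1 : δ ≤ 1 := by
    rw [hδdef, div_le_one (by positivity)]
    nlinarith [mul_pos hb hH]
  -- The three thresholds for ε serve, in order, the bound on h(s), the lower bound Im s ≥ σ₂ - ε ≥
  -- σ₂/2, and the inequality ε ≤ δ Im s.
  refine ⟨2 / δ ^ 2, by positivity, min (1 / 4) (min (σ₂ / 2) (σ₂ / 2 * δ)), by positivity,
    σ₂ / 2, by positivity, H, hH, ?_⟩
  intro ι _ lam r hla hlb hr hc1 hc2 s ε hs hε happ
  have hε1 : ε ≤ 1 / 4 := hε.trans (min_le_left _ _)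
  have hε2 : ε ≤ σ₂ / 2 := hε.trans ((min_le_right _ _).trans (min_le_left _ _))
  have hε3 : ε ≤ σ₂ / 2 * δ := hε.trans ((min_le_right _ _).trans (min_le_right _ _))
  have hε0 : 0 ≤ ε := (norm_nonneg _).trans happ
  have hl : ∀ k, 0 ≤ lam k := fun k => ha.le.trans (hla k)
  have hHs : ‖hFun s‖ ≤ H := norm_hFun_le_of_approx ha hla hlb hb hr hc2 happ hε1
  have hhs := im_hFun_pos hs
  have him : |s.im - (phi lam r w (hFun s)).im| ≤ ε := by
    rw [← Complex.sub_im]; exact (Complex.abs_im_le_norm _).trans happ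
  have hσ : σ₂ / 2 ≤ s.im := by
    have h1 := im_phi_ge ha hla hlb hr hc1 hw hhs.le hHs
    have h2 := (abs_le.1 him).1
    linarith
  refine ⟨hσ, hHs, fun t ht hfix => ?_⟩
  have happt : ‖t - phi lam r w (hFun t)‖ ≤ 0 := by rw [← hfix]; simp
  have hHt : ‖hFun t‖ ≤ H := norm_hFun_le_of_approx ha hla hlb hb hr hc2 happt (by norm_num)
  have hht := im_hFun_pos ht
  have ks := im_mul_absSum_two_le hl hb hlb hr hw hhs.le
    (((le_abs_self _).trans (Complex.abs_im_le_norm _)).trans hHs)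
  have kt := im_mul_absSum_two_le hl hb hlb hr hw hht.le
    (((le_abs_self _).trans (Complex.abs_im_le_norm _)).trans hHt)
  rw [← hδdef] at ks kt
  rw [← hfix] at kt
  have hY := absSum_nonneg (w := w) (κ := hFun s) hr hl 2
  have hY' := absSum_nonneg (w := w) (κ := hFun t) hr hl 2
  have sp := hFun_schwarzPick hs ht
  have hphi := norm_phi_sub_sq_le hw hhs.le hht.le hl hr
  rw [← hfix] at hphi
  rw [Complex.normSq_eq_norm_sq, Complex.normSq_eq_norm_sq] at sp
  set Y := absSum lam r w (hFun s) 2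
  set Y' := absSum lam r w (hFun t) 2
  set P := phi lam r w (hFun s)
  have hP : P.im ≤ s.im + ε := by have := (abs_le.1 him).1; linarith
  -- At an approximate fixed point Im φ exceeds Im s by at most ε ≤ δ Im s; the gap 1 - δ absorbs
  -- the resulting factor 1 + δ.
  have ks' : (hFun s).im * Y ≤ (1 - δ) * ((1 + δ) * s.im) := by
    refine ks.trans (mul_le_mul_of_nonneg_left (hP.trans ?_) (by linarith))
    have := mul_le_mul_of_nonneg_right hσ hδ.le
    linarith
  have kt' : (hFun t).im * Y' ≤ t.im := by
    have := mul_pos hδ ht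
    linarith
  -- P = φ(h(s)) is closer to t than s is, by the contraction factor, while |s - P| ≤ ε. The
  -- triangle inequality then leaves (δ²/2)|s - t| ≤ ε.
  have h5 : ‖P - t‖ ≤ (1 - δ ^ 2 / 2) * ‖s - t‖ :=
    contraction_of_schwarzPick hδ hδ1 hs ht hht.le hY hY' (norm_nonneg _)
      hphi sp ks' kt'
  have h6 : ‖s - t‖ ≤ ‖s - P‖ + ‖P - t‖ := norm_sub_le_norm_sub_add_norm_sub _ _ _
  have h7 : δ ^ 2 / 2 * ‖s - t‖ ≤ ε := by linarith
  rw [div_mul_eq_mul_div, le_div_iff₀ (by positivity)]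
  linarith

/-- An exact fixed point exists as soon as there are approximate ones. -/
theorem exists_fixedPoint_of_approx {a b : ℝ} {w : ℂ} (ha : 0 < a) (hb : 0 < b) (hw : 0 < w.im)
    {ι : Type} [Fintype ι] [Nonempty ι] (lam : ι → ℝ) (r : ℝ) (hla : ∀ k, a ≤ lam k)
    (hlb : ∀ k, lam k ≤ b) (hr : 0 < r)
    (happ : ∀ ε > 0, ∃ s : ℂ, 0 < s.im ∧ ‖s - phi lam r w (hFun s)‖ ≤ ε) :
    ∃ s : ℂ, 0 < s.im ∧ s = phi lam r w (hFun s) := by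
  have hcard : 0 < r * Fintype.card ι := by
    have : 0 < Fintype.card ι := Fintype.card_pos
    positivity
  obtain ⟨C, -, ε₀, hε₀, σ, hσ, H, hH, hstab⟩ := fixedPoint_stability ha hb hcard hcard hw
  set u : ℕ → ℝ := fun n => min ε₀ (1 / (n + 1))
  have hu : ∀ n, 0 < u n := fun n => by positivity
  choose s hs hsa using fun n => happ (u n) (hu n)
  have hst := fun n => hstab lam r hla hlb hr.le le_rfl le_rfl (s n) (u n) (hs n)
    (min_le_left _ _) (hsa n)
  have hl : ∀ k, 0 ≤ lam k := fun k => ha.le.trans (hla k)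
  have hbd : ∀ n, s n ∈ Metric.closedBall (0 : ℂ) (ε₀ + r * Fintype.card ι * b * w.im⁻¹) := by
    intro n
    rw [mem_closedBall_zero_iff]
    have h1 : ‖phi lam r w (hFun (s n))‖ ≤ r * Fintype.card ι * b * w.im⁻¹ := by
      rw [phi, norm_mul, Complex.norm_real, Real.norm_of_nonneg hr.le]
      calc _ ≤ r * (Fintype.card ι • (b * w.im⁻¹)) := by
            refine mul_le_mul_of_nonneg_left ((norm_sum_le _ _).trans ?_) hr.le
            rw [← Finset.card_univ]
            refine Finset.sum_le_card_nsmul _ _ _ fun k _ => ?_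
            rw [div_eq_mul_inv, norm_mul, Complex.norm_real, Real.norm_of_nonneg (hl k)]
            exact mul_le_mul (hlb k)
              (norm_inv_neg_sub_mul_le hw (im_hFun_pos (hs n)).le (hl k)) (norm_nonneg _) hb.le
        _ = _ := by rw [nsmul_eq_mul]; ring
    have h2 := norm_sub_norm_le (s n) (phi lam r w (hFun (s n)))
    have h3 := hsa n
    have h4 : u n ≤ ε₀ := min_le_left _ _
    linarith
  -- A limit point of approximate fixed points stays in the open half-plane because of the uniform
  -- lower bound σ, so the equation is continuous there.
  obtain ⟨s', -, φ, hφ, hlim⟩ := (isCompact_closedBall _ _).tendsto_subseq hbd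
  have him : σ ≤ s'.im :=
    ge_of_tendsto' ((Complex.continuous_im.tendsto _).comp hlim) fun n => (hst (φ n)).1
  have hs' : 0 < s'.im := hσ.trans_le him
  have hcont : ContinuousAt (fun s => phi lam r w (hFun s)) s' := by
    have h1 : ContinuousAt hFun s' := by
      unfold hFun
      refine ContinuousAt.div continuousAt_id (by fun_prop) (one_sub_sq_ne_zero hs')
    unfold phi
    refine continuousAt_const.mul ?_
    refine tendsto_finsetSum _ fun k _ => ?_
    refine ContinuousAt.div (a := s') continuousAt_const ?_
      (neg_sub_mul_ne_zero hw (im_hFun_pos hs').le (hl k))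
    exact continuousAt_const.sub (h1.mul continuousAt_const)
  refine ⟨s', hs', ?_⟩
  have hlim2 := (hlim.sub (hcont.tendsto.comp hlim)).norm
  have hu0 : Tendsto (fun n => u (φ n)) atTop (𝓝 0) := by
    refine Tendsto.comp (g := u) ?_ hφ.tendsto_atTop
    refine squeeze_zero (fun n => (hu n).le) (fun n => min_le_right _ _)
      tendsto_one_div_add_atTop_nhds_zero_nat
  have h0 : ‖s' - phi lam r w (hFun s')‖ ≤ 0 :=
    le_of_tendsto_of_tendsto' hlim2 hu0 fun n => hsa (φ n)
  exact sub_eq_zero.1 (norm_le_zero_iff.1 h0)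

end

end PastFuture

namespace PastFuture

section

/-! ### Stieltjes transforms -/

theorem ofReal_sub_ne_zero {z : ℂ} (hz : z.im ≠ 0) (x : ℝ) : (x : ℂ) - z ≠ 0 := by
  intro h
  have := congrArg Complex.im h
  simp at this
  exact hz this

theorem norm_inv_ofReal_sub_le {z : ℂ} (hz : z.im ≠ 0) (x : ℝ) :
    ‖((x : ℂ) - z)⁻¹‖ ≤ |z.im|⁻¹ := by
  rw [norm_inv]
  refine inv_anti₀ (abs_pos.2 hz) ?_
  have := Complex.abs_im_le_norm ((x : ℂ) - z)
  simpa using this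

theorem continuous_inv_ofReal_sub {z : ℂ} (hz : z.im ≠ 0) :
    Continuous fun x : ℝ => ((x : ℂ) - z)⁻¹ :=
  (by fun_prop : Continuous fun x : ℝ => (x : ℂ) - z).inv₀ (ofReal_sub_ne_zero hz)

/-- The function `x ↦ (x - z)⁻¹` for non-real `z`, as a bounded continuous function. -/
noncomputable def resolventBCF (z : {z : ℂ // z.im ≠ 0}) : ℝ →ᵇ ℂ :=
  BoundedContinuousFunction.ofNormedAddCommGroup (fun x : ℝ => ((x : ℂ) - z)⁻¹)
    (continuous_inv_ofReal_sub z.2) |z.1.im|⁻¹ (norm_inv_ofReal_sub_le z.2)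

@[simp]
theorem resolventBCF_apply (z : {z : ℂ // z.im ≠ 0}) (x : ℝ) :
    resolventBCF z x = ((x : ℂ) - z)⁻¹ := rfl

theorem inv_sub_inv_ofReal_sub {z z' : ℂ} (hz : z.im ≠ 0) (hz' : z'.im ≠ 0) (x : ℝ) :
    ((x : ℂ) - z)⁻¹ - ((x : ℂ) - z')⁻¹ = (z - z') * (((x : ℂ) - z)⁻¹ * ((x : ℂ) - z')⁻¹) := by
  have h1 := ofReal_sub_ne_zero hz x
  have h2 := ofReal_sub_ne_zero hz' x
  rw [inv_sub_inv h1 h2, ← mul_inv, div_eq_mul_inv]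
  congr 1; ring

theorem resolventBCF_sub (z z' : {z : ℂ // z.im ≠ 0}) :
    resolventBCF z - resolventBCF z' = (z.1 - z'.1) • (resolventBCF z * resolventBCF z') := by
  ext x
  simpa using inv_sub_inv_ofReal_sub z.2 z'.2 x

theorem norm_resolventBCF_le (z : {z : ℂ // z.im ≠ 0}) : ‖resolventBCF z‖ ≤ |z.1.im|⁻¹ :=
  BoundedContinuousFunction.norm_ofNormedAddCommGroup_le _ (by positivity) _

/-- The closed linear span of the constants and of the resolvent functions. -/
noncomputable def resolventSpan : Submodule ℂ (ℝ →ᵇ ℂ) :=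
  (Submodule.span ℂ (insert 1 (Set.range resolventBCF))).topologicalClosure

theorem resolventBCF_mem (z : {z : ℂ // z.im ≠ 0}) : resolventBCF z ∈ resolventSpan :=
  Submodule.le_topologicalClosure _ (Submodule.subset_span (Set.mem_insert_of_mem _ ⟨z, rfl⟩))

theorem one_mem_resolventSpan : (1 : ℝ →ᵇ ℂ) ∈ resolventSpan :=
  Submodule.le_topologicalClosure _ (Submodule.subset_span (Set.mem_insert _ _))

theorem isClosed_resolventSpan : IsClosed (resolventSpan : Set (ℝ →ᵇ ℂ)) :=
  Submodule.isClosed_topologicalClosure _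

/-- For z ≠ z' the resolvent identity writes the product as a multiple of a difference. The square
is a norm limit of such products along z + 1/(n+1), which is why the span has to be closed. -/
theorem resolventBCF_mul_mem (z z' : {z : ℂ // z.im ≠ 0}) :
    resolventBCF z * resolventBCF z' ∈ resolventSpan := by
  have hne : ∀ z z' : {z : ℂ // z.im ≠ 0}, z ≠ z' →
      resolventBCF z * resolventBCF z' ∈ resolventSpan := by
    intro z z' h
    have h' : z.1 - z'.1 ≠ 0 := sub_ne_zero.2 fun e => h (Subtype.ext e)
    have : resolventBCF z * resolventBCF z' =
        (z.1 - z'.1)⁻¹ • (resolventBCF z - resolventBCF z') := by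
      rw [resolventBCF_sub, smul_smul, inv_mul_cancel₀ h', one_smul]
    rw [this]
    exact Submodule.smul_mem _ _ (Submodule.sub_mem _ (resolventBCF_mem z) (resolventBCF_mem z'))
  by_cases h : z = z'
  · subst h
    let u : ℕ → {z : ℂ // z.im ≠ 0} := fun n =>
      ⟨z.1 + ((1 / ((n : ℝ) + 1) : ℝ) : ℂ), by
        rw [Complex.add_im, Complex.ofReal_im, add_zero]; exact z.2⟩
    have hu : ∀ n, (u n).1.im = z.1.im := fun n => by
      simp only [u]; rw [Complex.add_im, Complex.ofReal_im, add_zero]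
    have hlim : Tendsto (fun n => resolventBCF (u n)) atTop (𝓝 (resolventBCF z)) := by
      rw [tendsto_iff_norm_sub_tendsto_zero]
      have h0 : Tendsto (fun n : ℕ => (1 / ((n : ℝ) + 1)) * (|z.1.im|⁻¹ * |z.1.im|⁻¹)) atTop
          (𝓝 0) := by
        have := (tendsto_one_div_add_atTop_nhds_zero_nat (𝕜 := ℝ)).mul_const
          (|z.1.im|⁻¹ * |z.1.im|⁻¹)
        simpa using this
      refine squeeze_zero (fun n => norm_nonneg _) (fun n => ?_) h0
      rw [resolventBCF_sub, norm_smul]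
      have e : ‖(u n).1 - z.1‖ = 1 / ((n : ℝ) + 1) := by
        simp only [u, add_sub_cancel_left]
        rw [Complex.norm_real, Real.norm_of_nonneg (by positivity)]
      rw [e]
      refine mul_le_mul_of_nonneg_left ((norm_mul_le _ _).trans ?_) (by positivity)
      have h1 := norm_resolventBCF_le (u n)
      rw [hu] at h1
      exact mul_le_mul h1 (norm_resolventBCF_le z) (norm_nonneg _) (by positivity)
    refine isClosed_resolventSpan.mem_of_tendsto (hlim.const_mul (resolventBCF z)) ?_
    refine Eventually.of_forall fun n => hne _ _ fun e => ?_
    have e1 := congrArg (fun z => (z.1 : ℂ).re) e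
    simp only [u, Complex.add_re, Complex.ofReal_re] at e1
    have : (0 : ℝ) < 1 / ((n : ℝ) + 1) := by positivity
    linarith
  · exact hne _ _ h

theorem resolventBCF_mul_mem_of_mem (z : {z : ℂ // z.im ≠ 0}) {g : ℝ →ᵇ ℂ}
    (hg : g ∈ resolventSpan) : resolventBCF z * g ∈ resolventSpan := by
  let T : (ℝ →ᵇ ℂ) →L[ℂ] (ℝ →ᵇ ℂ) := ContinuousLinearMap.mul ℂ (ℝ →ᵇ ℂ) (resolventBCF z)
  have hle : resolventSpan ≤ resolventSpan.comap (T : (ℝ →ᵇ ℂ) →ₗ[ℂ] (ℝ →ᵇ ℂ)) := by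
    refine Submodule.topologicalClosure_minimal _ ?_ ?_
    · rw [Submodule.span_le]
      rintro f (rfl | ⟨z', rfl⟩)
      · change resolventBCF z * 1 ∈ resolventSpan
        rw [mul_one]; exact resolventBCF_mem z
      · exact resolventBCF_mul_mem z z'
    · exact isClosed_resolventSpan.preimage T.continuous
  exact hle hg

/-- The closed span contains 1 and is stable under multiplication by the generators, hence contains
the algebra. Two measures with equal mass and equal transforms therefore agree on a star algebra
that separates points. -/
theorem adjoin_le_resolventSpan {g : ℝ →ᵇ ℂ}
    (hg : g ∈ StarAlgebra.adjoin ℂ (Set.range resolventBCF)) : g ∈ resolventSpan := by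
  have hstar : star (Set.range resolventBCF) ⊆ Set.range resolventBCF := by
    rintro f ⟨z, hz⟩
    refine ⟨⟨starRingEnd ℂ z.1, by simpa using z.2⟩, ?_⟩
    rw [← star_star f, ← hz]
    ext x
    simp
  have hadj : g ∈ Algebra.adjoin ℂ (Set.range resolventBCF) := by
    have : g ∈ Algebra.adjoin ℂ (Set.range resolventBCF ∪ star (Set.range resolventBCF)) := hg
    rwa [Set.union_eq_self_of_subset_right hstar] at this
  have key : ∀ f ∈ resolventSpan, g * f ∈ resolventSpan := by
    refine Algebra.adjoin_induction (R := ℂ)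
      (p := fun g _ => ∀ f ∈ resolventSpan, g * f ∈ resolventSpan) ?_ ?_ ?_ ?_ hadj
    · rintro _ ⟨z, rfl⟩ f hf
      exact resolventBCF_mul_mem_of_mem z hf
    · intro r f hf
      rw [← Algebra.smul_def]
      exact Submodule.smul_mem _ _ hf
    · intro a b _ _ ha hb f hf
      rw [add_mul]
      exact Submodule.add_mem _ (ha f hf) (hb f hf)
    · intro a b _ _ ha hb f hf
      rw [mul_assoc]
      exact ha _ (hb f hf)
  simpa using key 1 one_mem_resolventSpan

theorem integrable_inv_ofReal_sub (μ : Measure ℝ) [IsFiniteMeasure μ] {z : ℂ} (hz : z.im ≠ 0) :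
    Integrable (fun x : ℝ => ((x : ℂ) - z)⁻¹) μ :=
  (resolventBCF ⟨z, hz⟩).integrable μ

/-- The total mass of a finite measure is determined by its Stieltjes transform. -/
theorem tendsto_stieltjes_mass (μ : Measure ℝ) [IsFiniteMeasure μ] :
    Tendsto (fun y : ℝ => -(Complex.I * y) * ∫ x : ℝ, ((x : ℂ) - Complex.I * y)⁻¹ ∂μ) atTop
      (𝓝 ((μ.real Set.univ : ℝ) : ℂ)) := by
  have h1 : ((μ.real Set.univ : ℝ) : ℂ) = ∫ _ : ℝ, (1 : ℂ) ∂μ := by simp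
  rw [h1]
  simp_rw [← integral_const_mul]
  refine tendsto_integral_filter_of_dominated_convergence (fun _ => 1) ?_ ?_ (integrable_const _) ?_
  · filter_upwards [eventually_gt_atTop 0] with y hy
    exact ((integrable_inv_ofReal_sub μ (by simpa using hy.ne')).const_mul _).aestronglyMeasurable
  · filter_upwards [eventually_gt_atTop 0] with y hy
    refine Eventually.of_forall fun x => ?_
    have h := norm_inv_ofReal_sub_le (z := Complex.I * y) (by simpa using hy.ne') x
    rw [norm_mul, norm_neg, norm_mul, Complex.norm_I, one_mul, Complex.norm_real,
      Real.norm_of_nonneg hy.le]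
    have e : |(Complex.I * (y : ℂ)).im| = y := by simp [abs_of_pos hy]
    rw [e] at h
    calc _ ≤ y * y⁻¹ := by gcongr
      _ = 1 := mul_inv_cancel₀ hy.ne'
  -- Pointwise, -iy/(x - iy) = (1 + ix/y)⁻¹, which tends to 1.
  · refine Eventually.of_forall fun x => ?_
    have h2 : Tendsto (fun y : ℝ => (1 + Complex.I * ((x / y : ℝ) : ℂ))⁻¹) atTop (𝓝 1) := by
      have h3 : Tendsto (fun y : ℝ => x / y) atTop (𝓝 0) := tendsto_const_nhds.div_atTop tendsto_id
      have h4 := (Complex.continuous_ofReal.tendsto 0).comp h3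
      have h5 := ((h4.const_mul Complex.I).const_add 1).inv₀ (by simp)
      simpa using h5
    refine h2.congr' ?_
    filter_upwards [eventually_gt_atTop 0] with y hy
    have hy' : (y : ℂ) ≠ 0 := by exact_mod_cast hy.ne'
    have h6 : (x : ℂ) - Complex.I * y ≠ 0 := ofReal_sub_ne_zero (by simpa using hy.ne') x
    have h7 : (x : ℂ) - Complex.I * y = -(Complex.I * y) * (1 + Complex.I * ((x / y : ℝ) : ℂ)) := by
      push_cast
      field_simp
      linear_combination (x : ℂ) * Complex.I_sq
    rw [h7] at h6 ⊢
    rw [mul_inv, ← mul_assoc, mul_inv_cancel₀ (left_ne_zero_of_mul h6), one_mul]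

/-- A finite measure on `ℝ` is determined by its Stieltjes transform. -/
theorem measure_eq_of_stieltjes_eq (μ μ' : Measure ℝ) [IsFiniteMeasure μ] [IsFiniteMeasure μ']
    (h : ∀ z : ℂ, 0 < z.im → ∫ x : ℝ, ((x : ℂ) - z)⁻¹ ∂μ = ∫ x : ℝ, ((x : ℂ) - z)⁻¹ ∂μ') :
    μ = μ' := by
  -- Conjugation extends the equality of transforms to the lower half-plane, which is needed for a
  -- family of test functions closed under the star operation.
  have hconj : ∀ (ρ : Measure ℝ) (z : ℂ), ∫ x : ℝ, ((x : ℂ) - starRingEnd ℂ z)⁻¹ ∂ρ =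
      starRingEnd ℂ (∫ x : ℝ, ((x : ℂ) - z)⁻¹ ∂ρ) := by
    intro ρ z
    rw [← integral_conj]
    simp
  have h' : ∀ z : ℂ, z.im ≠ 0 →
      ∫ x : ℝ, ((x : ℂ) - z)⁻¹ ∂μ = ∫ x : ℝ, ((x : ℂ) - z)⁻¹ ∂μ' := by
    intro z hz
    rcases lt_or_gt_of_ne hz with hz | hz
    · have := h (starRingEnd ℂ z) (by simpa using hz)
      rw [hconj, hconj] at this
      exact (starRingEnd ℂ).injective this
    · exact h z hz
  have hmass : ((μ.real Set.univ : ℝ) : ℂ) = ((μ'.real Set.univ : ℝ) : ℂ) := by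
    refine tendsto_nhds_unique (tendsto_stieltjes_mass μ)
      ((tendsto_stieltjes_mass μ').congr' ?_)
    filter_upwards [eventually_gt_atTop 0] with y hy
    rw [h' _ (by simpa using hy.ne')]
  -- The test functions on which both measures agree form a closed subspace; constants belong to it
  -- by the mass identity.
  let W : Submodule ℂ (ℝ →ᵇ ℂ) :=
    { carrier := {g | ∫ x, g x ∂μ = ∫ x, g x ∂μ'}
      zero_mem' := by simp
      add_mem' := fun {f g} hf hg => by
        simp only [Set.mem_ofPred_eq, BoundedContinuousFunction.coe_add, Pi.add_apply] at *
        rw [integral_add (f.integrable μ) (g.integrable μ),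
          integral_add (f.integrable μ') (g.integrable μ'), hf, hg]
      smul_mem' := fun c g hg => by
        simp only [Set.mem_ofPred_eq, BoundedContinuousFunction.coe_smul] at *
        rw [integral_smul, integral_smul, hg] }
  have hcont : ∀ (ρ : Measure ℝ) [IsFiniteMeasure ρ],
      Continuous fun g : ℝ →ᵇ ℂ => ∫ x, g x ∂ρ := by
    intro ρ _
    refine continuous_iff_continuousAt.2 fun g => ?_
    rw [ContinuousAt, tendsto_iff_norm_sub_tendsto_zero]
    have h0 : Tendsto (fun f : ℝ →ᵇ ℂ => ‖f - g‖ * ρ.real Set.univ) (𝓝 g) (𝓝 0) := by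
      have hc : Continuous fun f : ℝ →ᵇ ℂ => ‖f - g‖ * ρ.real Set.univ := by fun_prop
      simpa using hc.tendsto g
    refine squeeze_zero (fun f => norm_nonneg _) (fun f => ?_) h0
    rw [← integral_sub (f.integrable ρ) (g.integrable ρ)]
    exact norm_integral_le_of_norm_le_const
      (Eventually.of_forall fun x => (f - g).norm_coe_le_norm x)
  have hWclosed : IsClosed (W : Set (ℝ →ᵇ ℂ)) := isClosed_eq (hcont μ) (hcont μ')
  have hspan : resolventSpan ≤ W := by
    refine Submodule.topologicalClosure_minimal _ ?_ hWclosed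
    rw [Submodule.span_le]
    rintro f (rfl | ⟨z, rfl⟩)
    · change ∫ x : ℝ, (1 : ℂ) ∂μ = ∫ x : ℝ, (1 : ℂ) ∂μ'
      simpa using hmass
    · exact h' z.1 z.2
  refine ext_of_forall_mem_subalgebra_integral_eq_of_polish (𝕜 := ℂ)
    (A := StarAlgebra.adjoin ℂ (Set.range resolventBCF)) ?_
    fun g hg => hspan (adjoin_le_resolventSpan hg)
  intro x y hxy
  let z : {z : ℂ // z.im ≠ 0} := ⟨Complex.I, by simp⟩
  refine ⟨fun x => resolventBCF z x, ⟨(resolventBCF z).toContinuousMap, ⟨resolventBCF z,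
    StarAlgebra.subset_adjoin ℂ _ ⟨z, rfl⟩, rfl⟩, rfl⟩, ?_⟩
  intro e
  simp only [resolventBCF_apply, _root_.inv_inj, sub_left_inj, Complex.ofReal_inj] at e
  exact hxy e

end

end PastFuture

namespace PastFuture

/-! ### Tightness and weak limits from Stieltjes transforms -/

section

/-- The tail of a probability measure is controlled by its Stieltjes transform. -/
theorem measure_tail_le_stieltjes (μ : Measure ℝ) [IsProbabilityMeasure μ] {y : ℝ} (hy : 0 < y) :
    μ.real {x | y < ‖x‖} ≤
      2 * ‖1 + Complex.I * y * ∫ x : ℝ, ((x : ℂ) - Complex.I * y)⁻¹ ∂μ‖ := by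
  have hz : (Complex.I * (y : ℂ)).im ≠ 0 := by simpa using hy.ne'
  have hint := (integrable_inv_ofReal_sub μ hz).const_mul (Complex.I * y)
  have e1 : 1 + Complex.I * y * ∫ x : ℝ, ((x : ℂ) - Complex.I * y)⁻¹ ∂μ =
      ∫ x : ℝ, (1 + Complex.I * y * ((x : ℂ) - Complex.I * y)⁻¹) ∂μ := by
    rw [integral_add (integrable_const _) hint, integral_const_mul]
    simp
  have hint' : Integrable (fun x : ℝ => 1 + Complex.I * y * ((x : ℂ) - Complex.I * y)⁻¹) μ :=
    (integrable_const _).add hint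
  -- The real part is x²/(x² + y²), which is nonnegative and at least 1/2 where |x| > y; Markov's
  -- inequality follows.
  have e2 : ∀ x : ℝ, (1 + Complex.I * y * ((x : ℂ) - Complex.I * y)⁻¹).re =
      x ^ 2 / (x ^ 2 + y ^ 2) := by
    intro x
    have hne : (x : ℂ) - Complex.I * y ≠ 0 := ofReal_sub_ne_zero hz x
    have hpos : 0 < x ^ 2 + y ^ 2 := by positivity
    have e3 : 1 + Complex.I * y * ((x : ℂ) - Complex.I * y)⁻¹ =
        x * ((x : ℂ) - Complex.I * y)⁻¹ := by
      field_simp; ring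
    rw [e3, Complex.re_ofReal_mul, Complex.inv_re, Complex.normSq_apply]
    simp
    rw [mul_div_assoc', ← pow_two, ← pow_two]
  have e4 : (1 / 2 : ℝ) * μ.real {x | y < ‖x‖} ≤
      ∫ x : ℝ, (1 + Complex.I * y * ((x : ℂ) - Complex.I * y)⁻¹).re ∂μ := by
    have hm : MeasurableSet {x : ℝ | y < ‖x‖} := measurableSet_lt measurable_const measurable_norm
    have : (1 / 2 : ℝ) * μ.real {x | y < ‖x‖} =
        ∫ x : ℝ, Set.indicator {x : ℝ | y < ‖x‖} (fun _ => (1 / 2 : ℝ)) x ∂μ := by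
      rw [integral_indicator_const _ hm]; simp [mul_comm]
    rw [this]
    refine integral_mono_of_nonneg ?_ hint'.re ?_
    · exact Eventually.of_forall fun x => Set.indicator_nonneg (fun _ _ => by norm_num) _
    · refine Eventually.of_forall fun x => ?_
      simp only
      change _ ≤ (1 + Complex.I * y * ((x : ℂ) - Complex.I * y)⁻¹).re
      rw [e2]
      refine Set.indicator_le' (g := fun x : ℝ => x ^ 2 / (x ^ 2 + y ^ 2)) (fun x hx => ?_)
        (fun x _ => by positivity) x
      have hx' : y < |x| := hx
      have h1 : y ^ 2 ≤ x ^ 2 := by rw [← sq_abs x]; exact pow_le_pow_left₀ hy.le hx'.le 2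
      rw [div_le_div_iff₀ (by norm_num) (by positivity)]
      linarith
  have e5 : ∫ x : ℝ, (1 + Complex.I * y * ((x : ℂ) - Complex.I * y)⁻¹).re ∂μ ≤
      ‖1 + Complex.I * y * ∫ x : ℝ, ((x : ℂ) - Complex.I * y)⁻¹ ∂μ‖ := by
    rw [e1]
    have := integral_re hint'
    refine (le_of_eq this).trans ?_
    exact (le_abs_self _).trans (Complex.abs_re_le_norm _)
  linarith

/-- The tail beyond level y is at most 2‖1 + iy m(iy)‖. Control for large n is enough, since on ℝ
tightness of a sequence can be tested on the limsup of the tails. -/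
theorem isTightMeasureSet_range_of_stieltjes (μ : ℕ → Measure ℝ)
    [∀ n, IsProbabilityMeasure (μ n)]
    (h : ∀ ε > 0, ∃ y : ℝ, 0 < y ∧ ∀ᶠ n in atTop,
      ‖1 + Complex.I * y * ∫ x : ℝ, ((x : ℂ) - Complex.I * y)⁻¹ ∂(μ n)‖ ≤ ε) :
    IsTightMeasureSet (Set.range μ) := by
  refine isTightMeasureSet_range_of_tendsto_limsup_measure_norm_gt ?_
  rw [ENNReal.tendsto_nhds_zero]
  intro ε hε
  obtain ⟨δ, hδ0, hδ⟩ : ∃ δ : ℝ, 0 < δ ∧ ENNReal.ofReal (2 * δ) ≤ ε := by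
    by_cases htop : ε = ⊤
    · exact ⟨1, one_pos, by simp [htop]⟩
    · refine ⟨ε.toReal / 2, by have := ENNReal.toReal_pos hε.ne' htop; positivity, ?_⟩
      rw [mul_div_cancel₀ _ (two_ne_zero)]
      exact ENNReal.ofReal_toReal_le
  obtain ⟨y, hy, hev⟩ := h δ hδ0
  filter_upwards [eventually_ge_atTop y] with r hr
  refine limsup_le_of_le (by isBoundedDefault) ?_
  filter_upwards [hev] with n hn
  calc μ n {x | r < ‖x‖} ≤ μ n {x | y < ‖x‖} := measure_mono fun x hx => hr.trans_lt hx
    _ = ENNReal.ofReal ((μ n).real {x | y < ‖x‖}) := by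
        rw [ofReal_measureReal]
    _ ≤ ENNReal.ofReal (2 * δ) :=
        ENNReal.ofReal_le_ofReal ((measure_tail_le_stieltjes (μ n) hy).trans (by gcongr))
    _ ≤ ε := hδ

/-- A measure of total mass one, as a bundled probability measure. -/
def toProbabilityMeasure (μ : Measure ℝ) (h : IsProbabilityMeasure μ) : ProbabilityMeasure ℝ :=
  ⟨μ, h⟩

theorem tendsto_integral_resolvent {γ : Type*} {F : Filter γ} {μs : γ → ProbabilityMeasure ℝ}
    {μ : ProbabilityMeasure ℝ} (h : Tendsto μs F (𝓝 μ)) {z : ℂ} (hz : z.im ≠ 0) :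
    Tendsto (fun i => ∫ x : ℝ, ((x : ℂ) - z)⁻¹ ∂(μs i : Measure ℝ)) F
      (𝓝 (∫ x : ℝ, ((x : ℂ) - z)⁻¹ ∂(μ : Measure ℝ))) :=
  (ProbabilityMeasure.tendsto_iff_forall_integral_rclike_tendsto ℂ).1 h (resolventBCF ⟨z, hz⟩)

/-- If the Stieltjes transforms get close and one of the sequences is uniformly tight, then the
measures get close weakly. -/
theorem tendsto_integral_sub_of_stieltjes (μ ν : ℕ → Measure ℝ)
    [hμ : ∀ n, IsProbabilityMeasure (μ n)] [hν : ∀ n, IsProbabilityMeasure (ν n)]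
    (htight : ∀ ε > 0, ∃ y : ℝ, 0 < y ∧ ∀ᶠ n in atTop,
      ‖1 + Complex.I * y * ∫ x : ℝ, ((x : ℂ) - Complex.I * y)⁻¹ ∂(ν n)‖ ≤ ε)
    (h : ∀ z : ℂ, 0 < z.im → Tendsto (fun n => (∫ x : ℝ, ((x : ℂ) - z)⁻¹ ∂(μ n)) -
      ∫ x : ℝ, ((x : ℂ) - z)⁻¹ ∂(ν n)) atTop (𝓝 0)) (f : ℝ →ᵇ ℝ) :
    Tendsto (fun n => (∫ x, f x ∂(μ n)) - ∫ x, f x ∂(ν n)) atTop (𝓝 0) := by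
  have tν := isTightMeasureSet_range_of_stieltjes ν htight
  -- Tightness passes from ν to μ because the transforms at the test point iy are asymptotically
  -- equal.
  have tμ : IsTightMeasureSet (Set.range μ) := by
    refine isTightMeasureSet_range_of_stieltjes μ fun ε hε => ?_
    obtain ⟨y, hy, hev⟩ := htight (ε / 2) (by positivity)
    refine ⟨y, hy, ?_⟩
    have h1 := ((h (Complex.I * y) (by simpa using hy)).const_mul (Complex.I * (y : ℂ))).norm
    rw [mul_zero, norm_zero] at h1
    filter_upwards [hev, h1.eventually (gt_mem_nhds (half_pos hε))] with n h2 h3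
    have : 1 + Complex.I * y * ∫ x : ℝ, ((x : ℂ) - Complex.I * y)⁻¹ ∂(μ n) =
        (1 + Complex.I * y * ∫ x : ℝ, ((x : ℂ) - Complex.I * y)⁻¹ ∂(ν n)) +
        Complex.I * y * ((∫ x : ℝ, ((x : ℂ) - Complex.I * y)⁻¹ ∂(μ n)) -
          ∫ x : ℝ, ((x : ℂ) - Complex.I * y)⁻¹ ∂(ν n)) := by ring
    rw [this]
    refine (norm_add_le _ _).trans ?_
    linarith
  have comp : ∀ (ρ : ℕ → Measure ℝ) (hρ : ∀ n, IsProbabilityMeasure (ρ n)),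
      IsTightMeasureSet (Set.range ρ) →
      IsCompact (closure (Set.range fun n => toProbabilityMeasure (ρ n) (hρ n))) := by
    intro ρ hρ ht
    refine isCompact_closure_of_isTightMeasureSet (ht.subset ?_)
    rintro _ ⟨_, ⟨n, rfl⟩, rfl⟩
    exact ⟨n, rfl⟩
  -- Along an ultrafilter both relatively compact sequences converge at once, with no need to
  -- extract subsequences; the two limits have the same Stieltjes transform.
  rw [tendsto_iff_ultrafilter]
  intro U hU
  have lim : ∀ (ρ : ℕ → Measure ℝ) (hρ : ∀ n, IsProbabilityMeasure (ρ n)),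
      IsTightMeasureSet (Set.range ρ) →
      ∃ ρ₀ : ProbabilityMeasure ℝ,
        Tendsto (fun n => toProbabilityMeasure (ρ n) (hρ n)) U (𝓝 ρ₀) := by
    intro ρ hρ ht
    obtain ⟨x, -, hx⟩ := (comp ρ hρ ht).ultrafilter_le_nhds
      (U.map fun n => toProbabilityMeasure (ρ n) (hρ n)) (by
        rw [Filter.le_principal_iff, Ultrafilter.coe_map, Filter.mem_map]
        exact Filter.univ_mem' fun n => subset_closure ⟨n, rfl⟩)
    exact ⟨x, hx⟩
  obtain ⟨μ₀, hμ₀⟩ := lim μ hμ tμ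
  obtain ⟨ν₀, hν₀⟩ := lim ν hν tν
  have heq : (μ₀ : Measure ℝ) = ν₀ := by
    refine measure_eq_of_stieltjes_eq _ _ fun z hz => ?_
    have h1 := (tendsto_integral_resolvent hμ₀ hz.ne').sub (tendsto_integral_resolvent hν₀ hz.ne')
    have h2 := (h z hz).mono_left hU
    exact sub_eq_zero.1 (tendsto_nhds_unique h1 h2)
  have h1 := (ProbabilityMeasure.tendsto_iff_forall_integral_tendsto.1 hμ₀ f).sub
    (ProbabilityMeasure.tendsto_iff_forall_integral_tendsto.1 hν₀ f)
  rw [heq, sub_self] at h1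
  exact h1

theorem norm_stieltjes_sub_le (μ : Measure ℝ) [IsProbabilityMeasure μ] {z z' : ℂ}
    (hz : 0 < z.im) (hz' : 0 < z'.im) :
    ‖(∫ x : ℝ, ((x : ℂ) - z)⁻¹ ∂μ) - ∫ x : ℝ, ((x : ℂ) - z')⁻¹ ∂μ‖ ≤
      ‖z - z'‖ * (z.im⁻¹ * z'.im⁻¹) := by
  rw [← integral_sub (integrable_inv_ofReal_sub μ hz.ne') (integrable_inv_ofReal_sub μ hz'.ne')]
  have : ∀ x : ℝ, ‖((x : ℂ) - z)⁻¹ - ((x : ℂ) - z')⁻¹‖ ≤ ‖z - z'‖ * (z.im⁻¹ * z'.im⁻¹) := by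
    intro x
    rw [inv_sub_inv_ofReal_sub hz.ne' hz'.ne', norm_mul, norm_mul]
    have h1 := norm_inv_ofReal_sub_le hz.ne' x
    have h2 := norm_inv_ofReal_sub_le hz'.ne' x
    rw [abs_of_pos hz] at h1
    rw [abs_of_pos hz'] at h2
    gcongr
  have h3 := norm_integral_le_of_norm_le_const (μ := μ) (Eventually.of_forall this)
  simpa using h3

theorem continuous_of_lipBound (F : {z : ℂ // 0 < z.im} → ℂ)
    (h : ∀ z z', ‖F z - F z'‖ ≤ ‖z.1 - z'.1‖ * (z.1.im⁻¹ * z'.1.im⁻¹)) : Continuous F := by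
  refine continuous_iff_continuousAt.2 fun z => ?_
  rw [ContinuousAt, tendsto_iff_norm_sub_tendsto_zero]
  refine squeeze_zero (fun z' => norm_nonneg _) (fun z' => h z' z) ?_
  have hc : ContinuousAt (fun z' : {z : ℂ // 0 < z.im} =>
      ‖z'.1 - z.1‖ * (z'.1.im⁻¹ * z.1.im⁻¹)) z := by
    refine ContinuousAt.mul (by fun_prop) (ContinuousAt.mul ?_ continuousAt_const)
    exact ContinuousAt.inv₀ (by fun_prop) z.2.ne'
  have := hc.tendsto
  simpa using this

/-- A function on the upper half-plane which can be approximated on finite sets by Stieltjes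
transforms of probability measures on `[0, ∞)`, without loss of mass at infinity, is a Stieltjes
transform. -/
theorem exists_measure_of_approx (F : ℂ → ℂ)
    (happ : ∀ (Z : Finset ℂ), (∀ z ∈ Z, 0 < z.im) → ∀ ε > 0, ∃ μ : Measure ℝ,
      IsProbabilityMeasure μ ∧ μ (Set.Iio 0) = 0 ∧
      ∀ z ∈ Z, ‖(∫ x : ℝ, ((x : ℂ) - z)⁻¹ ∂μ) - F z‖ ≤ ε)
    (hF : ∀ ε > 0, ∃ y : ℝ, 0 < y ∧ ‖1 + Complex.I * y * F (Complex.I * y)‖ ≤ ε) :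
    ∃ μ : Measure ℝ, IsProbabilityMeasure μ ∧ μ (Set.Iio 0) = 0 ∧
      ∀ z : ℂ, 0 < z.im → ∫ x : ℝ, ((x : ℂ) - z)⁻¹ ∂μ = F z := by
  classical
  -- F inherits the Lipschitz estimate of Stieltjes transforms from approximations at two points. It
  -- makes F continuous, so that agreement on a dense set suffices.
  have hlip : ∀ z z' : ℂ, 0 < z.im → 0 < z'.im →
      ‖F z - F z'‖ ≤ ‖z - z'‖ * (z.im⁻¹ * z'.im⁻¹) := by
    intro z z' hz hz'
    refine le_of_forall_pos_le_add fun ε hε => ?_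
    obtain ⟨μ, hμ, -, hZ⟩ := happ {z, z'} (by simp [hz, hz']) (ε / 2) (by positivity)
    have h1 := hZ z (by simp)
    have h2 := hZ z' (by simp)
    have h3 := norm_stieltjes_sub_le μ hz hz'
    have e : F z - F z' = -((∫ x : ℝ, ((x : ℂ) - z)⁻¹ ∂μ) - F z) +
        ((∫ x : ℝ, ((x : ℂ) - z)⁻¹ ∂μ) - ∫ x : ℝ, ((x : ℂ) - z')⁻¹ ∂μ) +
        ((∫ x : ℝ, ((x : ℂ) - z')⁻¹ ∂μ) - F z') := by ring
    rw [e]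
    refine (norm_add_le _ _).trans ((add_le_add_left (norm_add_le _ _) _).trans ?_)
    rw [norm_neg]
    linarith
  choose y hy hyF using fun n : ℕ => hF (1 / ((n : ℝ) + 1)) (by positivity)
  obtain ⟨D, hDc, hDd⟩ := TopologicalSpace.exists_countable_dense {z : ℂ // 0 < z.im}
  have : Nonempty {z : ℂ // 0 < z.im} := ⟨⟨Complex.I, by simp⟩⟩
  obtain ⟨d, hd⟩ := hDc.exists_eq_range hDd.nonempty
  -- The n-th test set contains the first n points of a dense sequence and the first n points iy_k
  -- used for tightness.
  let Z : ℕ → Finset ℂ := fun n => (Finset.range n).image (fun k => (d k).1) ∪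
    (Finset.range n).image fun k => Complex.I * (y k : ℂ)
  have hZ : ∀ n, ∀ z ∈ Z n, 0 < z.im := by
    intro n z hz
    simp only [Z, Finset.mem_union, Finset.mem_image] at hz
    rcases hz with ⟨k, -, rfl⟩ | ⟨k, -, rfl⟩
    · exact (d k).2
    · simpa using hy k
  choose μ hμ hμ0 hμZ using fun n : ℕ => happ (Z n) (hZ n) (1 / ((n : ℝ) + 1)) (by positivity)
  have hconv : ∀ z : ℂ, (∀ᶠ n in atTop, z ∈ Z n) →
      Tendsto (fun n => ∫ x : ℝ, ((x : ℂ) - z)⁻¹ ∂(μ n)) atTop (𝓝 (F z)) := by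
    intro z hz
    rw [tendsto_iff_norm_sub_tendsto_zero]
    refine squeeze_zero' (Eventually.of_forall fun n => norm_nonneg _) ?_
      tendsto_one_div_add_atTop_nhds_zero_nat
    filter_upwards [hz] with n hn
    exact hμZ n z hn
  have hyZ : ∀ k, ∀ᶠ n in atTop, Complex.I * (y k : ℂ) ∈ Z n := fun k => by
    filter_upwards [eventually_gt_atTop k] with n hn
    exact Finset.mem_union_right _ (Finset.mem_image.2 ⟨k, Finset.mem_range.2 hn, rfl⟩)
  have hdZ : ∀ k, ∀ᶠ n in atTop, (d k).1 ∈ Z n := fun k => by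
    filter_upwards [eventually_gt_atTop k] with n hn
    exact Finset.mem_union_left _ (Finset.mem_image.2 ⟨k, Finset.mem_range.2 hn, rfl⟩)
  have ht : IsTightMeasureSet (Set.range μ) := by
    refine isTightMeasureSet_range_of_stieltjes μ fun ε hε => ?_
    obtain ⟨k, hk⟩ := exists_nat_one_div_lt hε
    refine ⟨y k, hy k, ?_⟩
    have h1 := (((hconv _ (hyZ k)).const_mul (Complex.I * (y k : ℂ))).const_add 1).norm
    filter_upwards [h1.eventually (gt_mem_nhds ((hyF k).trans_lt hk))] with n hn
    exact hn.le
  have hcomp : IsCompact (closure (Set.range fun n =>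
      toProbabilityMeasure (μ n) (hμ n))) := by
    refine isCompact_closure_of_isTightMeasureSet (ht.subset ?_)
    rintro _ ⟨_, ⟨n, rfl⟩, rfl⟩
    exact ⟨n, rfl⟩
  obtain ⟨μ₀, -, φ, hφ, hlim⟩ := hcomp.tendsto_subseq
    (x := fun n => toProbabilityMeasure (μ n) (hμ n)) fun n => subset_closure ⟨n, rfl⟩
  refine ⟨μ₀, inferInstance, ?_, ?_⟩
  -- The half-line (-∞, 0) is open, so the portmanteau inequality keeps its mass zero in the limit.
  · have h1 := ProbabilityMeasure.le_liminf_measure_open_of_tendsto hlim (isOpen_Iio (a := (0 : ℝ)))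
    refine le_antisymm (h1.trans ?_) zero_le
    have : ∀ n, (((fun n => toProbabilityMeasure (μ n) (hμ n)) ∘ φ) n : Measure ℝ)
        (Set.Iio 0) = 0 := fun n => hμ0 (φ n)
    simp_rw [this]
    simp
  · have hDeq : ∀ k, ∫ x : ℝ, ((x : ℂ) - (d k).1)⁻¹ ∂(μ₀ : Measure ℝ) = F (d k).1 := by
      intro k
      have h1 := tendsto_integral_resolvent hlim (d k).2.ne'
      exact tendsto_nhds_unique h1 ((hconv _ (hdZ k)).comp hφ.tendsto_atTop)
    have hcontL : Continuous fun z : {z : ℂ // 0 < z.im} =>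
        ∫ x : ℝ, ((x : ℂ) - z.1)⁻¹ ∂(μ₀ : Measure ℝ) := by
      refine continuous_of_lipBound _ fun z z' => norm_stieltjes_sub_le _ z.2 z'.2
    have hcontR : Continuous fun z : {z : ℂ // 0 < z.im} => F z.1 :=
      continuous_of_lipBound _ fun z z' => hlip _ _ z.2 z'.2
    have := hcontL.ext_on hDd hcontR (by
      rw [hd]; rintro _ ⟨k, rfl⟩; exact hDeq k)
    intro z hz
    exact congrFun this ⟨z, hz⟩

end

end PastFuture

namespace PastFuture

section

/-! ### Concentration for functions with bounded differences -/

theorem integrable_of_abs_le {X : Type*} [MeasurableSpace X] {μ : Measure X} [IsFiniteMeasure μ]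
    {f : X → ℝ} (hf : Measurable f) {C : ℝ} (hC : ∀ x, |f x| ≤ C) : Integrable f μ :=
  Integrable.of_bound hf.aestronglyMeasurable C (Eventually.of_forall hC)

/-- Hoeffding's lemma on the interval of half-length c around an arbitrary value of f; the variance
proxy c² is not optimal but needs no supremum or infimum. -/
theorem hoeffding_mgf_le {E : Type*} [MeasurableSpace E] (μ : Measure E) [IsProbabilityMeasure μ]
    {f : E → ℝ} (hf : Measurable f) {c : ℝ} (hd : ∀ x y, |f x - f y| ≤ c) (t : ℝ) :
    ∫ x, Real.exp (t * (f x - ∫ y, f y ∂μ)) ∂μ ≤ Real.exp (c ^ 2 * t ^ 2 / 2) := by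
  have hne : Nonempty E := nonempty_of_isProbabilityMeasure μ
  obtain ⟨e⟩ := hne
  have hc : 0 ≤ c := (abs_nonneg _).trans (hd e e)
  have h := hasSubgaussianMGF_of_mem_Icc (μ := μ) (X := f) (a := f e - c) (b := f e + c)
    hf.aemeasurable (Eventually.of_forall fun x => by
      have := abs_le.1 (hd x e); constructor <;> linarith [this.1, this.2])
  have h2 := h.mgf_le t
  have e1 : (((‖f e + c - (f e - c)‖₊ / 2) ^ 2 : NNReal) : ℝ) = c ^ 2 := by
    push_cast
    rw [Real.norm_eq_abs, div_pow, sq_abs]; ring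
  rw [e1] at h2
  exact h2

/-- Induction on the number of coordinates: integrating out the first one leaves a function with the
same bounded differences, and the deviation from this conditional mean is handled by Hoeffding's
lemma for each fixed value of the others. -/
theorem boundedDifference_mgf_le {E : Type*} [MeasurableSpace E] (μ : Measure E)
    [IsProbabilityMeasure μ] (n : ℕ) (f : (Fin n → E) → ℝ) (hf : Measurable f) {C : ℝ}
    (hC : ∀ x, |f x| ≤ C) {c : ℝ}
    (hd : ∀ x i e, |f x - f (Function.update x i e)| ≤ c) (t : ℝ) :
    ∫ x, Real.exp (t * (f x - ∫ y, f y ∂(Measure.pi fun _ => μ))) ∂(Measure.pi fun _ => μ) ≤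
      Real.exp (n * c ^ 2 * t ^ 2 / 2) := by
  induction n with
  | zero =>
    have hconst : ∀ x, f x = f default := fun x => congrArg f (Subsingleton.elim _ _)
    simp [hconst]
  | succ n ih =>
    let π : Measure (Fin n → E) := Measure.pi fun _ => μ
    let Φ : E × (Fin n → E) → (Fin (n + 1) → E) := fun p => Fin.cons p.1 p.2
    have hΦ : MeasurePreserving Φ (μ.prod π) (Measure.pi fun _ : Fin (n + 1) => μ) := by
      have := (measurePreserving_piFinSuccAbove (fun _ : Fin (n + 1) => μ) 0).symm
      have e : ⇑(MeasurableEquiv.piFinSuccAbove (fun _ : Fin (n + 1) => E) 0).symm = Φ := by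
        ext1 p
        simp [Φ, MeasurableEquiv.piFinSuccAbove, Fin.consEquiv]
      rwa [e] at this
    have hΦm : Measurable Φ := hΦ.measurable
    have hcov : ∀ g : (Fin (n + 1) → E) → ℝ, Measurable g → (∃ K, ∀ x, |g x| ≤ K) →
        ∫ x, g x ∂(Measure.pi fun _ : Fin (n + 1) => μ) = ∫ x, ∫ a, g (Fin.cons a x) ∂μ ∂π := by
      rintro g hg ⟨K, hK⟩
      rw [← hΦ.map_eq, integral_map hΦm.aemeasurable hg.aestronglyMeasurable]
      exact integral_prod_symm _ (integrable_of_abs_le (hg.comp hΦm) fun p => hK _)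
    let g : (Fin n → E) → ℝ := fun x => ∫ a, f (Fin.cons a x) ∂μ
    have hfm : Measurable fun p : E × (Fin n → E) => f (Fin.cons p.1 p.2) := hf.comp hΦm
    have hsec : ∀ x, Measurable fun a => f (Fin.cons a x) := fun x =>
      hfm.comp measurable_prodMk_right
    have hgm : Measurable g :=
      (hfm.stronglyMeasurable.integral_prod_left' (μ := μ)).measurable
    have hsi : ∀ x, Integrable (fun a => f (Fin.cons a x)) μ := fun x =>
      integrable_of_abs_le (hsec x) fun a => hC _
    have hgC : ∀ x, |g x| ≤ C := fun x => by
      have := norm_integral_le_of_norm_le_const (μ := μ) (f := fun a => f (Fin.cons a x))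
        (C := C) (Eventually.of_forall fun a => hC _)
      simpa using this
    have hgd : ∀ x i e, |g x - g (Function.update x i e)| ≤ c := by
      intro x i e
      rw [← integral_sub (hsi _) (hsi _)]
      have := norm_integral_le_of_norm_le_const (μ := μ)
        (f := fun a => f (Fin.cons a x) - f (Fin.cons a (Function.update x i e)))
        (C := c) (Eventually.of_forall fun a => by
          rw [Real.norm_eq_abs, Fin.cons_update]; exact hd _ _ _)
      simpa using this
    have hEf : ∫ y, f y ∂(Measure.pi fun _ : Fin (n + 1) => μ) = ∫ x, g x ∂π :=
      hcov f hf ⟨C, hC⟩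
    have hEb : |∫ x, g x ∂π| ≤ C := by
      have := norm_integral_le_of_norm_le_const (μ := π) (f := g) (C := C)
        (Eventually.of_forall hgC)
      simpa using this
    rw [hcov _ (by fun_prop) ⟨Real.exp (|t| * (2 * C)), fun x => ?_⟩, hEf]
    · have hin : ∀ x, ∫ a, Real.exp (t * (f (Fin.cons a x) - ∫ x, g x ∂π)) ∂μ ≤
          Real.exp (c ^ 2 * t ^ 2 / 2) * Real.exp (t * (g x - ∫ x, g x ∂π)) := by
        intro x
        have e : ∀ a, Real.exp (t * (f (Fin.cons a x) - ∫ x, g x ∂π)) =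
            Real.exp (t * (g x - ∫ x, g x ∂π)) * Real.exp (t * (f (Fin.cons a x) - g x)) := by
          intro a; rw [← Real.exp_add]; congr 1; ring
        simp_rw [e]
        rw [integral_const_mul, mul_comm]
        refine mul_le_mul_of_nonneg_right ?_ (Real.exp_pos _).le
        refine hoeffding_mgf_le μ (hsec x) (c := c) (fun a b => ?_) t
        have := hd (Fin.cons a x) 0 b
        rwa [Fin.update_cons_zero] at this
      have hexpb : ∀ x, |Real.exp (t * (g x - ∫ x, g x ∂π))| ≤ Real.exp (|t| * (2 * C)) := by
        intro x
        rw [abs_of_pos (Real.exp_pos _)]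
        refine Real.exp_le_exp.2 ((le_abs_self _).trans ?_)
        rw [abs_mul]
        refine mul_le_mul_of_nonneg_left ((abs_sub _ _).trans ?_) (abs_nonneg _)
        linarith [hgC x]
      calc _ ≤ ∫ x, Real.exp (c ^ 2 * t ^ 2 / 2) * Real.exp (t * (g x - ∫ x, g x ∂π)) ∂π := by
            refine integral_mono_of_nonneg ?_ ?_ (Eventually.of_forall hin)
            · exact Eventually.of_forall fun x => integral_nonneg fun a => (Real.exp_pos _).le
            · exact (integrable_of_abs_le (by fun_prop) hexpb).const_mul _
        _ ≤ Real.exp (c ^ 2 * t ^ 2 / 2) * Real.exp (n * c ^ 2 * t ^ 2 / 2) := by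
            rw [integral_const_mul]
            exact mul_le_mul_of_nonneg_left (ih g hgm hgC hgd) (Real.exp_pos _).le
        _ = _ := by rw [← Real.exp_add]; congr 1; push_cast; ring
    · rw [abs_of_pos (Real.exp_pos _)]
      refine Real.exp_le_exp.2 ((le_abs_self _).trans ?_)
      rw [abs_mul]
      refine mul_le_mul_of_nonneg_left ((abs_sub _ _).trans ?_) (abs_nonneg _)
      rw [hEf]
      linarith [hC x]

theorem boundedDifference_hasSubgaussianMGF {E : Type*} [MeasurableSpace E] (μ : Measure E)
    [IsProbabilityMeasure μ] (n : ℕ) (f : (Fin n → E) → ℝ) (hf : Measurable f) {C : ℝ}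
    (hC : ∀ x, |f x| ≤ C) {c : ℝ} (hd : ∀ x i e, |f x - f (Function.update x i e)| ≤ c)
    {σ : ℝ} (hσ : 0 < σ) (hcσ : n * c ^ 2 ≤ σ ^ 2) :
    HasSubgaussianMGF (fun x => f x - ∫ y, f y ∂(Measure.pi fun _ => μ))
      (⟨σ ^ 2, by positivity⟩ : NNReal) (Measure.pi fun _ => μ) where
  integrable_exp_mul t := by
    refine integrable_of_abs_le (by fun_prop) (C := Real.exp (|t| * (C + |∫ y, f y ∂(Measure.pi
      fun _ : Fin n => μ)|))) fun x => ?_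
    rw [abs_of_pos (Real.exp_pos _)]
    refine Real.exp_le_exp.2 ((le_abs_self _).trans ?_)
    rw [abs_mul]
    refine mul_le_mul_of_nonneg_left ((abs_sub _ _).trans ?_) (abs_nonneg _)
    linarith [hC x]
  mgf_le t := by
    refine (boundedDifference_mgf_le μ n f hf hC hd t).trans (Real.exp_le_exp.2 ?_)
    change _ ≤ σ ^ 2 * t ^ 2 / 2
    gcongr

/-- Uses |x| ≤ eˣ + e⁻ˣ for x = X/σ; at ±1/σ the moment generating function is at most e^{1/2} ≤ 2.
-/
theorem HasSubgaussianMGF.integral_abs_le {Ω : Type*} [MeasurableSpace Ω] {μ : Measure Ω}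
    {X : Ω → ℝ} {σ : ℝ} (hσ : 0 < σ)
    (h : HasSubgaussianMGF X (⟨σ ^ 2, by positivity⟩ : NNReal) μ) :
    ∫ ω, |X ω| ∂μ ≤ 4 * σ := by
  have hexp : ∀ t : ℝ, t ^ 2 = (σ⁻¹) ^ 2 → ∫ ω, Real.exp (t * X ω) ∂μ ≤ 2 := by
    intro t ht
    refine (h.mgf_le t).trans ?_
    change Real.exp (σ ^ 2 * t ^ 2 / 2) ≤ 2
    rw [ht, ← mul_pow, mul_inv_cancel₀ hσ.ne', one_pow]
    have h1 := Real.add_one_le_exp (-(1 / 2 : ℝ))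
    have h2 : Real.exp (1 / 2 : ℝ) * Real.exp (-(1 / 2 : ℝ)) = 1 := by
      rw [← Real.exp_add]; simp
    nlinarith [Real.exp_pos (1 / 2 : ℝ)]
  have hb : ∀ ω, |X ω| ≤ σ * (Real.exp (σ⁻¹ * X ω) + Real.exp (-σ⁻¹ * X ω)) := by
    intro ω
    have h1 := Real.add_one_le_exp (σ⁻¹ * X ω)
    have h2 := Real.add_one_le_exp (-σ⁻¹ * X ω)
    have h3 := Real.exp_pos (σ⁻¹ * X ω)
    have h4 := Real.exp_pos (-σ⁻¹ * X ω)
    have h5 : |σ⁻¹ * X ω| ≤ Real.exp (σ⁻¹ * X ω) + Real.exp (-σ⁻¹ * X ω) := by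
      rw [abs_le]; constructor <;> linarith
    rw [abs_mul, abs_of_pos (inv_pos.2 hσ)] at h5
    calc |X ω| = σ * (σ⁻¹ * |X ω|) := by rw [← mul_assoc, mul_inv_cancel₀ hσ.ne', one_mul]
      _ ≤ _ := by gcongr
  have i1 := h.integrable_exp_mul σ⁻¹
  have i2 := h.integrable_exp_mul (-σ⁻¹)
  calc ∫ ω, |X ω| ∂μ ≤ ∫ ω, σ * (Real.exp (σ⁻¹ * X ω) + Real.exp (-σ⁻¹ * X ω)) ∂μ :=
        integral_mono_of_nonneg (Eventually.of_forall fun ω => abs_nonneg _)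
          ((i1.add i2).const_mul _) (Eventually.of_forall hb)
    _ = σ * (∫ ω, Real.exp (σ⁻¹ * X ω) ∂μ + ∫ ω, Real.exp (-σ⁻¹ * X ω) ∂μ) := by
        rw [integral_const_mul, integral_add i1 i2]
    _ ≤ σ * (2 + 2) := by
        gcongr
        · exact hexp _ rfl
        · exact hexp _ (by ring)
    _ = _ := by ring

theorem boundedDifference_re_im {E : Type*} [MeasurableSpace E] (μ : Measure E)
    [IsProbabilityMeasure μ] (n : ℕ) (f : (Fin n → E) → ℂ) (hf : Measurable f) {C : ℝ}
    (hC : ∀ x, ‖f x‖ ≤ C) {c : ℝ} (hd : ∀ x i e, ‖f x - f (Function.update x i e)‖ ≤ c) {σ : ℝ}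
    (hσ : 0 < σ) (hcσ : n * c ^ 2 ≤ σ ^ 2) :
    HasSubgaussianMGF (fun x => (f x - ∫ y, f y ∂(Measure.pi fun _ => μ)).re)
      (⟨σ ^ 2, by positivity⟩ : NNReal) (Measure.pi fun _ => μ) ∧
    HasSubgaussianMGF (fun x => (f x - ∫ y, f y ∂(Measure.pi fun _ => μ)).im)
      (⟨σ ^ 2, by positivity⟩ : NNReal) (Measure.pi fun _ => μ) := by
  have hint : Integrable f (Measure.pi fun _ => μ) :=
    Integrable.of_bound hf.aestronglyMeasurable C (Eventually.of_forall hC)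
  have e1 : (∫ y, f y ∂(Measure.pi fun _ => μ)).re = ∫ y, (f y).re ∂(Measure.pi fun _ => μ) :=
    (integral_re hint).symm
  have e2 : (∫ y, f y ∂(Measure.pi fun _ => μ)).im = ∫ y, (f y).im ∂(Measure.pi fun _ => μ) :=
    (integral_im hint).symm
  simp only [Complex.sub_re, Complex.sub_im, e1, e2]
  constructor
  · refine boundedDifference_hasSubgaussianMGF μ n _ (Complex.measurable_re.comp hf)
      (fun x => (Complex.abs_re_le_norm _).trans (hC x)) (fun x i e => ?_) hσ hcσ
    rw [Function.comp_apply, Function.comp_apply, ← Complex.sub_re]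
    exact (Complex.abs_re_le_norm _).trans (hd x i e)
  · refine boundedDifference_hasSubgaussianMGF μ n _ (Complex.measurable_im.comp hf)
      (fun x => (Complex.abs_im_le_norm _).trans (hC x)) (fun x i e => ?_) hσ hcσ
    rw [Function.comp_apply, Function.comp_apply, ← Complex.sub_im]
    exact (Complex.abs_im_le_norm _).trans (hd x i e)

theorem boundedDifference_integral_norm_le {E : Type*} [MeasurableSpace E] (μ : Measure E)
    [IsProbabilityMeasure μ] (n : ℕ) (f : (Fin n → E) → ℂ) (hf : Measurable f) {C : ℝ}
    (hC : ∀ x, ‖f x‖ ≤ C) {c : ℝ} (hd : ∀ x i e, ‖f x - f (Function.update x i e)‖ ≤ c) {σ : ℝ}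
    (hσ : 0 < σ) (hcσ : n * c ^ 2 ≤ σ ^ 2) :
    ∫ x, ‖f x - ∫ y, f y ∂(Measure.pi fun _ => μ)‖ ∂(Measure.pi fun _ => μ) ≤ 8 * σ := by
  obtain ⟨h1, h2⟩ := boundedDifference_re_im μ n f hf hC hd hσ hcσ
  calc _ ≤ ∫ x, (|(f x - ∫ y, f y ∂(Measure.pi fun _ => μ)).re| +
        |(f x - ∫ y, f y ∂(Measure.pi fun _ => μ)).im|) ∂(Measure.pi fun _ => μ) :=
        integral_mono_of_nonneg (Eventually.of_forall fun x => norm_nonneg _)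
          (h1.integrable.abs.add h2.integrable.abs)
          (Eventually.of_forall fun x => Complex.norm_le_abs_re_add_abs_im _)
    _ ≤ 4 * σ + 4 * σ := by
        rw [integral_add h1.integrable.abs h2.integrable.abs]
        exact add_le_add (HasSubgaussianMGF.integral_abs_le hσ h1)
          (HasSubgaussianMGF.integral_abs_le hσ h2)
    _ = _ := by ring

theorem boundedDifference_tail {E : Type*} [MeasurableSpace E] (μ : Measure E)
    [IsProbabilityMeasure μ] (n : ℕ) (f : (Fin n → E) → ℂ) (hf : Measurable f) {C : ℝ}
    (hC : ∀ x, ‖f x‖ ≤ C) {c : ℝ} (hd : ∀ x i e, ‖f x - f (Function.update x i e)‖ ≤ c) {σ : ℝ}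
    (hσ : 0 < σ) (hcσ : n * c ^ 2 ≤ σ ^ 2)
    {ε : ℝ} (hε : 0 ≤ ε) :
    (Measure.pi fun _ => μ).real {x | ε ≤ ‖f x - ∫ y, f y ∂(Measure.pi fun _ => μ)‖} ≤
      4 * Real.exp (-(ε / 2) ^ 2 / (2 * σ ^ 2)) := by
  obtain ⟨h1, h2⟩ := boundedDifference_re_im μ n f hf hC hd hσ hcσ
  have hε2 : 0 ≤ ε / 2 := by positivity
  have t1 := h1.measure_ge_le hε2
  have t2 := h1.neg.measure_ge_le hε2
  have t3 := h2.measure_ge_le hε2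
  have t4 := h2.neg.measure_ge_le hε2
  set m := ∫ y, f y ∂(Measure.pi fun _ : Fin n => μ)
  -- A complex number of modulus at least ε has a real or imaginary part of modulus at least ε/2,
  -- hence the union of four one-sided tails.
  have hsub : {x | ε ≤ ‖f x - m‖} ⊆
      ({x | ε / 2 ≤ (f x - m).re} ∪ {x | ε / 2 ≤ (-fun x => (f x - m).re) x}) ∪
      ({x | ε / 2 ≤ (f x - m).im} ∪ {x | ε / 2 ≤ (-fun x => (f x - m).im) x}) := by
    intro x hx
    have hx' : ε ≤ ‖f x - m‖ := hx
    have h3 := Complex.norm_le_abs_re_add_abs_im (f x - m)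
    simp only [Set.mem_union, Set.mem_ofPred_eq, Pi.neg_apply]
    rcases le_or_gt (ε / 2) |(f x - m).re| with h4 | h4
    · left; exact le_abs.1 h4
    · right; exact le_abs.1 (by linarith)
  refine (measureReal_mono hsub).trans ((measureReal_union_le _ _).trans ?_)
  refine (add_le_add (measureReal_union_le _ _) (measureReal_union_le _ _)).trans ?_
  refine (add_le_add (add_le_add t1 t2) (add_le_add t3 t4)).trans (le_of_eq ?_)
  change Real.exp (-(ε / 2) ^ 2 / (2 * σ ^ 2)) + Real.exp (-(ε / 2) ^ 2 / (2 * σ ^ 2)) +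
    (Real.exp (-(ε / 2) ^ 2 / (2 * σ ^ 2)) + Real.exp (-(ε / 2) ^ 2 / (2 * σ ^ 2))) = _
  ring

end

end PastFuture

namespace PastFuture

section

/-! ### Complex Gaussian measures -/

/-- The real part of a standard complex Gaussian variable has this law. -/
noncomputable abbrev halfGaussian : Measure ℝ := gaussianReal 0 (1 / 2)

/-- The standard complex Gaussian measure. -/
noncomputable def stdComplexGaussian : Measure ℂ :=
  (halfGaussian.prod halfGaussian).map fun p => (p.1 : ℂ) + p.2 * Complex.I

theorem measurable_ofReal_add_mul_I :
    Measurable fun p : ℝ × ℝ => (p.1 : ℂ) + p.2 * Complex.I := by fun_prop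

instance : IsProbabilityMeasure stdComplexGaussian :=
  Measure.isProbabilityMeasure_map measurable_ofReal_add_mul_I.aemeasurable

theorem integral_stdComplexGaussian {E : Type*} [NormedAddCommGroup E] [NormedSpace ℝ E]
    {F : ℂ → E} (hF : AEStronglyMeasurable F stdComplexGaussian) :
    ∫ z, F z ∂stdComplexGaussian =
      ∫ p : ℝ × ℝ, F (p.1 + p.2 * Complex.I) ∂(halfGaussian.prod halfGaussian) :=
  integral_map measurable_ofReal_add_mul_I.aemeasurable hF

/-- The characteristic function depends on |t| only; rotation invariance of the measure is read off
from this. -/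
theorem charFun_stdComplexGaussian (t : ℂ) :
    charFun stdComplexGaussian t = Complex.exp (-(Complex.normSq t : ℂ) / 4) := by
  rw [charFun_apply, integral_stdComplexGaussian (by fun_prop)]
  have e : ∀ p : ℝ × ℝ, Complex.exp ((inner ℝ ((p.1 : ℂ) + p.2 * Complex.I) t : ℝ) * Complex.I) =
      Complex.exp ((t.re : ℂ) * p.1 * Complex.I) * Complex.exp ((t.im : ℂ) * p.2 * Complex.I) := by
    intro p
    rw [← Complex.exp_add]
    congr 1
    rw [Complex.inner]
    simp
    ring
  simp_rw [e]
  rw [integral_prod_mul (fun x : ℝ => Complex.exp ((t.re : ℂ) * x * Complex.I))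
    (fun y : ℝ => Complex.exp ((t.im : ℂ) * y * Complex.I)), ← charFun_apply_real,
    ← charFun_apply_real, charFun_gaussianReal, charFun_gaussianReal, ← Complex.exp_add]
  congr 1
  rw [Complex.normSq_apply]
  push_cast
  ring

/-- The standard complex Gaussian measure is invariant under rotations. -/
theorem measurePreserving_mul_stdComplexGaussian {u : ℂ} (hu : ‖u‖ = 1) :
    MeasurePreserving (fun z => u * z) stdComplexGaussian stdComplexGaussian := by
  have hm : Measurable fun z : ℂ => u * z := by fun_prop
  refine ⟨hm, ?_⟩
  have : IsProbabilityMeasure (stdComplexGaussian.map fun z => u * z) :=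
    Measure.isProbabilityMeasure_map hm.aemeasurable
  refine Measure.ext_of_charFun (funext fun t => ?_)
  have h1 : charFun (stdComplexGaussian.map fun z => u * z) t =
      charFun stdComplexGaussian (starRingEnd ℂ u * t) := by
    rw [charFun_apply, charFun_apply, integral_map hm.aemeasurable (by fun_prop)]
    refine integral_congr_ae (Eventually.of_forall fun z => ?_)
    simp only
    congr 3
    simp only [Complex.inner, map_mul]
    ring_nf
  rw [h1, charFun_stdComplexGaussian, charFun_stdComplexGaussian, map_mul, Complex.normSq_conj,
    Complex.normSq_eq_norm_sq u, hu]
  simp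

/-- Gaussian integration by parts on the real line. -/
theorem integral_smul_halfGaussian {E : Type*} [NormedAddCommGroup E] [NormedSpace ℝ E]
    [CompleteSpace E] {F F' : ℝ → E} (hF : ∀ x, HasDerivAt F (F' x) x) {C : ℝ}
    (hC : ∀ x, ‖F x‖ ≤ C) (hC' : ∀ x, ‖F' x‖ ≤ C) (hF'm : Continuous F') :
    ∫ x, x • F x ∂halfGaussian = (1 / 2 : ℝ) • ∫ x, F' x ∂halfGaussian := by
  have hv : (1 / 2 : NNReal) ≠ 0 := by norm_num
  have hFc : Continuous F := continuous_iff_continuousAt.2 fun x => (hF x).continuousAt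
  have hid : Integrable (fun x : ℝ => x) halfGaussian :=
    (memLp_id_gaussianReal 1).integrable (by norm_num)
  set u := gaussianPDFReal 0 (1 / 2) with hu
  have hui : Integrable u := integrable_gaussianPDFReal _ _
  have huc : Continuous u := by
    rw [hu, gaussianPDFReal_def]; fun_prop
  have hder : ∀ x, HasDerivAt u (-(2 * x) * u x) x := by
    intro x
    rw [hu, gaussianPDFReal_def]
    have h1 : HasDerivAt (fun x : ℝ => -(x - 0) ^ 2 / (2 * ((1 / 2 : NNReal) : ℝ))) (-(2 * x)) x := by
      have h2 := (((hasDerivAt_id x).sub_const 0).pow 2).neg.div_const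
        (2 * ((1 / 2 : NNReal) : ℝ))
      refine h2.congr_deriv ?_
      simp
    have h3 := h1.exp.const_mul (√(2 * Real.pi * ((1 / 2 : NNReal) : ℝ)))⁻¹
    refine h3.congr_deriv ?_
    ring
  have hxu : Integrable fun x : ℝ => x * u x := by
    have := (integrable_rpow_mul_exp_neg_mul_sq (b := 1) one_pos (s := 1) (by norm_num)).const_mul
      (√(2 * Real.pi * ((1 / 2 : NNReal) : ℝ)))⁻¹
    refine this.congr (Eventually.of_forall fun x => ?_)
    simp only [hu, gaussianPDFReal_def, Real.rpow_one]
    have : -(x - 0) ^ 2 / (2 * ((1 / 2 : NNReal) : ℝ)) = -1 * x ^ 2 := by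
      push_cast; ring
    rw [this]; ring
  have bdd : ∀ {g : ℝ → ℝ} {G : ℝ → E}, Integrable g → Continuous G → (∀ x, ‖G x‖ ≤ C) →
      Integrable fun x => g x • G x := by
    intro g G hg hG hb
    refine Integrable.mono' (hg.norm.mul_const C)
      (hg.aestronglyMeasurable.smul hG.aestronglyMeasurable) (Eventually.of_forall fun x => ?_)
    rw [norm_smul]
    exact mul_le_mul_of_nonneg_left (hb x) (norm_nonneg _)
  have hxu' : Integrable fun x : ℝ => -(2 * x) * u x := by
    refine (hxu.const_mul (-2)).congr (Eventually.of_forall fun x => ?_)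
    simp only; ring
  have key := integral_bilinear_hasDerivAt_right_eq_neg_left_of_integrable
    (L := ContinuousLinearMap.lsmul ℝ ℝ (E := E)) (u := u) (v := F) (u' := fun x => -(2 * x) * u x)
    (v' := F') (fun x _ => hder x) (fun x _ => hF x) (bdd hui hF'm hC') (bdd hxu' hFc hC)
    (bdd hui hFc hC)
  simp only [ContinuousLinearMap.lsmul_apply] at key
  rw [integral_gaussianReal_eq_integral_smul hv, integral_gaussianReal_eq_integral_smul hv]
  rw [key, ← integral_neg, ← integral_smul]
  refine integral_congr_ae (Eventually.of_forall fun x => ?_)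
  simp only [smul_smul, ← neg_smul]
  congr 1
  ring

/-- Gaussian integration by parts for the standard complex Gaussian measure. -/
theorem integral_smul_stdComplexGaussian {E : Type*} [NormedAddCommGroup E] [NormedSpace ℂ E]
    [CompleteSpace E] {F Fx Fy : ℂ → E}
    (hx : ∀ x y : ℝ, HasDerivAt (fun t : ℝ => F (t + y * Complex.I)) (Fx (x + y * Complex.I)) x)
    (hy : ∀ x y : ℝ, HasDerivAt (fun t : ℝ => F (x + t * Complex.I)) (Fy (x + y * Complex.I)) y)
    {C : ℝ} (hC : ∀ z, ‖F z‖ ≤ C) (hCx : ∀ z, ‖Fx z‖ ≤ C) (hCy : ∀ z, ‖Fy z‖ ≤ C)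
    (hFc : Continuous F) (hFx : Continuous Fx) (hFy : Continuous Fy) :
    ∫ z, z • F z ∂stdComplexGaussian =
      (1 / 2 : ℝ) • ∫ z, (Fx z + Complex.I • Fy z) ∂stdComplexGaussian ∧
    ∫ z, starRingEnd ℂ z • F z ∂stdComplexGaussian =
      (1 / 2 : ℝ) • ∫ z, (Fx z - Complex.I • Fy z) ∂stdComplexGaussian := by
  have hid : Integrable (fun x : ℝ => x) halfGaussian :=
    (memLp_id_gaussianReal 1).integrable (by norm_num)
  have hmeas : Continuous fun p : ℝ × ℝ => (p.1 : ℂ) + p.2 * Complex.I := by fun_prop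
  have bdd : ∀ {g : ℝ × ℝ → ℝ} {G : ℂ → E}, Integrable g (halfGaussian.prod halfGaussian) → Continuous G → (∀ x, ‖G x‖ ≤ C) →
      Integrable (fun p => g p • G (p.1 + p.2 * Complex.I)) (halfGaussian.prod halfGaussian) := by
    intro g G hg hG hb
    refine Integrable.mono' (hg.norm.mul_const C)
      (hg.aestronglyMeasurable.smul (hG.comp hmeas).aestronglyMeasurable)
      (Eventually.of_forall fun x => ?_)
    rw [norm_smul]
    exact mul_le_mul_of_nonneg_left (hb _) (norm_nonneg _)
  have i1 : Integrable (fun p : ℝ × ℝ => p.1) (halfGaussian.prod halfGaussian) := hid.comp_fst _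
  have i2 : Integrable (fun p : ℝ × ℝ => p.2) (halfGaussian.prod halfGaussian) := hid.comp_snd _
  have b1 : ∀ {G : ℂ → E}, Continuous G → (∀ x, ‖G x‖ ≤ C) →
      Integrable (fun p : ℝ × ℝ => G (p.1 + p.2 * Complex.I)) (halfGaussian.prod halfGaussian) := fun hG hb =>
    Integrable.of_bound (hG.comp hmeas).aestronglyMeasurable C (Eventually.of_forall fun _ => hb _)
  -- Fubini reduces to the one-dimensional formula in each real coordinate. The combinations (Fx ± i
  -- Fy)/2 of the conclusion are the Wirtinger derivatives of F, so ζ integrates to the derivative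
  -- in ζ̄ and conversely.
  have e1 : ∫ p : ℝ × ℝ, p.1 • F (p.1 + p.2 * Complex.I) ∂(halfGaussian.prod halfGaussian) =
      (1 / 2 : ℝ) • ∫ p : ℝ × ℝ, Fx (p.1 + p.2 * Complex.I) ∂(halfGaussian.prod halfGaussian) := by
    rw [integral_prod_symm _ (bdd i1 hFc hC), integral_prod_symm _ (b1 hFx hCx), ← integral_smul]
    refine integral_congr_ae (Eventually.of_forall fun y => ?_)
    exact integral_smul_halfGaussian (fun x => hx x y) (fun x => hC _) (fun x => hCx _)
      (hFx.comp (by fun_prop))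
  have e2 : ∫ p : ℝ × ℝ, p.2 • F (p.1 + p.2 * Complex.I) ∂(halfGaussian.prod halfGaussian) =
      (1 / 2 : ℝ) • ∫ p : ℝ × ℝ, Fy (p.1 + p.2 * Complex.I) ∂(halfGaussian.prod halfGaussian) := by
    rw [integral_prod _ (bdd i2 hFc hC), integral_prod _ (b1 hFy hCy), ← integral_smul]
    refine integral_congr_ae (Eventually.of_forall fun x => ?_)
    exact integral_smul_halfGaussian (fun y => hy x y) (fun x => hC _) (fun x => hCy _)
      (hFy.comp (by fun_prop))
  have j2 : Integrable (fun p : ℝ × ℝ => Complex.I • (p.2 • F (p.1 + p.2 * Complex.I))) (halfGaussian.prod halfGaussian) :=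
    (bdd i2 hFc hC).smul Complex.I
  have jy : Integrable (fun p : ℝ × ℝ => Complex.I • Fy (p.1 + p.2 * Complex.I)) (halfGaussian.prod halfGaussian) :=
    (b1 hFy hCy).smul Complex.I
  have hcont : ∀ {G : ℂ → E}, Continuous G → AEStronglyMeasurable G stdComplexGaussian :=
    fun hG => hG.aestronglyMeasurable
  constructor
  · rw [integral_stdComplexGaussian (hcont (by fun_prop)),
      integral_stdComplexGaussian (hcont (by fun_prop))]
    have e3 : ∀ p : ℝ × ℝ, ((p.1 : ℂ) + p.2 * Complex.I) • F (p.1 + p.2 * Complex.I) =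
        p.1 • F (p.1 + p.2 * Complex.I) + Complex.I • (p.2 • F (p.1 + p.2 * Complex.I)) := by
      intro p
      rw [add_smul, mul_comm, mul_smul, Complex.coe_smul, Complex.coe_smul]
    simp_rw [e3]
    rw [integral_add (bdd i1 hFc hC) j2, integral_smul, e1, e2,
      integral_add (b1 hFx hCx) jy, integral_smul, smul_add,
      smul_comm Complex.I]
  · rw [integral_stdComplexGaussian (hcont (by fun_prop)),
      integral_stdComplexGaussian (hcont (by fun_prop))]
    have e3 : ∀ p : ℝ × ℝ, starRingEnd ℂ ((p.1 : ℂ) + p.2 * Complex.I) •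
        F (p.1 + p.2 * Complex.I) =
        p.1 • F (p.1 + p.2 * Complex.I) - Complex.I • (p.2 • F (p.1 + p.2 * Complex.I)) := by
      intro p
      rw [map_add, map_mul, Complex.conj_ofReal, Complex.conj_ofReal, Complex.conj_I, mul_neg,
        ← sub_eq_add_neg, sub_smul, mul_comm, mul_smul, Complex.coe_smul, Complex.coe_smul]
    simp_rw [e3]
    rw [integral_sub (bdd i1 hFc hC) j2, integral_smul, e1, e2,
      integral_sub (b1 hFx hCx) jy, integral_smul, smul_sub,
      smul_comm Complex.I]

end

end PastFuture

namespace PastFuture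

/-! ### Product Gaussian measures: resampling and symmetries -/

section

section

variable {ι : Type*} [Fintype ι] [DecidableEq ι] {X : ι → Type*} [∀ i, MeasurableSpace (X i)]
  (μ : ∀ i, Measure (X i)) [∀ i, IsProbabilityMeasure (μ i)]

/-- Resampling one coordinate preserves a product measure. -/
theorem measurePreserving_update (i : ι) :
    MeasurePreserving (fun p : (∀ j, X j) × X i => Function.update p.1 i p.2)
      ((Measure.pi μ).prod (μ i)) (Measure.pi μ) := by
  have hm : Measurable fun p : (∀ j, X j) × X i => Function.update p.1 i p.2 := by
    refine measurable_pi_lambda _ fun j => ?_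
    by_cases h : j = i
    · subst h; simpa using measurable_snd
    · simp only [Function.update_of_ne h]; fun_prop
  refine ⟨hm, (Measure.pi_eq fun s hs => ?_).symm⟩
  rw [Measure.map_apply hm (MeasurableSet.univ_pi hs)]
  have : (fun p : (∀ j, X j) × X i => Function.update p.1 i p.2) ⁻¹' Set.univ.pi s =
      (Set.univ.pi (Function.update s i Set.univ)) ×ˢ s i := by
    ext p
    simp only [Set.mem_preimage, Set.mem_pi, Set.mem_univ, true_imp_iff, Set.mem_prod]
    constructor
    · intro h
      refine ⟨fun j => ?_, by simpa using h i⟩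
      by_cases hj : j = i
      · subst hj; simp
      · have := h j
        rw [Function.update_of_ne hj] at this ⊢
        exact this
    · rintro ⟨h1, h2⟩ j
      by_cases hj : j = i
      · subst hj; simpa using h2
      · have := h1 j
        rw [Function.update_of_ne hj] at this ⊢
        exact this
  rw [this, Measure.prod_prod, Measure.pi_pi, ← Finset.mul_prod_erase _ _ (Finset.mem_univ i),
    ← Finset.mul_prod_erase (Finset.univ) (fun j => μ j (s j)) (Finset.mem_univ i)]
  simp only [Function.update_self, measure_univ, one_mul]
  rw [mul_comm]
  congr 1
  refine Finset.prod_congr rfl fun j hj => ?_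
  rw [Function.update_of_ne (Finset.ne_of_mem_erase hj)]

theorem lintegral_update (i : ι) {f : (∀ j, X j) → ENNReal} (hf : Measurable f) :
    ∫⁻ x, f x ∂(Measure.pi μ) = ∫⁻ x, ∫⁻ t, f (Function.update x i t) ∂(μ i) ∂(Measure.pi μ) := by
  have h := measurePreserving_update μ i
  rw [← lintegral_prod (fun p => f (Function.update p.1 i p.2)) (hf.comp h.measurable).aemeasurable]
  exact (h.lintegral_comp hf).symm

end

variable {m : Type*} [Fintype m]

/-- The law of `K` independent standard complex Gaussian vectors. -/
noncomputable def gaussianField (K : ℕ) (m : Type*) [Fintype m] : Measure (Fin K → m → ℂ) :=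
  Measure.pi fun _ => Measure.pi fun _ => stdComplexGaussian

instance (K : ℕ) : IsProbabilityMeasure (gaussianField K m) := by
  unfold gaussianField; infer_instance

/-- Replace one scalar coordinate of a field of vectors. -/
def setCoord [DecidableEq m] {K : ℕ} (Ξ : Fin K → m → ℂ) (n : Fin K) (j : m) (ζ : ℂ) :
    Fin K → m → ℂ :=
  Function.update Ξ n (Function.update (Ξ n) j ζ)

/-- Both integrals are first averaged over a fresh vector at time n; what remains is the resampling
of one coordinate inside that vector. -/
theorem measurePreserving_setCoord [DecidableEq m] {K : ℕ} (n : Fin K) (j : m) :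
    MeasurePreserving (fun p : (Fin K → m → ℂ) × ℂ => setCoord p.1 n j p.2)
      ((gaussianField K m).prod stdComplexGaussian) (gaussianField K m) := by
  have hm : Measurable fun p : (Fin K → m → ℂ) × ℂ => setCoord p.1 n j p.2 := by
    refine measurable_pi_lambda _ fun k => ?_
    by_cases h : k = n
    · subst h
      simp only [setCoord, Function.update_self]
      refine measurable_pi_lambda _ fun l => ?_
      by_cases h : l = j
      · subst h; simpa using measurable_snd
      · simp only [Function.update_of_ne h]; fun_prop
    · simp only [setCoord, Function.update_of_ne h]; fun_prop
  refine ⟨hm, Measure.ext_of_lintegral _ fun f hf => ?_⟩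
  rw [lintegral_map hf hm,
    lintegral_prod (fun p => f (setCoord p.1 n j p.2)) (hf.comp hm).aemeasurable]
  have hmeas1 : Measurable fun Ξ : Fin K → m → ℂ =>
      ∫⁻ ζ, f (setCoord Ξ n j ζ) ∂stdComplexGaussian :=
    Measurable.lintegral_prod_right' (f := fun p : (Fin K → m → ℂ) × ℂ => f (setCoord p.1 n j p.2))
      (hf.comp hm)
  unfold gaussianField
  rw [lintegral_update _ n hmeas1, lintegral_update _ n hf]
  refine lintegral_congr fun Ξ => ?_
  have hsec : Measurable fun v : m → ℂ => f (Function.update Ξ n v) :=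
    hf.comp (measurable_update Ξ)
  rw [lintegral_update (fun _ : m => stdComplexGaussian) j hsec]
  simp only [setCoord, Function.update_self, Function.update_idem]

theorem integral_setCoord [DecidableEq m] {K : ℕ} {E : Type*} [NormedAddCommGroup E]
    [NormedSpace ℝ E] (n : Fin K) (j : m) {F : (Fin K → m → ℂ) → E}
    (hF : Integrable F (gaussianField K m)) :
    ∫ Ξ, F Ξ ∂(gaussianField K m) =
      ∫ Ξ, ∫ ζ, F (setCoord Ξ n j ζ) ∂stdComplexGaussian ∂(gaussianField K m) := by
  have h := measurePreserving_setCoord (K := K) n j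
  rw [← integral_prod (fun p : (Fin K → m → ℂ) × ℂ => F (setCoord p.1 n j p.2))
    (h.integrable_comp_of_integrable hF)]
  have hF' := hF.aestronglyMeasurable
  rw [← h.map_eq] at hF'
  rw [← integral_map h.measurable.aemeasurable hF', h.map_eq]

/-- The phase may depend on time. With phases u^t this is the gauge symmetry of the Hankel model. -/
theorem measurePreserving_phase {K : ℕ} (u : Fin K → ℂ) (hu : ∀ n, ‖u n‖ = 1) :
    MeasurePreserving (fun (Ξ : Fin K → m → ℂ) n j => u n * Ξ n j)
      (gaussianField K m) (gaussianField K m) :=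
  measurePreserving_pi _ _ fun n => measurePreserving_pi _ _ fun _ =>
    measurePreserving_mul_stdComplexGaussian (hu n)

/-- The vectors are i.i.d., so the order of time is irrelevant to their joint law; this is the
source of the symmetry between past and future. -/
theorem measurePreserving_comp_rev {K : ℕ} :
    MeasurePreserving (fun (Ξ : Fin K → m → ℂ) n => Ξ (Fin.rev n))
      (gaussianField K m) (gaussianField K m) := by
  have hm : Measurable fun (Ξ : Fin K → m → ℂ) n => Ξ (Fin.rev n) := by fun_prop
  refine ⟨hm, (Measure.pi_eq fun s hs => ?_).symm⟩
  rw [Measure.map_apply hm (MeasurableSet.univ_pi hs)]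
  have : (fun (Ξ : Fin K → m → ℂ) n => Ξ (Fin.rev n)) ⁻¹' Set.univ.pi s =
      Set.univ.pi fun n => s (Fin.rev n) := by
    ext Ξ
    simp only [Set.mem_preimage, Set.mem_pi, Set.mem_univ, true_imp_iff]
    constructor
    · intro h n
      simpa using h (Fin.rev n)
    · intro h n
      simpa using h (Fin.rev n)
  rw [this, gaussianField, Measure.pi_pi]
  exact Equiv.prod_comp Fin.revPerm fun n => (Measure.pi fun _ : m => stdComplexGaussian) (s n)

theorem stdComplexGaussian_rect {s t : Set ℝ} (hs : MeasurableSet s) (ht : MeasurableSet t) :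
    stdComplexGaussian (Complex.re ⁻¹' s ∩ Complex.im ⁻¹' t) = halfGaussian s * halfGaussian t := by
  rw [stdComplexGaussian, Measure.map_apply measurable_ofReal_add_mul_I
    ((Complex.measurable_re hs).inter (Complex.measurable_im ht)), ← Measure.prod_prod]
  congr 1
  ext p
  simp

/-- A standard complex Gaussian family, restricted to finitely many times, has law
`gaussianField`. -/
theorem IsStdComplexGaussianFamily.map_eq {Ω : Type*} [MeasurableSpace Ω] {P : Measure Ω}
    [IsProbabilityMeasure P] {ξ : ℕ → m → Ω → ℂ}
    (h : IsStdComplexGaussianFamily P fun k : ℕ × m => ξ k.1 k.2) (K : ℕ) :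
    AEMeasurable (fun ω (n : Fin K) j => ξ n j ω) P ∧
      P.map (fun ω (n : Fin K) j => ξ n j ω) = gaussianField K m := by
  obtain ⟨hre, him, hind⟩ := h
  let σ := (Fin K × m) ⊕ (Fin K × m)
  let emb : σ → (ℕ × m) ⊕ (ℕ × m) :=
    Sum.map (fun p => ((p.1 : ℕ), p.2)) fun p => ((p.1 : ℕ), p.2)
  have hinj : Function.Injective fun p : Fin K × m => ((p.1 : ℕ), p.2) := by
    rintro ⟨a, b⟩ ⟨c, d⟩ e
    simp only [Prod.mk.injEq] at e
    exact Prod.ext (Fin.ext e.1) e.2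
  have hemb : Function.Injective emb := hinj.sumMap hinj
  have hind' := hind.precomp hemb
  set Y : (ℕ × m) ⊕ (ℕ × m) → Ω → ℝ :=
    Sum.elim (fun k ω => (ξ k.1 k.2 ω).re) fun k ω => (ξ k.1 k.2 ω).im with hY
  have hYm : ∀ k, AEMeasurable (Y k) P := by
    rintro (k | k)
    · exact (hre k).aemeasurable
    · exact (him k).aemeasurable
  have hYlaw : ∀ k, P.map (Y k) = halfGaussian := by
    rintro (k | k)
    · exact (hre k).map_eq
    · exact (him k).map_eq
  have hjoint : P.map (fun ω (k : σ) => Y (emb k) ω) = Measure.pi fun _ : σ => halfGaussian := by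
    have := (iIndepFun_iff_map_fun_eq_pi_map (f := fun k : σ => Y (emb k))
      fun k => hYm (emb k)).1 hind'
    rw [this]
    simp only [hYlaw]
  -- A and B pass between real and complex coordinates. Both laws are compared in real coordinates,
  -- where independence makes each of them a product of half Gaussians.
  let A : (σ → ℝ) → Fin K → m → ℂ := fun x n j =>
    (x (Sum.inl (n, j)) : ℂ) + x (Sum.inr (n, j)) * Complex.I
  let B : (Fin K → m → ℂ) → σ → ℝ := fun Ξ => Sum.elim (fun k => (Ξ k.1 k.2).re)
    fun k => (Ξ k.1 k.2).im
  have hA : Measurable A := by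
    refine measurable_pi_lambda _ fun n => measurable_pi_lambda _ fun j => ?_
    simp only [A]; fun_prop
  have hB : Measurable B := by
    refine measurable_pi_lambda _ ?_
    rintro (k | k)
    · exact Complex.measurable_re.comp (by fun_prop)
    · exact Complex.measurable_im.comp (by fun_prop)
  have hAB : A ∘ B = id := by
    ext Ξ n j
    simp [A, B, Complex.re_add_im]
  have hBlaw : (gaussianField K m).map B = Measure.pi fun _ : σ => halfGaussian := by
    refine (Measure.pi_eq fun s hs => ?_).symm
    rw [Measure.map_apply hB (MeasurableSet.univ_pi hs)]
    have : B ⁻¹' Set.univ.pi s = Set.univ.pi fun n => Set.univ.pi fun j =>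
        Complex.re ⁻¹' s (Sum.inl (n, j)) ∩ Complex.im ⁻¹' s (Sum.inr (n, j)) := by
      ext Ξ
      simp only [Set.mem_preimage, Set.mem_pi, Set.mem_univ, true_imp_iff, Set.mem_inter_iff, B]
      refine ⟨fun h n j => ⟨h (Sum.inl (n, j)), h (Sum.inr (n, j))⟩, fun h => ?_⟩
      rintro (k | k)
      · exact (h k.1 k.2).1
      · exact (h k.1 k.2).2
    rw [this, gaussianField, Measure.pi_pi]
    simp_rw [Measure.pi_pi]
    rw [Fintype.prod_sum_type, Fintype.prod_prod_type, Fintype.prod_prod_type,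
      ← Finset.prod_mul_distrib]
    refine Finset.prod_congr rfl fun n _ => ?_
    rw [← Finset.prod_mul_distrib]
    exact Finset.prod_congr rfl fun j _ => stdComplexGaussian_rect (hs _) (hs _)
  have hYjm : AEMeasurable (fun ω (k : σ) => Y (emb k) ω) P :=
    aemeasurable_pi_lambda _ fun k => hYm (emb k)
  have hrep : (fun ω (n : Fin K) j => ξ n j ω) = A ∘ fun ω (k : σ) => Y (emb k) ω := by
    ext ω n j
    simp [A, hY, emb, Complex.re_add_im]
  constructor
  · rw [hrep]; exact hA.comp_aemeasurable hYjm
  · rw [hrep, ← AEMeasurable.map_map_of_aemeasurable hA.aemeasurable hYjm, hjoint, ← hBlaw,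
      Measure.map_map hA hB, hAB, Measure.map_id]

end

end PastFuture

namespace PastFuture

section

open scoped Matrix.Norms.L2Operator Kronecker

set_option linter.unusedSectionVars false

/-! ### Dissipative matrices, traces and ranks -/

section

variable {n : Type*} [Fintype n]

theorem star_dotProduct_eq_inner (u v : n → ℂ) :
    star u ⬝ᵥ v = inner ℂ (WithLp.toLp 2 u : EuclideanSpace ℂ n) (WithLp.toLp 2 v) := by
  rw [EuclideanSpace.inner_toLp_toLp, dotProduct_comm]

theorem re_star_dotProduct_self (v : n → ℂ) :
    (star v ⬝ᵥ v).re = ‖(WithLp.toLp 2 v : EuclideanSpace ℂ n)‖ ^ 2 := by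
  rw [star_dotProduct_eq_inner, inner_self_eq_norm_sq_to_K]
  norm_cast

theorem norm_star_dotProduct_le (u v : n → ℂ) :
    ‖star u ⬝ᵥ v‖ ≤ ‖(WithLp.toLp 2 u : EuclideanSpace ℂ n)‖ *
      ‖(WithLp.toLp 2 v : EuclideanSpace ℂ n)‖ := by
  rw [star_dotProduct_eq_inner]
  exact norm_inner_le_norm _ _

theorem norm_toLp_mulVec_le {l : Type*} [Fintype l] [DecidableEq n] (A : Matrix l n ℂ) (v : n → ℂ) :
    ‖(WithLp.toLp 2 (A *ᵥ v) : EuclideanSpace ℂ l)‖ ≤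
      ‖A‖ * ‖(WithLp.toLp 2 v : EuclideanSpace ℂ n)‖ :=
  Matrix.l2_opNorm_mulVec A (WithLp.toLp 2 v)

theorem l2_opNorm_le_of_mulVec {l : Type*} [Fintype l] [DecidableEq n] (A : Matrix l n ℂ) {C : ℝ}
    (hC : 0 ≤ C)
    (h : ∀ v : n → ℂ, ‖(WithLp.toLp 2 (A *ᵥ v) : EuclideanSpace ℂ l)‖ ≤
      C * ‖(WithLp.toLp 2 v : EuclideanSpace ℂ n)‖) : ‖A‖ ≤ C := by
  rw [Matrix.l2_opNorm_def]
  refine ContinuousLinearMap.opNorm_le_bound _ hC fun x => ?_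
  exact h (WithLp.ofLp x)

/-- The imaginary part of `X` is at most `-η`. -/
def Dissipative (η : ℝ) (X : Matrix n n ℂ) : Prop :=
  ∀ v : n → ℂ, η * (star v ⬝ᵥ v).re ≤ -(star v ⬝ᵥ X *ᵥ v).im

/-- The imaginary part of `X` is nonnegative. -/
def ImNonneg (X : Matrix n n ℂ) : Prop := ∀ v : n → ℂ, 0 ≤ (star v ⬝ᵥ X *ᵥ v).im

theorem Dissipative.sub {η : ℝ} {X Y : Matrix n n ℂ} (hX : Dissipative η X) (hY : ImNonneg Y) :
    Dissipative η (X - Y) := by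
  intro v
  rw [sub_mulVec, dotProduct_sub, Complex.sub_im]
  linarith [hX v, hY v]

theorem im_star_dotProduct_of_isHermitian {X : Matrix n n ℂ} (hX : X.IsHermitian) (v : n → ℂ) :
    (star v ⬝ᵥ X *ᵥ v).im = 0 := by
  have h : starRingEnd ℂ (star v ⬝ᵥ X *ᵥ v) = star v ⬝ᵥ X *ᵥ v := by
    rw [starRingEnd_apply, ← Matrix.star_dotProduct_star, star_star, star_mulVec, hX.eq,
      ← dotProduct_mulVec]
  exact Complex.conj_eq_iff_im.1 h

/-- Cauchy–Schwarz: η‖v‖² ≤ -Im⟨v, Xv⟩ ≤ ‖v‖‖Xv‖. Invertibility and the bound on the inverse follow,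
with no assumption on the Hermitian part of X. -/
theorem Dissipative.norm_le [DecidableEq n] {η : ℝ} (hη : 0 < η) {X : Matrix n n ℂ}
    (hX : Dissipative η X) (v : n → ℂ) :
    ‖(WithLp.toLp 2 v : EuclideanSpace ℂ n)‖ ≤
      η⁻¹ * ‖(WithLp.toLp 2 (X *ᵥ v) : EuclideanSpace ℂ n)‖ := by
  have h1 := hX v
  rw [re_star_dotProduct_self] at h1
  have h2 := (neg_le_abs _).trans (Complex.abs_im_le_norm (star v ⬝ᵥ X *ᵥ v))
  have h3 := norm_star_dotProduct_le v (X *ᵥ v)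
  set a := ‖(WithLp.toLp 2 v : EuclideanSpace ℂ n)‖
  set b := ‖(WithLp.toLp 2 (X *ᵥ v) : EuclideanSpace ℂ n)‖
  rcases (norm_nonneg (WithLp.toLp 2 v : EuclideanSpace ℂ n)).eq_or_lt with h0 | h0
  · change 0 = a at h0
    rw [← h0]; positivity
  · change 0 < a at h0
    have h4 : a * (η * a) ≤ a * b := by nlinarith
    have h5 := le_of_mul_le_mul_left h4 h0
    rw [inv_mul_eq_div, le_div_iff₀ hη]
    linarith

theorem Dissipative.isUnit [DecidableEq n] {η : ℝ} (hη : 0 < η) {X : Matrix n n ℂ}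
    (hX : Dissipative η X) : IsUnit X := by
  rw [← Matrix.mulVec_injective_iff_isUnit]
  intro u v huv
  have h : X *ᵥ (u - v) = 0 := by rw [mulVec_sub]; exact sub_eq_zero.2 huv
  have := hX.norm_le hη (u - v)
  rw [h] at this
  simp only [WithLp.toLp_zero, norm_zero, mul_zero, norm_le_zero_iff, WithLp.toLp_eq_zero] at this
  exact sub_eq_zero.1 this

theorem Dissipative.isUnit_det [DecidableEq n] {η : ℝ} (hη : 0 < η) {X : Matrix n n ℂ}
    (hX : Dissipative η X) : IsUnit X.det :=
  (Matrix.isUnit_iff_isUnit_det X).1 (hX.isUnit hη)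

theorem Dissipative.norm_inv_le [DecidableEq n] {η : ℝ} (hη : 0 < η) {X : Matrix n n ℂ}
    (hX : Dissipative η X) : ‖X⁻¹‖ ≤ η⁻¹ := by
  refine l2_opNorm_le_of_mulVec _ (by positivity) fun v => ?_
  have := hX.norm_le hη (X⁻¹ *ᵥ v)
  rwa [mulVec_mulVec, Matrix.mul_nonsing_inv _ (hX.isUnit_det hη), one_mulVec] at this

theorem Dissipative.imNonneg_inv [DecidableEq n] {η : ℝ} (hη : 0 < η) {X : Matrix n n ℂ}
    (hX : Dissipative η X) : ImNonneg X⁻¹ := by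
  intro u
  set v := X⁻¹ *ᵥ u with hv
  have hu : X *ᵥ v = u := by
    rw [hv, mulVec_mulVec, Matrix.mul_nonsing_inv _ (hX.isUnit_det hη), one_mulVec]
  have h1 := hX v
  rw [hu] at h1
  have h2 : star u ⬝ᵥ v = starRingEnd ℂ (star v ⬝ᵥ u) := by
    rw [starRingEnd_apply, ← Matrix.star_dotProduct_star, star_star, dotProduct_comm]
  rw [h2, Complex.conj_im]
  have h3 : 0 ≤ (star v ⬝ᵥ v).re := by rw [re_star_dotProduct_self]; positivity
  have := mul_nonneg hη.le h3
  linarith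

theorem ImNonneg.conj {l : Type*} [Fintype l] {X : Matrix n n ℂ} (hX : ImNonneg X)
    (B : Matrix l n ℂ) : ImNonneg (B * X * Bᴴ) := by
  intro v
  have := hX (Bᴴ *ᵥ v)
  rwa [star_mulVec, conjTranspose_conjTranspose, ← dotProduct_mulVec, mulVec_mulVec, mulVec_mulVec] at this

theorem imNonneg_sum {ι : Type*} (s : Finset ι) {X : ι → Matrix n n ℂ}
    (h : ∀ i ∈ s, ImNonneg (X i)) : ImNonneg (∑ i ∈ s, X i) := by
  intro v
  rw [sum_mulVec, dotProduct_sum, Complex.im_sum]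
  exact Finset.sum_nonneg fun i hi => h i hi v

theorem ImNonneg.add {X Y : Matrix n n ℂ} (hX : ImNonneg X) (hY : ImNonneg Y) :
    ImNonneg (X + Y) := by
  intro v
  rw [add_mulVec, dotProduct_add, Complex.add_im]
  exact add_nonneg (hX v) (hY v)

theorem ImNonneg.trace [DecidableEq n] {X : Matrix n n ℂ} (hX : ImNonneg X) : 0 ≤ X.trace.im := by
  rw [Matrix.trace, Complex.im_sum]
  refine Finset.sum_nonneg fun i _ => ?_
  have := hX (Pi.single i 1)
  have e : star (Pi.single i (1 : ℂ)) ⬝ᵥ X *ᵥ Pi.single i 1 = X i i := by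
    rw [mulVec_single_one, ← Pi.single_star, star_one, single_one_dotProduct]
    rfl
  rwa [e] at this

/-- The quadratic form of a matrix is bounded by its operator norm. -/
theorem norm_quadForm_le [DecidableEq n] (A : Matrix n n ℂ) (v : n → ℂ) :
    ‖star v ⬝ᵥ A *ᵥ v‖ ≤ ‖A‖ * ‖(WithLp.toLp 2 v : EuclideanSpace ℂ n)‖ ^ 2 := by
  refine (norm_star_dotProduct_le _ _).trans ?_
  have := norm_toLp_mulVec_le A v
  nlinarith [norm_nonneg (WithLp.toLp 2 v : EuclideanSpace ℂ n)]

theorem norm_apply_le [DecidableEq n] (A : Matrix n n ℂ) (i : n) : ‖A i i‖ ≤ ‖A‖ := by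
  have h := norm_quadForm_le A (Pi.single i 1)
  have e : star (Pi.single i (1 : ℂ)) ⬝ᵥ A *ᵥ Pi.single i 1 = A i i := by
    rw [mulVec_single_one, ← Pi.single_star, star_one, single_one_dotProduct]
    rfl
  rw [e] at h
  have e2 : ‖(WithLp.toLp 2 (Pi.single i (1 : ℂ)) : EuclideanSpace ℂ n)‖ = 1 := by
    simp
  rwa [e2, one_pow, mul_one] at h

theorem norm_trace_le [DecidableEq n] (A : Matrix n n ℂ) :
    ‖A.trace‖ ≤ Fintype.card n * ‖A‖ := by
  rw [Matrix.trace]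
  refine (norm_sum_le _ _).trans ?_
  rw [← nsmul_eq_mul, ← Finset.card_univ]
  exact Finset.sum_le_card_nsmul _ _ _ fun i _ => norm_apply_le A i

/-- The trace is bounded by the rank times the operator norm. -/
theorem norm_trace_le_rank [DecidableEq n] (A : Matrix n n ℂ) :
    ‖A.trace‖ ≤ A.rank * ‖A‖ := by
  let T : EuclideanSpace ℂ n →ₗ[ℂ] EuclideanSpace ℂ n := Matrix.toLpLin 2 2 A
  let S := LinearMap.range T
  have hT : ∀ v, ‖T v‖ ≤ ‖A‖ * ‖v‖ := fun v => Matrix.l2_opNorm_mulVec A v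
  have htr : A.trace = LinearMap.trace ℂ _ T := by
    change _ = LinearMap.trace ℂ _ (Matrix.toLpLin 2 2 A)
    rw [Matrix.toLpLin_eq_toLin, Matrix.trace_toLin_eq]
  have hrank : Module.finrank ℂ S = A.rank := by
    change Module.finrank ℂ (LinearMap.range (Matrix.toLpLin 2 2 A)) = _
    rw [Matrix.toLpLin_eq_toLin, ← Matrix.rank_eq_finrank_range_toLin]
  -- By cyclicity the trace may be taken on the range of the operator; there it is a sum of `rank`
  -- diagonal entries, each bounded by the operator norm.
  have hcomp : LinearMap.trace ℂ _ T = LinearMap.trace ℂ S (T.rangeRestrict ∘ₗ S.subtype) := by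
    rw [← LinearMap.trace_comp_comm']
    rfl
  rw [htr, hcomp, LinearMap.trace_eq_sum_inner _ (stdOrthonormalBasis ℂ S), ← hrank]
  refine (norm_sum_le _ _).trans ?_
  refine (Finset.sum_le_card_nsmul _ _ ‖A‖ fun i _ => ?_).trans_eq ?_
  · refine (norm_inner_le_norm (𝕜 := ℂ) _ _).trans ?_
    rw [(stdOrthonormalBasis ℂ S).norm_eq_one, one_mul]
    have := hT (stdOrthonormalBasis ℂ S i : EuclideanSpace ℂ n)
    rw [Submodule.norm_coe, (stdOrthonormalBasis ℂ S).norm_eq_one, mul_one] at this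
    exact this
  rw [Finset.card_univ, Fintype.card_fin, nsmul_eq_mul]

theorem inv_sub_inv_eq_mul [DecidableEq n] {X Y : Matrix n n ℂ} (hX : IsUnit X.det)
    (hY : IsUnit Y.det) : X⁻¹ - Y⁻¹ = X⁻¹ * (Y - X) * Y⁻¹ := by
  rw [mul_sub, Matrix.nonsing_inv_mul _ hX, sub_mul, one_mul, mul_assoc,
    Matrix.mul_nonsing_inv _ hY, mul_one]

/-- Traces against resolvents of dissipative matrices change little under low-rank
perturbations. -/
theorem Dissipative.norm_trace_inv_sub_le [DecidableEq n] {η : ℝ} (hη : 0 < η)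
    {X Y : Matrix n n ℂ} (hX : Dissipative η X) (hY : Dissipative η Y) (B : Matrix n n ℂ) :
    ‖(B * X⁻¹).trace - (B * Y⁻¹).trace‖ ≤ (Y - X).rank * (‖B‖ * (2 * η⁻¹)) := by
  rw [← Matrix.trace_sub, ← mul_sub]
  refine (norm_trace_le_rank _).trans ?_
  have h1 : ‖B * (X⁻¹ - Y⁻¹)‖ ≤ ‖B‖ * (2 * η⁻¹) := by
    refine (norm_mul_le _ _).trans (mul_le_mul_of_nonneg_left ?_ (norm_nonneg _))
    refine (norm_sub_le _ _).trans ?_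
    linarith [hX.norm_inv_le hη, hY.norm_inv_le hη]
  have h2 : (B * (X⁻¹ - Y⁻¹)).rank ≤ (Y - X).rank := by
    rw [inv_sub_inv_eq_mul (hX.isUnit_det hη) (hY.isUnit_det hη)]
    refine (Matrix.rank_mul_le_right _ _).trans ?_
    exact (Matrix.rank_mul_le_left _ _).trans (Matrix.rank_mul_le_right _ _)
  calc ((B * (X⁻¹ - Y⁻¹)).rank : ℝ) * ‖B * (X⁻¹ - Y⁻¹)‖
      ≤ (Y - X).rank * (‖B‖ * (2 * η⁻¹)) := by gcongr

end

end

end PastFuture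

namespace PastFuture

section

open scoped Matrix.Norms.L2Operator Kronecker

set_option linter.unusedSectionVars false

/-! ### Gaussian Hermitian pencils -/

theorem rank_add_le_add {l n : Type*} [Fintype l] [Fintype n] (A B : Matrix l n ℂ) :
    (A + B).rank ≤ A.rank + B.rank := by
  refine le_trans ?_ (Submodule.finrank_add_le_finrank_add_finrank _ _)
  refine Submodule.finrank_mono ?_
  rw [Matrix.mulVecLin_add]
  exact LinearMap.range_add_le _ _

theorem rank_sum_le_sum {l n ι : Type*} [Fintype l] [Fintype n] (s : Finset ι)
    (A : ι → Matrix l n ℂ) : (∑ i ∈ s, A i).rank ≤ ∑ i ∈ s, (A i).rank := by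
  classical
  induction s using Finset.induction_on with
  | empty => simp
  | insert a s ha ih =>
    rw [Finset.sum_insert ha, Finset.sum_insert ha]
    exact (rank_add_le_add _ _).trans (by gcongr)

theorem memLp_id_stdComplexGaussian : MemLp id 2 stdComplexGaussian := by
  unfold stdComplexGaussian
  rw [memLp_map_measure_iff (by fun_prop) measurable_ofReal_add_mul_I.aemeasurable]
  have h : MemLp (fun x : ℝ => (x : ℂ)) 2 halfGaussian :=
    (memLp_id_gaussianReal (μ := 0) (v := 1 / 2) 2).ofReal
  exact (h.comp_fst halfGaussian).add ((h.comp_snd halfGaussian).mul_const Complex.I)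

section

variable {m : Type*} [Fintype m]

theorem measurePreserving_coord {K : ℕ} (k : Fin K) (j : m) :
    MeasurePreserving (fun Ξ : Fin K → m → ℂ => Ξ k j) (gaussianField K m) stdComplexGaussian :=
  (measurePreserving_eval (fun _ : m => stdComplexGaussian) j).comp
    (measurePreserving_eval (fun _ : Fin K => Measure.pi fun _ : m => stdComplexGaussian) k)

theorem memLp_coord {K : ℕ} (k : Fin K) (j : m) :
    MemLp (fun Ξ : Fin K → m → ℂ => Ξ k j) 2 (gaussianField K m) :=
  memLp_id_stdComplexGaussian.comp_measurePreserving (measurePreserving_coord k j)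

theorem integrable_coord {K : ℕ} (k : Fin K) (j : m) :
    Integrable (fun Ξ : Fin K → m → ℂ => Ξ k j) (gaussianField K m) :=
  (memLp_coord k j).integrable (by norm_num)

theorem integral_norm_sq_coord {K : ℕ} (k : Fin K) (j : m) :
    ∫ Ξ : Fin K → m → ℂ, ‖Ξ k j‖ ^ 2 ∂(gaussianField K m) =
      ∫ ζ : ℂ, ‖ζ‖ ^ 2 ∂stdComplexGaussian := by
  have h := measurePreserving_coord k j (K := K) (m := m)
  rw [← h.map_eq, integral_map h.measurable.aemeasurable]
  exact (by fun_prop : Continuous fun ζ : ℂ => ‖ζ‖ ^ 2).aestronglyMeasurable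

end

section

variable {n m α : Type*} [Fintype n] [DecidableEq n] [Fintype m] [DecidableEq m] [Fintype α]
  {K : ℕ}

theorem continuous_inv_of_isUnit {T : Type*} [TopologicalSpace T] {X : T → Matrix n n ℂ}
    (hX : Continuous X) (hu : ∀ t, IsUnit (X t)) : Continuous fun t => (X t)⁻¹ := by
  simp_rw [Matrix.nonsing_inv_eq_ringInverse]
  rw [continuous_iff_continuousAt]
  intro t
  obtain ⟨u, h⟩ := hu t
  have h1 := NormedRing.inverse_continuousAt u
  rw [h] at h1
  exact ContinuousAt.comp (f := X) h1 hX.continuousAt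

theorem hasDerivAt_matrix_inv {X : ℝ → Matrix n n ℂ} {X' : Matrix n n ℂ} {t : ℝ}
    (hX : HasDerivAt X X' t) (hu : IsUnit (X t)) :
    HasDerivAt (fun t => (X t)⁻¹) (-((X t)⁻¹ * X' * (X t)⁻¹)) t := by
  simp_rw [Matrix.nonsing_inv_eq_ringInverse]
  obtain ⟨u, h⟩ := hu
  have h1 := hasFDerivAt_ringInverse (𝕜 := ℝ) u
  rw [h] at h1
  have h2 := h1.comp_hasDerivAt t hX
  rw [← h, Ring.inverse_unit]
  exact h2

/-- A family of matrices depending affinely on the coordinates of a field of vectors and on their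
conjugates. -/
structure Pencil (n m α : Type*) (K : ℕ) where
  /-- the deterministic part -/
  base : Matrix n n ℂ
  /-- the left factors -/
  U : α → Matrix n m ℂ
  /-- the right factors -/
  V : α → Matrix (Fin K) n ℂ
  /-- the factor of the covariance -/
  S : Matrix m m ℂ

namespace Pencil

variable (A : Pencil n m α K)

/-- The part of the pencil that is linear in the field. -/
noncomputable def noise (Ξ : Fin K → m → ℂ) : Matrix n n ℂ :=
  ∑ a, A.U a * A.S * (Matrix.of Ξ)ᵀ * A.V a

/-- The value of the pencil at a field. -/
noncomputable def mat (Ξ : Fin K → m → ℂ) : Matrix n n ℂ :=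
  A.base + (A.noise Ξ + (A.noise Ξ)ᴴ)

/-- The inverse of the pencil. -/
noncomputable def res (Ξ : Fin K → m → ℂ) : Matrix n n ℂ := (A.mat Ξ)⁻¹

/-- The coefficient of a coordinate in the pencil. -/
noncomputable def coef (k : Fin K) (j : m) : Matrix n n ℂ :=
  ∑ a, A.U a * A.S * Matrix.single j k (1 : ℂ) * A.V a

theorem noise_add (Ξ Ξ' : Fin K → m → ℂ) : A.noise (Ξ + Ξ') = A.noise Ξ + A.noise Ξ' := by
  unfold noise
  rw [← Finset.sum_add_distrib]
  refine Finset.sum_congr rfl fun a _ => ?_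
  rw [← Matrix.add_mul, ← Matrix.mul_add]
  rfl

theorem noise_single (k : Fin K) (j : m) (ζ : ℂ) :
    A.noise (Pi.single k (Pi.single j ζ)) = ζ • A.coef k j := by
  unfold noise coef
  rw [Finset.smul_sum]
  refine Finset.sum_congr rfl fun a _ => ?_
  have : (Matrix.of (Pi.single k (Pi.single j ζ) : Fin K → m → ℂ))ᵀ =
      ζ • Matrix.single j k (1 : ℂ) := by
    ext i l
    simp only [Matrix.transpose_apply, Matrix.of_apply, Matrix.smul_apply, Matrix.single_apply,
      Pi.single_apply, smul_eq_mul]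
    by_cases h1 : k = l <;> by_cases h2 : j = i <;>
      simp [@eq_comm _ l k, @eq_comm _ i j, h1, h2]
  rw [this, Matrix.mul_smul, Matrix.smul_mul]

/-- The pencil is affine in each scalar coordinate with the others frozen, so the derivative of its
inverse along that coordinate is explicit. -/
theorem noise_setCoord (Ξ : Fin K → m → ℂ) (k : Fin K) (j : m) (ζ : ℂ) :
    A.noise (setCoord Ξ k j ζ) = A.noise (setCoord Ξ k j 0) + ζ • A.coef k j := by
  rw [← noise_single, ← noise_add]
  congr 1
  ext k' j'
  by_cases h1 : k' = k
  · subst h1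
    by_cases h2 : j' = j
    · subst h2; simp [setCoord]
    · simp [setCoord, h2]
  · simp [setCoord, h1]

theorem noise_eq_sum (Ξ : Fin K → m → ℂ) : A.noise Ξ = ∑ k, ∑ j, Ξ k j • A.coef k j := by
  have h : (Matrix.of Ξ)ᵀ = ∑ k, ∑ j, Ξ k j • Matrix.single j k (1 : ℂ) := by
    ext i l
    simp [Matrix.sum_apply, Matrix.single_apply, ite_and]
  unfold noise coef
  simp_rw [h, Matrix.mul_sum, Matrix.sum_mul, Finset.smul_sum, Matrix.mul_smul, Matrix.smul_mul]
  rw [Finset.sum_comm]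
  refine Finset.sum_congr rfl fun k _ => ?_
  rw [Finset.sum_comm]

theorem mat_setCoord (Ξ : Fin K → m → ℂ) (k : Fin K) (j : m) (ζ : ℂ) :
    A.mat (setCoord Ξ k j ζ) = A.mat (setCoord Ξ k j 0) +
      (ζ • A.coef k j + starRingEnd ℂ ζ • (A.coef k j)ᴴ) := by
  unfold mat
  rw [noise_setCoord, Matrix.conjTranspose_add, Matrix.conjTranspose_smul, starRingEnd_apply]
  abel

theorem continuous_noise : Continuous A.noise := by
  unfold noise
  fun_prop

theorem continuous_mat : Continuous A.mat := by
  have := A.continuous_noise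
  unfold mat
  fun_prop

variable {A} {η : ℝ}

theorem dissipative_mat (hA : Dissipative η A.base) (Ξ : Fin K → m → ℂ) :
    Dissipative η (A.mat Ξ) := by
  intro v
  have h := hA v
  have h2 := im_star_dotProduct_of_isHermitian
    (show (A.noise Ξ + (A.noise Ξ)ᴴ).IsHermitian from Matrix.isHermitian_add_transpose_self _) v
  rw [mat, add_mulVec, dotProduct_add, Complex.add_im, h2, add_zero]
  exact h

theorem continuous_res (hη : 0 < η) (hA : Dissipative η A.base) : Continuous A.res :=
  continuous_inv_of_isUnit A.continuous_mat fun Ξ => (dissipative_mat hA Ξ).isUnit hη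

theorem norm_res_le (hη : 0 < η) (hA : Dissipative η A.base) (Ξ : Fin K → m → ℂ) :
    ‖A.res Ξ‖ ≤ η⁻¹ := (dissipative_mat hA Ξ).norm_inv_le hη

theorem integrable_res (hη : 0 < η) (hA : Dissipative η A.base) :
    Integrable A.res (gaussianField K m) :=
  Integrable.of_bound (continuous_res hη hA).aestronglyMeasurable η⁻¹
    (Eventually.of_forall (norm_res_le hη hA))

/-- Gaussian integration by parts in one coordinate. Multiplication by ζ becomes the derivative in
ζ̄, and ζ̄ enters the pencil through the adjoint of the coefficient; hence the adjoint in the first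
formula and not in the second. -/
theorem integral_smul_res (hη : 0 < η) (hA : Dissipative η A.base) (k : Fin K) (j : m) :
    ∫ Ξ, Ξ k j • A.res Ξ ∂(gaussianField K m) =
      -∫ Ξ, A.res Ξ * (A.coef k j)ᴴ * A.res Ξ ∂(gaussianField K m) ∧
    ∫ Ξ, starRingEnd ℂ (Ξ k j) • A.res Ξ ∂(gaussianField K m) =
      -∫ Ξ, A.res Ξ * A.coef k j * A.res Ξ ∂(gaussianField K m) := by
  have hc := continuous_res hη hA
  have hb := norm_res_le hη hA
  have hbdd : ∀ B : Matrix n n ℂ, ∀ Ξ, ‖A.res Ξ * B * A.res Ξ‖ ≤ η⁻¹ * ‖B‖ * η⁻¹ := by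
    intro B Ξ
    refine (norm_mul_le _ _).trans ?_
    refine mul_le_mul ((norm_mul_le _ _).trans ?_) (hb Ξ) (norm_nonneg _) (by positivity)
    exact mul_le_mul_of_nonneg_right (hb Ξ) (norm_nonneg _)
  have hint2 : ∀ B : Matrix n n ℂ,
      Integrable (fun Ξ => A.res Ξ * B * A.res Ξ) (gaussianField K m) := fun B =>
    Integrable.of_bound (by fun_prop : Continuous fun Ξ => A.res Ξ * B * A.res Ξ).aestronglyMeasurable
      _ (Eventually.of_forall (hbdd B))
  have hint1 : Integrable (fun Ξ => Ξ k j • A.res Ξ) (gaussianField K m) := by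
    refine Integrable.mono' ((integrable_coord k j).norm.mul_const η⁻¹)
      (by fun_prop : Continuous fun Ξ : Fin K → m → ℂ => Ξ k j • A.res Ξ).aestronglyMeasurable
      (Eventually.of_forall fun Ξ => ?_)
    rw [norm_smul]
    exact mul_le_mul_of_nonneg_left (hb Ξ) (norm_nonneg _)
  have hint1' : Integrable (fun Ξ => starRingEnd ℂ (Ξ k j) • A.res Ξ) (gaussianField K m) := by
    refine Integrable.mono' ((integrable_coord k j).norm.mul_const η⁻¹)
      (by fun_prop : Continuous fun Ξ : Fin K → m → ℂ =>
        starRingEnd ℂ (Ξ k j) • A.res Ξ).aestronglyMeasurable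
      (Eventually.of_forall fun Ξ => ?_)
    rw [norm_smul, RCLike.norm_conj]
    exact mul_le_mul_of_nonneg_left (hb Ξ) (norm_nonneg _)
  set B := A.coef k j with hB
  have key : ∀ Ξ : Fin K → m → ℂ,
      ∫ ζ, ζ • A.res (setCoord Ξ k j ζ) ∂stdComplexGaussian =
        -∫ ζ, A.res (setCoord Ξ k j ζ) * Bᴴ * A.res (setCoord Ξ k j ζ) ∂stdComplexGaussian ∧
      ∫ ζ, starRingEnd ℂ ζ • A.res (setCoord Ξ k j ζ) ∂stdComplexGaussian =
        -∫ ζ, A.res (setCoord Ξ k j ζ) * B * A.res (setCoord Ξ k j ζ) ∂stdComplexGaussian := by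
    intro Ξ
    set F : ℂ → Matrix n n ℂ := fun ζ => A.res (setCoord Ξ k j ζ) with hF
    have hsc : Continuous fun ζ : ℂ => setCoord Ξ k j ζ := by
      unfold setCoord
      exact continuous_const.update k (continuous_const.update j continuous_id)
    have hFc : Continuous F := hc.comp hsc
    have hmatx : ∀ x y : ℝ, HasDerivAt
        (fun t : ℝ => A.mat (setCoord Ξ k j (t + y * Complex.I))) (B + Bᴴ) x := by
      intro x y
      have h1 : HasDerivAt (fun t : ℝ => (t : ℂ) + y * Complex.I) 1 x :=
        (Complex.ofRealCLM.hasDerivAt (x := x)).add_const _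
      have h2 : HasDerivAt (fun t : ℝ => starRingEnd ℂ ((t : ℂ) + y * Complex.I)) 1 x := by
        simpa using h1.star
      have h3 := ((h1.smul_const B).add (h2.smul_const Bᴴ)).const_add (A.mat (setCoord Ξ k j 0))
      rw [one_smul, one_smul] at h3
      refine h3.congr_of_eventuallyEq (Eventually.of_forall fun t => ?_)
      exact A.mat_setCoord Ξ k j _
    have hmaty : ∀ x y : ℝ, HasDerivAt
        (fun t : ℝ => A.mat (setCoord Ξ k j (x + t * Complex.I)))
        (Complex.I • B - Complex.I • Bᴴ) y := by
      intro x y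
      have h1 : HasDerivAt (fun t : ℝ => (x : ℂ) + t * Complex.I) Complex.I y := by
        simpa using ((Complex.ofRealCLM.hasDerivAt (x := y)).mul_const Complex.I).const_add (x : ℂ)
      have h2 : HasDerivAt (fun t : ℝ => starRingEnd ℂ ((x : ℂ) + t * Complex.I)) (-Complex.I) y := by
        simpa using h1.star
      have h3 := ((h1.smul_const B).add (h2.smul_const Bᴴ)).const_add (A.mat (setCoord Ξ k j 0))
      rw [neg_smul, ← sub_eq_add_neg] at h3
      refine h3.congr_of_eventuallyEq (Eventually.of_forall fun t => ?_)
      exact A.mat_setCoord Ξ k j _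
    have hbd : ∀ (Y : Matrix n n ℂ) (ζ : ℂ), ‖-(F ζ * Y * F ζ)‖ ≤ η⁻¹ * ‖Y‖ * η⁻¹ := fun Y ζ => by
      rw [norm_neg]; exact hbdd Y _
    -- A common bound for the resolvent and for its two partial derivatives along the coordinate.
    set C := max η⁻¹ (max (η⁻¹ * ‖B + Bᴴ‖ * η⁻¹) (η⁻¹ * ‖Complex.I • B - Complex.I • Bᴴ‖ * η⁻¹))
    obtain ⟨r1, r2⟩ := integral_smul_stdComplexGaussian (F := F)
      (Fx := fun ζ => -(F ζ * (B + Bᴴ) * F ζ))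
      (Fy := fun ζ => -(F ζ * (Complex.I • B - Complex.I • Bᴴ) * F ζ)) (C := C)
      (fun x y => hasDerivAt_matrix_inv (hmatx x y) ((dissipative_mat hA _).isUnit hη))
      (fun x y => hasDerivAt_matrix_inv (hmaty x y) ((dissipative_mat hA _).isUnit hη))
      (fun ζ => (hb _).trans (le_max_left _ _))
      (fun ζ => (hbd _ ζ).trans ((le_max_left _ _).trans (le_max_right _ _)))
      (fun ζ => (hbd _ ζ).trans ((le_max_right _ _).trans (le_max_right _ _)))
      hFc (by fun_prop) (by fun_prop)
    constructor
    · change ∫ ζ, ζ • F ζ ∂stdComplexGaussian = _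
      rw [r1, ← integral_smul, ← integral_neg]
      congr 1
      ext1 ζ
      simp only [mul_add, add_mul, mul_sub, sub_mul, Matrix.mul_smul, Matrix.smul_mul, smul_neg,
        smul_sub, smul_smul, Complex.I_mul_I]
      module
    · change ∫ ζ, starRingEnd ℂ ζ • F ζ ∂stdComplexGaussian = _
      rw [r2, ← integral_smul, ← integral_neg]
      congr 1
      ext1 ζ
      simp only [mul_add, add_mul, mul_sub, sub_mul, Matrix.mul_smul, Matrix.smul_mul, smul_neg,
        smul_sub, smul_smul, Complex.I_mul_I]
      module
  have hself : ∀ (Ξ : Fin K → m → ℂ) ζ, setCoord Ξ k j ζ k j = ζ := fun Ξ ζ => by simp [setCoord]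
  constructor
  · rw [integral_setCoord k j hint1, integral_setCoord k j (hint2 _), ← integral_neg]
    simp_rw [hself]
    exact integral_congr_ae (Eventually.of_forall fun Ξ => (key Ξ).1)
  · rw [integral_setCoord k j hint1', integral_setCoord k j (hint2 _), ← integral_neg]
    simp_rw [hself]
    exact integral_congr_ae (Eventually.of_forall fun Ξ => (key Ξ).2)

end Pencil

end

end

end PastFuture

namespace PastFuture

/-! ### The Schwinger–Dyson equation -/

section

open scoped Matrix.Norms.L2Operator Kronecker

set_option linter.unusedSectionVars false

/-- Summing over all coordinates of the field contracts a matrix to its trace. This is how the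
self-energy comes to depend on traces only. -/
theorem sum_single_mul_mul_single_swap {κ m : Type*} [Fintype κ] [DecidableEq κ] [Fintype m]
    [DecidableEq m] (C : Matrix κ κ ℂ) :
    ∑ k : κ, ∑ j : m, Matrix.single j k (1 : ℂ) * C * Matrix.single k j (1 : ℂ) =
      C.trace • (1 : Matrix m m ℂ) := by
  simp_rw [Matrix.single_mul_mul_single, one_mul, mul_one]
  rw [Finset.sum_comm, ← Matrix.sum_single_one, Finset.smul_sum]
  refine Finset.sum_congr rfl fun j _ => ?_
  rw [Matrix.trace, Finset.sum_smul]
  refine Finset.sum_congr rfl fun k _ => ?_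
  rw [Matrix.smul_single, smul_eq_mul, mul_one, Matrix.diag_apply]

namespace Pencil

variable {n m α : Type*} [Fintype n] [DecidableEq n] [Fintype m] [DecidableEq m] [Fintype α]
  {K : ℕ} (A : Pencil n m α K)

/-- The expectation of the resolvent. -/
noncomputable def meanRes : Matrix n n ℂ := ∫ Ξ, A.res Ξ ∂(gaussianField K m)

/-- The self-energy of the pencil. -/
noncomputable def selfEnergy (Y : Matrix n n ℂ) : Matrix n n ℂ :=
  ∑ a, ∑ b, (((A.V b)ᴴ * A.V a * Y).trace • (A.U a * (A.S * A.Sᴴ) * (A.U b)ᴴ) +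
    (A.U b * (A.S * A.Sᴴ) * (A.U a)ᴴ * Y).trace • ((A.V a)ᴴ * A.V b))

theorem selfEnergy_sub (Y Y' : Matrix n n ℂ) :
    A.selfEnergy (Y - Y') = A.selfEnergy Y - A.selfEnergy Y' := by
  unfold selfEnergy
  simp_rw [← Finset.sum_sub_distrib]
  refine Finset.sum_congr rfl fun a _ => Finset.sum_congr rfl fun b _ => ?_
  rw [mul_sub, mul_sub, Matrix.trace_sub, Matrix.trace_sub, sub_smul, sub_smul]
  abel

theorem conjTranspose_coef (k : Fin K) (j : m) :
    (A.coef k j)ᴴ = ∑ b, (A.V b)ᴴ * Matrix.single k j (1 : ℂ) * A.Sᴴ * (A.U b)ᴴ := by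
  unfold coef
  rw [Matrix.conjTranspose_sum]
  refine Finset.sum_congr rfl fun b _ => ?_
  rw [Matrix.conjTranspose_mul, Matrix.conjTranspose_mul, Matrix.conjTranspose_mul,
    Matrix.conjTranspose_single, star_one]
  simp only [Matrix.mul_assoc]

theorem sum_coef_mul (Y : Matrix n n ℂ) :
    ∑ k, ∑ j, A.coef k j * Y * (A.coef k j)ᴴ =
      ∑ a, ∑ b, ((A.V b)ᴴ * A.V a * Y).trace • (A.U a * (A.S * A.Sᴴ) * (A.U b)ᴴ) := by
  have h : ∀ k j, A.coef k j * Y * (A.coef k j)ᴴ = ∑ a, ∑ b, (A.U a * A.S) *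
      (Matrix.single j k (1 : ℂ) * (A.V a * Y * (A.V b)ᴴ) * Matrix.single k j (1 : ℂ)) *
      (A.Sᴴ * (A.U b)ᴴ) := by
    intro k j
    rw [conjTranspose_coef, coef, Matrix.sum_mul, Matrix.sum_mul]
    refine Finset.sum_congr rfl fun a _ => ?_
    rw [Matrix.mul_sum]
    refine Finset.sum_congr rfl fun b _ => ?_
    simp only [Matrix.mul_assoc]
  have h2 : ∀ a b, ((A.V b)ᴴ * A.V a * Y).trace • (A.U a * (A.S * A.Sᴴ) * (A.U b)ᴴ) =
      ∑ k : Fin K, ∑ j : m, (A.U a * A.S) *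
      (Matrix.single j k (1 : ℂ) * (A.V a * Y * (A.V b)ᴴ) * Matrix.single k j (1 : ℂ)) *
      (A.Sᴴ * (A.U b)ᴴ) := by
    intro a b
    simp_rw [← Matrix.sum_mul, ← Matrix.mul_sum]
    rw [sum_single_mul_mul_single_swap, Matrix.mul_smul, Matrix.smul_mul, Matrix.mul_one,
      Matrix.trace_mul_cycle (A.V a)]
    simp only [Matrix.mul_assoc]
  simp_rw [h, h2]
  calc _ = ∑ k : Fin K, ∑ a : α, ∑ j : m, ∑ b : α, _ :=
        Finset.sum_congr rfl fun k _ => Finset.sum_comm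
    _ = ∑ a : α, ∑ k : Fin K, ∑ j : m, ∑ b : α, _ := Finset.sum_comm
    _ = ∑ a : α, ∑ k : Fin K, ∑ b : α, ∑ j : m, _ :=
        Finset.sum_congr rfl fun a _ => Finset.sum_congr rfl fun k _ => Finset.sum_comm
    _ = _ := Finset.sum_congr rfl fun a _ => Finset.sum_comm

theorem sum_conjTranspose_coef_mul (Y : Matrix n n ℂ) :
    ∑ k, ∑ j, (A.coef k j)ᴴ * Y * A.coef k j =
      ∑ a, ∑ b, (A.U b * (A.S * A.Sᴴ) * (A.U a)ᴴ * Y).trace • ((A.V a)ᴴ * A.V b) := by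
  have h : ∀ k j, (A.coef k j)ᴴ * Y * A.coef k j = ∑ a, ∑ b, (A.V a)ᴴ *
      (Matrix.single k j (1 : ℂ) * (A.Sᴴ * (A.U a)ᴴ * Y * A.U b * A.S) *
        Matrix.single j k (1 : ℂ)) * A.V b := by
    intro k j
    rw [conjTranspose_coef, coef, Matrix.sum_mul, Matrix.sum_mul]
    refine Finset.sum_congr rfl fun a _ => ?_
    rw [Matrix.mul_sum]
    refine Finset.sum_congr rfl fun b _ => ?_
    simp only [Matrix.mul_assoc]
  have h2 : ∀ a b, (A.U b * (A.S * A.Sᴴ) * (A.U a)ᴴ * Y).trace • ((A.V a)ᴴ * A.V b) =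
      ∑ j : m, ∑ k : Fin K, (A.V a)ᴴ *
      (Matrix.single k j (1 : ℂ) * (A.Sᴴ * (A.U a)ᴴ * Y * A.U b * A.S) *
        Matrix.single j k (1 : ℂ)) * A.V b := by
    intro a b
    simp_rw [← Matrix.sum_mul, ← Matrix.mul_sum]
    rw [sum_single_mul_mul_single_swap, Matrix.mul_smul, Matrix.smul_mul, Matrix.mul_one]
    congr 1
    have := Matrix.trace_mul_comm (A.U b * A.S) (A.Sᴴ * (A.U a)ᴴ * Y)
    simp only [Matrix.mul_assoc] at this ⊢
    exact this
  simp_rw [h, h2]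
  calc _ = ∑ k : Fin K, ∑ a : α, ∑ j : m, ∑ b : α, _ :=
        Finset.sum_congr rfl fun k _ => Finset.sum_comm
    _ = ∑ a : α, ∑ k : Fin K, ∑ j : m, ∑ b : α, _ := Finset.sum_comm
    _ = ∑ a : α, ∑ k : Fin K, ∑ b : α, ∑ j : m, _ :=
        Finset.sum_congr rfl fun a _ => Finset.sum_congr rfl fun k _ => Finset.sum_comm
    _ = ∑ a : α, ∑ b : α, ∑ k : Fin K, ∑ j : m, _ :=
        Finset.sum_congr rfl fun a _ => Finset.sum_comm
    _ = _ := Finset.sum_congr rfl fun a _ => Finset.sum_congr rfl fun b _ => Finset.sum_comm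

/-- Two faces of the same map: the sum over coordinates is what integration by parts produces and
shows positivity, while the defining trace form shows that only traces of its argument matter, and
these concentrate. -/
theorem selfEnergy_eq_sum (Y : Matrix n n ℂ) :
    A.selfEnergy Y =
      ∑ k, ∑ j, (A.coef k j * Y * (A.coef k j)ᴴ + (A.coef k j)ᴴ * Y * A.coef k j) := by
  simp_rw [Finset.sum_add_distrib]
  rw [sum_coef_mul, sum_conjTranspose_coef_mul, selfEnergy]
  simp_rw [Finset.sum_add_distrib]

/-- Hence the base minus the self-energy of the mean resolvent is as dissipative as the base, and
the Dyson equation can be inverted with the bound 1/η. -/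
theorem imNonneg_selfEnergy {Y : Matrix n n ℂ} (hY : ImNonneg Y) : ImNonneg (A.selfEnergy Y) := by
  rw [selfEnergy_eq_sum]
  refine imNonneg_sum _ fun k _ => imNonneg_sum _ fun j _ => (hY.conj _).add ?_
  have := hY.conj (A.coef k j)ᴴ
  rwa [Matrix.conjTranspose_conjTranspose] at this

variable {A} {η : ℝ}

/-- The trace of a product with the resolvent, integrated. -/
theorem integral_trace_mul_res (hη : 0 < η) (hA : Dissipative η A.base) (B : Matrix n n ℂ) :
    ∫ Ξ, (B * A.res Ξ).trace ∂(gaussianField K m) = (B * A.meanRes).trace := by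
  let ℓ : Matrix n n ℂ →L[ℂ] ℂ :=
    LinearMap.toContinuousLinearMap ((Matrix.traceLinearMap n ℂ ℂ).comp (LinearMap.mulLeft ℂ B))
  exact ℓ.integral_comp_comm (integrable_res hη hA)

theorem imNonneg_meanRes (hη : 0 < η) (hA : Dissipative η A.base) : ImNonneg A.meanRes := by
  intro v
  let ℓ : Matrix n n ℂ →ₗ[ℂ] ℂ :=
    { toFun := fun Y => star v ⬝ᵥ Y *ᵥ v
      map_add' := fun Y Y' => by rw [add_mulVec, dotProduct_add]
      map_smul' := fun c Y => by rw [smul_mulVec, dotProduct_smul, RingHom.id_apply] }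
  have h1 := (LinearMap.toContinuousLinearMap ℓ).integral_comp_comm (integrable_res hη hA)
  have h2 : star v ⬝ᵥ A.meanRes *ᵥ v = ∫ Ξ, (star v ⬝ᵥ A.res Ξ *ᵥ v) ∂(gaussianField K m) :=
    h1.symm
  have h3 : Integrable (fun Ξ => star v ⬝ᵥ A.res Ξ *ᵥ v) (gaussianField K m) :=
    (LinearMap.toContinuousLinearMap ℓ).integrable_comp (integrable_res hη hA)
  rw [h2]
  have h4 := integral_im h3
  change ∫ Ξ, (star v ⬝ᵥ A.res Ξ *ᵥ v).im ∂(gaussianField K m) =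
    (∫ Ξ, (star v ⬝ᵥ A.res Ξ *ᵥ v) ∂(gaussianField K m)).im at h4
  rw [← h4]
  exact integral_nonneg fun Ξ => (dissipative_mat hA Ξ).imNonneg_inv hη v

theorem continuous_selfEnergy : Continuous A.selfEnergy := by
  unfold selfEnergy
  fun_prop

/-- The Schwinger–Dyson equation of the pencil. -/
theorem base_mul_meanRes (hη : 0 < η) (hA : Dissipative η A.base) :
    A.base * A.meanRes = 1 + ∫ Ξ, A.selfEnergy (A.res Ξ) * A.res Ξ ∂(gaussianField K m) := by
  have hres := integrable_res hη hA (m := m)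
  have hb := norm_res_le hη hA
  have hc := continuous_res hη hA
  have hbdd : ∀ B C : Matrix n n ℂ, Integrable (fun Ξ => C * (A.res Ξ * B * A.res Ξ))
      (gaussianField K m) := by
    intro B C
    refine Integrable.of_bound (by fun_prop : Continuous fun Ξ =>
      C * (A.res Ξ * B * A.res Ξ)).aestronglyMeasurable (‖C‖ * (η⁻¹ * ‖B‖ * η⁻¹))
      (Eventually.of_forall fun Ξ => ?_)
    refine (norm_mul_le _ _).trans (mul_le_mul_of_nonneg_left ?_ (norm_nonneg _))
    refine (norm_mul_le _ _).trans ?_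
    refine mul_le_mul ((norm_mul_le _ _).trans ?_) (hb Ξ) (norm_nonneg _) (by positivity)
    exact mul_le_mul_of_nonneg_right (hb Ξ) (norm_nonneg _)
  have hbdd1 : ∀ B : Matrix n n ℂ, Integrable (fun Ξ => A.res Ξ * B * A.res Ξ)
      (gaussianField K m) := fun B => by simpa using hbdd B 1
  have hint1 : ∀ k j, Integrable (fun Ξ => Ξ k j • A.res Ξ) (gaussianField K m) := by
    intro k j
    refine Integrable.mono' ((integrable_coord k j).norm.mul_const η⁻¹)
      (by fun_prop : Continuous fun Ξ : Fin K → m → ℂ => Ξ k j • A.res Ξ).aestronglyMeasurable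
      (Eventually.of_forall fun Ξ => ?_)
    rw [norm_smul]
    exact mul_le_mul_of_nonneg_left (hb Ξ) (norm_nonneg _)
  have hint2 : ∀ k j, Integrable (fun Ξ => starRingEnd ℂ (Ξ k j) • A.res Ξ)
      (gaussianField K m) := by
    intro k j
    refine Integrable.mono' ((integrable_coord k j).norm.mul_const η⁻¹)
      (by fun_prop : Continuous fun Ξ : Fin K → m → ℂ =>
        starRingEnd ℂ (Ξ k j) • A.res Ξ).aestronglyMeasurable
      (Eventually.of_forall fun Ξ => ?_)
    rw [norm_smul, RCLike.norm_conj]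
    exact mul_le_mul_of_nonneg_left (hb Ξ) (norm_nonneg _)
  have hone : ∀ Ξ, A.mat Ξ * A.res Ξ = 1 := fun Ξ =>
    Matrix.mul_nonsing_inv _ ((dissipative_mat hA Ξ).isUnit_det hη)
  -- The identity mat · res = 1 is solved for base · res; each coordinate term on the right is then
  -- integrated by parts, and its minus sign cancels the one coming from the derivative of an
  -- inverse.
  have hexp : ∀ Ξ, A.base * A.res Ξ = 1 - ∑ k, ∑ j, (A.coef k j * (Ξ k j • A.res Ξ) +
      (A.coef k j)ᴴ * (starRingEnd ℂ (Ξ k j) • A.res Ξ)) := by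
    intro Ξ
    rw [eq_sub_iff_add_eq, ← hone Ξ, mat, noise_eq_sum, Matrix.conjTranspose_sum, add_mul]
    congr 1
    simp_rw [Matrix.conjTranspose_sum, Matrix.conjTranspose_smul, ← Finset.sum_add_distrib,
      Finset.sum_mul, add_mul, Matrix.smul_mul, Matrix.mul_smul]
    rfl
  have hse : ∀ Ξ, A.selfEnergy (A.res Ξ) * A.res Ξ = ∑ k, ∑ j,
      (A.coef k j * (A.res Ξ * (A.coef k j)ᴴ * A.res Ξ) +
      (A.coef k j)ᴴ * (A.res Ξ * A.coef k j * A.res Ξ)) := by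
    intro Ξ
    rw [selfEnergy_eq_sum]
    simp_rw [Finset.sum_mul, add_mul, Matrix.mul_assoc]
  have h1 : A.base * A.meanRes = ∫ Ξ, A.base * A.res Ξ ∂(gaussianField K m) :=
    (integral_const_mul_of_integrable hres).symm
  rw [h1]
  simp_rw [hexp, hse]
  have hI1 : ∀ k j, Integrable (fun Ξ => A.coef k j * (Ξ k j • A.res Ξ) +
      (A.coef k j)ᴴ * (starRingEnd ℂ (Ξ k j) • A.res Ξ)) (gaussianField K m) := fun k j =>
    ((hint1 k j).const_mul _).add ((hint2 k j).const_mul _)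
  have hI2 : ∀ k j, Integrable (fun Ξ => A.coef k j * (A.res Ξ * (A.coef k j)ᴴ * A.res Ξ) +
      (A.coef k j)ᴴ * (A.res Ξ * A.coef k j * A.res Ξ)) (gaussianField K m) := fun k j =>
    (hbdd _ _).add (hbdd _ _)
  rw [integral_sub (integrable_const _)
    (integrable_finsetSum _ fun k _ => integrable_finsetSum _ fun j _ => hI1 k j),
    integral_const, probReal_univ, one_smul, sub_eq_add_neg]
  congr 1
  rw [integral_finsetSum _ fun k _ => integrable_finsetSum _ fun j _ => hI1 k j,
    integral_finsetSum _ fun k _ => integrable_finsetSum _ fun j _ => hI2 k j,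
    ← Finset.sum_neg_distrib]
  refine Finset.sum_congr rfl fun k _ => ?_
  rw [integral_finsetSum _ fun j _ => hI1 k j, integral_finsetSum _ fun j _ => hI2 k j,
    ← Finset.sum_neg_distrib]
  refine Finset.sum_congr rfl fun j _ => ?_
  rw [integral_add ((hint1 k j).const_mul _) ((hint2 k j).const_mul _),
    integral_add (hbdd _ _) (hbdd _ _), integral_const_mul_of_integrable (hint1 k j),
    integral_const_mul_of_integrable (hint2 k j), integral_const_mul_of_integrable (hbdd1 _),
    integral_const_mul_of_integrable (hbdd1 _), (integral_smul_res hη hA k j).1,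
    (integral_smul_res hη hA k j).2]
  rw [mul_neg, mul_neg, neg_add, neg_neg, neg_neg]

end Pencil

end

end PastFuture

namespace PastFuture

/-! ### Concentration of traces and the approximate Dyson equation -/

section

open scoped Matrix.Norms.L2Operator Kronecker

set_option linter.unusedSectionVars false

/-- Replacing one column of the field changes its matrix by a matrix of rank at most one. -/
theorem rank_of_update_sub_le {m : Type*} [Fintype m] {K : ℕ} (Ξ : Fin K → m → ℂ)
    (k : Fin K) (e : m → ℂ) :
    ((Matrix.of (Function.update Ξ k e - Ξ))ᵀ : Matrix m (Fin K) ℂ).rank ≤ 1 := by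
  have h : ((Matrix.of (Function.update Ξ k e - Ξ))ᵀ : Matrix m (Fin K) ℂ) =
      Matrix.vecMulVec (e - Ξ k) (Pi.single k 1) := by
    ext j l
    by_cases hl : l = k
    · subst hl; simp [Matrix.vecMulVec_apply]
    · simp [Matrix.vecMulVec_apply, hl]
  rw [h]
  exact Matrix.rank_vecMulVec_le _ _

namespace Pencil

variable {n m α : Type*} [Fintype n] [DecidableEq n] [Fintype m] [DecidableEq m] [Fintype α]
  {K : ℕ} {A : Pencil n m α K} {η : ℝ}

/-- The field enters every summand through one matrix factor, and changing one vector changes that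
factor by rank one. -/
theorem rank_noise_update_sub_le (Ξ : Fin K → m → ℂ) (k : Fin K) (e : m → ℂ) :
    (A.noise (Function.update Ξ k e) - A.noise Ξ).rank ≤ Fintype.card α := by
  have h : A.noise (Function.update Ξ k e) - A.noise Ξ =
      A.noise (Function.update Ξ k e - Ξ) := by
    rw [sub_eq_iff_eq_add, ← noise_add, sub_add_cancel]
  rw [h, noise]
  refine (rank_sum_le_sum _ _).trans ?_
  rw [← Finset.card_univ, Finset.card_eq_sum_ones]
  refine Finset.sum_le_sum fun a _ => ?_
  refine (Matrix.rank_mul_le_left _ _).trans ((Matrix.rank_mul_le_right _ _).trans ?_)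
  exact rank_of_update_sub_le Ξ k e

theorem rank_mat_update_sub_le (Ξ : Fin K → m → ℂ) (k : Fin K) (e : m → ℂ) :
    (A.mat (Function.update Ξ k e) - A.mat Ξ).rank ≤ 2 * Fintype.card α := by
  have h : A.mat (Function.update Ξ k e) - A.mat Ξ =
      (A.noise (Function.update Ξ k e) - A.noise Ξ) +
        (A.noise (Function.update Ξ k e) - A.noise Ξ)ᴴ := by
    rw [mat, mat, Matrix.conjTranspose_sub]
    abel
  rw [h, two_mul]
  refine (rank_add_le_add _ _).trans ?_
  rw [Matrix.rank_conjTranspose]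
  exact add_le_add (rank_noise_update_sub_le Ξ k e) (rank_noise_update_sub_le Ξ k e)

theorem continuous_trace_mul_res (hη : 0 < η) (hA : Dissipative η A.base) (B : Matrix n n ℂ) :
    Continuous fun Ξ => (B * A.res Ξ).trace := by
  have := continuous_res hη hA
  fun_prop

/-- Linear statistics of the resolvent concentrate around their mean. -/
theorem integral_norm_trace_sub_le [Nonempty α] (hK : 0 < K) (hη : 0 < η)
    (hA : Dissipative η A.base) {B : Matrix n n ℂ} {β : ℝ} (hβ : 0 < β) (hB : ‖B‖ ≤ β) :
    ∫ Ξ, ‖(B * A.res Ξ).trace - (B * A.meanRes).trace‖ ∂(gaussianField K m) ≤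
      8 * (√K * (2 * Fintype.card α * (β * (2 * η⁻¹)))) := by
  have hc := continuous_trace_mul_res hη hA B
  have hα : 0 < (Fintype.card α : ℝ) := by exact_mod_cast Fintype.card_pos
  have hK' : 0 < √(K : ℝ) := Real.sqrt_pos.2 (by exact_mod_cast hK)
  rw [← integral_trace_mul_res hη hA B]
  -- Changing one of the K vectors perturbs the pencil by rank at most 2|α| and hence the trace by
  -- at most c; the scale is σ = √K c.
  refine boundedDifference_integral_norm_le (Measure.pi fun _ : m => stdComplexGaussian) K
    (fun Ξ => (B * A.res Ξ).trace) hc.measurable (C := Fintype.card n * (β * η⁻¹))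
    (c := 2 * Fintype.card α * (β * (2 * η⁻¹))) (fun Ξ => ?_) (fun Ξ k e => ?_) (by positivity) ?_
  · refine (norm_trace_le _).trans (mul_le_mul_of_nonneg_left ?_ (by positivity))
    exact (norm_mul_le _ _).trans
      (mul_le_mul hB (norm_res_le hη hA Ξ) (norm_nonneg _) hβ.le)
  · refine ((dissipative_mat hA Ξ).norm_trace_inv_sub_le hη (dissipative_mat hA _) B).trans ?_
    have h := rank_mat_update_sub_le (A := A) Ξ k e
    have h' : ((A.mat (Function.update Ξ k e) - A.mat Ξ).rank : ℝ) ≤ 2 * Fintype.card α := by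
      exact_mod_cast h
    gcongr
  · rw [mul_pow √(K : ℝ), Real.sq_sqrt (by positivity)]

theorem integrable_norm_trace_sub (hη : 0 < η) (hA : Dissipative η A.base) (B : Matrix n n ℂ) :
    Integrable (fun Ξ => ‖(B * A.res Ξ).trace - (B * A.meanRes).trace‖) (gaussianField K m) := by
  have hc := continuous_trace_mul_res hη hA B
  refine (Integrable.sub ?_ (integrable_const _)).norm
  refine Integrable.of_bound hc.aestronglyMeasurable (Fintype.card n * (‖B‖ * η⁻¹))
    (Eventually.of_forall fun Ξ => ?_)
  refine (norm_trace_le _).trans (mul_le_mul_of_nonneg_left ?_ (by positivity))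
  exact (norm_mul_le _ _).trans (mul_le_mul_of_nonneg_left (norm_res_le hη hA Ξ) (norm_nonneg _))

/-- The mean resolvent nearly solves the Dyson equation. -/
theorem norm_meanRes_sub_le [Nonempty α] (hK : 0 < K) (hη : 0 < η)
    (hA : Dissipative η A.base) {ρ : ℝ} (hρ : 0 < ρ) (hU : ∀ a, ‖A.U a‖ ≤ 1)
    (hV : ∀ a, ‖A.V a‖ ≤ 1) (hS : ‖A.S * A.Sᴴ‖ ≤ ρ) :
    ‖A.meanRes - (A.base - A.selfEnergy A.meanRes)⁻¹‖ ≤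
      η⁻¹ * ((Fintype.card α : ℝ) ^ 2 *
        (16 * ρ * (√K * (2 * Fintype.card α * (2 * η⁻¹)))) * η⁻¹) := by
  have hX : Dissipative η (A.base - A.selfEnergy A.meanRes) :=
    hA.sub (A.imNonneg_selfEnergy (imNonneg_meanRes hη hA))
  have hb := norm_res_le hη hA
  have hc := continuous_res hη hA
  have hsc := continuous_selfEnergy (A := A)
  have hVV : ∀ a b, ‖(A.V b)ᴴ * A.V a‖ ≤ 1 := fun a b => by
    refine (Matrix.l2_opNorm_mul _ _).trans ?_
    rw [Matrix.l2_opNorm_conjTranspose]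
    exact mul_le_one₀ (hV b) (norm_nonneg _) (hV a)
  have hUU : ∀ a b, ‖A.U b * (A.S * A.Sᴴ) * (A.U a)ᴴ‖ ≤ ρ := fun a b => by
    refine (Matrix.l2_opNorm_mul _ _).trans ?_
    rw [Matrix.l2_opNorm_conjTranspose]
    calc ‖A.U b * (A.S * A.Sᴴ)‖ * ‖A.U a‖ ≤ ρ * 1 := by
          refine mul_le_mul ((Matrix.l2_opNorm_mul _ _).trans ?_) (hU a) (norm_nonneg _) hρ.le
          calc ‖A.U b‖ * ‖A.S * A.Sᴴ‖ ≤ 1 * ρ :=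
                mul_le_mul (hU b) hS (norm_nonneg _) zero_le_one
            _ = ρ := one_mul _
      _ = ρ := mul_one _
  -- Each trace fluctuation in the self-energy is weighted by the norm of the matrix it multiplies:
  -- ρ for the U-terms, 1 for the V-terms. The traces of the second kind already carry a factor ρ,
  -- so both contributions are of order ρ√K.
  let g : α → α → (Fin K → m → ℂ) → ℝ := fun a b Ξ =>
    ‖((A.V b)ᴴ * A.V a * A.res Ξ).trace - ((A.V b)ᴴ * A.V a * A.meanRes).trace‖ * ρ +
    ‖(A.U b * (A.S * A.Sᴴ) * (A.U a)ᴴ * A.res Ξ).trace -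
      (A.U b * (A.S * A.Sᴴ) * (A.U a)ᴴ * A.meanRes).trace‖
  have hgi : ∀ a b, Integrable (g a b) (gaussianField K m) := fun a b =>
    ((integrable_norm_trace_sub hη hA _).mul_const ρ).add (integrable_norm_trace_sub hη hA _)
  have hgle : ∀ a b, ∫ Ξ, g a b Ξ ∂(gaussianField K m) ≤
      16 * ρ * (√K * (2 * Fintype.card α * (2 * η⁻¹))) := by
    intro a b
    have h1 := integral_norm_trace_sub_le hK hη hA (m := m) one_pos (hVV a b)
    have h2 := integral_norm_trace_sub_le hK hη hA (m := m) hρ (hUU a b)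
    simp only [g]
    rw [integral_add ((integrable_norm_trace_sub hη hA _).mul_const ρ)
      (integrable_norm_trace_sub hη hA _), integral_mul_const]
    have h3 := mul_le_mul_of_nonneg_right h1 hρ.le
    calc _ ≤ _ := add_le_add h3 h2
      _ = _ := by ring
  have hse : ∀ Ξ, ‖A.selfEnergy (A.res Ξ - A.meanRes)‖ ≤ ∑ a, ∑ b, g a b Ξ := by
    intro Ξ
    unfold selfEnergy
    refine (norm_sum_le _ _).trans (Finset.sum_le_sum fun a _ => ?_)
    refine (norm_sum_le _ _).trans (Finset.sum_le_sum fun b _ => ?_)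
    refine (norm_add_le _ _).trans ?_
    rw [norm_smul, norm_smul, mul_sub, mul_sub, Matrix.trace_sub, Matrix.trace_sub]
    refine add_le_add (mul_le_mul_of_nonneg_left (hUU b a) (norm_nonneg _)) ?_
    exact mul_le_of_le_one_right (norm_nonneg _) (hVV b a)
  have hres := integrable_res hη hA (m := m)
  have hint1 : Integrable (fun Ξ => A.selfEnergy (A.res Ξ) * A.res Ξ) (gaussianField K m) := by
    obtain ⟨C, hC⟩ : ∃ C, ∀ Y : Matrix n n ℂ, ‖Y‖ ≤ η⁻¹ → ‖A.selfEnergy Y‖ ≤ C := by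
      have hcpt : IsCompact (Metric.closedBall (0 : Matrix n n ℂ) η⁻¹) :=
        isCompact_closedBall _ _
      obtain ⟨C, hC⟩ := hcpt.exists_bound_of_continuousOn hsc.continuousOn
      exact ⟨C, fun Y hY => hC Y (by simpa using hY)⟩
    refine Integrable.of_bound (by fun_prop : Continuous fun Ξ =>
      A.selfEnergy (A.res Ξ) * A.res Ξ).aestronglyMeasurable (C * η⁻¹)
      (Eventually.of_forall fun Ξ => ?_)
    refine (norm_mul_le _ _).trans (mul_le_mul (hC _ (hb Ξ)) (hb Ξ) (norm_nonneg _) ?_)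
    exact (norm_nonneg _).trans (hC _ (hb Ξ))
  -- By linearity of the self-energy, replacing its argument by the mean leaves an error that
  -- involves only the fluctuation of the resolvent.
  have heq : (A.base - A.selfEnergy A.meanRes) * A.meanRes =
      1 + ∫ Ξ, A.selfEnergy (A.res Ξ - A.meanRes) * A.res Ξ ∂(gaussianField K m) := by
    have h1 : A.selfEnergy A.meanRes * A.meanRes =
        ∫ Ξ, A.selfEnergy A.meanRes * A.res Ξ ∂(gaussianField K m) :=
      (integral_const_mul_of_integrable hres).symm
    rw [sub_mul, base_mul_meanRes hη hA, h1, add_sub_assoc,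
      ← integral_sub hint1 (hres.const_mul _)]
    simp_rw [selfEnergy_sub, sub_mul]
  have hdiff : A.meanRes - (A.base - A.selfEnergy A.meanRes)⁻¹ =
      (A.base - A.selfEnergy A.meanRes)⁻¹ *
        ∫ Ξ, A.selfEnergy (A.res Ξ - A.meanRes) * A.res Ξ ∂(gaussianField K m) := by
    have h1 := congrArg (fun Y => (A.base - A.selfEnergy A.meanRes)⁻¹ * Y) heq
    simp only [mul_add, mul_one] at h1
    rw [← Matrix.mul_assoc, Matrix.nonsing_inv_mul _ (hX.isUnit_det hη), Matrix.one_mul] at h1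
    exact sub_eq_of_eq_add' h1
  rw [hdiff]
  refine (norm_mul_le _ _).trans (mul_le_mul (hX.norm_inv_le hη) ?_ (norm_nonneg _) (by positivity))
  calc ‖∫ Ξ, A.selfEnergy (A.res Ξ - A.meanRes) * A.res Ξ ∂(gaussianField K m)‖
      ≤ ∫ Ξ, (∑ a, ∑ b, g a b Ξ) * η⁻¹ ∂(gaussianField K m) := by
        refine norm_integral_le_of_norm_le ?_ (Eventually.of_forall fun Ξ => ?_)
        · exact (integrable_finsetSum _ fun a _ => integrable_finsetSum _ fun b _ =>
            hgi a b).mul_const _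
        · refine (norm_mul_le _ _).trans (mul_le_mul (hse Ξ) (hb Ξ) (norm_nonneg _) ?_)
          exact (norm_nonneg _).trans (hse Ξ)
    _ = (∑ a, ∑ b, ∫ Ξ, g a b Ξ ∂(gaussianField K m)) * η⁻¹ := by
        rw [integral_mul_const, integral_finsetSum _ fun a _ => integrable_finsetSum _ fun b _ =>
            hgi a b]
        congr 1
        exact Finset.sum_congr rfl fun a _ => integral_finsetSum _ fun b _ => hgi a b
    _ ≤ _ := by
        refine mul_le_mul_of_nonneg_right ?_ (by positivity)
        calc _ ≤ ∑ a : α, ∑ b : α, 16 * ρ * (√K * (2 * Fintype.card α * (2 * η⁻¹))) :=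
              Finset.sum_le_sum fun a _ => Finset.sum_le_sum fun b _ => hgle a b
          _ = _ := by
              simp only [Finset.sum_const, Finset.card_univ, nsmul_eq_mul]
              ring

end Pencil

end

end PastFuture

namespace PastFuture

section

open scoped Matrix.Norms.L2Operator Kronecker

set_option linter.unusedSectionVars false

/-! ### The Hankel pencil -/

/-- If a measure-preserving change of the field acts on the pencil as conjugation by a unitary, it
acts so on the inverse, and the mean inverse commutes with that unitary. -/
theorem Pencil.meanRes_eq_conj {n m α : Type*} [Fintype n] [DecidableEq n] [Fintype m]
    [DecidableEq m] [Fintype α] {K : ℕ} {A : Pencil n m α K} {η : ℝ} (hη : 0 < η)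
    (hA : Dissipative η A.base) {φ : (Fin K → m → ℂ) → Fin K → m → ℂ}
    (hφ : MeasurePreserving φ (gaussianField K m) (gaussianField K m)) {D : Matrix n n ℂ}
    (hD : D * Dᴴ = 1) (h : ∀ Ξ, A.mat (φ Ξ) = D * A.mat Ξ * Dᴴ) :
    A.meanRes = D * A.meanRes * Dᴴ := by
  have hD' : Dᴴ * D = 1 := mul_eq_one_comm.1 hD
  have hres : ∀ Ξ, A.res (φ Ξ) = D * A.res Ξ * Dᴴ := by
    intro Ξ
    rw [Pencil.res, h]
    refine Matrix.inv_eq_right_inv ?_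
    have e := Matrix.mul_nonsing_inv _ ((Pencil.dissipative_mat hA Ξ).isUnit_det hη)
    calc D * A.mat Ξ * Dᴴ * (D * A.res Ξ * Dᴴ)
        = D * A.mat Ξ * (Dᴴ * D) * A.res Ξ * Dᴴ := by simp only [Matrix.mul_assoc]
      _ = D * (A.mat Ξ * A.res Ξ) * Dᴴ := by rw [hD', Matrix.mul_one, Matrix.mul_assoc D]
      _ = 1 := by
        change D * (A.mat Ξ * (A.mat Ξ)⁻¹) * Dᴴ = 1
        rw [e, Matrix.mul_one, hD]
  have hint := Pencil.integrable_res hη hA (m := m)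
  have hsm := hint.aestronglyMeasurable
  rw [← hφ.map_eq] at hsm
  have h1 : A.meanRes = ∫ Ξ, A.res (φ Ξ) ∂(gaussianField K m) := by
    rw [Pencil.meanRes, ← integral_map hφ.measurable.aemeasurable hsm, hφ.map_eq]
  refine h1.trans ?_
  simp_rw [hres]
  rw [integral_mul_const_of_integrable (hint.const_mul D), integral_const_mul_of_integrable hint]
  rfl

/-- The position of a block row in the sequence of observations. -/
def rowOffset {L : ℕ} (a : Bool × Fin L) : ℕ := (if a.1 then L else 0) + a.2

/-- Past rows have offsets 0, …, L-1 and future rows L, …, 2L-1, so the offset alone identifies the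
block row. This lets the gauge weights separate all 2L block rows. -/
theorem rowOffset_injective {L : ℕ} : Function.Injective (rowOffset (L := L)) := by
  rintro ⟨β, i⟩ ⟨β', i'⟩ h
  have hi := i.2
  have hi' := i'.2
  cases β <;> cases β' <;> simp only [rowOffset, if_true, if_false, Bool.false_eq_true] at h
  · exact Prod.ext rfl (Fin.ext (by simpa using h))
  · omega
  · omega
  · exact Prod.ext rfl (Fin.ext (by simpa using h))

theorem rowOffset_add_lt {L N : ℕ} (a : Bool × Fin L) (ν : Fin N) :
    rowOffset a + ν < N + 2 * L - 1 := by
  obtain ⟨β, i⟩ := a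
  have hi := i.2
  have hν := ν.2
  cases β <;> simp only [rowOffset, if_true, if_false, Bool.false_eq_true] <;> omega

variable {m : Type*} [Fintype m] [DecidableEq m]

/-- The block-diagonal matrix made of the two block-Hankel matrices. -/
noncomputable def bigW (L N : ℕ) (y : ℕ → m → ℂ) :
    Matrix ((Bool × Fin L) × m) (Bool × Fin N) ℂ :=
  Matrix.of fun x c =>
    if c.1 = x.1.1 then ((√(N : ℝ) : ℝ) : ℂ)⁻¹ * y (rowOffset x.1 + c.2) x.2 else 0

/-- Extension of a finite field by zero. -/
def extendField {K : ℕ} (Ξ : Fin K → m → ℂ) (t : ℕ) : m → ℂ :=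
  if h : t < K then Ξ ⟨t, h⟩ else 0

theorem extendField_coe {K : ℕ} (Ξ : Fin K → m → ℂ) (t : Fin K) : extendField Ξ t = Ξ t := by
  simp [extendField]

/-- The matrix with `-s` on the diagonal and `-1` off the diagonal. -/
def flipMat (s : ℂ) : Matrix Bool Bool ℂ := Matrix.of fun β β' => if β = β' then -s else -1

/-- The inverse of `flipMat s`. -/
noncomputable def flipInv (s : ℂ) : Matrix Bool Bool ℂ :=
  Matrix.of fun β β' => if β = β' then hFun s else -(1 - s ^ 2)⁻¹

theorem flipMat_mul_flipInv {s : ℂ} (hs : 0 < s.im) : flipMat s * flipInv s = 1 := by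
  have h := one_sub_sq_ne_zero hs
  ext β β'
  cases β <;> cases β' <;>
    simp [flipMat, flipInv, Matrix.mul_apply, hFun] <;> field_simp <;> ring

/-- The linearization of the product of block-Hankel matrices. -/
noncomputable def hankelPencil (L N : ℕ) (S : Matrix m m ℂ) (w : ℂ) (η : ℝ) :
    Pencil (((Bool × Fin L) × m) ⊕ (Bool × Fin N)) m (Bool × Fin L) (N + 2 * L - 1) where
  -- The flip pairs past columns with future columns, so its elimination produces the products of
  -- W_p and W_f; the diagonal entries -iη provide dissipativity on the column indices.
  base := Matrix.fromBlocks (-(w • 1)) 0 0 (flipMat (Complex.I * η) ⊗ₖ 1)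
  U a := Matrix.of fun x j => if x = Sum.inl (a, j) then 1 else 0
  V a := Matrix.of fun t x => Sum.elim (fun _ => 0)
    (fun c => if c.1 = a.1 ∧ rowOffset a + c.2 = t then 1 else 0) x
  S := ((√(N : ℝ) : ℝ) : ℂ)⁻¹ • S

section

variable {L N : ℕ} {S : Matrix m m ℂ} {w : ℂ} {η : ℝ}

theorem hankelPencil_U_mul_apply {l : Type*} (a : Bool × Fin L) (C : Matrix m l ℂ) (x y) :
    ((hankelPencil L N S w η).U a * C) x y =
      Sum.elim (fun p : (Bool × Fin L) × m => if p.1 = a then C p.2 y else 0) (fun _ => 0) x := by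
  rw [Matrix.mul_apply]
  rcases x with ⟨a', j⟩ | c
  · simp only [hankelPencil, Matrix.of_apply, Sum.inl.injEq, Prod.mk.injEq, Sum.elim_inl, ite_and,
      ite_mul, one_mul, zero_mul]
    by_cases h : a' = a
    · simp [h]
    · simp [h]
  · simp [hankelPencil]

theorem hankelPencil_noise (Ξ : Fin (N + 2 * L - 1) → m → ℂ) :
    (hankelPencil L N S w η).noise Ξ =
      Matrix.fromBlocks 0 (bigW L N fun t => S *ᵥ extendField Ξ t) 0 0 := by
  have hV : ∀ (a : Bool × Fin L) (C : Matrix m (Fin (N + 2 * L - 1)) ℂ) j y,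
      (C * (hankelPencil L N S w η).V a) j y =
        Sum.elim (fun _ => 0) (fun c : Bool × Fin N =>
          if c.1 = a.1 then C j ⟨rowOffset a + c.2, rowOffset_add_lt a c.2⟩ else 0) y := by
    intro a C j y
    rw [Matrix.mul_apply]
    rcases y with p | c
    · simp [hankelPencil]
    · simp only [hankelPencil, Matrix.of_apply, Sum.elim_inr]
      by_cases h : c.1 = a.1
      · simp only [h, true_and, mul_ite, mul_one, mul_zero, if_true]
        rw [Finset.sum_eq_single ⟨rowOffset a + c.2, rowOffset_add_lt a c.2⟩]
        · simp
        · intro t _ ht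
          rw [if_neg]
          exact fun h' => ht (Fin.ext h'.symm)
        · simp
      · simp [h]
  ext x y
  unfold Pencil.noise
  simp_rw [Matrix.mul_assoc ((hankelPencil L N S w η).U _), Matrix.mul_assoc]
  rw [Matrix.sum_apply]
  simp_rw [hankelPencil_U_mul_apply]
  rcases x with ⟨a, j⟩ | c
  · simp only [Sum.elim_inl, Finset.sum_ite_eq, Finset.mem_univ, if_true]
    rw [← Matrix.mul_assoc, hV]
    rcases y with p | c
    · simp
    · simp only [Sum.elim_inr, Matrix.fromBlocks_apply₁₂, bigW, Matrix.of_apply]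
      congr 1
      rw [show extendField Ξ (rowOffset a + c.2) = Ξ ⟨_, rowOffset_add_lt a c.2⟩ from
        extendField_coe Ξ ⟨_, rowOffset_add_lt a c.2⟩]
      simp only [hankelPencil, Matrix.smul_mul, Matrix.smul_apply, smul_eq_mul]
      rfl
  · rcases y with p | c <;> simp

theorem hankelPencil_mat (Ξ : Fin (N + 2 * L - 1) → m → ℂ) :
    (hankelPencil L N S w η).mat Ξ =
      Matrix.fromBlocks (-(w • 1)) (bigW L N fun t => S *ᵥ extendField Ξ t)
        (bigW L N fun t => S *ᵥ extendField Ξ t)ᴴ (flipMat (Complex.I * η) ⊗ₖ 1) := by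
  rw [Pencil.mat, hankelPencil_noise, Matrix.fromBlocks_conjTranspose, Matrix.fromBlocks_add]
  simp only [hankelPencil, Matrix.conjTranspose_zero, add_zero, zero_add, Matrix.fromBlocks_add]

theorem norm_hankelPencil_U_le (a : Bool × Fin L) : ‖(hankelPencil L N S w η).U a‖ ≤ 1 := by
  have h : ((hankelPencil L N S w η).U a)ᴴ * (hankelPencil L N S w η).U a = 1 := by
    ext i j
    rw [Matrix.mul_apply, Matrix.one_apply, Fintype.sum_sum_type]
    simp only [hankelPencil, Matrix.conjTranspose_apply, Matrix.of_apply, Sum.inl.injEq,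
      reduceCtorEq, if_false, star_zero, mul_zero, Finset.sum_const_zero, add_zero]
    rw [Finset.sum_eq_single (a, i)]
    · simp
    · intro x _ hx
      simp [hx]
    · simp
  have h2 := Matrix.l2_opNorm_conjTranspose_mul_self ((hankelPencil L N S w η).U a)
  rw [h] at h2
  have h3 : ‖(1 : Matrix m m ℂ)‖ ≤ 1 := by
    refine l2_opNorm_le_of_mulVec _ zero_le_one fun v => ?_
    rw [one_mulVec, one_mul]
  nlinarith [norm_nonneg ((hankelPencil L N S w η).U a)]

/-- The product is a partial shift of the columns by the difference of the two row offsets; all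
correlations due to the Hankel structure are encoded in these shifts. -/
theorem conjTranspose_hankelPencil_V_mul (a b : Bool × Fin L) (x y) :
    (((hankelPencil L N S w η).V b)ᴴ * (hankelPencil L N S w η).V a) x y =
      Sum.elim (fun _ => 0) (fun c : Bool × Fin N => Sum.elim (fun _ => 0)
        (fun c' : Bool × Fin N => if c.1 = b.1 ∧ c'.1 = a.1 ∧
          rowOffset b + c.2 = rowOffset a + c'.2 then (1 : ℂ) else 0) y) x := by
  rw [Matrix.mul_apply]
  rcases x with p | c
  · simp [hankelPencil]
  rcases y with p | c'
  · simp [hankelPencil]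
  simp only [hankelPencil, Matrix.conjTranspose_apply, Matrix.of_apply, Sum.elim_inr]
  rw [Finset.sum_eq_single ⟨rowOffset b + c.2, rowOffset_add_lt b c.2⟩]
  · by_cases h1 : c.1 = b.1 <;> by_cases h2 : c'.1 = a.1 <;> simp [h1, h2, eq_comm]
  · intro t _ ht
    rw [if_neg]
    · simp
    · rintro ⟨_, h⟩
      exact ht (Fin.ext h.symm)
  · simp

theorem norm_hankelPencil_V_le (a : Bool × Fin L) : ‖(hankelPencil L N S w η).V a‖ ≤ 1 := by
  have h : ((hankelPencil L N S w η).V a)ᴴ * (hankelPencil L N S w η).V a =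
      Matrix.diagonal (Sum.elim (fun _ => 0) fun c => if c.1 = a.1 then 1 else 0) := by
    ext x y
    rw [conjTranspose_hankelPencil_V_mul, Matrix.diagonal_apply]
    rcases x with p | c
    · simp
    rcases y with p | c'
    · simp
    simp only [Sum.elim_inr, Sum.inr.injEq, add_right_inj]
    by_cases h1 : c = c'
    · subst h1; simp
    · rw [if_neg h1, if_neg]
      rintro ⟨h2, h3, h4⟩
      exact h1 (Prod.ext (h2.trans h3.symm) (Fin.ext h4))
  have h2 := Matrix.l2_opNorm_conjTranspose_mul_self ((hankelPencil L N S w η).V a)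
  rw [h, Matrix.l2_opNorm_diagonal] at h2
  have h3 : ‖(Sum.elim (fun _ => 0) fun c => if c.1 = a.1 then 1 else 0 :
      ((Bool × Fin L) × m) ⊕ (Bool × Fin N) → ℂ)‖ ≤ 1 := by
    refine (pi_norm_le_iff_of_nonneg zero_le_one).2 ?_
    rintro (p | c)
    · simp
    · by_cases h : c.1 = a.1 <;> simp [h]
  rw [h2] at h3
  nlinarith [norm_nonneg ((hankelPencil L N S w η).V a)]

theorem hankelPencil_S_mul (hN : 0 < N) :
    (hankelPencil L N S w η).S * (hankelPencil L N S w η).Sᴴ = (N : ℂ)⁻¹ • (S * Sᴴ) := by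
  have h : ((√(N : ℝ) : ℝ) : ℂ) * ((√(N : ℝ) : ℝ) : ℂ) = N := by
    rw [← Complex.ofReal_mul, Real.mul_self_sqrt (by positivity)]
    simp
  simp only [hankelPencil, Matrix.conjTranspose_smul, Matrix.smul_mul, Matrix.mul_smul, smul_smul]
  congr 1
  rw [← h, mul_inv, star_inv₀]
  simp

/-- The base is a Hermitian matrix minus a diagonal one with entries w and iη, whose imaginary parts
are at least η. -/
theorem dissipative_hankelPencil (hw : η ≤ w.im) :
    Dissipative η (hankelPencil L N S w η).base := by
  intro v
  have hflip : flipMat (Complex.I * η) ⊗ₖ (1 : Matrix (Fin N) (Fin N) ℂ) =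
      flipMat 0 ⊗ₖ (1 : Matrix (Fin N) (Fin N) ℂ) - (Complex.I * η) • 1 := by
    ext x y
    simp only [flipMat, Matrix.kroneckerMap_apply, Matrix.of_apply, Matrix.sub_apply,
      Matrix.smul_apply, Matrix.one_apply, Prod.ext_iff, smul_eq_mul]
    by_cases h1 : x.1 = y.1 <;> by_cases h2 : x.2 = y.2 <;> simp [h1, h2]
  have hbase : (hankelPencil L N S w η).base =
      (Matrix.fromBlocks 0 0 0 (flipMat 0 ⊗ₖ (1 : Matrix (Fin N) (Fin N) ℂ))) -
      Matrix.diagonal (Sum.elim (fun _ => w) fun _ => Complex.I * η) := by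
    rw [← Matrix.fromBlocks_diagonal]
    simp only [hankelPencil, hflip, sub_eq_add_neg, Matrix.fromBlocks_neg, Matrix.fromBlocks_add,
      ← Matrix.smul_one_eq_diagonal]
    simp
  have hherm : (Matrix.fromBlocks (0 : Matrix ((Bool × Fin L) × m) ((Bool × Fin L) × m) ℂ) 0 0
      (flipMat 0 ⊗ₖ (1 : Matrix (Fin N) (Fin N) ℂ))).IsHermitian := by
    refine Matrix.IsHermitian.fromBlocks Matrix.isHermitian_zero (by simp) ?_
    rw [Matrix.IsHermitian, Matrix.conjTranspose_kronecker, Matrix.conjTranspose_one]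
    congr 1
    ext β β'
    by_cases h : β = β'
    · simp [flipMat, h]
    · simp [flipMat, h, Ne.symm h]
  rw [hbase, sub_mulVec, dotProduct_sub, Complex.sub_im, im_star_dotProduct_of_isHermitian hherm,
    zero_sub, neg_neg]
  simp only [dotProduct, Complex.re_sum, Complex.im_sum, Finset.mul_sum]
  refine Finset.sum_le_sum fun x _ => ?_
  rw [Matrix.mulVec_diagonal]
  have h1 : (star v x * v x) = (Complex.normSq (v x) : ℂ) := Complex.normSq_eq_conj_mul_self.symm
  have h2 : ∀ d : ℂ, star v x * (d * v x) = d * (Complex.normSq (v x) : ℂ) := fun d => by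
    rw [← h1]; ring
  rw [h1, h2]
  have h3 := Complex.normSq_nonneg (v x)
  rcases x with p | c
  · simp only [Sum.elim_inl, Complex.ofReal_re, Complex.im_mul_ofReal]
    exact mul_le_mul_of_nonneg_right hw h3
  · simp

end

end

end PastFuture

namespace PastFuture

/-! ### Symmetries of the Hankel pencil: phases and time reversal -/

section

open scoped Matrix.Norms.L2Operator Kronecker

set_option linter.unusedSectionVars false

variable {m : Type*} [Fintype m] [DecidableEq m] {L N : ℕ} {S : Matrix m m ℂ} {w : ℂ} {η : ℝ}

/-- The weight of an index under the gauge group. -/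
def gaugeWeight (L N : ℕ) (m : Type*) : ((Bool × Fin L) × m) ⊕ (Bool × Fin N) → ℤ :=
  Sum.elim (fun p => rowOffset p.1) fun c => -(c.2 : ℤ)

theorem star_zpow_of_norm_eq_one {u : ℂ} (hu : ‖u‖ = 1) (k : ℤ) : star (u ^ k) = u ^ (-k) := by
  have h1 : star u = u⁻¹ := by
    rw [Complex.inv_def, Complex.normSq_eq_norm_sq, hu]
    simp
  rw [star_zpow₀, h1, _root_.inv_zpow, _root_.zpow_neg]

/-- The Hankel entry in a row of offset o and column ν carries time o + ν, so its phase splits as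
u^o · u^ν. Weight o for rows and -ν for columns turns this into a unitary conjugation; the flip
block is unaffected because it preserves ν. -/
theorem hankelPencil_mat_phase {u : ℂ} (hu : ‖u‖ = 1) (Ξ : Fin (N + 2 * L - 1) → m → ℂ) :
    (hankelPencil L N S w η).mat (fun t j => u ^ (t : ℤ) * Ξ t j) =
      Matrix.diagonal (fun x => u ^ gaugeWeight L N m x) * (hankelPencil L N S w η).mat Ξ *
        (Matrix.diagonal (fun x => u ^ gaugeWeight L N m x))ᴴ := by
  have hu0 : u ≠ 0 := by
    rintro rfl
    simp at hu
  have hconj := star_zpow_of_norm_eq_one hu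
  have hext : ∀ t : ℕ, t < N + 2 * L - 1 → ∀ j,
      (S *ᵥ extendField (fun (t : Fin (N + 2 * L - 1)) j => u ^ (t : ℤ) * Ξ t j) t) j =
        u ^ (t : ℤ) * (S *ᵥ extendField Ξ t) j := by
    intro t ht j
    simp only [Matrix.mulVec, dotProduct, extendField, ht, dif_pos, Finset.mul_sum]
    refine Finset.sum_congr rfl fun i _ => ?_
    ring
  rw [Matrix.diagonal_conjTranspose]
  ext x y
  rw [Matrix.mul_diagonal, Matrix.diagonal_mul, hankelPencil_mat, hankelPencil_mat]
  simp only [Pi.star_apply, hconj]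
  rcases x with ⟨a, j⟩ | c <;> rcases y with ⟨a', j'⟩ | c'
  · by_cases h : (a, j) = (a', j')
    · rw [h]
      simp only [Matrix.fromBlocks_apply₁₁]
      rw [mul_comm (u ^ _), mul_assoc, ← zpow_add₀ hu0]
      simp
    · simp [h]
  · simp only [Matrix.fromBlocks_apply₁₂, bigW, Matrix.of_apply]
    by_cases h : c'.1 = a.1
    · rw [if_pos h, if_pos h, hext _ (rowOffset_add_lt a c'.2)]
      simp only [gaugeWeight, Sum.elim_inl, Sum.elim_inr, neg_neg]
      push_cast
      rw [zpow_add₀ hu0]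
      ring
    · simp [h]
  · simp only [Matrix.fromBlocks_apply₂₁, Matrix.conjTranspose_apply, bigW, Matrix.of_apply]
    by_cases h : c.1 = a'.1
    · rw [if_pos h, if_pos h, hext _ (rowOffset_add_lt a' c.2)]
      simp only [gaugeWeight, Sum.elim_inl, Sum.elim_inr, star_mul', hconj]
      push_cast
      rw [neg_add, zpow_add₀ hu0]
      ring
    · simp [h]
  · simp only [Matrix.fromBlocks_apply₂₂, Matrix.kroneckerMap_apply, Matrix.one_apply]
    by_cases h : c.2 = c'.2
    · simp only [gaugeWeight, Sum.elim_inr, h, if_true, neg_neg]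
      rw [mul_comm (u ^ _), mul_assoc, ← zpow_add₀ hu0]
      simp
    · simp [h]

/-- Entries of the mean resolvent between indices of different weights vanish. -/
theorem hankelPencil_meanRes_eq_zero (hη : 0 < η) (hw : η ≤ w.im)
    {x y : ((Bool × Fin L) × m) ⊕ (Bool × Fin N)}
    (hxy : gaugeWeight L N m x ≠ gaugeWeight L N m y) :
    (hankelPencil L N S w η).meanRes x y = 0 := by
  set k : ℤ := gaugeWeight L N m x - gaugeWeight L N m y with hk
  have hk0 : (k : ℂ) ≠ 0 := by
    rw [Int.cast_ne_zero]; exact sub_ne_zero.2 hxy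
  -- The phase is chosen with u^k = -1 for the weight difference k, so invariance forces the entry
  -- to equal its opposite.
  set u : ℂ := Complex.exp (((Real.pi / k : ℝ) : ℂ) * Complex.I) with hu
  have hu1 : ‖u‖ = 1 := Complex.norm_exp_ofReal_mul_I _
  have hu0 : u ≠ 0 := Complex.exp_ne_zero _
  have huk : u ^ k = -1 := by
    rw [hu, ← Complex.exp_int_mul, ← Complex.exp_pi_mul_I]
    congr 1
    push_cast
    field_simp
  have hphase := measurePreserving_phase (m := m) (K := N + 2 * L - 1) (fun t => u ^ (t : ℤ))
    fun t => by rw [norm_zpow, hu1, _root_.one_zpow]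
  have hconj := star_zpow_of_norm_eq_one hu1
  have hD : Matrix.diagonal (fun x => u ^ gaugeWeight L N m x) *
      (Matrix.diagonal (fun x => u ^ gaugeWeight L N m x))ᴴ = 1 := by
    rw [Matrix.diagonal_conjTranspose, Matrix.diagonal_mul_diagonal, ← Matrix.diagonal_one]
    congr 1
    ext x
    rw [Pi.star_apply, hconj, ← zpow_add₀ hu0]
    simp
  have h := Pencil.meanRes_eq_conj hη (dissipative_hankelPencil (S := S) (L := L) (N := N) hw)
    hphase hD (fun Ξ => hankelPencil_mat_phase hu1 Ξ)
  have h2 := congrFun (congrFun h x) y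
  rw [Matrix.diagonal_conjTranspose, Matrix.mul_diagonal, Matrix.diagonal_mul, Pi.star_apply,
    hconj, mul_comm (u ^ _), mul_assoc, ← zpow_add₀ hu0, ← sub_eq_add_neg, ← hk, huk] at h2
  have h3 : 2 * (hankelPencil L N S w η).meanRes x y = 0 := by linear_combination h2
  simpa using h3

/-- Time reversal of the indices. -/
def timeReversal (L N : ℕ) (m : Type*) :
    Equiv.Perm (((Bool × Fin L) × m) ⊕ (Bool × Fin N)) :=
  Equiv.sumCongr (Equiv.prodCongr (Equiv.prodCongr Equiv.boolNot Fin.revPerm) (Equiv.refl m))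
    (Equiv.prodCongr Equiv.boolNot Fin.revPerm)

/-- Time runs over 0, …, N + 2L - 2. Reversing it amounts to reversing the rows and the columns and
exchanging past and future. -/
theorem rowOffset_rev (a : Bool × Fin L) (ν : Fin N) :
    rowOffset (!a.1, Fin.rev a.2) + (Fin.rev ν : Fin N) =
      N + 2 * L - 1 - 1 - (rowOffset a + ν) := by
  obtain ⟨β, i⟩ := a
  have hi := i.2
  have hν := ν.2
  cases β <;> simp [rowOffset, Fin.val_rev] <;> omega

theorem bigW_timeReversal (Ξ : Fin (N + 2 * L - 1) → m → ℂ) (a : Bool × Fin L) (j : m)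
    (c : Bool × Fin N) :
    bigW L N (fun t => S *ᵥ extendField (fun t => Ξ (Fin.rev t)) t) (a, j) c =
      bigW L N (fun t => S *ᵥ extendField Ξ t) ((!a.1, Fin.rev a.2), j) (!c.1, Fin.rev c.2) := by
  have h : extendField (fun t => Ξ (Fin.rev t)) (rowOffset a + c.2) =
      extendField Ξ (rowOffset (!a.1, Fin.rev a.2) + (Fin.rev c.2 : Fin N)) := by
    rw [rowOffset_rev]
    have h1 := rowOffset_add_lt a c.2
    have h2 : N + 2 * L - 1 - 1 - (rowOffset a + c.2) < N + 2 * L - 1 := by omega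
    simp only [extendField, h1, h2, dif_pos]
    congr 1
    ext
    simp only [Fin.val_rev]
    omega
  simp only [bigW, Matrix.of_apply, h]
  by_cases hc : c.1 = a.1
  · rw [if_pos hc, if_pos (by rw [hc])]
  · rw [if_neg hc, if_neg (by simpa using hc)]

theorem hankelPencil_mat_rev (Ξ : Fin (N + 2 * L - 1) → m → ℂ) :
    (hankelPencil L N S w η).mat (fun t => Ξ (Fin.rev t)) =
      ((hankelPencil L N S w η).mat Ξ).submatrix (timeReversal L N m) (timeReversal L N m) := by
  ext x y
  rw [hankelPencil_mat, hankelPencil_mat]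
  rcases x with ⟨a, j⟩ | c <;> rcases y with ⟨a', j'⟩ | c'
  · simp [timeReversal, Matrix.one_apply, Prod.ext_iff]
  · simp only [Matrix.fromBlocks_apply₁₂, Matrix.submatrix_apply]
    exact bigW_timeReversal Ξ a j c'
  · simp only [Matrix.fromBlocks_apply₂₁, Matrix.submatrix_apply, Matrix.conjTranspose_apply]
    exact congrArg star (bigW_timeReversal Ξ a' j' c)
  · simp [timeReversal, Matrix.one_apply, flipMat]

theorem hankelPencil_meanRes_timeReversal (hη : 0 < η) (hw : η ≤ w.im)
    (x y : ((Bool × Fin L) × m) ⊕ (Bool × Fin N)) :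
    (hankelPencil L N S w η).meanRes (timeReversal L N m x) (timeReversal L N m y) =
      (hankelPencil L N S w η).meanRes x y := by
  set P : Matrix (((Bool × Fin L) × m) ⊕ (Bool × Fin N)) (((Bool × Fin L) × m) ⊕ (Bool × Fin N)) ℂ :=
    (timeReversal L N m).toPEquiv.toMatrix with hP
  have hPsub : ∀ Y : Matrix _ _ ℂ, P * Y * Pᴴ =
      Y.submatrix (timeReversal L N m) (timeReversal L N m) := by
    intro Y
    have h1 : Pᴴ = (timeReversal L N m).symm.toPEquiv.toMatrix := by
      ext i j
      simp only [hP, Matrix.conjTranspose_apply, PEquiv.toMatrix_apply, Equiv.toPEquiv_apply,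
        Option.mem_some_iff]
      by_cases h : (timeReversal L N m) j = i
      · rw [if_pos h, if_pos (by rw [← h, Equiv.symm_apply_apply]), star_one]
      · rw [if_neg h, if_neg (fun h' => h (by rw [← h', Equiv.apply_symm_apply])), star_zero]
    rw [h1, hP, PEquiv.toMatrix_toPEquiv_mul, PEquiv.mul_toMatrix_toPEquiv]
    rfl
  have hD : P * Pᴴ = 1 := by
    have := hPsub 1
    rwa [Matrix.mul_one, Matrix.submatrix_one_equiv] at this
  have h := Pencil.meanRes_eq_conj hη (dissipative_hankelPencil (S := S) (L := L) (N := N) hw)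
    measurePreserving_comp_rev hD (fun Ξ => by rw [hPsub]; exact hankelPencil_mat_rev Ξ)
  rw [hPsub] at h
  exact (congrFun (congrFun h x) y).symm

end

end PastFuture

namespace PastFuture

/-! ### The self-energy at the mean resolvent -/

section

open scoped Matrix.Norms.L2Operator Kronecker

set_option linter.unusedSectionVars false

variable {m : Type*} [Fintype m] [DecidableEq m] {L N : ℕ} {S : Matrix m m ℂ} {w : ℂ} {η : ℝ}

/-- A diagonal block of a matrix, associated with a block row. -/
def rowBlock {L N : ℕ} (a : Bool × Fin L)
    (Y : Matrix (((Bool × Fin L) × m) ⊕ (Bool × Fin N)) (((Bool × Fin L) × m) ⊕ (Bool × Fin N)) ℂ) :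
    Matrix m m ℂ :=
  Y.submatrix (fun j => Sum.inl (a, j)) fun j => Sum.inl (a, j)

theorem hankelPencil_mul_conjTranspose_U_apply {l : Type*} (a : Bool × Fin L) (C : Matrix l m ℂ)
    (x y) : (C * ((hankelPencil L N S w η).U a)ᴴ) x y =
      Sum.elim (fun p : (Bool × Fin L) × m => if p.1 = a then C x p.2 else 0) (fun _ => 0) y := by
  have h : C * ((hankelPencil L N S w η).U a)ᴴ = ((hankelPencil L N S w η).U a * Cᴴ)ᴴ := by
    rw [Matrix.conjTranspose_mul, Matrix.conjTranspose_conjTranspose]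
  rw [h, Matrix.conjTranspose_apply, hankelPencil_U_mul_apply]
  rcases y with ⟨b, j⟩ | c
  · by_cases hb : b = a <;> simp [hb]
  · simp

theorem hankelPencil_conjTranspose_U_mul_mul (a b : Bool × Fin L)
    (Y : Matrix (((Bool × Fin L) × m) ⊕ (Bool × Fin N))
      (((Bool × Fin L) × m) ⊕ (Bool × Fin N)) ℂ) :
    ((hankelPencil L N S w η).U a)ᴴ * Y * (hankelPencil L N S w η).U b =
      Y.submatrix (fun j => Sum.inl (a, j)) fun j => Sum.inl (b, j) := by
  ext i j
  rw [Matrix.mul_apply, Matrix.submatrix_apply, Finset.sum_eq_single (Sum.inl (b, j))]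
  · rw [Matrix.mul_apply, Finset.sum_eq_single (Sum.inl (a, i))]
    · simp [hankelPencil]
    · intro x _ hx
      simp [hankelPencil, hx]
    · simp
  · intro x _ hx
    simp [hankelPencil, hx]
  · simp

theorem norm_rowBlock_le (a : Bool × Fin L)
    (Y : Matrix (((Bool × Fin L) × m) ⊕ (Bool × Fin N))
      (((Bool × Fin L) × m) ⊕ (Bool × Fin N)) ℂ) : ‖rowBlock a Y‖ ≤ ‖Y‖ := by
  have h := hankelPencil_conjTranspose_U_mul_mul (S := (0 : Matrix m m ℂ)) (w := 0) (η := 0) a a Y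
  rw [rowBlock, ← h]
  have hU := norm_hankelPencil_U_le (N := N) (S := (0 : Matrix m m ℂ)) (w := 0) (η := 0) a
  refine (Matrix.l2_opNorm_mul _ _).trans ?_
  calc _ ≤ ‖Y‖ * 1 := by
        refine mul_le_mul ((Matrix.l2_opNorm_mul _ _).trans ?_) hU (norm_nonneg _) (norm_nonneg _)
        rw [Matrix.l2_opNorm_conjTranspose]
        exact mul_le_of_le_one_left (norm_nonneg _) hU
    _ = ‖Y‖ := mul_one _

theorem trace_hankelPencil_U_mul (a b : Bool × Fin L) (B : Matrix m m ℂ)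
    (Y : Matrix (((Bool × Fin L) × m) ⊕ (Bool × Fin N))
      (((Bool × Fin L) × m) ⊕ (Bool × Fin N)) ℂ) :
    ((hankelPencil L N S w η).U b * B * ((hankelPencil L N S w η).U a)ᴴ * Y).trace =
      (B * Y.submatrix (fun j => Sum.inl (a, j)) fun j => Sum.inl (b, j)).trace := by
  rw [← hankelPencil_conjTranspose_U_mul_mul (S := S) (w := w) (η := η) a b Y]
  have := Matrix.trace_mul_comm ((hankelPencil L N S w η).U b)
    (B * ((hankelPencil L N S w η).U a)ᴴ * Y)
  simp only [Matrix.mul_assoc] at this ⊢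
  exact this

/-- The normalized trace of the mean resolvent over one family of columns. -/
noncomputable def meanKappa (L N : ℕ) (S : Matrix m m ℂ) (w : ℂ) (η : ℝ) : ℂ :=
  (N : ℂ)⁻¹ * ∑ ν : Fin N,
    (hankelPencil L N S w η).meanRes (Sum.inr (true, ν)) (Sum.inr (true, ν))

/-- The normalized weighted trace of the mean resolvent over one family of rows. -/
noncomputable def meanTau (L N : ℕ) (S : Matrix m m ℂ) (w : ℂ) (η : ℝ) : ℂ :=
  (N : ℂ)⁻¹ * ∑ i : Fin L,
    (S * Sᴴ * rowBlock (true, i) (hankelPencil L N S w η).meanRes).trace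

/-- Time reversal identifies the two families of columns, so a single scalar describes both. -/
theorem sum_meanRes_column (hη : 0 < η) (hw : η ≤ w.im) (hN : 0 < N) (β : Bool) :
    ∑ ν : Fin N, (hankelPencil L N S w η).meanRes (Sum.inr (β, ν)) (Sum.inr (β, ν)) =
      N * meanKappa L N S w η := by
  have hN' : (N : ℂ) ≠ 0 := by exact_mod_cast hN.ne'
  rw [meanKappa, mul_inv_cancel_left₀ hN']
  cases β
  · rw [← Equiv.sum_comp Fin.revPerm]
    refine Finset.sum_congr rfl fun ν _ => ?_
    exact hankelPencil_meanRes_timeReversal hη hw (Sum.inr (true, ν)) (Sum.inr (true, ν))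
  · rfl

theorem sum_meanRes_row (hη : 0 < η) (hw : η ≤ w.im) (hN : 0 < N) (β : Bool) :
    ∑ i : Fin L, (S * Sᴴ * rowBlock (β, i) (hankelPencil L N S w η).meanRes).trace =
      N * meanTau L N S w η := by
  have hN' : (N : ℂ) ≠ 0 := by exact_mod_cast hN.ne'
  rw [meanTau, mul_inv_cancel_left₀ hN']
  cases β
  · rw [← Equiv.sum_comp Fin.revPerm]
    refine Finset.sum_congr rfl fun i _ => ?_
    congr 2
    ext j j'
    exact hankelPencil_meanRes_timeReversal hη hw (Sum.inl ((true, i), j))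
      (Sum.inl ((true, i), j'))
  · rfl

/-- The shift matrix pairs columns whose indices differ by the difference of the offsets of a and b,
whereas the mean resolvent vanishes between columns of different weights. Only equal offsets, that
is a = b, contribute: here the Hankel correlations disappear. -/
theorem hankelPencil_trace_V (hη : 0 < η) (hw : η ≤ w.im) (hN : 0 < N) (a b : Bool × Fin L) :
    (((hankelPencil L N S w η).V b)ᴴ * (hankelPencil L N S w η).V a *
      (hankelPencil L N S w η).meanRes).trace =
      if a = b then N * meanKappa L N S w η else 0 := by
  have hterm : ∀ x y, (((hankelPencil L N S w η).V b)ᴴ * (hankelPencil L N S w η).V a) x y *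
      (hankelPencil L N S w η).meanRes y x =
      if a = b ∧ x = y then Sum.elim (fun _ => 0) (fun c : Bool × Fin N => if c.1 = a.1 then
        (hankelPencil L N S w η).meanRes x x else 0) x else 0 := by
    intro x y
    rw [conjTranspose_hankelPencil_V_mul]
    rcases x with p | c
    · simp
    rcases y with p | c'
    · simp
    simp only [Sum.elim_inr, Sum.inr.injEq]
    by_cases h2 : c.2 = c'.2
    · by_cases h1 : a = b
      · subst h1
        by_cases h3 : c.1 = a.1
        · by_cases h4 : c'.1 = a.1
          · have : c = c' := Prod.ext (h3.trans h4.symm) h2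
            subst this
            simp [h3]
          · have : c ≠ c' := fun h => h4 (h ▸ h3)
            simp [h4, this]
        · simp [h3]
      · rw [if_neg (show ¬(a = b ∧ c = c') from fun h => h1 h.1), if_neg, zero_mul]
        rintro ⟨_, _, h⟩
        rw [h2, add_left_inj] at h
        exact h1 (rowOffset_injective h.symm)
    · rw [hankelPencil_meanRes_eq_zero hη hw, mul_zero, if_neg (fun h => h2 (by rw [h.2]))]
      simp only [gaugeWeight, Sum.elim_inr, ne_eq, neg_inj, Nat.cast_inj]
      exact fun h => h2 (Fin.ext h.symm)
  rw [Matrix.trace]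
  simp_rw [Matrix.diag_apply, Matrix.mul_apply (M := _ * _), hterm]
  by_cases h : a = b
  · subst h
    simp only [true_and, Finset.sum_ite_eq, Finset.mem_univ, if_true]
    rw [Fintype.sum_sum_type, ← sum_meanRes_column hη hw hN a.1]
    simp only [Sum.elim_inl, Finset.sum_const_zero, zero_add, Sum.elim_inr,
      Fintype.sum_prod_type]
    rw [Finset.sum_eq_single a.1]
    · simp
    · intro β _ hβ
      simp [hβ]
    · simp
  · simp [h]

theorem hankelPencil_trace_U (hη : 0 < η) (hw : η ≤ w.im) (B : Matrix m m ℂ)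
    (a b : Bool × Fin L) :
    ((hankelPencil L N S w η).U b * B * ((hankelPencil L N S w η).U a)ᴴ *
      (hankelPencil L N S w η).meanRes).trace =
      if a = b then (B * rowBlock a (hankelPencil L N S w η).meanRes).trace else 0 := by
  rw [trace_hankelPencil_U_mul]
  by_cases h : a = b
  · subst h; simp [rowBlock]
  · rw [if_neg h]
    have : (hankelPencil L N S w η).meanRes.submatrix (fun j => Sum.inl (a, j))
        (fun j => Sum.inl (b, j)) = (0 : Matrix m m ℂ) := by
      ext i j
      refine hankelPencil_meanRes_eq_zero hη hw ?_
      simp only [gaugeWeight, Sum.elim_inl, ne_eq, Nat.cast_inj]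
      exact fun h' => h (rowOffset_injective h')
    rw [this, Matrix.mul_zero, Matrix.trace_zero]

/-- Gauge invariance removes the terms with a ≠ b, and time reversal makes the remaining
coefficients equal for past and future, so two scalars are left. -/
theorem hankelPencil_selfEnergy (hη : 0 < η) (hw : η ≤ w.im) (hN : 0 < N) :
    (hankelPencil L N S w η).selfEnergy (hankelPencil L N S w η).meanRes =
      Matrix.fromBlocks (1 ⊗ₖ (meanKappa L N S w η • (S * Sᴴ))) 0 0
        (meanTau L N S w η • 1) := by
  have hN' : (N : ℂ) ≠ 0 := by exact_mod_cast hN.ne'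
  unfold Pencil.selfEnergy
  simp_rw [hankelPencil_trace_V hη hw hN, hankelPencil_trace_U hη hw, hankelPencil_S_mul hN,
    ite_smul, zero_smul, Finset.sum_add_distrib, Finset.sum_ite_eq, Finset.mem_univ, if_true]
  ext x y
  rw [Matrix.add_apply, Matrix.sum_apply, Matrix.sum_apply]
  simp_rw [Matrix.smul_apply, conjTranspose_hankelPencil_V_mul, Matrix.mul_assoc,
    hankelPencil_U_mul_apply]
  rcases x with ⟨a, j⟩ | c
  · simp only [Sum.elim_inl, smul_zero, Finset.sum_const_zero, add_zero, smul_ite]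
    rw [Finset.sum_ite_eq, if_pos (Finset.mem_univ _), hankelPencil_mul_conjTranspose_U_apply]
    rcases y with ⟨a', j'⟩ | c'
    · simp only [Sum.elim_inl, Matrix.fromBlocks_apply₁₁, Matrix.kroneckerMap_apply,
        Matrix.one_apply, Matrix.smul_apply, smul_eq_mul]
      by_cases h : a = a'
      · subst h
        simp only [if_true, one_mul]
        field_simp
      · simp [h, Ne.symm h]
    · simp
  · simp only [Sum.elim_inr, smul_zero, Finset.sum_const_zero, zero_add]
    rcases y with p | c'
    · simp
    · simp only [Sum.elim_inr, Matrix.fromBlocks_apply₂₂, Matrix.smul_apply, Matrix.one_apply,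
        add_right_inj, smul_eq_mul, mul_ite, mul_one, mul_zero]
      by_cases h : c = c'
      · subst h
        rw [if_pos rfl, Fintype.sum_prod_type, Finset.sum_eq_single c.1]
        · have h1 := sum_meanRes_row (S := S) (L := L) hη hw hN c.1
          simp only [and_self, if_true, Matrix.smul_mul, Matrix.trace_smul,
            smul_eq_mul, ← Finset.mul_sum]
          rw [h1, inv_mul_cancel_left₀ hN']
        · intro β _ hβ
          simp [Ne.symm hβ]
        · simp
      · rw [if_neg h]
        refine Finset.sum_eq_zero fun a _ => if_neg ?_
        rintro ⟨h1, h2, h3⟩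
        exact h (Prod.ext (h1.trans h2.symm) (Fin.ext h3))

end

end PastFuture

namespace PastFuture

/-! ### Solving the Dyson equation of the Hankel pencil -/

section

open scoped Matrix.Norms.L2Operator Kronecker

set_option linter.unusedSectionVars false

section

variable {m : Type*} [Fintype m] [DecidableEq m]

/-- The resolvent-like matrix `(-w - κ R)⁻¹`. -/
noncomputable def ratInv (R : Matrix m m ℂ) (w κ : ℂ) : Matrix m m ℂ :=
  (-(w • (1 : Matrix m m ℂ)) - κ • R)⁻¹

theorem star_dotProduct_self_eq (v : m → ℂ) :
    star v ⬝ᵥ v = ((‖(WithLp.toLp 2 v : EuclideanSpace ℂ m)‖ ^ 2 : ℝ) : ℂ) := by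
  rw [star_dotProduct_eq_inner, inner_self_eq_norm_sq_to_K]
  push_cast
  rfl

theorem imNonneg_smul_mul_conjTranspose {l : Type*} [Fintype l] [DecidableEq l] {κ : ℂ}
    (hκ : 0 ≤ κ.im) (S : Matrix m l ℂ) : ImNonneg (κ • (S * Sᴴ)) := by
  have h1 : ImNonneg (κ • (1 : Matrix l l ℂ)) := by
    intro v
    rw [smul_mulVec, one_mulVec, dotProduct_smul, smul_eq_mul, star_dotProduct_self_eq,
      Complex.im_mul_ofReal]
    positivity
  have h2 := h1.conj S
  rwa [Matrix.mul_smul, Matrix.mul_one, Matrix.smul_mul] at h2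

theorem dissipative_neg_smul_one (w : ℂ) : Dissipative w.im (-(w • (1 : Matrix m m ℂ))) := by
  intro v
  rw [neg_mulVec, smul_mulVec, one_mulVec, dotProduct_neg, dotProduct_smul, smul_eq_mul,
    star_dotProduct_self_eq, Complex.neg_im, neg_neg, Complex.im_mul_ofReal, Complex.ofReal_re]

theorem dissipative_rat {w κ : ℂ} (hκ : 0 ≤ κ.im) (S : Matrix m m ℂ) :
    Dissipative w.im (-(w • (1 : Matrix m m ℂ)) - κ • (S * Sᴴ)) :=
  (dissipative_neg_smul_one w).sub (imNonneg_smul_mul_conjTranspose hκ S)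

/-- Resolvent identity; both inverses are bounded by 1/Im w because κ and κ' lie in the closed upper
half-plane. -/
theorem norm_ratInv_sub_le {w κ κ' : ℂ} (hw : 0 < w.im) (hκ : 0 ≤ κ.im) (hκ' : 0 ≤ κ'.im)
    (S : Matrix m m ℂ) {b : ℝ} (hb : ‖S * Sᴴ‖ ≤ b) :
    ‖ratInv (S * Sᴴ) w κ - ratInv (S * Sᴴ) w κ'‖ ≤ w.im⁻¹ ^ 2 * b * ‖κ - κ'‖ := by
  have h1 := dissipative_rat (w := w) hκ S
  have h2 := dissipative_rat (w := w) hκ' S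
  unfold ratInv
  rw [inv_sub_inv_eq_mul (h1.isUnit_det hw) (h2.isUnit_det hw)]
  have e : -(w • (1 : Matrix m m ℂ)) - κ' • (S * Sᴴ) - (-(w • (1 : Matrix m m ℂ)) - κ • (S * Sᴴ)) =
      (κ - κ') • (S * Sᴴ) := by
    rw [sub_smul]; abel
  rw [e]
  calc _ ≤ w.im⁻¹ * (‖κ - κ'‖ * b) * w.im⁻¹ := by
        refine (norm_mul_le _ _).trans ?_
        refine mul_le_mul ((norm_mul_le _ _).trans ?_) (h2.norm_inv_le hw) (norm_nonneg _)
          (by have := (norm_nonneg _).trans hb; positivity)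
        refine mul_le_mul (h1.norm_inv_le hw) ?_ (norm_nonneg _) (by positivity)
        rw [norm_smul]
        exact mul_le_mul_of_nonneg_left hb (norm_nonneg _)
    _ = _ := by ring

theorem ratInv_spectral {R V : Matrix m m ℂ} {lam : m → ℝ} (hV : V * Vᴴ = 1)
    (hR : R = V * Matrix.diagonal (fun k => (lam k : ℂ)) * Vᴴ) (hl : ∀ k, 0 ≤ lam k) {w κ : ℂ}
    (hw : 0 < w.im) (hκ : 0 ≤ κ.im) :
    ratInv R w κ = V * Matrix.diagonal (fun k => (-w - κ * lam k)⁻¹) * Vᴴ := by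
  have hV' : Vᴴ * V = 1 := mul_eq_one_comm.1 hV
  have e : -(w • (1 : Matrix m m ℂ)) - κ • R =
      V * Matrix.diagonal (fun k => -w - κ * lam k) * Vᴴ := by
    have h1 : Matrix.diagonal (fun k => -w - κ * lam k) =
        -(w • (1 : Matrix m m ℂ)) - κ • Matrix.diagonal (fun k => (lam k : ℂ)) := by
      rw [Matrix.smul_one_eq_diagonal, ← Matrix.diagonal_smul, Matrix.diagonal_neg,
        Matrix.diagonal_sub]
      rfl
    rw [h1, mul_sub, sub_mul, mul_neg, neg_mul, Matrix.mul_smul, Matrix.smul_mul, Matrix.mul_one,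
      hV, Matrix.mul_smul, Matrix.smul_mul, ← hR]
  unfold ratInv
  rw [e]
  refine Matrix.inv_eq_right_inv ?_
  calc V * Matrix.diagonal (fun k => -w - κ * lam k) * Vᴴ *
        (V * Matrix.diagonal (fun k => (-w - κ * lam k)⁻¹) * Vᴴ)
      = V * Matrix.diagonal (fun k => -w - κ * lam k) * (Vᴴ * V) *
        Matrix.diagonal (fun k => (-w - κ * lam k)⁻¹) * Vᴴ := by simp only [Matrix.mul_assoc]
    _ = V * (Matrix.diagonal (fun k => -w - κ * lam k) *
        Matrix.diagonal (fun k => (-w - κ * lam k)⁻¹)) * Vᴴ := by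
        rw [hV', Matrix.mul_one, Matrix.mul_assoc V]
    _ = 1 := by
        rw [Matrix.diagonal_mul_diagonal]
        have : (fun k => (-w - κ * lam k) * (-w - κ * lam k)⁻¹) = fun _ => (1 : ℂ) := by
          ext k
          exact mul_inv_cancel₀ (neg_sub_mul_ne_zero hw hκ (hl k))
        rw [this, Matrix.diagonal_one, Matrix.mul_one, hV]

theorem trace_mul_ratInv {R V : Matrix m m ℂ} {lam : m → ℝ} (hV : V * Vᴴ = 1)
    (hR : R = V * Matrix.diagonal (fun k => (lam k : ℂ)) * Vᴴ) (hl : ∀ k, 0 ≤ lam k) {w κ : ℂ}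
    (hw : 0 < w.im) (hκ : 0 ≤ κ.im) :
    (R * ratInv R w κ).trace = ∑ k, (lam k : ℂ) / (-w - κ * lam k) := by
  have hV' : Vᴴ * V = 1 := mul_eq_one_comm.1 hV
  rw [ratInv_spectral hV hR hl hw hκ]
  nth_rw 1 [hR]
  have e : V * Matrix.diagonal (fun k => (lam k : ℂ)) * Vᴴ *
      (V * Matrix.diagonal (fun k => (-w - κ * lam k)⁻¹) * Vᴴ) =
      V * (Matrix.diagonal (fun k => (lam k : ℂ)) *
        Matrix.diagonal (fun k => (-w - κ * lam k)⁻¹)) * Vᴴ := by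
    calc _ = V * Matrix.diagonal (fun k => (lam k : ℂ)) * (Vᴴ * V) *
          Matrix.diagonal (fun k => (-w - κ * lam k)⁻¹) * Vᴴ := by simp only [Matrix.mul_assoc]
      _ = _ := by rw [hV', Matrix.mul_one, Matrix.mul_assoc V]
  rw [e, Matrix.diagonal_mul_diagonal, Matrix.trace_mul_comm, ← Matrix.mul_assoc, hV',
    Matrix.one_mul, Matrix.trace_diagonal]
  rfl

end

variable {m : Type*} [Fintype m] [DecidableEq m] {L N : ℕ} {S : Matrix m m ℂ} {w : ℂ} {η : ℝ}

theorem meanKappa_im_nonneg (hη : 0 < η) (hw : η ≤ w.im) : 0 ≤ (meanKappa L N S w η).im := by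
  have h := Pencil.imNonneg_meanRes hη (dissipative_hankelPencil (S := S) (L := L) (N := N) hw)
  rw [meanKappa, ← Complex.ofReal_natCast, ← Complex.ofReal_inv, Complex.im_ofReal_mul,
    Complex.im_sum]
  refine mul_nonneg (by positivity) (Finset.sum_nonneg fun ν _ => ?_)
  have := h (Pi.single (Sum.inr (true, ν)) 1)
  rwa [mulVec_single_one, ← Pi.single_star, star_one, single_one_dotProduct] at this

theorem meanTau_im_nonneg (hη : 0 < η) (hw : η ≤ w.im) : 0 ≤ (meanTau L N S w η).im := by
  have h := Pencil.imNonneg_meanRes hη (dissipative_hankelPencil (S := S) (L := L) (N := N) hw)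
  rw [meanTau, ← Complex.ofReal_natCast, ← Complex.ofReal_inv, Complex.im_ofReal_mul,
    Complex.im_sum]
  refine mul_nonneg (by positivity) (Finset.sum_nonneg fun i _ => ?_)
  have h1 := (h.conj ((hankelPencil L N S w η).U (true, i))ᴴ).conj Sᴴ
  rw [Matrix.conjTranspose_conjTranspose, Matrix.conjTranspose_conjTranspose,
    hankelPencil_conjTranspose_U_mul_mul] at h1
  have h2 := h1.trace
  rwa [Matrix.trace_mul_comm, ← Matrix.mul_assoc] at h2

/-- After the self-energy is subtracted, the row part is -w - κSS^* in every block and the column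
part is the flip with parameter s = iη + τ. Its inverse has h(s) on the diagonal, which is where the
function h comes from. -/
theorem hankelPencil_dyson_inv (hη : 0 < η) (hw : η ≤ w.im) (hN : 0 < N) :
    ((hankelPencil L N S w η).base -
      (hankelPencil L N S w η).selfEnergy (hankelPencil L N S w η).meanRes)⁻¹ =
      Matrix.fromBlocks (1 ⊗ₖ ratInv (S * Sᴴ) w (meanKappa L N S w η)) 0 0
        (flipInv (Complex.I * η + meanTau L N S w η) ⊗ₖ 1) := by
  have hτ := meanTau_im_nonneg (L := L) (N := N) (S := S) hη hw
  have hκ := meanKappa_im_nonneg (L := L) (N := N) (S := S) hη hw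
  have hs : 0 < (Complex.I * η + meanTau L N S w η).im := by
    simp only [Complex.add_im, Complex.mul_im, Complex.I_re, Complex.I_im, Complex.ofReal_re,
      Complex.ofReal_im]
    linarith
  have hw0 : 0 < w.im := hη.trans_le hw
  have e : (hankelPencil L N S w η).base -
      (hankelPencil L N S w η).selfEnergy (hankelPencil L N S w η).meanRes =
      Matrix.fromBlocks ((1 : Matrix (Bool × Fin L) (Bool × Fin L) ℂ) ⊗ₖ
        (-(w • 1) - meanKappa L N S w η • (S * Sᴴ))) 0 0
        (flipMat (Complex.I * η + meanTau L N S w η) ⊗ₖ 1) := by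
    rw [hankelPencil_selfEnergy hη hw hN]
    ext x y
    rcases x with ⟨a, j⟩ | c <;> rcases y with ⟨a', j'⟩ | c'
    · simp only [hankelPencil, Matrix.sub_apply, Matrix.fromBlocks_apply₁₁,
        Matrix.kroneckerMap_apply, Matrix.one_apply, Matrix.neg_apply, Matrix.smul_apply,
        Prod.mk.injEq, smul_eq_mul]
      by_cases h1 : a = a' <;> by_cases h2 : j = j' <;> simp [h1, h2]
    · simp [hankelPencil]
    · simp [hankelPencil]
    · simp only [hankelPencil, Matrix.sub_apply, Matrix.fromBlocks_apply₂₂,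
        Matrix.kroneckerMap_apply, Matrix.one_apply, Matrix.smul_apply, flipMat, Matrix.of_apply,
        smul_eq_mul]
      by_cases h1 : c.1 = c'.1 <;> by_cases h2 : c.2 = c'.2 <;> simp [h1, h2, Prod.ext_iff]
      ring
  rw [e]
  refine Matrix.inv_eq_right_inv ?_
  rw [Matrix.fromBlocks_multiply, ← Matrix.mul_kronecker_mul, ← Matrix.mul_kronecker_mul,
    flipMat_mul_flipInv hs, ratInv,
    Matrix.mul_nonsing_inv _ ((dissipative_rat hκ S).isUnit_det hw0)]
  simp

/-- The mean resolvent, compared with the solution of its Dyson equation. -/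
theorem hankelPencil_meanRes_estimates (hη : 0 < η) (hw : η ≤ w.im) (hN : 0 < N) (hL : 0 < L)
    {b δ : ℝ} (hb : ‖S * Sᴴ‖ ≤ b)
    (hδ : ‖(hankelPencil L N S w η).meanRes - ((hankelPencil L N S w η).base -
      (hankelPencil L N S w η).selfEnergy (hankelPencil L N S w η).meanRes)⁻¹‖ ≤ δ) :
    ‖meanKappa L N S w η - hFun (Complex.I * η + meanTau L N S w η)‖ ≤ δ ∧
    ‖meanTau L N S w η - ((L / N : ℝ) : ℂ) *
      (S * Sᴴ * ratInv (S * Sᴴ) w (meanKappa L N S w η)).trace‖ ≤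
        L / N * (Fintype.card m * (b * δ)) ∧
    ∀ B : Matrix m m ℂ, ‖(L : ℂ)⁻¹ * ∑ i : Fin L,
      (B * rowBlock (true, i) (hankelPencil L N S w η).meanRes).trace -
        (B * ratInv (S * Sᴴ) w (meanKappa L N S w η)).trace‖ ≤
        Fintype.card m * (‖B‖ * δ) := by
  set T := ((hankelPencil L N S w η).base -
      (hankelPencil L N S w η).selfEnergy (hankelPencil L N S w η).meanRes)⁻¹ with hTdef
  have hT := hankelPencil_dyson_inv (L := L) (S := S) hη hw hN
  rw [← hTdef] at hT
  set Y := (hankelPencil L N S w η).meanRes with hY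
  have hN' : (0 : ℝ) < N := by exact_mod_cast hN
  have hL' : (0 : ℝ) < L := by exact_mod_cast hL
  have hN'' : (N : ℂ) ≠ 0 := by exact_mod_cast hN.ne'
  have hL'' : (L : ℂ) ≠ 0 := by exact_mod_cast hL.ne'
  have hb0 : 0 ≤ b := (norm_nonneg _).trans hb
  have hδ0 : 0 ≤ δ := (norm_nonneg _).trans hδ
  have hrow : ∀ i, rowBlock (true, i) T = ratInv (S * Sᴴ) w (meanKappa L N S w η) := by
    intro i
    rw [hT]
    ext j j'
    simp [rowBlock, Matrix.kroneckerMap_apply]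
  have htr : ∀ (B : Matrix m m ℂ) i, ‖(B * rowBlock (true, i) Y).trace -
      (B * ratInv (S * Sᴴ) w (meanKappa L N S w η)).trace‖ ≤ Fintype.card m * (‖B‖ * δ) := by
    intro B i
    rw [← hrow i, ← Matrix.trace_sub, ← mul_sub]
    refine (norm_trace_le _).trans (mul_le_mul_of_nonneg_left ?_ (by positivity))
    refine (norm_mul_le _ _).trans (mul_le_mul_of_nonneg_left ?_ (norm_nonneg _))
    have : rowBlock (true, i) Y - rowBlock (true, i) T = rowBlock (true, i) (Y - T) := rfl
    rw [this]
    exact (norm_rowBlock_le _ _).trans hδ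
  have hsum : ∀ B : Matrix m m ℂ, ‖∑ i : Fin L, (B * rowBlock (true, i) Y).trace -
      L * (B * ratInv (S * Sᴴ) w (meanKappa L N S w η)).trace‖ ≤
        L * (Fintype.card m * (‖B‖ * δ)) := by
    intro B
    have e : (L : ℂ) * (B * ratInv (S * Sᴴ) w (meanKappa L N S w η)).trace =
        ∑ i : Fin L, (B * ratInv (S * Sᴴ) w (meanKappa L N S w η)).trace := by simp
    rw [e, ← Finset.sum_sub_distrib]
    refine (norm_sum_le _ _).trans ?_
    refine (Finset.sum_le_sum fun i _ => htr B i).trans_eq ?_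
    simp
  -- The closeness of the mean resolvent to the Dyson solution is read off on the diagonal entries
  -- of the columns, then on the row blocks weighted by SS^*, then on the row blocks against any B.
  refine ⟨?_, ?_, fun B => ?_⟩
  · have hdiag : ∀ ν : Fin N, T (Sum.inr (true, ν)) (Sum.inr (true, ν)) =
        hFun (Complex.I * η + meanTau L N S w η) := by
      intro ν
      rw [hT]
      simp [flipInv]
    have e : meanKappa L N S w η - hFun (Complex.I * η + meanTau L N S w η) =
        (N : ℂ)⁻¹ * ∑ ν : Fin N, (Y - T) (Sum.inr (true, ν)) (Sum.inr (true, ν)) := by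
      simp_rw [Matrix.sub_apply, hdiag, Finset.sum_sub_distrib]
      rw [meanKappa, mul_sub]
      simp [hN'', ← hY]
    rw [e, norm_mul, norm_inv, Complex.norm_natCast, inv_mul_le_iff₀ hN']
    refine (norm_sum_le _ _).trans ?_
    refine (Finset.sum_le_sum fun ν _ => (norm_apply_le (Y - T) _).trans hδ).trans_eq ?_
    simp
  · have e : meanTau L N S w η - ((L / N : ℝ) : ℂ) *
        (S * Sᴴ * ratInv (S * Sᴴ) w (meanKappa L N S w η)).trace =
        (N : ℂ)⁻¹ * (∑ i : Fin L, (S * Sᴴ * rowBlock (true, i) Y).trace -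
          L * (S * Sᴴ * ratInv (S * Sᴴ) w (meanKappa L N S w η)).trace) := by
      rw [meanTau]
      push_cast
      ring
    rw [e, norm_mul, norm_inv, Complex.norm_natCast, inv_mul_le_iff₀ hN']
    refine (hsum _).trans ?_
    have : (N : ℝ) * (L / N * (Fintype.card m * (b * δ))) = L * (Fintype.card m * (b * δ)) := by
      field_simp
    rw [this]
    gcongr
  · have e : (L : ℂ)⁻¹ * ∑ i : Fin L, (B * rowBlock (true, i) Y).trace -
        (B * ratInv (S * Sᴴ) w (meanKappa L N S w η)).trace =
        (L : ℂ)⁻¹ * (∑ i : Fin L, (B * rowBlock (true, i) Y).trace -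
          L * (B * ratInv (S * Sᴴ) w (meanKappa L N S w η)).trace) := by
      rw [mul_sub, inv_mul_cancel_left₀ hL'']
    rw [e, norm_mul, norm_inv, Complex.norm_natCast, inv_mul_le_iff₀ hL']
    exact hsum B

end

end PastFuture

namespace PastFuture

section

open scoped Matrix.Norms.L2Operator Kronecker

set_option linter.unusedSectionVars false

/-! ### Removal of the regularization -/

/-- A Schur test: the bilinear sum over columns is split by 2xy ≤ x² + y², and the row and column
sums of E absorb the rest. Only the sum of the squared entries of W enters, whose expectation is
immediate, instead of its operator norm. -/
theorem norm_trace_mul_conj_le {p q : Type*} [Fintype p] [DecidableEq p] [Fintype q]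
    (C : Matrix p p ℂ) (W : Matrix p q ℂ) (E : Matrix q q ℂ) {ε : ℝ}
    (h1 : ∀ c, ∑ c', ‖E c c'‖ ≤ ε) (h2 : ∀ c', ∑ c, ‖E c c'‖ ≤ ε) :
    ‖(C * (W * E * Wᴴ)).trace‖ ≤ ‖C‖ * (ε * ∑ c, ∑ x, ‖W x c‖ ^ 2) := by
  let nv : q → ℝ := fun c => ‖(WithLp.toLp 2 (fun x => W x c) : EuclideanSpace ℂ p)‖
  have hnv : ∀ c, nv c ^ 2 = ∑ x, ‖W x c‖ ^ 2 := fun c => EuclideanSpace.norm_sq_eq _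
  have e : (C * (W * E * Wᴴ)).trace =
      ∑ c, ∑ c', E c c' * (star (fun x => W x c') ⬝ᵥ C *ᵥ fun x => W x c) := by
    have : (C * (W * E * Wᴴ)).trace = (E * (Wᴴ * C * W)).trace := by
      have := Matrix.trace_mul_comm (C * W) (E * Wᴴ)
      rw [← Matrix.mul_assoc, ← Matrix.mul_assoc, Matrix.mul_assoc (C * W), this]
      simp only [Matrix.mul_assoc]
    rw [this, Matrix.trace]
    refine Finset.sum_congr rfl fun c _ => ?_
    rw [Matrix.diag_apply, Matrix.mul_apply]
    refine Finset.sum_congr rfl fun c' _ => ?_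
    congr 1
    rw [Matrix.mul_assoc, Matrix.mul_apply]
    rfl
  have hterm : ∀ c c', ‖E c c' * (star (fun x => W x c') ⬝ᵥ C *ᵥ fun x => W x c)‖ ≤
      ‖C‖ * (‖E c c'‖ * nv c ^ 2 / 2 + ‖E c c'‖ * nv c' ^ 2 / 2) := by
    intro c c'
    rw [norm_mul]
    have h3 : ‖star (fun x => W x c') ⬝ᵥ C *ᵥ fun x => W x c‖ ≤ nv c' * (‖C‖ * nv c) :=
      (norm_star_dotProduct_le _ _).trans
        (mul_le_mul_of_nonneg_left (norm_toLp_mulVec_le C _) (norm_nonneg _))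
    have h4 : nv c' * nv c ≤ nv c ^ 2 / 2 + nv c' ^ 2 / 2 := by
      nlinarith [sq_nonneg (nv c - nv c')]
    calc ‖E c c'‖ * ‖star (fun x => W x c') ⬝ᵥ C *ᵥ fun x => W x c‖
        ≤ ‖E c c'‖ * (nv c' * (‖C‖ * nv c)) := mul_le_mul_of_nonneg_left h3 (norm_nonneg _)
      _ = ‖C‖ * ‖E c c'‖ * (nv c' * nv c) := by ring
      _ ≤ ‖C‖ * ‖E c c'‖ * (nv c ^ 2 / 2 + nv c' ^ 2 / 2) :=
          mul_le_mul_of_nonneg_left h4 (by positivity)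
      _ = _ := by ring
  rw [e]
  simp_rw [← hnv]
  calc _ ≤ ∑ c, ∑ c', ‖C‖ * (‖E c c'‖ * nv c ^ 2 / 2 + ‖E c c'‖ * nv c' ^ 2 / 2) := by
        refine (norm_sum_le _ _).trans (Finset.sum_le_sum fun c _ => ?_)
        exact (norm_sum_le _ _).trans (Finset.sum_le_sum fun c' _ => hterm c c')
    _ = ‖C‖ * (∑ c, (∑ c', ‖E c c'‖) * (nv c ^ 2 / 2) +
          ∑ c', (∑ c, ‖E c c'‖) * (nv c' ^ 2 / 2)) := by
        simp_rw [← Finset.mul_sum, Finset.sum_add_distrib]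
        rw [Finset.sum_comm (f := fun c c' => ‖E c c'‖ * nv c' ^ 2 / 2)]
        simp_rw [Finset.sum_mul, mul_div_assoc]
    _ ≤ ‖C‖ * (∑ c, ε * (nv c ^ 2 / 2) + ∑ c', ε * (nv c' ^ 2 / 2)) := by
        gcongr with c _ c' _
        · exact h1 c
        · exact h2 c'
    _ = _ := by
        rw [← Finset.sum_add_distrib, Finset.mul_sum (a := ε)]
        congr 1
        refine Finset.sum_congr rfl fun c _ => ?_
        ring

theorem flipInv_mul_flipMat {s : ℂ} (hs : 0 < s.im) : flipInv s * flipMat s = 1 :=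
  mul_eq_one_comm.1 (flipMat_mul_flipInv hs)

theorem one_sub_sq_I_mul (η : ℝ) : 1 - (Complex.I * η) ^ 2 = ((1 + η ^ 2 : ℝ) : ℂ) := by
  rw [mul_pow, Complex.I_sq]
  push_cast
  ring

theorem conjTranspose_flipMat_zero : (flipMat 0)ᴴ = flipMat 0 := by
  ext β β'
  by_cases h : β = β'
  · simp [flipMat, h]
  · simp [flipMat, h, Ne.symm h]

/-- A multiple of the identity with nonnegative imaginary part when η ≥ 0, plus a Hermitian part:
this keeps the regularized matrix dissipative and displays its O(η) distance from `flipMat 0`. -/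
theorem flipInv_I_mul (η : ℝ) :
    flipInv (Complex.I * η) = (Complex.I * ((η / (1 + η ^ 2) : ℝ) : ℂ)) • (1 : Matrix Bool Bool ℂ) +
      (((1 + η ^ 2)⁻¹ : ℝ) : ℂ) • flipMat 0 := by
  ext β β'
  by_cases h : β = β'
  · simp only [flipInv, hFun, one_sub_sq_I_mul, h, Matrix.of_apply, if_true, Matrix.add_apply,
      Matrix.smul_apply, Matrix.one_apply_eq, flipMat, smul_eq_mul]
    push_cast
    ring
  · simp only [flipInv, one_sub_sq_I_mul, h, Matrix.of_apply, if_false, Matrix.add_apply,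
      Matrix.smul_apply, Matrix.one_apply, flipMat, smul_eq_mul]
    push_cast
    ring

section

variable {m : Type*} [Fintype m] [DecidableEq m] {L N : ℕ}

/-- The Hermitian matrix whose off-diagonal block is the product of the block-Hankel matrices. -/
noncomputable def bigH (L N : ℕ) (y : ℕ → m → ℂ) :
    Matrix ((Bool × Fin L) × m) ((Bool × Fin L) × m) ℂ :=
  -(bigW L N y * (flipMat 0 ⊗ₖ (1 : Matrix (Fin N) (Fin N) ℂ)) * (bigW L N y)ᴴ)

theorem bigH_isHermitian (y : ℕ → m → ℂ) : (bigH L N y).IsHermitian := by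
  unfold bigH Matrix.IsHermitian
  rw [Matrix.conjTranspose_neg, Matrix.conjTranspose_mul, Matrix.conjTranspose_mul,
    Matrix.conjTranspose_conjTranspose, Matrix.conjTranspose_kronecker, conjTranspose_flipMat_zero,
    Matrix.conjTranspose_one, Matrix.mul_assoc]

theorem dissipative_isHermitian_sub {p : Type*} [Fintype p] [DecidableEq p] {H : Matrix p p ℂ}
    (hH : H.IsHermitian) (w : ℂ) : Dissipative w.im (H - w • 1) := by
  intro v
  have h := dissipative_neg_smul_one (m := p) w v
  rw [sub_eq_add_neg, add_mulVec, dotProduct_add, Complex.add_im,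
    im_star_dotProduct_of_isHermitian hH, zero_add]
  exact h

/-- The resolvent of `bigH`. -/
noncomputable def bigQ (L N : ℕ) (y : ℕ → m → ℂ) (w : ℂ) :
    Matrix ((Bool × Fin L) × m) ((Bool × Fin L) × m) ℂ := (bigH L N y - w • 1)⁻¹

/-- A diagonal block of a matrix. -/
def pBlock (a : Bool × Fin L) (Y : Matrix ((Bool × Fin L) × m) ((Bool × Fin L) × m) ℂ) :
    Matrix m m ℂ := Y.submatrix (fun j => (a, j)) fun j => (a, j)

/-- The inclusion of a block. -/
def blockIncl (m : Type*) [DecidableEq m] (a : Bool × Fin L) : Matrix ((Bool × Fin L) × m) m ℂ :=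
  Matrix.of fun x j => if x = (a, j) then 1 else 0

theorem conjTranspose_blockIncl_mul_mul (a : Bool × Fin L)
    (Y : Matrix ((Bool × Fin L) × m) ((Bool × Fin L) × m) ℂ) :
    (blockIncl m a)ᴴ * Y * blockIncl m a = pBlock a Y := by
  ext i j
  rw [Matrix.mul_apply, pBlock, Matrix.submatrix_apply, Finset.sum_eq_single (a, j)]
  · rw [Matrix.mul_apply, Finset.sum_eq_single (a, i)]
    · simp [blockIncl]
    · intro x _ hx
      simp [blockIncl, hx]
    · simp
  · intro x _ hx
    simp [blockIncl, hx]
  · simp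

theorem norm_blockIncl_le (a : Bool × Fin L) : ‖blockIncl m a‖ ≤ 1 := by
  have h : (blockIncl m a)ᴴ * blockIncl m a = 1 := by
    have h1 := conjTranspose_blockIncl_mul_mul a (1 : Matrix ((Bool × Fin L) × m) _ ℂ)
    rw [Matrix.mul_one] at h1
    rw [h1]
    ext i j
    simp [pBlock, Matrix.one_apply]
  have h2 := Matrix.l2_opNorm_conjTranspose_mul_self (blockIncl m a)
  rw [h] at h2
  have h3 : ‖(1 : Matrix m m ℂ)‖ ≤ 1 := by
    refine l2_opNorm_le_of_mulVec _ zero_le_one fun v => ?_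
    rw [one_mulVec, one_mul]
  nlinarith [norm_nonneg (blockIncl m a)]

theorem norm_blockIncl_conj_le (a : Bool × Fin L) (B : Matrix m m ℂ) :
    ‖blockIncl m a * B * (blockIncl m a)ᴴ‖ ≤ ‖B‖ := by
  have hU := norm_blockIncl_le (m := m) a
  refine (Matrix.l2_opNorm_mul _ _).trans ?_
  rw [Matrix.l2_opNorm_conjTranspose]
  calc _ ≤ ‖B‖ * 1 := by
        refine mul_le_mul ((Matrix.l2_opNorm_mul _ _).trans ?_) hU (norm_nonneg _) (norm_nonneg _)
        exact mul_le_of_le_one_left (norm_nonneg _) hU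
    _ = ‖B‖ := mul_one _

theorem trace_mul_pBlock (a : Bool × Fin L) (B : Matrix m m ℂ)
    (Y : Matrix ((Bool × Fin L) × m) ((Bool × Fin L) × m) ℂ) :
    (B * pBlock a Y).trace = (blockIncl m a * B * (blockIncl m a)ᴴ * Y).trace := by
  rw [← conjTranspose_blockIncl_mul_mul a Y]
  have := Matrix.trace_mul_comm (blockIncl m a) (B * (blockIncl m a)ᴴ * Y)
  simp only [Matrix.mul_assoc] at this ⊢
  exact this.symm

variable {S : Matrix m m ℂ} {w : ℂ} {η : ℝ}

/-- The regularized version of `bigH - w`. -/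
noncomputable def regMat (L N : ℕ) (y : ℕ → m → ℂ) (w : ℂ) (η : ℝ) :
    Matrix ((Bool × Fin L) × m) ((Bool × Fin L) × m) ℂ :=
  -(w • 1) - bigW L N y * (flipInv (Complex.I * η) ⊗ₖ (1 : Matrix (Fin N) (Fin N) ℂ)) *
    (bigW L N y)ᴴ

/-- The constant is Im w and does not degrade as η → 0, unlike the constant η of the full pencil. -/
theorem dissipative_regMat (hη : 0 ≤ η) (y : ℕ → m → ℂ) :
    Dissipative w.im (regMat L N y w η) := by
  refine (dissipative_neg_smul_one w).sub (ImNonneg.conj ?_ _)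
  rw [flipInv_I_mul, Matrix.add_kronecker, Matrix.smul_kronecker, Matrix.smul_kronecker,
    Matrix.one_kronecker_one]
  refine ImNonneg.add ?_ ?_
  · have := imNonneg_smul_mul_conjTranspose (m := Bool × Fin N)
      (κ := Complex.I * ((η / (1 + η ^ 2) : ℝ) : ℂ)) (by
        simp only [Complex.mul_im, Complex.I_re, Complex.I_im, Complex.ofReal_re,
          Complex.ofReal_im, zero_mul, one_mul, zero_add]
        positivity) (1 : Matrix (Bool × Fin N) (Bool × Fin N) ℂ)
    rwa [Matrix.conjTranspose_one, Matrix.one_mul] at this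
  · intro v
    refine (im_star_dotProduct_of_isHermitian ?_ v).ge
    rw [Matrix.IsHermitian, Matrix.conjTranspose_smul, Matrix.conjTranspose_kronecker,
      conjTranspose_flipMat_zero, Matrix.conjTranspose_one]
    simp

/-- Schur complement: the second block row of mat · res = 1 is solved for the lower left block and
substituted into the first. -/
theorem hankelPencil_res_toBlocks₁₁ (hη : 0 < η) (hw : η ≤ w.im)
    (Ξ : Fin (N + 2 * L - 1) → m → ℂ) :
    ((hankelPencil L N S w η).res Ξ).toBlocks₁₁ =
      (regMat L N (fun t => S *ᵥ extendField Ξ t) w η)⁻¹ := by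
  set y : ℕ → m → ℂ := fun t => S *ᵥ extendField Ξ t with hy
  have hs : 0 < (Complex.I * η).im := by simpa using hη
  have h1 : (hankelPencil L N S w η).mat Ξ * (hankelPencil L N S w η).res Ξ = 1 :=
    Matrix.mul_nonsing_inv _ ((Pencil.dissipative_mat
      (dissipative_hankelPencil (S := S) (L := L) (N := N) hw) Ξ).isUnit_det hη)
  set G := (hankelPencil L N S w η).res Ξ
  rw [hankelPencil_mat, ← Matrix.fromBlocks_toBlocks G, Matrix.fromBlocks_multiply,
    ← Matrix.fromBlocks_one, Matrix.fromBlocks_inj] at h1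
  obtain ⟨e1, -, e2, -⟩ := h1
  have e3 : G.toBlocks₂₁ = -((flipInv (Complex.I * η) ⊗ₖ (1 : Matrix (Fin N) (Fin N) ℂ)) *
      ((bigW L N y)ᴴ * G.toBlocks₁₁)) := by
    have h2 : flipInv (Complex.I * η) ⊗ₖ (1 : Matrix (Fin N) (Fin N) ℂ) *
        flipMat (Complex.I * η) ⊗ₖ (1 : Matrix (Fin N) (Fin N) ℂ) = 1 := by
      rw [← Matrix.mul_kronecker_mul, flipInv_mul_flipMat hs, Matrix.one_mul,
        Matrix.one_kronecker_one]
    have h3 := congrArg (fun Y => flipInv (Complex.I * η) ⊗ₖ (1 : Matrix (Fin N) (Fin N) ℂ) * Y) e2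
    simp only [Matrix.mul_add, Matrix.mul_zero] at h3
    rw [← Matrix.mul_assoc _ (flipMat (Complex.I * η) ⊗ₖ (1 : Matrix (Fin N) (Fin N) ℂ)), h2,
      Matrix.one_mul] at h3
    exact (neg_eq_of_add_eq_zero_right h3).symm
  symm
  refine Matrix.inv_eq_right_inv (Eq.trans ?_ e1)
  rw [regMat, e3, sub_mul, sub_eq_add_neg, Matrix.mul_neg]
  simp only [Matrix.mul_assoc, hy]

/-- The sum of the squared moduli of the entries of `bigW`. -/
theorem sum_norm_sq_bigW_le (y : ℕ → m → ℂ) :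
    ∑ c, ∑ x, ‖bigW L N y x c‖ ^ 2 ≤
      (N : ℝ)⁻¹ * ∑ a : Bool × Fin L, ∑ ν : Fin N, ∑ j, ‖y (rowOffset a + ν) j‖ ^ 2 := by
  have h : ∀ (x : (Bool × Fin L) × m) (c : Bool × Fin N), ‖bigW L N y x c‖ ^ 2 =
      if c.1 = x.1.1 then (N : ℝ)⁻¹ * ‖y (rowOffset x.1 + c.2) x.2‖ ^ 2 else 0 := by
    intro x c
    simp only [bigW, Matrix.of_apply]
    by_cases hc : c.1 = x.1.1
    · rw [if_pos hc, if_pos hc, norm_mul, mul_pow, norm_inv, Complex.norm_real,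
        Real.norm_of_nonneg (Real.sqrt_nonneg _), inv_pow, Real.sq_sqrt (by positivity)]
    · simp [hc]
  rw [Finset.sum_comm]
  simp_rw [h]
  rw [Fintype.sum_prod_type, Finset.mul_sum]
  refine Finset.sum_le_sum fun a _ => ?_
  rw [Finset.sum_comm, Fintype.sum_prod_type, Finset.sum_eq_single a.1]
  · simp only [if_true, ← Finset.mul_sum]
    exact le_rfl
  · intro β _ hβ
    simp [hβ]
  · simp

/-- The cost of removing the regularization. -/
theorem norm_trace_regMat_inv_sub_le (hη : 0 ≤ η) (hη1 : η ≤ 1) (hw : 0 < w.im) (y : ℕ → m → ℂ)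
    (a : Bool × Fin L) (B : Matrix m m ℂ) :
    ‖(B * pBlock a (bigQ L N y w)).trace - (B * pBlock a (regMat L N y w η)⁻¹).trace‖ ≤
      w.im⁻¹ ^ 2 * ‖B‖ * (2 * η * ∑ c, ∑ x, ‖bigW L N y x c‖ ^ 2) := by
  have hQ := dissipative_isHermitian_sub (bigH_isHermitian (L := L) (N := N) y) w
  have hX := dissipative_regMat (L := L) (N := N) (w := w) hη y
  set E : Matrix (Bool × Fin N) (Bool × Fin N) ℂ :=
    (flipMat 0 - flipInv (Complex.I * η)) ⊗ₖ (1 : Matrix (Fin N) (Fin N) ℂ) with hE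
  have hdiff : bigQ L N y w - (regMat L N y w η)⁻¹ =
      bigQ L N y w * (bigW L N y * E * (bigW L N y)ᴴ) * (regMat L N y w η)⁻¹ := by
    rw [bigQ, inv_sub_inv_eq_mul (hQ.isUnit_det hw) (hX.isUnit_det hw)]
    congr 2
    have hsub : E = flipMat 0 ⊗ₖ (1 : Matrix (Fin N) (Fin N) ℂ) -
        flipInv (Complex.I * η) ⊗ₖ (1 : Matrix (Fin N) (Fin N) ℂ) := by
      ext x y
      simp [hE, Matrix.kroneckerMap_apply, sub_mul]
    rw [regMat, bigH, hsub, Matrix.mul_sub, Matrix.sub_mul]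
    abel
  have hη2 : 0 < 1 + η ^ 2 := by positivity
  -- The entries are η/(1 + η²) on the diagonal and η²/(1 + η²) off it in modulus; the latter is at
  -- most η because η ≤ 1.
  have hEe : ∀ β β', ‖(flipMat 0 - flipInv (Complex.I * η)) β β'‖ ≤ η := by
    intro β β'
    rw [flipInv_I_mul]
    by_cases h : β = β'
    · simp only [h, Matrix.sub_apply, Matrix.add_apply, Matrix.smul_apply, flipMat,
        Matrix.of_apply, if_true, Matrix.one_apply_eq, smul_eq_mul, neg_zero, mul_zero, add_zero,
        mul_one, zero_sub, norm_neg, norm_mul, Complex.norm_I, one_mul, Complex.norm_real]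
      rw [Real.norm_of_nonneg (by positivity), div_le_iff₀ hη2]
      nlinarith [pow_nonneg hη 3]
    · simp only [h, Matrix.sub_apply, Matrix.add_apply, Matrix.smul_apply, flipMat,
        Matrix.of_apply, if_false, Matrix.one_apply_ne h, smul_eq_mul, mul_zero, zero_add,
        mul_neg, mul_one, sub_neg_eq_add]
      rw [show (-1 : ℂ) + (((1 + η ^ 2)⁻¹ : ℝ) : ℂ) = ((-1 + (1 + η ^ 2)⁻¹ : ℝ) : ℂ) by
        push_cast; ring, Complex.norm_real, Real.norm_eq_abs, abs_le]
      have h1 : (1 + η ^ 2)⁻¹ ≤ 1 := inv_le_one_of_one_le₀ (by nlinarith)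
      have h2 : 1 - η ^ 2 ≤ (1 + η ^ 2)⁻¹ := by
        rw [← one_div, le_div_iff₀ hη2]
        nlinarith [pow_nonneg hη 4]
      constructor <;> nlinarith
  have hrow : ∀ c, ∑ c', ‖E c c'‖ ≤ 2 * η := by
    intro c
    rw [Fintype.sum_prod_type]
    calc _ = ∑ β, ‖(flipMat 0 - flipInv (Complex.I * η)) c.1 β‖ := by
          refine Finset.sum_congr rfl fun β _ => ?_
          rw [Finset.sum_eq_single c.2]
          · simp [hE, Matrix.kroneckerMap_apply]
          · intro ν _ hν
            simp [hE, Matrix.kroneckerMap_apply, Ne.symm hν]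
          · simp
      _ ≤ ∑ β : Bool, η := Finset.sum_le_sum fun β _ => hEe _ _
      _ = 2 * η := by simp
  have hcol : ∀ c', ∑ c, ‖E c c'‖ ≤ 2 * η := by
    intro c'
    rw [Fintype.sum_prod_type]
    calc _ = ∑ β, ‖(flipMat 0 - flipInv (Complex.I * η)) β c'.1‖ := by
          refine Finset.sum_congr rfl fun β _ => ?_
          rw [Finset.sum_eq_single c'.2]
          · simp [hE, Matrix.kroneckerMap_apply]
          · intro ν _ hν
            simp [hE, Matrix.kroneckerMap_apply, hν]
          · simp
      _ ≤ ∑ β : Bool, η := Finset.sum_le_sum fun β _ => hEe _ _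
      _ = 2 * η := by simp
  rw [trace_mul_pBlock, trace_mul_pBlock, ← Matrix.trace_sub, ← mul_sub, hdiff]
  set Bh := blockIncl m a * B * (blockIncl m a)ᴴ
  have hcyc : (Bh * (bigQ L N y w * (bigW L N y * E * (bigW L N y)ᴴ) * (regMat L N y w η)⁻¹)).trace =
      ((regMat L N y w η)⁻¹ * Bh * bigQ L N y w * (bigW L N y * E * (bigW L N y)ᴴ)).trace := by
    have := Matrix.trace_mul_comm (Bh * (bigQ L N y w * (bigW L N y * E * (bigW L N y)ᴴ)))
      (regMat L N y w η)⁻¹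
    simp only [Matrix.mul_assoc] at this ⊢
    exact this
  rw [hcyc]
  refine (norm_trace_mul_conj_le _ _ _ hrow hcol).trans ?_
  refine mul_le_mul_of_nonneg_right ?_ (by positivity)
  calc _ ≤ w.im⁻¹ * ‖B‖ * w.im⁻¹ := by
        refine (norm_mul_le _ _).trans (mul_le_mul ((norm_mul_le _ _).trans ?_)
          (hQ.norm_inv_le hw) (norm_nonneg _) (by positivity))
        exact mul_le_mul (hX.norm_inv_le hw) (norm_blockIncl_conj_le a B) (norm_nonneg _)
          (by positivity)
    _ = _ := by ring

end

end

end PastFuture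

namespace PastFuture

section

open scoped Matrix.Norms.L2Operator Kronecker

set_option linter.unusedSectionVars false

/-! ### The averaged resolvent -/

section

variable {m : Type*} [Fintype m] [DecidableEq m] {L N : ℕ} {S : Matrix m m ℂ} {w : ℂ} {η : ℝ}

/-- The colored field. -/
def coloredField {K : ℕ} (S : Matrix m m ℂ) (Ξ : Fin K → m → ℂ) (t : ℕ) : m → ℂ :=
  S *ᵥ extendField Ξ t

/-- The average over the future block rows of the trace against a matrix. -/
noncomputable def linStat {L : ℕ} (B : Matrix m m ℂ)
    (Y : Matrix ((Bool × Fin L) × m) ((Bool × Fin L) × m) ℂ) : ℂ :=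
  ((L : ℂ) * Fintype.card m)⁻¹ * ∑ i : Fin L, (B * pBlock (true, i) Y).trace

/-- The second absolute moment of a standard complex Gaussian variable. -/
noncomputable def gaussianMoment : ℝ := ∫ ζ : ℂ, ‖ζ‖ ^ 2 ∂stdComplexGaussian

theorem gaussianMoment_nonneg : 0 ≤ gaussianMoment := integral_nonneg fun _ => by positivity

/-- An upper bound for the sum of the squared entries of the block-Hankel matrices. -/
noncomputable def energy (L N : ℕ) (b : ℝ) (Ξ : Fin (N + 2 * L - 1) → m → ℂ) : ℝ :=
  (N : ℝ)⁻¹ * ∑ a : Bool × Fin L, ∑ ν : Fin N,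
    b * ∑ j, ‖Ξ ⟨rowOffset a + ν, rowOffset_add_lt a ν⟩ j‖ ^ 2

/-- Pulls the coloring out through ‖S‖² = ‖SS^*‖ ≤ b, leaving a quadratic functional of the white
field with an explicit mean. -/
theorem sum_norm_sq_bigW_le_energy {b : ℝ} (hb : ‖S * Sᴴ‖ ≤ b)
    (Ξ : Fin (N + 2 * L - 1) → m → ℂ) :
    ∑ c, ∑ x, ‖bigW L N (coloredField S Ξ) x c‖ ^ 2 ≤ energy L N b Ξ := by
  have hS : ‖S‖ ^ 2 ≤ b := by
    have h := Matrix.l2_opNorm_conjTranspose_mul_self Sᴴ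
    rw [Matrix.conjTranspose_conjTranspose, Matrix.l2_opNorm_conjTranspose] at h
    rw [sq, ← h]
    exact hb
  refine (sum_norm_sq_bigW_le _).trans ?_
  unfold energy
  gcongr with a _ ν _
  have h1 := norm_toLp_mulVec_le S (Ξ ⟨rowOffset a + ν, rowOffset_add_lt a ν⟩)
  have h2 : coloredField S Ξ (rowOffset a + ν) =
      S *ᵥ Ξ ⟨rowOffset a + ν, rowOffset_add_lt a ν⟩ := by
    rw [coloredField]
    congr 1
    exact extendField_coe Ξ ⟨rowOffset a + ν, rowOffset_add_lt a ν⟩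
  rw [h2]
  have h3 := EuclideanSpace.norm_sq_eq (𝕜 := ℂ)
    (WithLp.toLp 2 (S *ᵥ Ξ ⟨rowOffset a + ν, rowOffset_add_lt a ν⟩))
  have h4 := EuclideanSpace.norm_sq_eq (𝕜 := ℂ)
    (WithLp.toLp 2 (Ξ ⟨rowOffset a + ν, rowOffset_add_lt a ν⟩))
  calc _ = _ := h3.symm
    _ ≤ (‖S‖ * ‖(WithLp.toLp 2 (Ξ ⟨rowOffset a + ν, rowOffset_add_lt a ν⟩) :
          EuclideanSpace ℂ m)‖) ^ 2 := by gcongr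
    _ = ‖S‖ ^ 2 * ‖(WithLp.toLp 2 (Ξ ⟨rowOffset a + ν, rowOffset_add_lt a ν⟩) :
          EuclideanSpace ℂ m)‖ ^ 2 := mul_pow _ _ _
    _ ≤ b * ‖(WithLp.toLp 2 (Ξ ⟨rowOffset a + ν, rowOffset_add_lt a ν⟩) :
          EuclideanSpace ℂ m)‖ ^ 2 := by gcongr
    _ = _ := by rw [h4]

theorem integrable_norm_sq_coord {K : ℕ} (k : Fin K) (j : m) :
    Integrable (fun Ξ : Fin K → m → ℂ => ‖Ξ k j‖ ^ 2) (gaussianField K m) :=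
  (memLp_coord k j).integrable_norm_pow (by norm_num)

theorem integrable_energy (b : ℝ) :
    Integrable (energy L N b) (gaussianField (N + 2 * L - 1) m) := by
  unfold energy
  refine (integrable_finsetSum _ fun a _ => integrable_finsetSum _ fun ν _ =>
    (integrable_finsetSum _ fun j _ => integrable_norm_sq_coord _ j).const_mul b).const_mul _

theorem integral_energy (hN : 0 < N) (b : ℝ) :
    ∫ Ξ, energy L N b Ξ ∂(gaussianField (N + 2 * L - 1) m) =
      2 * L * (b * (Fintype.card m * gaussianMoment)) := by
  have hN' : (N : ℝ) ≠ 0 := by exact_mod_cast hN.ne'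
  unfold energy
  rw [integral_const_mul, integral_finsetSum _ fun a _ => integrable_finsetSum _ fun ν _ =>
    (integrable_finsetSum _ fun j _ => integrable_norm_sq_coord _ j).const_mul b]
  have h : ∀ a : Bool × Fin L, ∫ Ξ : Fin (N + 2 * L - 1) → m → ℂ, ∑ ν : Fin N,
      b * ∑ j, ‖Ξ ⟨rowOffset a + ν, rowOffset_add_lt a ν⟩ j‖ ^ 2
      ∂(gaussianField (N + 2 * L - 1) m) = N * (b * (Fintype.card m * gaussianMoment)) := by
    intro a
    rw [integral_finsetSum _ fun ν _ =>
      (integrable_finsetSum _ fun j _ => integrable_norm_sq_coord _ j).const_mul b]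
    have : ∀ ν : Fin N, ∫ Ξ : Fin (N + 2 * L - 1) → m → ℂ,
        b * ∑ j, ‖Ξ ⟨rowOffset a + ν, rowOffset_add_lt a ν⟩ j‖ ^ 2
        ∂(gaussianField (N + 2 * L - 1) m) = b * (Fintype.card m * gaussianMoment) := by
      intro ν
      rw [integral_const_mul, integral_finsetSum _ fun j _ => integrable_norm_sq_coord _ j]
      simp_rw [integral_norm_sq_coord]
      simp [gaussianMoment]
    simp_rw [this]
    simp
  simp_rw [h]
  simp
  field_simp

/-- The matrix that represents `linStat` on the whole index set of the pencil. -/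
noncomputable def statMat (L N : ℕ) (B : Matrix m m ℂ) :
    Matrix (((Bool × Fin L) × m) ⊕ (Bool × Fin N)) (((Bool × Fin L) × m) ⊕ (Bool × Fin N)) ℂ :=
  ((L : ℂ) * Fintype.card m)⁻¹ • ∑ i : Fin L,
    (hankelPencil L N (0 : Matrix m m ℂ) 0 0).U (true, i) * B *
      ((hankelPencil L N (0 : Matrix m m ℂ) 0 0).U (true, i))ᴴ

theorem trace_statMat_mul (B : Matrix m m ℂ)
    (Y : Matrix (((Bool × Fin L) × m) ⊕ (Bool × Fin N))
      (((Bool × Fin L) × m) ⊕ (Bool × Fin N)) ℂ) :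
    (statMat L N B * Y).trace =
      ((L : ℂ) * Fintype.card m)⁻¹ * ∑ i : Fin L, (B * rowBlock (true, i) Y).trace := by
  rw [statMat, Matrix.smul_mul, Matrix.trace_smul, Matrix.sum_mul, Matrix.trace_sum, smul_eq_mul]
  congr 1
  refine Finset.sum_congr rfl fun i _ => ?_
  rw [trace_hankelPencil_U_mul]
  rfl

theorem linStat_toBlocks₁₁ (B : Matrix m m ℂ)
    (Y : Matrix (((Bool × Fin L) × m) ⊕ (Bool × Fin N))
      (((Bool × Fin L) × m) ⊕ (Bool × Fin N)) ℂ) :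
    linStat B Y.toBlocks₁₁ = (statMat L N B * Y).trace := by
  rw [trace_statMat_mul]
  rfl

theorem norm_statMat_le (hL : 0 < L) (B : Matrix m m ℂ) :
    ‖statMat L N B‖ ≤ (Fintype.card m : ℝ)⁻¹ * ‖B‖ := by
  have hL' : (0 : ℝ) < L := by exact_mod_cast hL
  have h : ∀ i : Fin L, ‖(hankelPencil L N (0 : Matrix m m ℂ) 0 0).U (true, i) * B *
      ((hankelPencil L N (0 : Matrix m m ℂ) 0 0).U (true, i))ᴴ‖ ≤ ‖B‖ := by
    intro i
    have hU := norm_hankelPencil_U_le (N := N) (S := (0 : Matrix m m ℂ)) (w := 0) (η := 0) (true, i)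
    refine (Matrix.l2_opNorm_mul _ _).trans ?_
    rw [Matrix.l2_opNorm_conjTranspose]
    calc _ ≤ ‖B‖ * 1 := by
          refine mul_le_mul ((Matrix.l2_opNorm_mul _ _).trans ?_) hU (norm_nonneg _)
            (norm_nonneg _)
          exact mul_le_of_le_one_left (norm_nonneg _) hU
      _ = ‖B‖ := mul_one _
  rw [statMat, norm_smul, norm_inv, norm_mul, Complex.norm_natCast, Complex.norm_natCast, mul_inv]
  calc _ ≤ (L : ℝ)⁻¹ * (Fintype.card m : ℝ)⁻¹ * (L * ‖B‖) := by
        refine mul_le_mul_of_nonneg_left ?_ (by positivity)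
        refine (norm_sum_le _ _).trans ((Finset.sum_le_sum fun i _ => h i).trans_eq ?_)
        simp
    _ = _ := by field_simp

/-- The expected deviation of the linear statistics of the resolvent, for a fixed regularization. -/
theorem integral_norm_linStat_sub_le [Nonempty m] (hη : 0 < η) (hη1 : η ≤ 1) (hw : η ≤ w.im)
    (hN : 0 < N) (hL : 0 < L) {b δ : ℝ} (hb : ‖S * Sᴴ‖ ≤ b)
    (hδ : ‖(hankelPencil L N S w η).meanRes - ((hankelPencil L N S w η).base -
      (hankelPencil L N S w η).selfEnergy (hankelPencil L N S w η).meanRes)⁻¹‖ ≤ δ)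
    {B : Matrix m m ℂ} (hB : ‖B‖ ≤ 1) :
    ∫ Ξ, ‖linStat B (bigQ L N (coloredField S Ξ) w) - (Fintype.card m : ℂ)⁻¹ *
      (B * ratInv (S * Sᴴ) w (hFun (Complex.I * η + meanTau L N S w η))).trace‖
      ∂(gaussianField (N + 2 * L - 1) m) ≤
      w.im⁻¹ ^ 2 * (2 * η) * (2 * L * (b * gaussianMoment)) +
      8 * (√((N + 2 * L - 1 : ℕ) : ℝ) * (2 * ((2 * L : ℕ) : ℝ) *
        ((Fintype.card m : ℝ)⁻¹ * (2 * η⁻¹)))) + (δ + w.im⁻¹ ^ 2 * b * δ) := by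
  have hw0 : 0 < w.im := hη.trans_le hw
  have hM : (0 : ℝ) < Fintype.card m := by exact_mod_cast Fintype.card_pos
  have hL' : (0 : ℝ) < L := by exact_mod_cast hL
  have hb0 : 0 ≤ b := (norm_nonneg _).trans hb
  have hδ0 : 0 ≤ δ := (norm_nonneg _).trans hδ
  have hA := dissipative_hankelPencil (S := S) (L := L) (N := N) hw
  obtain ⟨hκ, -, hest⟩ := hankelPencil_meanRes_estimates hη hw hN hL hb hδ
  have hτim := meanTau_im_nonneg (L := L) (N := N) (S := S) hη hw
  have hκim := meanKappa_im_nonneg (L := L) (N := N) (S := S) hη hw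
  set s := Complex.I * η + meanTau L N S w η with hs
  have hsim : 0 < s.im := by
    simp only [hs, Complex.add_im, Complex.mul_im, Complex.I_re, Complex.I_im, Complex.ofReal_re,
      Complex.ofReal_im]
    linarith
  set target := (Fintype.card m : ℂ)⁻¹ * (B * ratInv (S * Sᴴ) w (hFun s)).trace with htarget
  have hcard : Fintype.card (Bool × Fin L) = 2 * L := by simp
  have : Nonempty (Bool × Fin L) := ⟨(true, ⟨0, hL⟩)⟩
  have hconc := Pencil.integral_norm_trace_sub_le (m := m) (K := N + 2 * L - 1) (by omega) hη hA
    (β := (Fintype.card m : ℝ)⁻¹) (B := statMat L N B) (by positivity)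
    ((norm_statMat_le hL B).trans (mul_le_of_le_one_right (by positivity) hB))
  rw [hcard] at hconc
  have hdet : ‖(statMat L N B * (hankelPencil L N S w η).meanRes).trace - target‖ ≤
      δ + w.im⁻¹ ^ 2 * b * δ := by
    have h1 : ‖(statMat L N B * (hankelPencil L N S w η).meanRes).trace -
        (Fintype.card m : ℂ)⁻¹ * (B * ratInv (S * Sᴴ) w (meanKappa L N S w η)).trace‖ ≤ δ := by
      rw [trace_statMat_mul, mul_inv, mul_comm (L : ℂ)⁻¹, mul_assoc, ← mul_sub, norm_mul, norm_inv,
        Complex.norm_natCast, inv_mul_le_iff₀ hM]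
      refine (hest B).trans (mul_le_mul_of_nonneg_left ?_ hM.le)
      exact mul_le_of_le_one_left hδ0 hB
    have h2 : ‖(Fintype.card m : ℂ)⁻¹ * (B * ratInv (S * Sᴴ) w (meanKappa L N S w η)).trace -
        target‖ ≤ w.im⁻¹ ^ 2 * b * δ := by
      rw [htarget, ← mul_sub, ← Matrix.trace_sub, ← Matrix.mul_sub, norm_mul, norm_inv,
        Complex.norm_natCast, inv_mul_le_iff₀ hM]
      refine (norm_trace_le _).trans (mul_le_mul_of_nonneg_left ?_ hM.le)
      refine (norm_mul_le _ _).trans ?_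
      refine (mul_le_of_le_one_left (norm_nonneg _) hB).trans ?_
      refine (norm_ratInv_sub_le hw0 hκim (im_hFun_pos hsim).le S hb).trans ?_
      gcongr
    calc _ ≤ _ := norm_sub_le_norm_sub_add_norm_sub _ _ _
      _ ≤ _ := add_le_add h1 h2
  have hreg : ∀ Ξ : Fin (N + 2 * L - 1) → m → ℂ,
      ‖linStat B (bigQ L N (coloredField S Ξ) w) -
        (statMat L N B * (hankelPencil L N S w η).res Ξ).trace‖ ≤
      w.im⁻¹ ^ 2 * (2 * η) * ((Fintype.card m : ℝ)⁻¹ * energy L N b Ξ) := by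
    intro Ξ
    rw [← linStat_toBlocks₁₁, hankelPencil_res_toBlocks₁₁ hη hw, linStat, linStat, ← mul_sub,
      ← Finset.sum_sub_distrib, norm_mul, norm_inv, norm_mul, Complex.norm_natCast,
      Complex.norm_natCast, inv_mul_le_iff₀ (by positivity)]
    refine (norm_sum_le _ _).trans ?_
    have hterm : ∀ i : Fin L,
        ‖(B * pBlock (true, i) (bigQ L N (coloredField S Ξ) w)).trace -
          (B * pBlock (true, i) (regMat L N (fun t => S *ᵥ extendField Ξ t) w η)⁻¹).trace‖ ≤
        w.im⁻¹ ^ 2 * (2 * η * energy L N b Ξ) := by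
      intro i
      refine (norm_trace_regMat_inv_sub_le hη.le hη1 hw0 _ _ B).trans ?_
      have he := sum_norm_sq_bigW_le_energy hb Ξ
      have he0 : 0 ≤ ∑ c, ∑ x, ‖bigW L N (coloredField S Ξ) x c‖ ^ 2 :=
        Finset.sum_nonneg fun c _ => Finset.sum_nonneg fun x _ => by positivity
      calc _ ≤ w.im⁻¹ ^ 2 * 1 * (2 * η * energy L N b Ξ) := by
            refine mul_le_mul (mul_le_mul_of_nonneg_left hB (by positivity)) ?_
              (mul_nonneg (by positivity) he0) (by positivity)
            exact mul_le_mul_of_nonneg_left he (by positivity)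
        _ = _ := by ring
    refine (Finset.sum_le_sum fun i _ => hterm i).trans_eq ?_
    simp only [Finset.sum_const, Finset.card_univ, Fintype.card_fin, nsmul_eq_mul]
    field_simp
  have hint1 : Integrable (fun Ξ => w.im⁻¹ ^ 2 * (2 * η) *
      ((Fintype.card m : ℝ)⁻¹ * energy L N b Ξ)) (gaussianField (N + 2 * L - 1) m) :=
    ((integrable_energy b).const_mul _).const_mul _
  have hint2 := Pencil.integrable_norm_trace_sub hη hA (statMat L N B)
  -- Three errors: the removal of η, the fluctuation of the trace around its mean, and the deviation
  -- of the mean from the deterministic value.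
  calc _ ≤ ∫ Ξ, (w.im⁻¹ ^ 2 * (2 * η) * ((Fintype.card m : ℝ)⁻¹ * energy L N b Ξ) +
        ‖(statMat L N B * (hankelPencil L N S w η).res Ξ).trace -
          (statMat L N B * (hankelPencil L N S w η).meanRes).trace‖ +
        (δ + w.im⁻¹ ^ 2 * b * δ)) ∂(gaussianField (N + 2 * L - 1) m) := by
        refine integral_mono_of_nonneg (Eventually.of_forall fun Ξ => norm_nonneg _)
          ((hint1.add hint2).add (integrable_const _)) (Eventually.of_forall fun Ξ => ?_)
        calc _ ≤ _ := norm_sub_le_norm_sub_add_norm_sub _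
              (statMat L N B * (hankelPencil L N S w η).res Ξ).trace _
          _ ≤ _ := by
              have h3 := norm_sub_le_norm_sub_add_norm_sub
                (statMat L N B * (hankelPencil L N S w η).res Ξ).trace
                (statMat L N B * (hankelPencil L N S w η).meanRes).trace target
              linarith [hreg Ξ]
    _ ≤ _ := by
        have hi12 : Integrable (fun Ξ => w.im⁻¹ ^ 2 * (2 * η) *
            ((Fintype.card m : ℝ)⁻¹ * energy L N b Ξ) +
            ‖(statMat L N B * (hankelPencil L N S w η).res Ξ).trace -
            (statMat L N B * (hankelPencil L N S w η).meanRes).trace‖)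
            (gaussianField (N + 2 * L - 1) m) := hint1.add hint2
        rw [integral_add hi12 (integrable_const _),
          integral_add hint1 hint2, integral_const_mul, integral_const_mul, integral_energy hN,
          integral_const, probReal_univ, one_smul]
        refine add_le_add (add_le_add (le_of_eq ?_) hconc) le_rfl
        field_simp

end

end

end PastFuture

namespace PastFuture

/-! ### Approximate fixed points from large random matrices -/

section

open scoped Matrix.Norms.L2Operator Kronecker

set_option linter.unusedSectionVars false

theorem norm_spectral_le {m : Type*} [Fintype m] [DecidableEq m] {R V : Matrix m m ℂ}
    {lam : m → ℝ} (hV : V * Vᴴ = 1) (hR : R = V * Matrix.diagonal (fun k => (lam k : ℂ)) * Vᴴ)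
    {b : ℝ} (hb0 : 0 ≤ b) (hl : ∀ k, 0 ≤ lam k) (hb : ∀ k, lam k ≤ b) : ‖R‖ ≤ b := by
  have h1 : ‖(1 : Matrix m m ℂ)‖ ≤ 1 := by
    refine l2_opNorm_le_of_mulVec _ zero_le_one fun v => ?_
    rw [one_mulVec, one_mul]
  have hVn : ‖V‖ * ‖V‖ ≤ 1 := by
    have h2 := Matrix.l2_opNorm_conjTranspose_mul_self Vᴴ
    rw [Matrix.conjTranspose_conjTranspose, hV, Matrix.l2_opNorm_conjTranspose] at h2
    rw [← h2]
    exact h1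
  have hD : ‖Matrix.diagonal (fun k => (lam k : ℂ))‖ ≤ b := by
    rw [Matrix.l2_opNorm_diagonal]
    refine (pi_norm_le_iff_of_nonneg hb0).2 fun k => ?_
    rw [Complex.norm_real, Real.norm_of_nonneg (hl k)]
    exact hb k
  rw [hR]
  calc _ ≤ ‖V‖ * ‖Matrix.diagonal (fun k => (lam k : ℂ))‖ * ‖V‖ := by
        refine (norm_mul_le _ _).trans ?_
        rw [Matrix.l2_opNorm_conjTranspose]
        exact mul_le_mul_of_nonneg_right (norm_mul_le _ _) (norm_nonneg _)
    _ = (‖V‖ * ‖V‖) * ‖Matrix.diagonal (fun k => (lam k : ℂ))‖ := by ring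
    _ ≤ 1 * b := mul_le_mul hVn hD (norm_nonneg _) zero_le_one
    _ = b := one_mul b

/-- For large dimensions, the linear statistics of the resolvent are close, in mean, to a
deterministic equivalent built from a nearly fixed point. -/
theorem exists_approx_fixedPoint (L : ℕ) (hL : 0 < L) {b c₁ c₂ : ℝ} (hb : 0 < b) (hc₁ : 0 < c₁)
    {w : ℂ} (hw : 0 < w.im) {ε : ℝ} (hε : 0 < ε) :
    ∃ N₀ : ℕ, ∀ N, N₀ ≤ N → ∀ {m : Type} [Fintype m] [DecidableEq m] [Nonempty m]
      (S V : Matrix m m ℂ) (lam : m → ℝ), V * Vᴴ = 1 →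
      S * Sᴴ = V * Matrix.diagonal (fun k => (lam k : ℂ)) * Vᴴ → (∀ k, 0 ≤ lam k) →
      (∀ k, lam k ≤ b) → c₁ ≤ (L / N : ℝ) * Fintype.card m → (L / N : ℝ) * Fintype.card m ≤ c₂ →
      ∃ s : ℂ, 0 < s.im ∧ ‖s - phi lam (L / N) w (hFun s)‖ ≤ ε ∧
        ∀ B : Matrix m m ℂ, ‖B‖ ≤ 1 →
          ∫ Ξ, ‖linStat B (bigQ L N (coloredField S Ξ) w) - (Fintype.card m : ℂ)⁻¹ *
            (B * ratInv (S * Sᴴ) w (hFun s)).trace‖ ∂(gaussianField (N + 2 * L - 1) m) ≤ ε := by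
  have hL' : (0 : ℝ) < L := by exact_mod_cast hL
  have hγ := gaussianMoment_nonneg
  obtain ⟨A₁, hA₁⟩ : ∃ x : ℝ, x = w.im⁻¹ ^ 2 * 2 * (2 * L * (b * gaussianMoment)) := ⟨_, rfl⟩
  have hA₁0 : 0 ≤ A₁ := by rw [hA₁]; positivity
  -- η is fixed first, so that both the term iη in s and the cost A₁η of removing the regularization
  -- are at most ε/2. All other errors are then O(N^{-1/2}) with constants depending on η.
  obtain ⟨η, hηdef⟩ : ∃ x : ℝ, x = min (min 1 w.im) (ε / (2 * (1 + A₁))) := ⟨_, rfl⟩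
  have hη : 0 < η := hηdef ▸ lt_min (lt_min one_pos hw) (by positivity)
  have hη1 : η ≤ 1 := hηdef.le.trans <| (min_le_left _ _).trans (min_le_left _ _)
  have hηw : η ≤ w.im := hηdef.le.trans <| (min_le_left _ _).trans (min_le_right _ _)
  have hηε : η * (1 + A₁) ≤ ε / 2 := by
    have : η ≤ ε / (2 * (1 + A₁)) := hηdef.le.trans (min_le_right _ _)
    rw [le_div_iff₀ (by positivity)] at this
    linarith
  have hηA : 0 ≤ η * A₁ := mul_nonneg hη.le hA₁0
  have hηε1 : η ≤ ε / 2 := by linarith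
  have hηε2 : A₁ * η ≤ ε / 2 := by linarith
  obtain ⟨q, hq⟩ : ∃ x : ℝ, x = 1 + 2 * L := ⟨_, rfl⟩
  obtain ⟨Cδ, hCδ⟩ : ∃ x : ℝ, x = η⁻¹ * (((2 * L : ℕ) : ℝ) ^ 2 *
    (16 * b * (q * (2 * ((2 * L : ℕ) : ℝ) * (2 * η⁻¹)))) * η⁻¹) := ⟨_, rfl⟩
  have hq1 : 1 ≤ q := by rw [hq]; linarith
  have hCδ0 : 0 ≤ Cδ := by rw [hCδ, hq]; positivity
  obtain ⟨Cc, hCc⟩ : ∃ x : ℝ, x = 8 * (q * (2 * ((2 * L : ℕ) : ℝ) * (L / c₁ * (2 * η⁻¹)))) := ⟨_, rfl⟩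
  have hCc0 : 0 ≤ Cc := by rw [hCc, hq]; positivity
  -- D collects the constants in front of N^{-1/2}, for the equation and for the linear statistics
  -- together.
  obtain ⟨D, hD⟩ : ∃ x : ℝ, x = (|c₂| * b * Cδ + |c₂| * b ^ 2 * w.im⁻¹ ^ 2 * Cδ) +
    (Cc + (Cδ + w.im⁻¹ ^ 2 * b * Cδ)) := ⟨_, rfl⟩
  have hlim : Tendsto (fun N : ℕ => D / √(N : ℝ)) atTop (𝓝 0) :=
    tendsto_const_nhds.div_atTop (Real.tendsto_sqrt_atTop.comp tendsto_natCast_atTop_atTop)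
  obtain ⟨N₁, hN₁⟩ := eventually_atTop.1 (hlim.eventually (ge_mem_nhds (by positivity : 0 < ε / 2)))
  refine ⟨max N₁ 1, fun N hN m _ _ _ S V lam hV hSV hl hlb hc1 hc2 => ?_⟩
  have hN1 : 0 < N := (le_max_right N₁ 1).trans hN
  have hDN : D / √(N : ℝ) ≤ ε / 2 := hN₁ N ((le_max_left _ _).trans hN)
  have hN' : (0 : ℝ) < N := by exact_mod_cast hN1
  have hN1' : (1 : ℝ) ≤ N := by exact_mod_cast hN1
  have hsq : 0 < √(N : ℝ) := Real.sqrt_pos.2 hN'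
  have hM : (0 : ℝ) < Fintype.card m := by exact_mod_cast Fintype.card_pos
  have hSb : ‖S * Sᴴ‖ ≤ b := norm_spectral_le hV hSV hb.le hl hlb
  have hK : √((N + 2 * L - 1 : ℕ) : ℝ) ≤ q * √(N : ℝ) := by
    have hq0 : 0 ≤ q := zero_le_one.trans hq1
    refine Real.sqrt_le_iff.2 ⟨by positivity, ?_⟩
    rw [mul_pow, Real.sq_sqrt hN'.le]
    have h1 : ((N + 2 * L - 1 : ℕ) : ℝ) ≤ N + 2 * L := by
      exact_mod_cast Nat.sub_le _ _
    have h2 : (N + 2 * L : ℝ) ≤ q * N := by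
      have := mul_le_mul_of_nonneg_left hN1' (by positivity : (0 : ℝ) ≤ 2 * L)
      rw [hq, add_mul, one_mul]
      linarith
    have h3 : q * N ≤ q ^ 2 * N :=
      mul_le_mul_of_nonneg_right (le_self_pow₀ hq1 two_ne_zero) hN'.le
    linarith
  have hcard : Fintype.card (Bool × Fin L) = 2 * L := by simp
  have : Nonempty (Bool × Fin L) := ⟨(true, ⟨0, hL⟩)⟩
  have hA := dissipative_hankelPencil (S := S) (L := L) (N := N) hηw
  obtain ⟨δ, hδdef⟩ : ∃ x : ℝ, x = Cδ / √(N : ℝ) := ⟨_, rfl⟩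
  have hδ0 : 0 ≤ δ := by rw [hδdef]; positivity
  have hδ : ‖(hankelPencil L N S w η).meanRes - ((hankelPencil L N S w η).base -
      (hankelPencil L N S w η).selfEnergy (hankelPencil L N S w η).meanRes)⁻¹‖ ≤ δ := by
    -- The covariance factor of the pencil has norm at most b/N, which beats √K ≤ q√N.
    refine (Pencil.norm_meanRes_sub_le (by omega) hη hA (ρ := b / N) (by positivity)
      norm_hankelPencil_U_le norm_hankelPencil_V_le ?_).trans ?_
    · rw [hankelPencil_S_mul hN1, norm_smul, norm_inv, Complex.norm_natCast, inv_mul_eq_div]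
      gcongr
    · rw [hcard]
      calc _ ≤ η⁻¹ * (((2 * L : ℕ) : ℝ) ^ 2 * (16 * (b / N) *
            (q * √(N : ℝ) * (2 * ((2 * L : ℕ) : ℝ) * (2 * η⁻¹)))) * η⁻¹) := by gcongr
        _ = Cδ * (√(N : ℝ) / N) := by rw [hCδ]; ring
        _ = δ := by rw [hδdef, Real.sqrt_div_self, div_eq_mul_inv]
  obtain ⟨hκ, hτ, -⟩ := hankelPencil_meanRes_estimates hη hηw hN1 hL hSb hδ
  have hτim := meanTau_im_nonneg (L := L) (N := N) (S := S) hη hηw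
  have hκim := meanKappa_im_nonneg (L := L) (N := N) (S := S) hη hηw
  have hsim : 0 < (Complex.I * η + meanTau L N S w η).im := by
    simp only [Complex.add_im, Complex.mul_im, Complex.I_re, Complex.I_im, Complex.ofReal_re,
      Complex.ofReal_im]
    linarith
  refine ⟨Complex.I * η + meanTau L N S w η, hsim, ?_, fun B hB => ?_⟩
  · have hphi : ((L / N : ℝ) : ℂ) * (S * Sᴴ * ratInv (S * Sᴴ) w (meanKappa L N S w η)).trace =
        phi lam (L / N) w (meanKappa L N S w η) := by
      rw [trace_mul_ratInv hV hSV hl hw hκim, phi]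
    rw [hphi] at hτ
    have h3 := norm_phi_sub_le (lam := lam) (r := L / N) hw hκim (im_hFun_pos hsim).le hl hlb
      (by positivity)
    obtain ⟨s, hs⟩ : ∃ s : ℂ, s = Complex.I * η + meanTau L N S w η := ⟨_, rfl⟩
    rw [← hs] at h3 hκ hsim ⊢
    -- Besides the regularization iη, the defect consists of the error in the equation for τ and of
    -- the replacement of κ by h(s).
    have e : s - phi lam (L / N) w (hFun s) = Complex.I * η +
        ((meanTau L N S w η - phi lam (L / N) w (meanKappa L N S w η)) +
        (phi lam (L / N) w (meanKappa L N S w η) - phi lam (L / N) w (hFun s))) := by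
      rw [hs]; ring
    have h4 : ‖Complex.I * (η : ℂ)‖ = η := by
      rw [norm_mul, Complex.norm_I, one_mul, Complex.norm_real, Real.norm_of_nonneg hη.le]
    have hc2' := hc2.trans (le_abs_self c₂)
    have h5 : (L / N : ℝ) * (Fintype.card m * (b * δ)) ≤ |c₂| * b * δ := by
      calc _ = (L / N : ℝ) * Fintype.card m * (b * δ) := by ring
        _ ≤ |c₂| * (b * δ) := by gcongr
        _ = _ := by ring
    have h6 : (L / N : ℝ) * Fintype.card m * b ^ 2 * w.im⁻¹ ^ 2 *
        ‖meanKappa L N S w η - hFun s‖ ≤ |c₂| * b ^ 2 * w.im⁻¹ ^ 2 * δ := by gcongr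
    have h7 : |c₂| * b * δ + |c₂| * b ^ 2 * w.im⁻¹ ^ 2 * δ ≤ ε / 2 := by
      refine le_trans ?_ hDN
      rw [hδdef, hD, add_div]
      have : 0 ≤ (Cc + (Cδ + w.im⁻¹ ^ 2 * b * Cδ)) / √(N : ℝ) := by positivity
      have e2 : |c₂| * b * (Cδ / √(N : ℝ)) + |c₂| * b ^ 2 * w.im⁻¹ ^ 2 * (Cδ / √(N : ℝ)) =
          (|c₂| * b * Cδ + |c₂| * b ^ 2 * w.im⁻¹ ^ 2 * Cδ) / √(N : ℝ) := by ring
      rw [e2]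
      linarith
    rw [e]
    refine (norm_add_le _ _).trans ?_
    have h8 := norm_add_le (meanTau L N S w η - phi lam (L / N) w (meanKappa L N S w η))
      (phi lam (L / N) w (meanKappa L N S w η) - phi lam (L / N) w (hFun s))
    rw [h4]
    linarith
  · refine (integral_norm_linStat_sub_le hη hη1 hηw hN1 hL hSb hδ hB).trans ?_
    have hMinv : (Fintype.card m : ℝ)⁻¹ ≤ L / c₁ / N := by
      rw [inv_le_comm₀ hM (by positivity)]
      have : (L / c₁ / N : ℝ)⁻¹ = c₁ / (L / N) := by field_simp
      rw [this, div_le_iff₀ (by positivity)]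
      linarith
    have h1 : 8 * (√((N + 2 * L - 1 : ℕ) : ℝ) * (2 * ((2 * L : ℕ) : ℝ) *
        ((Fintype.card m : ℝ)⁻¹ * (2 * η⁻¹)))) ≤ Cc / √(N : ℝ) := by
      calc _ ≤ 8 * (q * √(N : ℝ) * (2 * ((2 * L : ℕ) : ℝ) * (L / c₁ / N * (2 * η⁻¹)))) := by
            gcongr
        _ = Cc * (√(N : ℝ) / N) := by rw [hCc]; ring
        _ = _ := by rw [Real.sqrt_div_self, div_eq_mul_inv]
    have h2 : w.im⁻¹ ^ 2 * (2 * η) * (2 * L * (b * gaussianMoment)) = A₁ * η := by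
      rw [hA₁]; ring
    have h3 : Cc / √(N : ℝ) + (δ + w.im⁻¹ ^ 2 * b * δ) ≤ ε / 2 := by
      refine le_trans ?_ hDN
      rw [hδdef, hD, add_div]
      have : 0 ≤ (|c₂| * b * Cδ + |c₂| * b ^ 2 * w.im⁻¹ ^ 2 * Cδ) / √(N : ℝ) := by positivity
      have e2 : Cc / √(N : ℝ) + (Cδ / √(N : ℝ) + w.im⁻¹ ^ 2 * b * (Cδ / √(N : ℝ))) =
          (Cc + (Cδ + w.im⁻¹ ^ 2 * b * Cδ)) / √(N : ℝ) := by ring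
      rw [e2]
      linarith
    rw [h2]
    linarith

end

end PastFuture

namespace PastFuture

/-! ### The deterministic equivalent -/

section

open scoped Matrix.Norms.L2Operator Kronecker

set_option linter.unusedSectionVars false

/-- Schwarz–Pick becomes a Lipschitz bound once Im s and Im t are bounded below and h is bounded
above. -/
theorem norm_hFun_sub_le {s t : ℂ} {σ H : ℝ} (hσ : 0 < σ) (hs : σ ≤ s.im) (ht : σ ≤ t.im)
    (hHs : ‖hFun s‖ ≤ H) (hHt : ‖hFun t‖ ≤ H) : ‖hFun s - hFun t‖ ≤ H / σ * ‖s - t‖ := by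
  have hs0 := hσ.trans_le hs
  have ht0 := hσ.trans_le ht
  have hH0 : 0 ≤ H := (norm_nonneg _).trans hHs
  have h := hFun_schwarzPick hs0 ht0
  rw [Complex.normSq_eq_norm_sq, Complex.normSq_eq_norm_sq] at h
  have h1 : ‖hFun s - hFun t‖ ^ 2 * (σ * σ) ≤ ‖s - t‖ ^ 2 * (H * H) := by
    calc _ ≤ ‖hFun s - hFun t‖ ^ 2 * (s.im * t.im) := by gcongr
      _ ≤ _ := h
      _ ≤ _ := by
        have e1 := ((le_abs_self _).trans (Complex.abs_im_le_norm (hFun s))).trans hHs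
        have e2 := ((le_abs_self _).trans (Complex.abs_im_le_norm (hFun t))).trans hHt
        have e3 := (im_hFun_pos hs0).le
        have e4 := (im_hFun_pos ht0).le
        gcongr
  refine abs_le_of_sq_le_sq' ?_ (by positivity) |>.2
  rw [mul_pow, div_pow, div_mul_eq_mul_div, le_div_iff₀ (by positivity)]
  calc _ = ‖hFun s - hFun t‖ ^ 2 * (σ * σ) := by ring
    _ ≤ _ := h1
    _ = _ := by ring

section

variable {m : Type*} [Fintype m] [DecidableEq m] {L N : ℕ} {S : Matrix m m ℂ} {w : ℂ}

theorem continuous_coloredField {K : ℕ} (S : Matrix m m ℂ) (t : ℕ) :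
    Continuous fun Ξ : Fin K → m → ℂ => coloredField S Ξ t := by
  unfold coloredField extendField
  by_cases h : t < K
  · simp only [h, dite_true]
    fun_prop
  · simp only [h, dite_false]
    exact continuous_const

theorem continuous_bigW_coloredField {K : ℕ} (S : Matrix m m ℂ) :
    Continuous fun Ξ : Fin K → m → ℂ => bigW L N (coloredField S Ξ) := by
  refine continuous_matrix fun x c => ?_
  simp only [bigW, Matrix.of_apply]
  split_ifs
  · exact continuous_const.mul ((continuous_apply x.2).comp (continuous_coloredField S _))
  · exact continuous_const

theorem isUnit_bigH_sub (hw : 0 < w.im) (y : ℕ → m → ℂ) : IsUnit (bigH L N y - w • 1) :=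
  (dissipative_isHermitian_sub (bigH_isHermitian (L := L) (N := N) y) w).isUnit hw

theorem norm_bigQ_le (hw : 0 < w.im) (y : ℕ → m → ℂ) : ‖bigQ L N y w‖ ≤ w.im⁻¹ :=
  (dissipative_isHermitian_sub (bigH_isHermitian (L := L) (N := N) y) w).norm_inv_le hw

theorem continuous_bigQ_coloredField {K : ℕ} (S : Matrix m m ℂ) (hw : 0 < w.im) :
    Continuous fun Ξ : Fin K → m → ℂ => bigQ L N (coloredField S Ξ) w := by
  have h := continuous_bigW_coloredField (L := L) (N := N) (K := K) S
  refine continuous_inv_of_isUnit ?_ fun Ξ => isUnit_bigH_sub hw _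
  unfold bigH
  exact (((h.matrix_mul continuous_const).matrix_mul h.matrix_conjTranspose).neg).sub
    continuous_const

theorem continuous_linStat (B : Matrix m m ℂ) :
    Continuous (linStat (L := L) B) := by
  unfold linStat pBlock
  fun_prop

theorem norm_linStat_le (hL : 0 < L) [Nonempty m] (B : Matrix m m ℂ)
    (Y : Matrix ((Bool × Fin L) × m) ((Bool × Fin L) × m) ℂ) : ‖linStat B Y‖ ≤ ‖B‖ * ‖Y‖ := by
  have hL' : (0 : ℝ) < L := by exact_mod_cast hL
  have hM : (0 : ℝ) < Fintype.card m := by exact_mod_cast Fintype.card_pos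
  have h : ∀ i : Fin L, ‖(B * pBlock (true, i) Y).trace‖ ≤ Fintype.card m * (‖B‖ * ‖Y‖) := by
    intro i
    refine (norm_trace_le _).trans (mul_le_mul_of_nonneg_left ?_ hM.le)
    refine (norm_mul_le _ _).trans (mul_le_mul_of_nonneg_left ?_ (norm_nonneg _))
    rw [← conjTranspose_blockIncl_mul_mul]
    have hU := norm_blockIncl_le (m := m) (true, i)
    have hU' : ‖(blockIncl m (true, i))ᴴ‖ ≤ 1 := by rwa [Matrix.l2_opNorm_conjTranspose]
    refine (Matrix.l2_opNorm_mul _ _).trans ?_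
    refine (mul_le_of_le_one_right (norm_nonneg _) hU).trans ?_
    exact (Matrix.l2_opNorm_mul _ _).trans (mul_le_of_le_one_left (norm_nonneg _) hU')
  rw [linStat, norm_mul, norm_inv, norm_mul, Complex.norm_natCast, Complex.norm_natCast,
    inv_mul_le_iff₀ (by positivity)]
  refine (norm_sum_le _ _).trans ((Finset.sum_le_sum fun i _ => h i).trans (le_of_eq ?_))
  simp [mul_assoc]

theorem integrable_linStat_bigQ (hL : 0 < L) [Nonempty m] (S B : Matrix m m ℂ) (hw : 0 < w.im)
    (K : ℕ) : Integrable (fun Ξ : Fin K → m → ℂ => linStat B (bigQ L N (coloredField S Ξ) w))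
      (gaussianField K m) := by
  refine Integrable.of_bound (C := ‖B‖ * w.im⁻¹) ?_ (Eventually.of_forall fun Ξ => ?_)
  · exact ((continuous_linStat B).comp
      (continuous_bigQ_coloredField S hw)).aestronglyMeasurable
  · exact (norm_linStat_le hL B _).trans
      (mul_le_mul_of_nonneg_left (norm_bigQ_le hw _) (norm_nonneg _))

end

/-- For large dimensions, the linear statistics of the resolvent are close, in mean, to the
deterministic equivalent. -/
theorem exists_deterministic_equivalent (L : ℕ) (hL : 0 < L) {a b c₁ c₂ : ℝ} (ha : 0 < a)
    (hb : 0 < b) (hc₁ : 0 < c₁) (hc₂ : 0 < c₂) {w : ℂ} (hw : 0 < w.im) {ε : ℝ} (hε : 0 < ε) :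
    ∃ N₀ : ℕ, ∀ N, N₀ ≤ N → ∀ {m : Type} [Fintype m] [DecidableEq m] [Nonempty m]
      (S V : Matrix m m ℂ) (lam : m → ℝ), V * Vᴴ = 1 →
      S * Sᴴ = V * Matrix.diagonal (fun k => (lam k : ℂ)) * Vᴴ → (∀ k, a ≤ lam k) →
      (∀ k, lam k ≤ b) → c₁ ≤ (L / N : ℝ) * Fintype.card m → (L / N : ℝ) * Fintype.card m ≤ c₂ →
      ∀ s : ℂ, 0 < s.im → s = phi lam (L / N) w (hFun s) →
        ∀ B : Matrix m m ℂ, ‖B‖ ≤ 1 →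
          ∫ Ξ, ‖linStat B (bigQ L N (coloredField S Ξ) w) - (Fintype.card m : ℂ)⁻¹ *
            (B * ratInv (S * Sᴴ) w (hFun s)).trace‖ ∂(gaussianField (N + 2 * L - 1) m) ≤ ε := by
  obtain ⟨C, hC, ε₀, hε₀, σ, hσ, H, hH, hstab⟩ := fixedPoint_stability ha hb hc₁ hc₂ hw
  obtain ⟨A, hA⟩ : ∃ A : ℝ, A = w.im⁻¹ ^ 2 * b * (H / σ * C) := ⟨_, rfl⟩
  have hA0 : 0 ≤ A := by rw [hA]; positivity
  -- Below ε₀ the stability estimate applies; the remaining total error is ε'(1 + A), where A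
  -- transports an error on s to the normalized trace.
  obtain ⟨ε', hε'⟩ : ∃ x : ℝ, x = min ε₀ (ε / (1 + A)) := ⟨_, rfl⟩
  have hε'0 : 0 < ε' := hε' ▸ lt_min hε₀ (by positivity)
  have hε'1 : ε' ≤ ε₀ := hε'.le.trans (min_le_left _ _)
  have hε'2 : ε' * (1 + A) ≤ ε := by
    have := hε'.le.trans (min_le_right ε₀ (ε / (1 + A)))
    rwa [le_div_iff₀ (by positivity)] at this
  obtain ⟨N₀, hN₀⟩ := exists_approx_fixedPoint L hL hb hc₁ (c₂ := c₂) hw hε'0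
  refine ⟨N₀, fun N hN m _ _ _ S V lam hV hSV hla hlb hc1 hc2 t ht hteq B hB => ?_⟩
  have hl0 : ∀ k, 0 ≤ lam k := fun k => ha.le.trans (hla k)
  obtain ⟨s, hs, hsapp, hsB⟩ := hN₀ N hN S V lam hV hSV hl0 hlb hc1 hc2
  obtain ⟨hσs, hHs, hst⟩ := hstab lam (L / N) hla hlb (by positivity) hc1 hc2 s ε' hs hε'1 hsapp
  -- The exact fixed point is an approximate one with error 0, so the same bounds σ and H hold for
  -- it.
  obtain ⟨hσt, hHt, -⟩ := hstab lam (L / N) hla hlb (by positivity) hc1 hc2 t 0 ht hε₀.le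
    (by rw [← hteq]; simp)
  have hh : ‖hFun s - hFun t‖ ≤ H / σ * C * ε' := by
    refine (norm_hFun_sub_le hσ hσs hσt hHs hHt).trans ?_
    rw [mul_assoc]
    exact mul_le_mul_of_nonneg_left (hst t ht hteq) (by positivity)
  have hSb : ‖S * Sᴴ‖ ≤ b := norm_spectral_le hV hSV hb.le hl0 hlb
  have hM : (0 : ℝ) < Fintype.card m := by exact_mod_cast Fintype.card_pos
  have hdet : ‖(Fintype.card m : ℂ)⁻¹ * (B * ratInv (S * Sᴴ) w (hFun s)).trace -
      (Fintype.card m : ℂ)⁻¹ * (B * ratInv (S * Sᴴ) w (hFun t)).trace‖ ≤ A * ε' := by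
    rw [← mul_sub, ← Matrix.trace_sub, ← Matrix.mul_sub, norm_mul, norm_inv,
      Complex.norm_natCast, inv_mul_le_iff₀ hM]
    refine (norm_trace_le _).trans (mul_le_mul_of_nonneg_left ?_ hM.le)
    refine (norm_mul_le _ _).trans ?_
    refine (mul_le_of_le_one_left (norm_nonneg _) hB).trans ?_
    refine (norm_ratInv_sub_le hw (im_hFun_pos hs).le (im_hFun_pos ht).le S hSb).trans ?_
    rw [hA, mul_assoc (w.im⁻¹ ^ 2 * b)]
    exact mul_le_mul_of_nonneg_left hh (by positivity)
  have hint : ∀ q : ℂ, Integrable (fun Ξ => ‖linStat B (bigQ L N (coloredField S Ξ) w) - q‖)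
      (gaussianField (N + 2 * L - 1) m) := fun q =>
    ((integrable_linStat_bigQ hL S B hw (N + 2 * L - 1)).sub (integrable_const q)).norm
  calc _ ≤ ∫ Ξ, (‖linStat B (bigQ L N (coloredField S Ξ) w) - (Fintype.card m : ℂ)⁻¹ *
            (B * ratInv (S * Sᴴ) w (hFun s)).trace‖ + A * ε') ∂(gaussianField (N + 2 * L - 1) m) := by
        refine integral_mono (hint _) ((hint _).add (integrable_const _)) fun Ξ => ?_
        exact (norm_sub_le_norm_sub_add_norm_sub _ _ _).trans (add_le_add_right hdet _)
    _ ≤ ε' + A * ε' := by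
        rw [integral_add (hint _) (integrable_const _), integral_const]
        simpa using hsB B hB
    _ = ε' * (1 + A) := by ring
    _ ≤ ε := hε'2

end

end PastFuture

namespace PastFuture

section

open scoped Matrix.Norms.L2Operator Kronecker

set_option linter.unusedSectionVars false

/-! ### Existence of the fixed point -/

/-- Repeating every eigenvalue k times while multiplying N by k leaves the equation unchanged. A
fixed equation is thus realized by models of arbitrarily large dimension. -/
theorem phi_comp_fst {ι : Type*} [Fintype ι] (lam : ι → ℝ) (L N : ℕ) {k : ℕ} (hk : 0 < k)
    (w κ : ℂ) : phi (fun x : ι × Fin k => lam x.1) (L / (N * k : ℕ)) w κ = phi lam (L / N) w κ := by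
  have hk' : (k : ℂ) ≠ 0 := by exact_mod_cast hk.ne'
  simp only [phi, Fintype.sum_prod_type, Finset.sum_const, Finset.card_univ, Fintype.card_fin,
    nsmul_eq_mul, ← Finset.mul_sum]
  push_cast
  rw [← mul_assoc]
  congr 1
  rw [div_mul_eq_mul_div, mul_div_mul_right _ _ hk']

theorem ratio_blowUp {ι : Type*} [Fintype ι] (L N : ℕ) {k : ℕ} (hk : 0 < k) :
    (L / (N * k : ℕ) : ℝ) * Fintype.card (ι × Fin k) = L / N * Fintype.card ι := by
  have hk' : (k : ℝ) ≠ 0 := by exact_mod_cast hk.ne'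
  rw [Fintype.card_prod, Fintype.card_fin]
  push_cast
  rw [div_mul_eq_mul_div, div_mul_eq_mul_div, ← mul_assoc, mul_div_mul_right _ _ hk']

theorem diagonal_sqrt_mul_conjTranspose {m : Type*} [Fintype m] [DecidableEq m] {lam : m → ℝ}
    (hl : ∀ k, 0 ≤ lam k) :
    Matrix.diagonal (fun k => ((√(lam k) : ℝ) : ℂ)) *
      (Matrix.diagonal (fun k => ((√(lam k) : ℝ) : ℂ)))ᴴ =
      1 * Matrix.diagonal (fun k => (lam k : ℂ)) * (1 : Matrix m m ℂ)ᴴ := by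
  rw [Matrix.diagonal_conjTranspose, Matrix.diagonal_mul_diagonal, Matrix.conjTranspose_one,
    Matrix.one_mul, Matrix.mul_one]
  congr 1
  funext k
  rw [Pi.star_apply, Complex.star_def, Complex.conj_ofReal, ← Complex.ofReal_mul,
    Real.mul_self_sqrt (hl k)]

/-- The blown-up models provide approximate solutions of arbitrary accuracy of one and the same
equation; stability and compactness turn them into an exact one. -/
theorem exists_fixedPoint {L N : ℕ} (hL : 0 < L) (hN : 0 < N) {a b : ℝ} (ha : 0 < a) (hb : 0 < b)
    {w : ℂ} (hw : 0 < w.im) {ι : Type} [Fintype ι] [DecidableEq ι] [Nonempty ι] (lam : ι → ℝ)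
    (hla : ∀ k, a ≤ lam k) (hlb : ∀ k, lam k ≤ b) :
    ∃ s : ℂ, 0 < s.im ∧ s = phi lam (L / N) w (hFun s) := by
  have hL' : (0 : ℝ) < L := by exact_mod_cast hL
  have hN' : (0 : ℝ) < N := by exact_mod_cast hN
  have hM : (0 : ℝ) < Fintype.card ι := by exact_mod_cast Fintype.card_pos
  refine exists_fixedPoint_of_approx ha hb hw lam (L / N) hla hlb (by positivity) fun ε hε => ?_
  obtain ⟨N₀, hN₀⟩ := exists_approx_fixedPoint L hL hb (c₁ := L / N * Fintype.card ι)
    (c₂ := L / N * Fintype.card ι) (by positivity) hw hε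
  have : NeZero (N₀ + 1) := ⟨by omega⟩
  -- N₀ + 1 copies ensure that the blown-up number of columns is at least N₀, whatever N ≥ 1 is.
  have hge : N₀ ≤ N * (N₀ + 1) := by nlinarith
  have hl : ∀ x : ι × Fin (N₀ + 1), 0 ≤ lam x.1 := fun x => ha.le.trans (hla _)
  obtain ⟨s, hs, h, -⟩ := hN₀ _ hge (m := ι × Fin (N₀ + 1)) _ 1 (fun x => lam x.1) (by simp)
    (diagonal_sqrt_mul_conjTranspose hl) hl (fun x => hlb _)
    (ratio_blowUp L N (Nat.succ_pos N₀)).ge (ratio_blowUp L N (Nat.succ_pos N₀)).le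
  rw [phi_comp_fst lam L N (Nat.succ_pos N₀)] at h
  exact ⟨s, hs, h⟩

/-! ### Block structure of the resolvent -/

/-- Eliminating the second block of (H - w)X = 1 leaves (KK^* - w²)X₁₁ = w. Hence the variable w
with w² = z throughout the argument. -/
theorem inv_submatrix_inl_eq {p q r : Type*} [Fintype p] [Fintype q] [Fintype r] [DecidableEq p]
    [DecidableEq q] [DecidableEq r] (e : p ⊕ q ≃ r) {H : Matrix r r ℂ} {K : Matrix p q ℂ}
    (hH : H.submatrix e e = Matrix.fromBlocks 0 K Kᴴ 0) {w : ℂ} (hw : 0 < w.im)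
    (hw2 : 0 < (w ^ 2).im) :
    ((H - w • (1 : Matrix r r ℂ))⁻¹).submatrix (e ∘ Sum.inl) (e ∘ Sum.inl) =
      w • (K * Kᴴ - w ^ 2 • (1 : Matrix p p ℂ))⁻¹ := by
  have hHh : H.IsHermitian := by
    have h : (H.submatrix e e).IsHermitian := by
      rw [hH]
      exact Matrix.IsHermitian.fromBlocks Matrix.isHermitian_zero rfl Matrix.isHermitian_zero
    have := h.submatrix e.symm
    simpa using this
  have hu := (dissipative_isHermitian_sub hHh w).isUnit_det hw
  have hKu := (dissipative_isHermitian_sub (Matrix.isHermitian_mul_conjTranspose_self K)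
    (w ^ 2)).isUnit_det hw2
  obtain ⟨X, hX⟩ : ∃ X, X = ((H - w • (1 : Matrix r r ℂ))⁻¹).submatrix e e := ⟨_, rfl⟩
  have h1 : Matrix.fromBlocks (-(w • 1)) K Kᴴ (-(w • 1)) * X = 1 := by
    have h2 : (H - w • (1 : Matrix r r ℂ)).submatrix e e =
        Matrix.fromBlocks (-(w • 1)) K Kᴴ (-(w • 1)) := by
      ext i j
      have h3 := congrFun (congrFun hH i) j
      rw [Matrix.submatrix_apply] at h3
      rw [Matrix.submatrix_apply, Matrix.sub_apply, h3, Matrix.smul_apply, Matrix.one_apply]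
      rcases i with i | i <;> rcases j with j | j <;> simp [Matrix.one_apply]
    rw [← h2, hX, Matrix.submatrix_mul_equiv, Matrix.mul_nonsing_inv _ hu,
      Matrix.submatrix_one_equiv]
  rw [← Matrix.fromBlocks_toBlocks X, Matrix.fromBlocks_multiply, ← Matrix.fromBlocks_one,
    Matrix.fromBlocks_inj] at h1
  obtain ⟨e1, -, e2, -⟩ := h1
  have e3 : ((H - w • (1 : Matrix r r ℂ))⁻¹).submatrix (e ∘ Sum.inl) (e ∘ Sum.inl) =
      X.toBlocks₁₁ := by rw [hX]; rfl
  rw [e3]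
  have e4 : (K * Kᴴ - w ^ 2 • (1 : Matrix p p ℂ)) * X.toBlocks₁₁ = w • 1 := by
    rw [Matrix.neg_mul, Matrix.smul_mul, Matrix.one_mul, ← sub_eq_add_neg, sub_eq_zero] at e2
    have e5 : K * (w • X.toBlocks₂₁) - w ^ 2 • X.toBlocks₁₁ =
        w • (-(w • 1) * X.toBlocks₁₁ + K * X.toBlocks₂₁) := by
      rw [Matrix.neg_mul, Matrix.smul_mul, Matrix.one_mul, Matrix.mul_smul, smul_add, smul_neg,
        smul_smul, sq]
      abel
    rw [Matrix.sub_mul, Matrix.mul_assoc, e2, Matrix.smul_mul, Matrix.one_mul, e5, e1]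
  calc _ = (K * Kᴴ - w ^ 2 • (1 : Matrix p p ℂ))⁻¹ *
        ((K * Kᴴ - w ^ 2 • (1 : Matrix p p ℂ)) * X.toBlocks₁₁) := by
        rw [← Matrix.mul_assoc, Matrix.nonsing_inv_mul _ hKu, Matrix.one_mul]
    _ = _ := by rw [e4, Matrix.mul_smul, Matrix.mul_one]

section

variable {m : Type*} [Fintype m] [DecidableEq m] {L N : ℕ} {w : ℂ}

/-- The splitting of the rows into future rows and past rows. -/
def splitRows (L : ℕ) (m : Type*) : (Fin L × m) ⊕ (Fin L × m) ≃ (Bool × Fin L) × m where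
  toFun := Sum.elim (fun x => ((true, x.1), x.2)) fun x => ((false, x.1), x.2)
  invFun x := if x.1.1 then Sum.inl (x.1.2, x.2) else Sum.inr (x.1.2, x.2)
  left_inv := by rintro (x | x) <;> rfl
  right_inv := by rintro ⟨⟨β, i⟩, j⟩; cases β <;> rfl

/-- The product of the future matrix and of the adjoint of the past matrix. -/
noncomputable def crossH (L N : ℕ) (y : ℕ → m → ℂ) : Matrix (Fin L × m) (Fin L × m) ℂ :=
  (bigH L N y).submatrix (fun x => ((true, x.1), x.2)) fun x => ((false, x.1), x.2)

theorem bigH_apply (y : ℕ → m → ℂ) (x x' : (Bool × Fin L) × m) :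
    bigH L N y x x' = if x.1.1 = x'.1.1 then 0 else
      ∑ ν : Fin N, ((√(N : ℝ) : ℝ) : ℂ)⁻¹ * y (rowOffset x.1 + ν) x.2 *
        star (((√(N : ℝ) : ℝ) : ℂ)⁻¹ * y (rowOffset x'.1 + ν) x'.2) := by
  have h : ∀ c, (bigW L N y * (flipMat 0 ⊗ₖ (1 : Matrix (Fin N) (Fin N) ℂ))) x c =
      -bigW L N y x (!c.1, c.2) := by
    rintro ⟨β, ν⟩
    rw [Matrix.mul_apply, Finset.sum_eq_single (!β, ν)]
    · simp [flipMat]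
    · rintro ⟨β', ν'⟩ - hne
      by_cases hν : ν' = ν
      · have hβ : β' = β := by
          by_contra hβ
          refine hne (Prod.ext ?_ hν)
          cases β <;> cases β' <;> simp_all
        simp [flipMat, hβ]
      · simp [hν]
    · simp
  rw [bigH, Matrix.neg_apply, Matrix.mul_apply]
  simp_rw [h]
  simp only [Matrix.conjTranspose_apply, Fintype.sum_prod_type, Fintype.sum_bool, bigW,
    Matrix.of_apply]
  obtain ⟨⟨β, i⟩, j⟩ := x
  obtain ⟨⟨β', i'⟩, j'⟩ := x'
  cases β <;> cases β' <;> simp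

theorem bigH_submatrix_splitRows (y : ℕ → m → ℂ) :
    (bigH L N y).submatrix (splitRows L m) (splitRows L m) =
      Matrix.fromBlocks 0 (crossH L N y) (crossH L N y)ᴴ 0 := by
  ext (i | i) (j | j)
  · simp [splitRows, bigH_apply]
  · rfl
  · rw [Matrix.fromBlocks_apply₂₁, Matrix.conjTranspose_apply]
    exact ((bigH_isHermitian y).apply _ _).symm
  · simp [splitRows, bigH_apply]

theorem linStat_bigQ_eq (hw : 0 < w.im) (hw2 : 0 < (w ^ 2).im) (d : m → ℂ) (y : ℕ → m → ℂ) :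
    linStat (Matrix.diagonal d) (bigQ L N y w) = w * (((L : ℂ) * Fintype.card m)⁻¹ *
      ∑ x : Fin L × m, d x.2 *
        (crossH L N y * (crossH L N y)ᴴ - w ^ 2 • (1 : Matrix (Fin L × m) (Fin L × m) ℂ))⁻¹ x x) := by
  have h := inv_submatrix_inl_eq (splitRows L m) (bigH_submatrix_splitRows (N := N) y) hw hw2
  rw [linStat, mul_left_comm w]
  congr 1
  rw [Finset.mul_sum, Fintype.sum_prod_type]
  refine Finset.sum_congr rfl fun i _ => ?_
  rw [Matrix.trace]
  refine Finset.sum_congr rfl fun j _ => ?_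
  rw [Matrix.diag_apply, Matrix.diagonal_mul]
  have h2 := congrFun (congrFun h (i, j)) (i, j)
  rw [Matrix.submatrix_apply, Matrix.smul_apply, smul_eq_mul] at h2
  rw [mul_left_comm, ← h2]
  rfl

end

theorem crossH_eq {M : ℕ} (L N : ℕ) (y : ℕ → Fin M → ℂ) :
    crossH L N y = Wf L N y * (Wp L N y)ᴴ := by
  ext x x'
  rw [crossH, Matrix.submatrix_apply, bigH_apply, if_neg (by simp), Matrix.mul_apply]
  simp [rowOffset, Wf, Wp]

theorem crossH_mul_conjTranspose {M : ℕ} (L N : ℕ) (y : ℕ → Fin M → ℂ) :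
    crossH L N y * (crossH L N y)ᴴ = gram L N y := by
  rw [crossH_eq, gram, Matrix.conjTranspose_mul, Matrix.conjTranspose_conjTranspose,
    ← Matrix.mul_assoc]

/-! ### Spectral measures -/

theorem exists_spectral {p : Type*} [Fintype p] [DecidableEq p] {A : Matrix p p ℂ}
    (hA : A.IsHermitian) : ∃ V : Matrix p p ℂ, V * Vᴴ = 1 ∧
      A = V * Matrix.diagonal (fun k => (hA.eigenvalues k : ℂ)) * Vᴴ := by
  refine ⟨hA.eigenvectorUnitary, Unitary.coe_mul_star_self _, ?_⟩
  conv_lhs => rw [hA.spectral_theorem]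
  rfl

theorem inv_sub_smul_spectral {p : Type*} [Fintype p] [DecidableEq p] {A V : Matrix p p ℂ}
    {lam : p → ℝ} (hV : V * Vᴴ = 1) (hA : A = V * Matrix.diagonal (fun k => (lam k : ℂ)) * Vᴴ)
    (hl : ∀ k, 0 ≤ lam k) {z : ℂ} (hz : 0 < z.im) :
    (A - z • (1 : Matrix p p ℂ))⁻¹ = V * Matrix.diagonal (fun k => ((lam k : ℂ) - z)⁻¹) * Vᴴ := by
  have h := ratInv_spectral hV hA hl hz (κ := -1) (by simp)
  rw [ratInv, neg_smul, one_smul, sub_neg_eq_add, neg_add_eq_sub] at h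
  rw [h]
  congr 3
  funext k
  congr 1
  ring

/-- A convex combination of diagonal entries of the resolvent of a positive semidefinite matrix is
the Stieltjes transform of a probability measure. -/
theorem exists_measure_resolvent {p : Type*} [Fintype p] [DecidableEq p] {A : Matrix p p ℂ}
    (hA : A.PosSemidef) {d : p → ℝ} (hd : ∀ x, 0 ≤ d x) (hd1 : ∑ x, d x = 1) :
    ∃ μ : Measure ℝ, IsProbabilityMeasure μ ∧ μ (Set.Iio 0) = 0 ∧ ∀ z : ℂ, 0 < z.im →
      ∫ x : ℝ, ((x : ℂ) - z)⁻¹ ∂μ = ∑ x, (d x : ℂ) * (A - z • (1 : Matrix p p ℂ))⁻¹ x x := by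
  obtain ⟨V, hV, hAV⟩ := exists_spectral hA.1
  have hl := hA.eigenvalues_nonneg
  -- The mass at the k-th eigenvalue is the average, with weights d, of the squared moduli in the
  -- k-th eigenvector; these masses add up to 1 because V is unitary.
  obtain ⟨g, hg⟩ : ∃ g : p → ℝ, g = fun k => ∑ x, d x * Complex.normSq (V x k) := ⟨_, rfl⟩
  have hg0 : ∀ k, 0 ≤ g k := fun k => hg ▸ Finset.sum_nonneg fun x _ =>
    mul_nonneg (hd x) (Complex.normSq_nonneg _)
  have hg1 : ∑ k, g k = 1 := by
    rw [hg, Finset.sum_comm, ← hd1]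
    refine Finset.sum_congr rfl fun x _ => ?_
    rw [← Finset.mul_sum]
    have h := congrFun (congrFun hV x) x
    rw [Matrix.mul_apply, Matrix.one_apply_eq] at h
    have h2 : ((∑ k, Complex.normSq (V x k) : ℝ) : ℂ) = 1 := by
      rw [← h]
      push_cast
      refine Finset.sum_congr rfl fun k _ => ?_
      rw [Matrix.conjTranspose_apply, Complex.star_def, Complex.mul_conj]
    rw [Complex.ofReal_eq_one.1 h2, mul_one]
  refine ⟨∑ k, ENNReal.ofReal (g k) • Measure.dirac (hA.1.eigenvalues k), ⟨?_⟩, ?_, fun z hz => ?_⟩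
  · simp only [Measure.coe_finsetSum, Finset.sum_apply, Measure.smul_apply, measure_univ,
      smul_eq_mul, mul_one]
    rw [← ENNReal.ofReal_sum_of_nonneg fun k _ => hg0 k, hg1, ENNReal.ofReal_one]
  · simp only [Measure.coe_finsetSum, Finset.sum_apply, Measure.smul_apply, smul_eq_mul]
    refine Finset.sum_eq_zero fun k _ => ?_
    rw [Measure.dirac_apply' _ measurableSet_Iio, Set.indicator_of_notMem, mul_zero]
    simpa using hl k
  · have : ∀ k : p, IsFiniteMeasure (ENNReal.ofReal (g k) • Measure.dirac (hA.1.eigenvalues k)) :=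
      fun k => Measure.smul_finite _ ENNReal.ofReal_ne_top
    rw [integral_finsetSum_measure fun k _ => integrable_inv_ofReal_sub _ hz.ne']
    simp only [integral_smul_measure, integral_dirac, ENNReal.toReal_ofReal (hg0 _)]
    have h3 : ∀ x, (A - z • (1 : Matrix p p ℂ))⁻¹ x x =
        ∑ k, ((Complex.normSq (V x k) : ℝ) : ℂ) * ((hA.1.eigenvalues k : ℂ) - z)⁻¹ := by
      intro x
      rw [inv_sub_smul_spectral hV hAV hl hz, Matrix.mul_apply]
      refine Finset.sum_congr rfl fun k _ => ?_
      have h4 : V x k * star (V x k) = (Complex.normSq (V x k) : ℂ) := Complex.mul_conj _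
      rw [Matrix.mul_diagonal, Matrix.conjTranspose_apply, mul_right_comm, h4]
    simp_rw [h3, Finset.mul_sum]
    rw [Finset.sum_comm]
    refine Finset.sum_congr rfl fun k _ => ?_
    rw [Complex.real_smul, hg]
    push_cast
    rw [Finset.sum_mul]
    refine Finset.sum_congr rfl fun x _ => ?_
    ring

end

end PastFuture

namespace PastFuture

section

open scoped Matrix.Norms.L2Operator Kronecker

set_option linter.unusedSectionVars false

/-! ### The canonical equation -/

theorem exists_sq_eq_quadrant {z : ℂ} (hz : 0 < z.im) :
    ∃ w : ℂ, w ^ 2 = z ∧ 0 < w.re ∧ 0 < w.im := by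
  obtain ⟨w, hw⟩ := IsAlgClosed.exists_pow_nat_eq z (n := 2) (by norm_num)
  have h : 2 * (w.re * w.im) = z.im := by
    rw [← hw, sq, Complex.mul_im]
    ring
  have h' : 0 < w.re * w.im := by linarith
  rcases pos_and_pos_or_neg_and_neg_of_mul_pos h' with ⟨h1, h2⟩ | ⟨h1, h2⟩
  · exact ⟨w, hw, h1, h2⟩
  · exact ⟨-w, by rw [neg_sq, hw], by simpa using h1, by simpa using h2⟩

theorem im_sq_pos {w : ℂ} (h1 : 0 < w.re) (h2 : 0 < w.im) : 0 < (w ^ 2).im := by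
  rw [sq, Complex.mul_im]
  positivity

/-- From 2 Re w · Im(wt) = Im(w²t) + |w|² Im t. The two half-plane conditions on t and zt thus place
s = c w t in the upper half-plane. -/
theorem im_mul_pos_of_quadrant {w t : ℂ} (hw : 0 < w.re) (h1 : 0 < t.im)
    (h2 : 0 < (w ^ 2 * t).im) : 0 < (w * t).im := by
  have h : 2 * w.re * (w * t).im = (w ^ 2 * t).im + Complex.normSq w * t.im := by
    simp only [sq, Complex.mul_im, Complex.mul_re, Complex.normSq_apply]
    ring
  have h3 : 0 < 2 * w.re * (w * t).im := by
    rw [h]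
    exact add_pos_of_pos_of_nonneg h2 (mul_nonneg (Complex.normSq_nonneg _) h1.le)
  exact pos_of_mul_pos_right h3 (by positivity)

theorem inv_smul_of_ne_zero {p : Type*} [Fintype p] [DecidableEq p] {k : ℂ} (hk : k ≠ 0)
    (A : Matrix p p ℂ) : (k • A)⁻¹ = k⁻¹ • A⁻¹ := by
  by_cases h : IsUnit A.det
  · refine Matrix.inv_eq_right_inv ?_
    rw [Matrix.smul_mul, Matrix.mul_smul, Matrix.mul_nonsing_inv _ h, smul_smul,
      mul_inv_cancel₀ hk, one_smul]
  · have h' : ¬ IsUnit (k • A).det := by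
      rw [Matrix.det_smul]
      intro h2
      exact h (isUnit_of_mul_isUnit_right h2)
    rw [Matrix.nonsing_inv_apply_not_isUnit _ h, Matrix.nonsing_inv_apply_not_isUnit _ h',
      smul_zero]

theorem canonical_coef_eq (c : ℝ) (w t : ℂ) :
    w ^ 2 * c * t / (1 - w ^ 2 * (c : ℂ) ^ 2 * t ^ 2) = w * hFun (c * w * t) := by
  rw [hFun, ← mul_div_assoc]
  congr 1 <;> ring

section

variable {M : ℕ}

theorem resolventOf_sq (R : Matrix (Fin M) (Fin M) ℂ) (c : ℝ) {w : ℂ} (hw : w ≠ 0) (t : ℂ) :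
    resolventOf R c (w ^ 2) t = w⁻¹ • ratInv R w (hFun (c * w * t)) := by
  rw [resolventOf, canonical_coef_eq, ratInv, ← inv_smul_of_ne_zero hw, smul_sub, smul_neg,
    smul_smul, smul_smul, sq]

variable {L N : ℕ} {R V : Matrix (Fin M) (Fin M) ℂ} {lam : Fin M → ℝ} {a b : ℝ}

/-- The change of variable s = c w t, with c/M = L/N. A solution s is only required to lie in the
upper half-plane; the conditions on t and zt come back from the sector property of fixed points, as
Im(w̄s) = c|w|² Im t and Im(ws) = c Im(zt). -/
theorem isCanonicalSolution_sq_iff (hM : 0 < M) (hL : 0 < L) (hN : 0 < N) (hV : V * Vᴴ = 1)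
    (hR : R = V * Matrix.diagonal (fun k => (lam k : ℂ)) * Vᴴ) (hl : ∀ k, 0 < lam k) {w : ℂ}
    (hre : 0 < w.re) (him : 0 < w.im) (t : ℂ) :
    IsCanonicalSolution R (ratio M L N) (w ^ 2) t ↔
      0 < ((ratio M L N : ℂ) * w * t).im ∧
        (ratio M L N : ℂ) * w * t = phi lam (L / N) w (hFun (ratio M L N * w * t)) := by
  have hM' : (0 : ℝ) < M := by exact_mod_cast hM
  have hL' : (0 : ℝ) < L := by exact_mod_cast hL
  have hN' : (0 : ℝ) < N := by exact_mod_cast hN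
  have : Nonempty (Fin M) := ⟨⟨0, hM⟩⟩
  have hw : w ≠ 0 := fun h => by simp [h] at hre
  obtain ⟨c, hc⟩ : ∃ c, c = ratio M L N := ⟨_, rfl⟩
  have hc0 : 0 < c := by rw [hc, ratio]; positivity
  have hcC : (c : ℂ) ≠ 0 := by exact_mod_cast hc0.ne'
  rw [← hc]
  have hrat : (c : ℂ) * (M : ℂ)⁻¹ = ((L / N : ℝ) : ℂ) := by
    have h1 : c * (M : ℝ)⁻¹ = L / N := by
      rw [hc, ratio]
      field_simp
    rw [← h1]
    push_cast
    rfl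
  obtain ⟨s, hs⟩ : ∃ s, s = (c : ℂ) * w * t := ⟨_, rfl⟩
  have key : 0 < s.im → ((t = (M : ℂ)⁻¹ * (R * resolventOf R c (w ^ 2) t).trace) ↔
      s = phi lam (L / N) w (hFun s)) := by
    intro h
    rw [resolventOf_sq R c hw, ← hs, Matrix.mul_smul, Matrix.trace_smul,
      trace_mul_ratInv hV hR (fun k => (hl k).le) him (im_hFun_pos h).le, phi, ← hrat,
      smul_eq_mul]
    obtain ⟨q, hq⟩ : ∃ x, x = ∑ k, (lam k : ℂ) / (-w - hFun s * lam k) := ⟨_, rfl⟩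
    rw [← hq]
    constructor
    · intro ht
      rw [hs]
      conv_lhs => rw [ht]
      field_simp
    · intro h2
      have h3 : (c : ℂ) * w * t = c * w * ((M : ℂ)⁻¹ * (w⁻¹ * q)) := by
        rw [← hs, h2]
        field_simp
      exact mul_left_cancel₀ (mul_ne_zero hcC hw) h3
  rw [IsCanonicalSolution, ← hs]
  have him_s : s.im = c * (w * t).im := by
    rw [hs, mul_assoc, Complex.im_ofReal_mul]
  constructor
  · rintro ⟨h1, h2, h3⟩
    have h4 : 0 < s.im := by
      rw [him_s]
      exact mul_pos hc0 (im_mul_pos_of_quadrant hre h1 h2)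
    exact ⟨h4, (key h4).1 h3⟩
  · rintro ⟨h1, h2⟩
    obtain ⟨h3, h4⟩ := im_mul_pos_of_fixedPoint him hre hl (by positivity) h1 h2
    refine ⟨?_, ?_, (key h1).2 h2⟩
    · have h5 : (starRingEnd ℂ w * s).im = c * Complex.normSq w * t.im := by
        rw [hs, ← Complex.im_ofReal_mul]
        congr 1
        push_cast
        rw [Complex.normSq_eq_conj_mul_self]
        ring
      rw [h5] at h3
      exact pos_of_mul_pos_right h3 (mul_nonneg hc0.le (Complex.normSq_nonneg _))
    · have h5 : (w * s).im = c * (w ^ 2 * t).im := by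
        rw [hs, ← Complex.im_ofReal_mul]
        congr 1
        ring
      rw [h5] at h4
      exact pos_of_mul_pos_right h4 hc0.le

/-- Stability applied with error 0. -/
theorem fixedPoint_unique (ha : 0 < a) (hb : 0 < b) {ι : Type} [Fintype ι] [Nonempty ι]
    {lam : ι → ℝ} (hla : ∀ k, a ≤ lam k) (hlb : ∀ k, lam k ≤ b) {r : ℝ} (hr : 0 < r) {w : ℂ}
    (hw : 0 < w.im) {s t : ℂ} (hs : 0 < s.im) (ht : 0 < t.im)
    (hs' : s = phi lam r w (hFun s)) (ht' : t = phi lam r w (hFun t)) : s = t := by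
  have hM : (0 : ℝ) < Fintype.card ι := by exact_mod_cast Fintype.card_pos
  obtain ⟨C, _, ε₀, hε₀, _, _, _, _, h⟩ := fixedPoint_stability ha hb
    (c₁ := r * Fintype.card ι) (c₂ := r * Fintype.card ι) (by positivity) (by positivity) hw
  have h1 := (h lam r hla hlb hr.le le_rfl le_rfl s 0 hs hε₀.le (by rw [← hs']; simp)).2.2 t ht ht'
  rw [mul_zero] at h1
  exact sub_eq_zero.1 (norm_le_zero_iff.1 h1)

theorem existsUnique_isCanonicalSolution (ha : 0 < a) (hb : 0 < b) (hM : 0 < M) (hL : 0 < L)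
    (hN : 0 < N) (hV : V * Vᴴ = 1)
    (hR : R = V * Matrix.diagonal (fun k => (lam k : ℂ)) * Vᴴ) (hla : ∀ k, a ≤ lam k)
    (hlb : ∀ k, lam k ≤ b) {z : ℂ} (hz : 0 < z.im) :
    ∃! t, IsCanonicalSolution R (ratio M L N) z t := by
  have hM' : (0 : ℝ) < M := by exact_mod_cast hM
  have hL' : (0 : ℝ) < L := by exact_mod_cast hL
  have hN' : (0 : ℝ) < N := by exact_mod_cast hN
  have : Nonempty (Fin M) := ⟨⟨0, hM⟩⟩
  have hl : ∀ k, 0 < lam k := fun k => ha.trans_le (hla k)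
  obtain ⟨w, rfl, hre, him⟩ := exists_sq_eq_quadrant hz
  have hw : w ≠ 0 := fun h => by simp [h] at hre
  have hc : (ratio M L N : ℂ) ≠ 0 := by
    have : 0 < ratio M L N := by rw [ratio]; positivity
    exact_mod_cast this.ne'
  have hcw := mul_ne_zero hc hw
  simp_rw [isCanonicalSolution_sq_iff hM hL hN hV hR hl hre him]
  obtain ⟨s, hs, hs'⟩ := exists_fixedPoint hL hN ha hb him lam hla hlb
  refine ⟨s / (ratio M L N * w), ?_, fun t ht => ?_⟩
  · simp only [mul_div_cancel₀ s hcw]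
    exact ⟨hs, hs'⟩
  · rw [eq_div_iff hcw, mul_comm]
    exact fixedPoint_unique ha hb hla hlb (by positivity) him ht.1 hs ht.2 hs'

/-- The coefficient of `R` in the inverse of `T(z)`. -/
noncomputable def kappa (R : Matrix (Fin M) (Fin M) ℂ) (c : ℝ) (z : ℂ) : ℂ :=
  z * c * tSol R c z / (1 - z * (c : ℂ) ^ 2 * tSol R c z ^ 2)

/-- The fixed point associated with the canonical solution. -/
theorem exists_fixedPoint_kappa (ha : 0 < a) (hb : 0 < b) (hM : 0 < M) (hL : 0 < L)
    (hN : 0 < N) (hV : V * Vᴴ = 1)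
    (hR : R = V * Matrix.diagonal (fun k => (lam k : ℂ)) * Vᴴ) (hla : ∀ k, a ≤ lam k)
    (hlb : ∀ k, lam k ≤ b) {w : ℂ} (hre : 0 < w.re) (him : 0 < w.im) :
    ∃ s : ℂ, 0 < s.im ∧ s = phi lam (L / N) w (hFun s) ∧
      kappa R (ratio M L N) (w ^ 2) = w * hFun s ∧
      TMat R (ratio M L N) (w ^ 2) = w⁻¹ • ratInv R w (hFun s) := by
  have h := Classical.epsilon_spec (existsUnique_isCanonicalSolution ha hb hM hL hN hV hR hla hlb
    (im_sq_pos hre him)).exists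
  have h' := (isCanonicalSolution_sq_iff hM hL hN hV hR (fun k => ha.trans_le (hla k)) hre him _).1 h
  have hw : w ≠ 0 := fun h => by simp [h] at hre
  exact ⟨_, h'.1, h'.2, canonical_coef_eq _ _ _, resolventOf_sq _ _ hw _⟩

theorem TMat_spectral (ha : 0 < a) (hb : 0 < b) (hM : 0 < M) (hL : 0 < L)
    (hN : 0 < N) (hV : V * Vᴴ = 1)
    (hR : R = V * Matrix.diagonal (fun k => (lam k : ℂ)) * Vᴴ) (hla : ∀ k, a ≤ lam k)
    (hlb : ∀ k, lam k ≤ b) {z : ℂ} (hz : 0 < z.im) :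
    TMat R (ratio M L N) z =
      V * Matrix.diagonal (fun k => (-z - kappa R (ratio M L N) z * lam k)⁻¹) * Vᴴ := by
  obtain ⟨w, rfl, hre, him⟩ := exists_sq_eq_quadrant hz
  obtain ⟨s, hs, -, hκ, hT⟩ := exists_fixedPoint_kappa ha hb hM hL hN hV hR hla hlb hre him
  rw [hT, hκ, ratInv_spectral hV hR (fun k => ha.le.trans (hla k)) him (im_hFun_pos hs).le,
    ← Matrix.smul_mul, ← Matrix.mul_smul, ← Matrix.diagonal_smul]
  congr 3
  funext k
  rw [Pi.smul_apply, smul_eq_mul, ← mul_inv]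
  congr 1
  ring

end

/-- Quantitative form of the absence of mass at infinity. -/
theorem norm_one_add_mul_inv_le {ι : Type*} [Fintype ι] [Nonempty ι] {lam : ι → ℝ} {b C r : ℝ}
    (hb : 0 < b) (hl : ∀ k, 0 ≤ lam k) (hlb : ∀ k, lam k ≤ b) (hr : 0 ≤ r)
    (hC : r * Fintype.card ι ≤ C) {w s : ℂ} (hw : 0 < w.im) (hCw : 2 * C * b ≤ w.im) (hs : 0 < s.im)
    (h : s = phi lam r w (hFun s)) (k : ι) :
    ‖1 + w ^ 2 * (-w ^ 2 - w * hFun s * lam k)⁻¹‖ ≤ 2 * C * b ^ 2 / w.im ^ 2 := by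
  have hw0 : w ≠ 0 := fun h => by simp [h] at hw
  have hC0 : 0 ≤ C := (by positivity : 0 ≤ r * Fintype.card ι).trans hC
  have hκ := (im_hFun_pos hs).le
  have hsn : ‖s‖ ≤ C * b / w.im := by
    rw [h, phi, norm_mul, Complex.norm_real, Real.norm_of_nonneg hr]
    have h1 : ‖∑ k, (lam k : ℂ) / (-w - hFun s * lam k)‖ ≤ Fintype.card ι * (b * w.im⁻¹) := by
      refine (norm_sum_le_of_le _ (n := fun _ => b * w.im⁻¹) fun j _ => ?_).trans (by simp)
      rw [div_eq_mul_inv, norm_mul, Complex.norm_real, Real.norm_of_nonneg (hl j)]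
      exact mul_le_mul (hlb j) (norm_inv_neg_sub_mul_le hw hκ (hl j)) (norm_nonneg _) hb.le
    calc _ ≤ r * (Fintype.card ι * (b * w.im⁻¹)) := mul_le_mul_of_nonneg_left h1 hr
      _ = (r * Fintype.card ι) * (b * w.im⁻¹) := by ring
      _ ≤ C * (b * w.im⁻¹) := mul_le_mul_of_nonneg_right hC (by positivity)
      _ = _ := by rw [div_eq_mul_inv]; ring
  -- For Im w large the fixed point is small, so h(s) is of the order of s and the whole expression
  -- is of order (Im w)⁻².
  have hs2 : ‖s‖ ≤ 1 / 2 := by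
    refine hsn.trans ?_
    rw [div_le_iff₀ hw]
    linarith
  have hh : ‖hFun s‖ ≤ 2 * ‖s‖ := by
    have h1 : 1 / 2 ≤ ‖1 - s ^ 2‖ := by
      have h2 := norm_sub_norm_le (1 : ℂ) (s ^ 2)
      rw [norm_one, norm_pow] at h2
      nlinarith [norm_nonneg s]
    rw [hFun, norm_div, div_le_iff₀ (by linarith)]
    nlinarith [norm_nonneg s]
  have hne := neg_sub_mul_ne_zero hw hκ (hl k)
  have e : 1 + w ^ 2 * (-w ^ 2 - w * hFun s * lam k)⁻¹ =
      -(hFun s * lam k * (-w - hFun s * lam k)⁻¹) := by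
    have e1 : -w ^ 2 - w * hFun s * lam k = w * (-w - hFun s * lam k) := by ring
    rw [e1]
    obtain ⟨x, hx⟩ : ∃ x, x = -w - hFun s * lam k := ⟨_, rfl⟩
    have hx2 : hFun s * lam k = -w - x := by rw [hx]; ring
    rw [← hx, hx2]
    rw [← hx] at hne
    field_simp
    ring
  rw [e, norm_neg, norm_mul, norm_mul, Complex.norm_real, Real.norm_of_nonneg (hl k)]
  calc _ ≤ (2 * (C * b / w.im)) * b * w.im⁻¹ := by
        refine mul_le_mul (mul_le_mul ?_ (hlb k) (hl k) (by positivity))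
          (norm_inv_neg_sub_mul_le hw hκ (hl k)) (norm_nonneg _) (by positivity)
        linarith
    _ = _ := by
        field_simp

end

end PastFuture

namespace PastFuture

section

open scoped Matrix.Norms.L2Operator Kronecker

set_option linter.unusedSectionVars false

/-! ### The scalar measures -/

section

variable {M L N : ℕ} {R V : Matrix (Fin M) (Fin M) ℂ} {lam : Fin M → ℝ} {a b : ℝ}

/-- The indicator of a coordinate in the blown-up model. -/
def coordIndicator (k : ℕ) (j : Fin M) : Fin M × Fin k → ℂ := fun x => if x.1 = j then 1 else 0

/-- The square root of the covariance of the blown-up model. -/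
noncomputable def blowUpSqrt (lam : Fin M → ℝ) (k : ℕ) :
    Matrix (Fin M × Fin k) (Fin M × Fin k) ℂ :=
  Matrix.diagonal fun x => ((√(lam x.1) : ℝ) : ℂ)

theorem norm_diagonal_coordIndicator_le (k : ℕ) (j : Fin M) :
    ‖Matrix.diagonal (coordIndicator k j)‖ ≤ 1 := by
  rw [Matrix.l2_opNorm_diagonal]
  refine (pi_norm_le_iff_of_nonneg zero_le_one).2 fun x => ?_
  rw [coordIndicator]
  split_ifs <;> simp

/-- The statistic averages the diagonal resolvent entries over the L block rows and the k copies of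
coordinate j. The factor 1/M appears because `linStat` normalizes by the full dimension LMk. -/
theorem exists_measure_linStat (hM : 0 < M) (hL : 0 < L) {k : ℕ} (hk : 0 < k) (n : ℕ) (j : Fin M)
    (y : ℕ → Fin M × Fin k → ℂ) :
    ∃ μ : Measure ℝ, IsProbabilityMeasure μ ∧ μ (Set.Iio 0) = 0 ∧ ∀ w : ℂ, 0 < w.re → 0 < w.im →
      linStat (Matrix.diagonal (coordIndicator k j)) (bigQ L n y w) =
        w * ((M : ℂ)⁻¹ * ∫ x : ℝ, ((x : ℂ) - w ^ 2)⁻¹ ∂μ) := by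
  have hk' : (k : ℝ) ≠ 0 := by exact_mod_cast hk.ne'
  have hL' : (L : ℝ) ≠ 0 := by exact_mod_cast hL.ne'
  have hkC : (k : ℂ) ≠ 0 := by exact_mod_cast hk.ne'
  have hLC : (L : ℂ) ≠ 0 := by exact_mod_cast hL.ne'
  have hMC : (M : ℂ) ≠ 0 := by exact_mod_cast hM.ne'
  obtain ⟨μ, h1, h2, h3⟩ := exists_measure_resolvent
    (Matrix.posSemidef_self_mul_conjTranspose (crossH L n y))
    (d := fun x => ((L : ℝ) * k)⁻¹ * (Pi.single j 1 : Fin M → ℝ) x.2.1)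
    (fun x => mul_nonneg (by positivity) (by rw [Pi.single_apply]; split_ifs <;> norm_num))
    (by
      rw [← Finset.mul_sum, Fintype.sum_prod_type]
      simp only [Fintype.sum_prod_type, Finset.sum_const, Finset.card_univ, Fintype.card_fin,
        nsmul_eq_mul, ← Finset.mul_sum, Finset.sum_pi_single', Finset.mem_univ, if_true]
      field_simp)
  refine ⟨μ, h1, h2, fun w hre him => ?_⟩
  rw [linStat_bigQ_eq him (im_sq_pos hre him), h3 _ (im_sq_pos hre him)]
  congr 1
  rw [Finset.mul_sum, Finset.mul_sum]
  refine Finset.sum_congr rfl fun x _ => ?_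
  rw [Fintype.card_prod, Fintype.card_fin, Fintype.card_fin, coordIndicator,
    Pi.single_apply]
  split_ifs
  · push_cast
    field_simp
  · simp

/-- The fixed point s is the same for every k, so the deterministic equivalent of the statistic does
not depend on k: it is the j-th eigenvalue of T at z = w², up to the factor w/M. -/
theorem exists_blowUp_close (ha : 0 < a) (hb : 0 < b) (hM : 0 < M) (hL : 0 < L)
    (hN : 0 < N) (hV : V * Vᴴ = 1)
    (hR : R = V * Matrix.diagonal (fun k => (lam k : ℂ)) * Vᴴ) (hla : ∀ k, a ≤ lam k)
    (hlb : ∀ k, lam k ≤ b) {w : ℂ} (hre : 0 < w.re) (him : 0 < w.im) {ε : ℝ} (hε : 0 < ε) :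
    ∃ k₀ : ℕ, ∀ k, k₀ ≤ k → 0 < k → ∀ j : Fin M,
      ∫ Ξ, ‖linStat (Matrix.diagonal (coordIndicator k j))
          (bigQ L (N * k) (coloredField (blowUpSqrt lam k) Ξ) w) -
        w * ((M : ℂ)⁻¹ * (-w ^ 2 - kappa R (ratio M L N) (w ^ 2) * lam j)⁻¹)‖
        ∂(gaussianField (N * k + 2 * L - 1) (Fin M × Fin k)) ≤ ε := by
  have hM' : (0 : ℝ) < M := by exact_mod_cast hM
  have hL' : (0 : ℝ) < L := by exact_mod_cast hL
  have hN' : (0 : ℝ) < N := by exact_mod_cast hN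
  have hw0 : w ≠ 0 := fun h => by simp [h] at him
  have : Nonempty (Fin M) := ⟨⟨0, hM⟩⟩
  have hMc : (0 : ℝ) < Fintype.card (Fin M) := by rw [Fintype.card_fin]; exact hM'
  obtain ⟨s, hs, hs', hκ, -⟩ := exists_fixedPoint_kappa ha hb hM hL hN hV hR hla hlb hre him
  obtain ⟨N₀, hN₀⟩ := exists_deterministic_equivalent L hL ha hb
    (c₁ := L / N * Fintype.card (Fin M)) (c₂ := L / N * Fintype.card (Fin M)) (by positivity)
    (by positivity) him hε
  refine ⟨N₀, fun k hk hk0 j => ?_⟩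
  have hk' : (k : ℂ) ≠ 0 := by exact_mod_cast hk0.ne'
  have : Nonempty (Fin k) := ⟨⟨0, hk0⟩⟩
  have hge : N₀ ≤ N * k := hk.trans (Nat.le_mul_of_pos_left k hN)
  have hl : ∀ x : Fin M × Fin k, 0 ≤ lam x.1 := fun x => ha.le.trans (hla _)
  have hone : (1 : Matrix (Fin M × Fin k) (Fin M × Fin k) ℂ) * 1ᴴ = 1 := by simp
  have hS : blowUpSqrt lam k * (blowUpSqrt lam k)ᴴ = _ := diagonal_sqrt_mul_conjTranspose hl
  have h := hN₀ _ hge (blowUpSqrt lam k) 1 (fun x => lam x.1) hone hS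
    (fun x => hla _) (fun x => hlb _) (ratio_blowUp L N hk0).ge (ratio_blowUp L N hk0).le s hs
    (by rw [phi_comp_fst lam L N hk0]; exact hs') _ (norm_diagonal_coordIndicator_le k j)
  have e : (Fintype.card (Fin M × Fin k) : ℂ)⁻¹ * (Matrix.diagonal (coordIndicator k j) *
      ratInv (blowUpSqrt lam k * (blowUpSqrt lam k)ᴴ) w (hFun s)).trace =
      w * ((M : ℂ)⁻¹ * (-w ^ 2 - kappa R (ratio M L N) (w ^ 2) * lam j)⁻¹) := by
    rw [ratInv_spectral hone hS hl him (im_hFun_pos hs).le, Matrix.one_mul,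
      Matrix.conjTranspose_one, Matrix.mul_one, Matrix.diagonal_mul_diagonal,
      Matrix.trace_diagonal, Fintype.card_prod, Fintype.card_fin, Fintype.card_fin, hκ]
    have e1 : -w ^ 2 - w * hFun s * lam j = w * (-w - hFun s * lam j) := by ring
    rw [e1]
    simp only [coordIndicator, Fintype.sum_prod_type, Finset.sum_const, Finset.card_univ,
      Fintype.card_fin, nsmul_eq_mul, ite_mul, one_mul, zero_mul, mul_ite, mul_zero,
      Finset.sum_ite_eq', Finset.mem_univ, if_true]
    push_cast
    rw [mul_inv, mul_inv]
    field_simp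
  rw [e] at h
  exact h

/-- The point y depends only on b, C and ε. This uniformity serves twice: no mass is lost in the
construction of each scalar measure, and the sequence ν_N is tight. -/
theorem exists_norm_one_add_le (hb : 0 < b) {C : ℝ} (hC : 0 ≤ C) {ε : ℝ} (hε : 0 < ε) :
    ∃ y : ℝ, 0 < y ∧ ∀ {M L N : ℕ} {R V : Matrix (Fin M) (Fin M) ℂ} {lam : Fin M → ℝ} {a : ℝ},
      0 < a → 0 < M → 0 < L → 0 < N → V * Vᴴ = 1 →
      R = V * Matrix.diagonal (fun k => (lam k : ℂ)) * Vᴴ → (∀ k, a ≤ lam k) → (∀ k, lam k ≤ b) →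
      ratio M L N ≤ C → ∀ j, ‖1 + Complex.I * y * (-(Complex.I * y) -
        kappa R (ratio M L N) (Complex.I * y) * lam j)⁻¹‖ ≤ ε := by
  -- The test point is w = v(1 + i), with w² = 2iv². As v is at least 1, at least 2Cb and at least
  -- 2Cb²/ε, the decay bound applies and is at most ε.
  obtain ⟨v, hv⟩ : ∃ v : ℝ, v = 1 + 2 * C * b + 2 * C * b ^ 2 / ε := ⟨_, rfl⟩
  have h1 : 0 ≤ 2 * C * b := by positivity
  have h2 : 0 ≤ 2 * C * b ^ 2 / ε := by positivity
  have hv0 : 0 < v := by linarith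
  have hw2 : (⟨v, v⟩ : ℂ) ^ 2 = Complex.I * ((2 * v ^ 2 : ℝ) : ℂ) := by
    apply Complex.ext
    · simp [sq]
    · simp [sq]
      ring
  refine ⟨2 * v ^ 2, by positivity, fun {M L N R V lam a} ha hM hL hN hV hR hla hlb hcC j => ?_⟩
  have : Nonempty (Fin M) := ⟨⟨0, hM⟩⟩
  obtain ⟨s, hs, hs', hκ, -⟩ := exists_fixedPoint_kappa ha hb hM hL hN hV hR hla hlb
    (w := ⟨v, v⟩) hv0 hv0
  rw [← hw2, hκ]
  have hle : (L / N : ℝ) * Fintype.card (Fin M) ≤ C := by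
    refine le_trans (le_of_eq ?_) hcC
    rw [ratio, Fintype.card_fin]
    ring
  refine (norm_one_add_mul_inv_le hb (fun k => ha.le.trans (hla k)) hlb (by positivity) hle hv0
    (by change 2 * C * b ≤ v; linarith) hs hs' j).trans ?_
  change 2 * C * b ^ 2 / v ^ 2 ≤ ε
  rw [div_le_iff₀ (by positivity)]
  have h3 : 2 * C * b ^ 2 / ε ≤ v ^ 2 := by nlinarith
  rwa [div_le_iff₀' hε] at h3

/-- On a finite set of points the function is approximated by the transform of one realization of
the blown-up model. The approximation holds in mean at each point, which is enough to find a
realization that is good at all of them. -/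
theorem exists_scalar_measure (ha : 0 < a) (hb : 0 < b) (hM : 0 < M) (hL : 0 < L)
    (hN : 0 < N) (hV : V * Vᴴ = 1)
    (hR : R = V * Matrix.diagonal (fun k => (lam k : ℂ)) * Vᴴ) (hla : ∀ k, a ≤ lam k)
    (hlb : ∀ k, lam k ≤ b) (j : Fin M) :
    ∃ μ : Measure ℝ, IsProbabilityMeasure μ ∧ μ (Set.Iio 0) = 0 ∧ ∀ z : ℂ, 0 < z.im →
      ∫ x : ℝ, ((x : ℂ) - z)⁻¹ ∂μ = (-z - kappa R (ratio M L N) z * lam j)⁻¹ := by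
  have hM' : (0 : ℝ) < M := by exact_mod_cast hM
  have hMC : (M : ℂ) ≠ 0 := by exact_mod_cast hM.ne'
  have : Nonempty (Fin M) := ⟨⟨0, hM⟩⟩
  refine exists_measure_of_approx (fun z => (-z - kappa R (ratio M L N) z * lam j)⁻¹) ?_ ?_
  · intro Z hZ ε hε
    have hw : ∀ z : Z, ∃ w : ℂ, w ^ 2 = z ∧ 0 < w.re ∧ 0 < w.im := fun z =>
      exists_sq_eq_quadrant (hZ z z.2)
    choose w hw2 hre him using hw
    have hwn : ∀ z : Z, 0 < ‖w z‖ := fun z => by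
      refine norm_pos_iff.2 fun h => ?_
      have := him z
      simp [h] at this
    -- Undoes the factor w/M of the statistic and shares ε among the points of Z; the +1 covers
    -- empty Z.
    obtain ⟨δ, hδ⟩ : ∃ δ : Z → ℝ, δ = fun z => ε * ‖w z‖ / (M * (Z.card + 1)) := ⟨_, rfl⟩
    have hδ0 : ∀ z, 0 < δ z := fun z => by
      have := hwn z
      rw [hδ]
      positivity
    have hk := fun z : Z => exists_blowUp_close ha hb hM hL hN hV hR hla hlb (hre z) (him z) (hδ0 z)
    choose k₀ hk₀ using hk
    obtain ⟨k, hk⟩ : ∃ k, k = ∑ z, k₀ z + 1 := ⟨_, rfl⟩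
    have hk0 : 0 < k := by omega
    have hkge : ∀ z, k₀ z ≤ k := fun z => by
      have := Finset.single_le_sum (f := k₀) (fun _ _ => Nat.zero_le _) (Finset.mem_univ z)
      omega
    have : Nonempty (Fin k) := ⟨⟨0, hk0⟩⟩
    obtain ⟨G, hG⟩ : ∃ G : Z → (Fin (N * k + 2 * L - 1) → Fin M × Fin k → ℂ) → ℝ,
        G = fun z Ξ => M / ‖w z‖ * ‖linStat (Matrix.diagonal (coordIndicator k j))
          (bigQ L (N * k) (coloredField (blowUpSqrt lam k) Ξ) (w z)) -
        w z * ((M : ℂ)⁻¹ * (-w z ^ 2 - kappa R (ratio M L N) (w z ^ 2) * lam j)⁻¹)‖ := ⟨_, rfl⟩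
    have hGi : ∀ z, Integrable (G z) (gaussianField (N * k + 2 * L - 1) (Fin M × Fin k)) := by
      intro z
      rw [hG]
      exact (((integrable_linStat_bigQ hL _ _ (him z) _).sub
        (integrable_const _)).norm).const_mul _
    have hGle : ∀ z, ∫ Ξ, G z Ξ ∂(gaussianField (N * k + 2 * L - 1) (Fin M × Fin k)) ≤
        ε / (Z.card + 1) := by
      intro z
      rw [hG, integral_const_mul]
      refine (mul_le_mul_of_nonneg_left (hk₀ z k (hkge z) hk0 j) (by positivity)).trans
        (le_of_eq ?_)
      have := (hwn z).ne'
      rw [hδ]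
      field_simp
    -- Some realization does not exceed the mean of the sum of the errors, and each error is
    -- dominated by that sum.
    obtain ⟨Ξ, hΞ⟩ := exists_le_integral (μ := gaussianField (N * k + 2 * L - 1) (Fin M × Fin k))
      (f := fun Ξ => ∑ z, G z Ξ) (integrable_finsetSum _ fun z _ => hGi z)
    rw [integral_finsetSum _ fun z _ => hGi z] at hΞ
    obtain ⟨μ, h1, h2, h3⟩ := exists_measure_linStat hM hL hk0 (N * k) j
      (coloredField (blowUpSqrt lam k) Ξ)
    refine ⟨μ, h1, h2, fun z hz => ?_⟩
    have h4 : G ⟨z, hz⟩ Ξ ≤ ε := by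
      have h5 : G ⟨z, hz⟩ Ξ ≤ ∑ z, G z Ξ := Finset.single_le_sum (f := fun z => G z Ξ)
        (fun z _ => by rw [hG]; positivity) (Finset.mem_univ _)
      refine h5.trans (hΞ.trans ((Finset.sum_le_sum fun z _ => hGle z).trans ?_))
      rw [Finset.sum_const, Finset.card_univ, Fintype.card_coe, nsmul_eq_mul, ← mul_div_assoc,
        div_le_iff₀ (by positivity)]
      nlinarith
    rw [hG] at h4
    simp only at h4
    rw [h3 _ (hre _) (him _), ← mul_sub, ← mul_sub, norm_mul, norm_mul, norm_inv,
      Complex.norm_natCast, hw2] at h4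
    have h6 := (hwn ⟨z, hz⟩).ne'
    refine le_trans (le_of_eq ?_) h4
    field_simp
  · intro ε hε
    have hc : 0 ≤ ratio M L N := by rw [ratio]; positivity
    obtain ⟨y, hy, h⟩ := exists_norm_one_add_le hb hc hε
    exact ⟨y, hy, h ha hM hL hN hV hR hla hlb le_rfl j⟩

end

end

end PastFuture

namespace PastFuture

section

/-! ### The matrix-valued measure -/

section

variable {M : ℕ}

theorem PosMatrixMeasure.scalarize_apply (μ : PosMatrixMeasure M)
    (φ : Matrix (Fin M) (Fin M) ℂ →+ ℝ) (hφ : Continuous φ)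
    (hpos : ∀ A : Matrix (Fin M) (Fin M) ℂ, A.PosSemidef → 0 ≤ φ A) {s : Set ℝ}
    (hs : MeasurableSet s) : μ.scalarize φ hφ hpos s = ENNReal.ofReal (φ (μ.val s)) := by
  rw [scalarize, SignedMeasure.toMeasureOfZeroLE_apply _ _ _ hs, ENNReal.ofReal]
  congr 1
  apply NNReal.eq
  rw [Real.coe_toNNReal _ (hpos _ (μ.posSemidef s hs))]
  simp [VectorMeasure.mapRange_apply]

theorem PosMatrixMeasure.quad_apply (μ : PosMatrixMeasure M) (x : Fin M → ℂ) {s : Set ℝ}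
    (hs : MeasurableSet s) :
    μ.quad x s = ENNReal.ofReal (star x ⬝ᵥ μ.val s *ᵥ x).re :=
  PosMatrixMeasure.scalarize_apply μ _ _ _ hs

theorem PosMatrixMeasure.ntr_apply (μ : PosMatrixMeasure M) {s : Set ℝ} (hs : MeasurableSet s) :
    μ.ntr s = ENNReal.ofReal ((M : ℝ)⁻¹ * (μ.val s).trace.re) :=
  PosMatrixMeasure.scalarize_apply μ _ _ _ hs

instance (μ : PosMatrixMeasure M) (x : Fin M → ℂ) : IsFiniteMeasure (μ.quad x) :=
  ⟨by rw [PosMatrixMeasure.quad_apply _ _ MeasurableSet.univ]; exact ENNReal.ofReal_lt_top⟩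

/-- The transform determines every scalar measure x^*μx, and a Hermitian matrix is determined by its
quadratic form; equality is obtained from the Loewner order in both directions. -/
theorem PosMatrixMeasure.eq_of_hasStieltjesTransform {μ μ' : PosMatrixMeasure M}
    {F : ℂ → Matrix (Fin M) (Fin M) ℂ} (h : μ.HasStieltjesTransform F)
    (h' : μ'.HasStieltjesTransform F) : μ = μ' := by
  have hq : ∀ x, μ.quad x = μ'.quad x := by
    intro x
    exact measure_eq_of_stieltjes_eq _ _ fun z hz => (h.2 z hz x).symm.trans (h'.2 z hz x)
  have key : ∀ (ρ ρ' : PosMatrixMeasure M), (∀ x, ρ.quad x = ρ'.quad x) →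
      ∀ s, MeasurableSet s → ρ.val s ≤ ρ'.val s := by
    intro ρ ρ' hρ s hs
    rw [Matrix.le_iff]
    refine Matrix.PosSemidef.of_dotProduct_mulVec_nonneg
      ((ρ'.posSemidef s hs).1.sub (ρ.posSemidef s hs).1) fun x => ?_
    have h1 := congrArg (fun m : Measure ℝ => m s) (hρ x)
    simp only [quad_apply _ _ hs] at h1
    have h3 := (ρ.posSemidef s hs).dotProduct_mulVec_nonneg x
    have h4 := (ρ'.posSemidef s hs).dotProduct_mulVec_nonneg x
    have h5 := Complex.le_def.1 h3
    have h6 := Complex.le_def.1 h4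
    have h7 := (ENNReal.ofReal_eq_ofReal_iff h5.1 h6.1).1 h1
    rw [Matrix.sub_mulVec, dotProduct_sub]
    have h8 : star x ⬝ᵥ ρ'.val s *ᵥ x = star x ⬝ᵥ ρ.val s *ᵥ x :=
      Complex.ext h7.symm (h6.2.symm.trans h5.2)
    rw [h8, sub_self]
  ext1
  refine VectorMeasure.ext fun s hs => ?_
  exact le_antisymm (key μ μ' hq s hs) (key μ' μ (fun x => (hq x).symm) s hs)

/-- The embedding of the reals along a rank-one projection. -/
noncomputable def projEmb (V : Matrix (Fin M) (Fin M) ℂ) (j : Fin M) :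
    ℝ →+ Matrix (Fin M) (Fin M) ℂ where
  toFun x := (x : ℂ) • (V * Matrix.single j j 1 * Vᴴ)
  map_zero' := by simp
  map_add' x y := by simp [add_smul]

theorem continuous_projEmb (V : Matrix (Fin M) (Fin M) ℂ) (j : Fin M) :
    Continuous (projEmb V j) := by
  change Continuous fun x : ℝ => (x : ℂ) • (V * Matrix.single j j 1 * Vᴴ)
  fun_prop

theorem sum_projEmb (V : Matrix (Fin M) (Fin M) ℂ) (g : Fin M → ℝ) :
    ∑ j, projEmb V j (g j) = V * Matrix.diagonal (fun j => (g j : ℂ)) * Vᴴ := by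
  have h : Matrix.diagonal (fun j => (g j : ℂ)) = ∑ j, (g j : ℂ) • Matrix.single j j (1 : ℂ) := by
    ext i i'
    rw [Matrix.sum_apply]
    simp [Matrix.diagonal_apply, Matrix.single_apply, Matrix.smul_apply, ite_and]
  rw [h, Matrix.mul_sum, Matrix.sum_mul]
  refine Finset.sum_congr rfl fun j _ => ?_
  rw [Matrix.mul_smul, Matrix.smul_mul]
  rfl

theorem sum_mapRange_projEmb_apply (V : Matrix (Fin M) (Fin M) ℂ) (μ : Fin M → Measure ℝ)
    [∀ j, IsFiniteMeasure (μ j)] {s : Set ℝ} (hs : MeasurableSet s) :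
    (∑ j, (μ j).toSignedMeasure.mapRange (projEmb V j) (continuous_projEmb V j)) s =
      V * Matrix.diagonal (fun j => (((μ j).real s : ℝ) : ℂ)) * Vᴴ := by
  rw [FunLike.coe_sum, Finset.sum_apply, ← sum_projEmb]
  refine Finset.sum_congr rfl fun j _ => ?_
  rw [VectorMeasure.mapRange_apply, Measure.toSignedMeasure_apply_measurable hs]

/-- The matrix-valued measure that is diagonal in a given orthonormal basis. -/
noncomputable def diagMeasure (V : Matrix (Fin M) (Fin M) ℂ) (μ : Fin M → Measure ℝ)
    [∀ j, IsFiniteMeasure (μ j)] : PosMatrixMeasure M where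
  val := ∑ j, (μ j).toSignedMeasure.mapRange (projEmb V j) (continuous_projEmb V j)
  posSemidef s hs := by
    rw [sum_mapRange_projEmb_apply V μ hs]
    refine Matrix.PosSemidef.mul_mul_conjTranspose_same (Matrix.PosSemidef.diagonal fun j => ?_) V
    exact Complex.zero_le_real.2 measureReal_nonneg

theorem star_dotProduct_spectral (V : Matrix (Fin M) (Fin M) ℂ) (g : Fin M → ℂ) (x : Fin M → ℂ) :
    star x ⬝ᵥ (V * Matrix.diagonal g * Vᴴ) *ᵥ x =
      ∑ j, (Complex.normSq ((Vᴴ *ᵥ x) j) : ℂ) * g j := by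
  rw [Matrix.mul_assoc, ← Matrix.mulVec_mulVec, ← Matrix.mulVec_mulVec, Matrix.dotProduct_mulVec]
  have h : star x ᵥ* V = star (Vᴴ *ᵥ x) := by
    rw [Matrix.star_mulVec, Matrix.conjTranspose_conjTranspose]
  rw [h, dotProduct]
  refine Finset.sum_congr rfl fun j _ => ?_
  rw [Matrix.mulVec_diagonal, Pi.star_apply, Complex.normSq_eq_conj_mul_self]
  change _ = star _ * _ * _
  ring

theorem quad_diagMeasure (V : Matrix (Fin M) (Fin M) ℂ) (μ : Fin M → Measure ℝ)
    [∀ j, IsFiniteMeasure (μ j)] (x : Fin M → ℂ) :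
    (diagMeasure V μ).quad x =
      ∑ j, ENNReal.ofReal (Complex.normSq ((Vᴴ *ᵥ x) j)) • μ j := by
  refine Measure.ext fun s hs => ?_
  have h : (diagMeasure V μ).val s = _ := sum_mapRange_projEmb_apply V μ hs
  rw [PosMatrixMeasure.quad_apply _ _ hs, h, star_dotProduct_spectral, Complex.re_sum,
    Measure.coe_finsetSum, Finset.sum_apply]
  simp_rw [← Complex.ofReal_mul, Complex.ofReal_re]
  rw [ENNReal.ofReal_sum_of_nonneg fun j _ =>
    mul_nonneg (Complex.normSq_nonneg _) measureReal_nonneg]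
  refine Finset.sum_congr rfl fun j _ => ?_
  rw [ENNReal.ofReal_mul (Complex.normSq_nonneg _), Measure.smul_apply, smul_eq_mul,
    ofReal_measureReal]

theorem ntr_diagMeasure {V : Matrix (Fin M) (Fin M) ℂ} (hV : V * Vᴴ = 1) (μ : Fin M → Measure ℝ)
    [∀ j, IsFiniteMeasure (μ j)] :
    (diagMeasure V μ).ntr = ∑ j, ENNReal.ofReal (M : ℝ)⁻¹ • μ j := by
  refine Measure.ext fun s hs => ?_
  have h : (diagMeasure V μ).val s = _ := sum_mapRange_projEmb_apply V μ hs
  rw [PosMatrixMeasure.ntr_apply _ hs, h, Matrix.mul_assoc, Matrix.trace_mul_comm, Matrix.mul_assoc,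
    mul_eq_one_comm.1 hV, Matrix.mul_one, Matrix.trace_diagonal, Complex.re_sum,
    Measure.coe_finsetSum, Finset.sum_apply, Finset.mul_sum]
  simp_rw [Complex.ofReal_re]
  rw [ENNReal.ofReal_sum_of_nonneg fun j _ => mul_nonneg (by positivity) measureReal_nonneg]
  refine Finset.sum_congr rfl fun j _ => ?_
  rw [ENNReal.ofReal_mul (by positivity), Measure.smul_apply, smul_eq_mul, ofReal_measureReal]

theorem integral_sum_smul_measure {ι : Type*} [Fintype ι] (g : ι → ℝ) (hg : ∀ j, 0 ≤ g j)
    (μ : ι → Measure ℝ) [∀ j, IsFiniteMeasure (μ j)] {z : ℂ} (hz : 0 < z.im) :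
    ∫ x : ℝ, ((x : ℂ) - z)⁻¹ ∂(∑ j, ENNReal.ofReal (g j) • μ j) =
      ∑ j, (g j : ℂ) * ∫ x : ℝ, ((x : ℂ) - z)⁻¹ ∂(μ j) := by
  have : ∀ j, IsFiniteMeasure (ENNReal.ofReal (g j) • μ j) :=
    fun j => Measure.smul_finite _ ENNReal.ofReal_ne_top
  rw [integral_finsetSum_measure fun k _ => integrable_inv_ofReal_sub _ hz.ne']
  refine Finset.sum_congr rfl fun j _ => ?_
  rw [integral_smul_measure, ENNReal.toReal_ofReal (hg j), Complex.real_smul]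

variable {L N : ℕ} {R V : Matrix (Fin M) (Fin M) ℂ} {lam : Fin M → ℝ} {a b : ℝ}

/-- T is diagonal in an eigenbasis of R, and each of its eigenvalues is the transform of a
probability measure; placing these measures on the eigenprojections gives the matrix measure, and
its normalized trace is their average. -/
theorem nu_spec (ha : 0 < a) (hb : 0 < b) (hM : 0 < M) (hL : 0 < L)
    (hN : 0 < N) (hV : V * Vᴴ = 1)
    (hR : R = V * Matrix.diagonal (fun k => (lam k : ℂ)) * Vᴴ) (hla : ∀ k, a ≤ lam k)
    (hlb : ∀ k, lam k ≤ b) :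
    (∃! μ : PosMatrixMeasure M, μ.HasStieltjesTransform (TMat R (ratio M L N))) ∧
      IsProbabilityMeasure (nu R (ratio M L N)) ∧
      ∀ z : ℂ, 0 < z.im → ∫ x : ℝ, ((x : ℂ) - z)⁻¹ ∂(nu R (ratio M L N)) =
        (M : ℂ)⁻¹ * ∑ j, (-z - kappa R (ratio M L N) z * lam j)⁻¹ := by
  have hM' : (M : ℝ) ≠ 0 := by exact_mod_cast hM.ne'
  choose μ hμ hμ0 hμz using exists_scalar_measure ha hb hM hL hN hV hR hla hlb
  have hS : (diagMeasure V μ).HasStieltjesTransform (TMat R (ratio M L N)) := by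
    refine ⟨?_, fun z hz x => ?_⟩
    · have h : (diagMeasure V μ).val (Set.Iio 0) = _ :=
        sum_mapRange_projEmb_apply V μ measurableSet_Iio
      rw [h]
      simp [measureReal_def, hμ0]
    · rw [quad_diagMeasure, TMat_spectral ha hb hM hL hN hV hR hla hlb hz,
        star_dotProduct_spectral, integral_sum_smul_measure _ (fun j => Complex.normSq_nonneg _) μ hz]
      refine Finset.sum_congr rfl fun j _ => ?_
      rw [hμz j z hz]
  have hnu : nu R (ratio M L N) = ∑ j, ENNReal.ofReal (M : ℝ)⁻¹ • μ j := by
    have h1 : nuT R (ratio M L N) = diagMeasure V μ :=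
      PosMatrixMeasure.eq_of_hasStieltjesTransform (Classical.epsilon_spec (p := fun ρ =>
        PosMatrixMeasure.HasStieltjesTransform ρ (TMat R (ratio M L N))) ⟨_, hS⟩) hS
    rw [nu, h1, ntr_diagMeasure hV]
  refine ⟨⟨_, hS, fun ρ hρ => PosMatrixMeasure.eq_of_hasStieltjesTransform hρ hS⟩, ⟨?_⟩,
    fun z hz => ?_⟩
  · rw [hnu, Measure.coe_finsetSum, Finset.sum_apply]
    simp only [Measure.smul_apply, measure_univ, smul_eq_mul, mul_one, Finset.sum_const,
      Finset.card_univ, Fintype.card_fin, nsmul_eq_mul]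
    rw [← ENNReal.ofReal_natCast, ← ENNReal.ofReal_mul (by positivity), mul_inv_cancel₀ hM',
      ENNReal.ofReal_one]
  · rw [hnu, integral_sum_smul_measure (fun _ => (M : ℝ)⁻¹) (fun j => by positivity) μ hz,
      ← Finset.mul_sum]
    push_cast
    congr 1
    exact Finset.sum_congr rfl fun j _ => hμz j z hz

end

end

end PastFuture

namespace PastFuture

section

open scoped Matrix.Norms.L2Operator Kronecker

set_option linter.unusedSectionVars false

/-! ### Concentration of the empirical Stieltjes transform -/

section

variable {m : Type*} [Fintype m] [DecidableEq m] {L N : ℕ} {w : ℂ}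

theorem bigW_congr {y y' : ℕ → m → ℂ} (h : ∀ t < N + 2 * L - 1, y t = y' t) :
    bigW L N y = bigW L N y' := by
  ext x c
  simp only [bigW, Matrix.of_apply]
  rw [h _ (rowOffset_add_lt x.1 c.2)]

/-- A given observation occurs at most once in each of the 2L block rows, and each occurrence
contributes rank one. -/
theorem rank_bigW_sub_le {y y' : ℕ → m → ℂ} {t₀ : ℕ} (h : ∀ t, t ≠ t₀ → y t = y' t) :
    (bigW L N y - bigW L N y').rank ≤ 2 * L := by
  have e : bigW L N y - bigW L N y' = ∑ a : Bool × Fin L, Matrix.vecMulVec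
      (fun x : (Bool × Fin L) × m => if x.1 = a then
        ((√(N : ℝ) : ℝ) : ℂ)⁻¹ * (y t₀ x.2 - y' t₀ x.2) else 0)
      (fun c : Bool × Fin N => if c.1 = a.1 ∧ rowOffset a + c.2 = t₀ then (1 : ℂ) else 0) := by
    ext x c
    rw [Matrix.sum_apply, Finset.sum_eq_single x.1]
    · rw [Matrix.vecMulVec_apply, if_pos rfl, Matrix.sub_apply]
      simp only [bigW, Matrix.of_apply]
      by_cases h1 : c.1 = x.1.1
      · by_cases h2 : rowOffset x.1 + (c.2 : ℕ) = t₀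
        · simp [h1, h2, mul_sub]
        · simp [h1, h2, h _ h2]
      · simp [h1]
    · intro a _ ha
      rw [Matrix.vecMulVec_apply, if_neg (Ne.symm ha), zero_mul]
    · simp
  rw [e]
  refine (rank_sum_le_sum _ _).trans ?_
  refine (Finset.sum_le_sum fun a _ => Matrix.rank_vecMulVec_le _ _).trans (le_of_eq ?_)
  simp

/-- Telescoping the quadratic expression in W doubles the rank. -/
theorem rank_bigH_sub_le {y y' : ℕ → m → ℂ} {t₀ : ℕ} (h : ∀ t, t ≠ t₀ → y t = y' t) :
    (bigH L N y - bigH L N y').rank ≤ 4 * L := by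
  have hr := rank_bigW_sub_le (L := L) (N := N) h
  obtain ⟨J, hJ⟩ : ∃ J : Matrix (Bool × Fin N) (Bool × Fin N) ℂ,
    J = flipMat 0 ⊗ₖ (1 : Matrix (Fin N) (Fin N) ℂ) := ⟨_, rfl⟩
  have e : bigH L N y - bigH L N y' =
      (bigW L N y - bigW L N y') * (-(J * (bigW L N y)ᴴ)) +
        (-(bigW L N y' * J)) * (bigW L N y - bigW L N y')ᴴ := by
    simp only [bigH, ← hJ, Matrix.conjTranspose_sub, Matrix.sub_mul, Matrix.mul_sub,
      Matrix.mul_neg, Matrix.neg_mul, Matrix.mul_assoc]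
    abel
  rw [e]
  refine (rank_add_le_add _ _).trans ?_
  have h1 := Matrix.rank_mul_le_left (bigW L N y - bigW L N y') (-(J * (bigW L N y)ᴴ))
  have h2 := Matrix.rank_mul_le_right (-(bigW L N y' * J)) (bigW L N y - bigW L N y')ᴴ
  rw [Matrix.rank_conjTranspose] at h2
  omega

/-- The rank 4L, the resolvent bound 2/Im w and the norm 1/M of the averaging matrix multiply to
8L/(M Im w). No regularization is needed for this part. -/
theorem norm_linStat_bigQ_sub_le [Nonempty m] (hL : 0 < L) (hw : 0 < w.im) {y y' : ℕ → m → ℂ}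
    {t₀ : ℕ} (h : ∀ t, t ≠ t₀ → y t = y' t) :
    ‖linStat 1 (bigQ L N y w) - linStat 1 (bigQ L N y' w)‖ ≤
      8 * L * w.im⁻¹ / Fintype.card m := by
  have hL' : (0 : ℝ) < L := by exact_mod_cast hL
  have hM : (0 : ℝ) < Fintype.card m := by exact_mod_cast Fintype.card_pos
  obtain ⟨C, hC⟩ : ∃ C : Matrix ((Bool × Fin L) × m) ((Bool × Fin L) × m) ℂ,
      C = ((L : ℂ) * Fintype.card m)⁻¹ • ∑ i : Fin L,
        blockIncl m (true, i) * (1 : Matrix m m ℂ) * (blockIncl m (true, i))ᴴ := ⟨_, rfl⟩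
  have hlin : ∀ Y : Matrix ((Bool × Fin L) × m) ((Bool × Fin L) × m) ℂ,
      linStat 1 Y = (C * Y).trace := by
    intro Y
    rw [hC, Matrix.smul_mul, Matrix.trace_smul, Matrix.sum_mul, Matrix.trace_sum, smul_eq_mul,
      linStat]
    simp_rw [trace_mul_pBlock]
  have h1 : ‖(1 : Matrix m m ℂ)‖ ≤ 1 := by
    refine l2_opNorm_le_of_mulVec _ zero_le_one fun v => ?_
    rw [one_mulVec, one_mul]
  have hCn : ‖C‖ ≤ (Fintype.card m : ℝ)⁻¹ := by
    rw [hC, norm_smul, norm_inv, norm_mul, Complex.norm_natCast, Complex.norm_natCast]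
    have h2 : ‖∑ i : Fin L, blockIncl m (true, i) * (1 : Matrix m m ℂ) *
        (blockIncl m (true, i))ᴴ‖ ≤ L := by
      refine (norm_sum_le_of_le _ (n := fun _ => (1 : ℝ)) fun i _ => ?_).trans (by simp)
      exact (norm_blockIncl_conj_le _ _).trans h1
    refine (mul_le_mul_of_nonneg_left h2 (by positivity)).trans (le_of_eq ?_)
    field_simp
  have hr : ((bigH L N y' - w • 1) - (bigH L N y - w • 1)).rank ≤ 4 * L := by
    rw [sub_sub_sub_cancel_right]
    exact rank_bigH_sub_le fun t ht => (h t ht).symm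
  rw [hlin, hlin]
  refine (Dissipative.norm_trace_inv_sub_le hw
    (dissipative_isHermitian_sub (bigH_isHermitian (L := L) (N := N) y) w)
    (dissipative_isHermitian_sub (bigH_isHermitian (L := L) (N := N) y') w) C).trans ?_
  calc _ ≤ (4 * L : ℝ) * ((Fintype.card m : ℝ)⁻¹ * (2 * w.im⁻¹)) := by
        refine mul_le_mul ?_ ?_ (by positivity) (by positivity)
        · exact_mod_cast hr
        · exact mul_le_mul_of_nonneg_right hCn (by positivity)
    _ = _ := by
        rw [div_eq_mul_inv]
        ring

theorem linStat_tail [Nonempty m] (hL : 0 < L) (hw : 0 < w.im) (S : Matrix m m ℂ)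
    {ε : ℝ} (hε : 0 ≤ ε) {σ : ℝ} (hσ : 0 < σ)
    (hσ' : (N + 2 * L - 1 : ℕ) * (8 * L * w.im⁻¹ / Fintype.card m) ^ 2 ≤ σ ^ 2) :
    (gaussianField (N + 2 * L - 1) m).real {Ξ | ε ≤ ‖linStat 1 (bigQ L N (coloredField S Ξ) w) -
      ∫ Ξ, linStat 1 (bigQ L N (coloredField S Ξ) w) ∂(gaussianField (N + 2 * L - 1) m)‖} ≤
      4 * Real.exp (-(ε / 2) ^ 2 / (2 * σ ^ 2)) := by
  refine boundedDifference_tail (Measure.pi fun _ : m => stdComplexGaussian) (N + 2 * L - 1)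
    (fun Ξ => linStat 1 (bigQ L N (coloredField S Ξ) w))
    ((continuous_linStat _).comp (continuous_bigQ_coloredField S hw)).measurable
    (C := ‖(1 : Matrix m m ℂ)‖ * w.im⁻¹)
    (fun Ξ => (norm_linStat_le hL _ _).trans
      (mul_le_mul_of_nonneg_left (norm_bigQ_le hw _) (norm_nonneg _)))
    (fun Ξ i e => ?_) hσ hσ' hε
  refine norm_linStat_bigQ_sub_le hL hw (t₀ := i) fun t ht => ?_
  simp only [coloredField, extendField]
  split_ifs with h
  · rw [Function.update_of_ne]
    intro h2
    exact ht (congrArg Fin.val h2)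
  · rfl

end

/-! ### The empirical eigenvalue distribution -/

theorem integral_empiricalEigDist {p : Type*} [Fintype p] [DecidableEq p] {A : Matrix p p ℂ}
    (hA : A.PosSemidef) {z : ℂ} (hz : 0 < z.im) :
    ∫ x : ℝ, ((x : ℂ) - z)⁻¹ ∂(empiricalEigDist hA.1) =
      (Fintype.card p : ℂ)⁻¹ * (A - z • (1 : Matrix p p ℂ))⁻¹.trace := by
  obtain ⟨V, hV, hAV⟩ := exists_spectral hA.1
  rw [inv_sub_smul_spectral hV hAV hA.eigenvalues_nonneg hz, Matrix.mul_assoc,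
    Matrix.trace_mul_comm, Matrix.mul_assoc, mul_eq_one_comm.1 hV, Matrix.mul_one,
    Matrix.trace_diagonal, empiricalEigDist, integral_smul_measure,
    integral_finsetSum_measure fun k _ => integrable_inv_ofReal_sub _ hz.ne']
  simp only [integral_dirac]
  rw [Complex.real_smul]
  simp

theorem isProbabilityMeasure_empiricalEigDist {p : Type*} [Fintype p] [DecidableEq p] [Nonempty p]
    {A : Matrix p p ℂ} (hA : A.IsHermitian) : IsProbabilityMeasure (empiricalEigDist hA) := by
  refine ⟨?_⟩
  rw [empiricalEigDist, Measure.smul_apply, Measure.coe_finsetSum, Finset.sum_apply]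
  simp only [measure_univ, Finset.sum_const, Finset.card_univ, nsmul_eq_mul, mul_one, smul_eq_mul]
  exact ENNReal.inv_mul_cancel (by simp [Fintype.card_ne_zero]) (by simp)

theorem linStat_one_bigQ {M : ℕ} (L N : ℕ) (y : ℕ → Fin M → ℂ) {w : ℂ} (hre : 0 < w.re)
    (him : 0 < w.im) :
    linStat 1 (bigQ L N y w) = w * ∫ x : ℝ, ((x : ℂ) - w ^ 2)⁻¹ ∂(nuHat L N y) := by
  have hps : (gram L N y).PosSemidef := by
    rw [← crossH_mul_conjTranspose]
    exact Matrix.posSemidef_self_mul_conjTranspose _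
  have h : nuHat L N y = empiricalEigDist hps.1 := rfl
  rw [h, integral_empiricalEigDist hps (im_sq_pos hre him), ← Matrix.diagonal_one,
    linStat_bigQ_eq him (im_sq_pos hre him), crossH_mul_conjTranspose, Matrix.trace,
    Fintype.card_prod, Fintype.card_fin, Fintype.card_fin]
  simp

end

end PastFuture

namespace PastFuture

section

/-! ### The covariance matrix -/

theorem exists_spectral_bounds {p : Type*} [Fintype p] [DecidableEq p] {R : Matrix p p ℂ} {a b : ℝ}
    (ha : (R - (a : ℂ) • (1 : Matrix p p ℂ)).PosSemidef)
    (hb : ((b : ℂ) • (1 : Matrix p p ℂ) - R).PosSemidef) :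
    ∃ (V : Matrix p p ℂ) (lam : p → ℝ), V * Vᴴ = 1 ∧
      R = V * Matrix.diagonal (fun k => (lam k : ℂ)) * Vᴴ ∧ (∀ k, a ≤ lam k) ∧ ∀ k, lam k ≤ b := by
  have hR : R.IsHermitian := by
    have h1 : ((a : ℂ) • (1 : Matrix p p ℂ)).IsHermitian := by
      rw [Matrix.IsHermitian, Matrix.conjTranspose_smul, Matrix.conjTranspose_one, Complex.star_def,
        Complex.conj_ofReal]
    have h2 := ha.1.add h1
    rwa [sub_add_cancel] at h2
  obtain ⟨V, hV, hRV⟩ := exists_spectral hR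
  have hV' := mul_eq_one_comm.1 hV
  have hdiag : Vᴴ * R * V = Matrix.diagonal (fun k => (hR.eigenvalues k : ℂ)) := by
    conv_lhs => rw [hRV]
    rw [Matrix.mul_assoc V, ← Matrix.mul_assoc Vᴴ, hV', Matrix.one_mul, Matrix.mul_assoc, hV',
      Matrix.mul_one]
  have hone : ∀ x : ℂ, Vᴴ * (x • (1 : Matrix p p ℂ)) * V = Matrix.diagonal fun _ => x := by
    intro x
    rw [Matrix.mul_smul, Matrix.mul_one, Matrix.smul_mul, hV', Matrix.smul_one_eq_diagonal]
  refine ⟨V, hR.eigenvalues, hV, hRV, fun k => ?_, fun k => ?_⟩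
  · have h := ha.conjTranspose_mul_mul_same V
    rw [Matrix.mul_sub, Matrix.sub_mul, hdiag, hone, Matrix.diagonal_sub,
      Matrix.posSemidef_diagonal_iff] at h
    have h1 := h k
    rw [← Complex.ofReal_sub, Complex.zero_le_real] at h1
    linarith
  · have h := hb.conjTranspose_mul_mul_same V
    rw [Matrix.mul_sub, Matrix.sub_mul, hdiag, hone, Matrix.diagonal_sub,
      Matrix.posSemidef_diagonal_iff] at h
    have h1 := h k
    rw [← Complex.ofReal_sub, Complex.zero_le_real] at h1
    linarith

theorem exists_colored_eq {M : ℕ} {R : Matrix (Fin M) (Fin M) ℂ} (hR : R.PosSemidef) :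
    ∃ S : Matrix (Fin M) (Fin M) ℂ, S * Sᴴ = R ∧ ∀ ξ, colored R ξ = S *ᵥ ξ := by
  refine ⟨CFC.sqrt R, ?_, fun _ => rfl⟩
  have h1 : (CFC.sqrt R)ᴴ = CFC.sqrt R :=
    (Matrix.nonneg_iff_posSemidef.1 (CFC.sqrt_nonneg R)).1
  rw [h1]
  exact CFC.sqrt_mul_sqrt_self R (Matrix.nonneg_iff_posSemidef.2 hR)

/-! ### The empirical measure -/

/-- In the regime M ≥ cN/L the variance proxy is O(1/N): about N coordinates, each with influence
O(1/N). The condition 2L ≤ N only serves to bound N + 2L - 1 by 2N. -/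
theorem sum_bound_le {L N M : ℕ} (hN : 0 < N) (hM : 0 < M) {c η : ℝ} (hc : 0 < c) (hη : 0 < η)
    (h : c ≤ ratio M L N) (hNL : 2 * L ≤ N) :
    ((N + 2 * L - 1 : ℕ) : ℝ) * (8 * L * η⁻¹ / M) ^ 2 ≤ 128 * L ^ 4 * η⁻¹ ^ 2 / (c ^ 2 * N) := by
  have hN' : (0 : ℝ) < N := by exact_mod_cast hN
  have hM' : (0 : ℝ) < M := by exact_mod_cast hM
  have h1 : ((N + 2 * L - 1 : ℕ) : ℝ) ≤ 2 * N := by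
    have : N + 2 * L - 1 ≤ 2 * N := by omega
    exact_mod_cast this
  have h2 : 8 * L * η⁻¹ / M ≤ 8 * L * η⁻¹ * L / (c * N) := by
    rw [ratio, le_div_iff₀ hN'] at h
    rw [div_le_div_iff₀ hM' (by positivity)]
    calc _ ≤ 8 * L * η⁻¹ * (M * L) := mul_le_mul_of_nonneg_left h (by positivity)
      _ = _ := by ring
  calc _ ≤ 2 * N * (8 * L * η⁻¹ * L / (c * N)) ^ 2 := by gcongr
    _ = _ := by
        field_simp
        ring

end

end PastFuture

namespace PastFuture

section

open scoped Matrix.Norms.L2Operator Kronecker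

set_option linter.unusedSectionVars false

/-! ### Almost sure convergence -/

theorem linStat_bigQ_colored {M : ℕ} {R S : Matrix (Fin M) (Fin M) ℂ}
    (hS : ∀ ξ, colored R ξ = S *ᵥ ξ) (L N : ℕ) (x : ℕ → Fin M → ℂ) {w : ℂ} (hre : 0 < w.re)
    (him : 0 < w.im) :
    linStat 1 (bigQ L N (coloredField S fun (n : Fin (N + 2 * L - 1)) j => x n j) w) =
      w * ∫ l : ℝ, ((l : ℂ) - w ^ 2)⁻¹ ∂(nuHat L N fun n => colored R (x n)) := by
  rw [← linStat_one_bigQ L N _ hre him, bigQ, bigQ, bigH, bigH, bigW_congr]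
  intro t ht
  rw [hS, coloredField, extendField, dif_pos ht]

theorem norm_integral_linStat_sub_le {L : ℕ} (hL : 0 < L) {a b c₁ c₂ : ℝ} (ha : 0 < a)
    (hb : 0 < b) (hc₁ : 0 < c₁) (hc₂ : 0 < c₂) {w : ℂ} (hre : 0 < w.re) (him : 0 < w.im) {ε : ℝ}
    (hε : 0 < ε) :
    ∃ N₀ : ℕ, ∀ N, N₀ ≤ N → 0 < N → ∀ {M : ℕ} {R S : Matrix (Fin M) (Fin M) ℂ}, 0 < M →
      (R - (a : ℂ) • (1 : Matrix (Fin M) (Fin M) ℂ)).PosSemidef →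
      ((b : ℂ) • (1 : Matrix (Fin M) (Fin M) ℂ) - R).PosSemidef → S * Sᴴ = R →
      c₁ ≤ ratio M L N → ratio M L N ≤ c₂ →
      ‖(∫ Ξ, linStat 1 (bigQ L N (coloredField S Ξ) w) ∂(gaussianField (N + 2 * L - 1) (Fin M))) -
        w * ∫ l : ℝ, ((l : ℂ) - w ^ 2)⁻¹ ∂(nu R (ratio M L N))‖ ≤ ε := by
  obtain ⟨N₀, h⟩ := exists_deterministic_equivalent L hL ha hb hc₁ hc₂ him hε
  refine ⟨N₀, fun N hN hN0 M R S hM hRa hRb hS h1 h2 => ?_⟩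
  obtain ⟨V, lam, hV, hR, hla, hlb⟩ := exists_spectral_bounds hRa hRb
  have : Nonempty (Fin M) := ⟨⟨0, hM⟩⟩
  have hw : w ≠ 0 := fun h => by simp [h] at hre
  have hr : (L / N : ℝ) * Fintype.card (Fin M) = ratio M L N := by
    rw [ratio, Fintype.card_fin]
    ring
  obtain ⟨s, hs, hs', -, hT⟩ := exists_fixedPoint_kappa ha hb hM hL hN0 hV hR hla hlb hre him
  have hone : ‖(1 : Matrix (Fin M) (Fin M) ℂ)‖ ≤ 1 := by
    refine l2_opNorm_le_of_mulVec _ zero_le_one fun v => ?_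
    rw [one_mulVec, one_mul]
  have h3 := h N hN S V lam hV (hS.trans hR) hla hlb (h1.trans hr.ge) (hr.le.trans h2) s hs hs' 1
    hone
  have hz := im_sq_pos hre him
  have htr : (Fintype.card (Fin M) : ℂ)⁻¹ *
      ((1 : Matrix (Fin M) (Fin M) ℂ) * ratInv (S * Sᴴ) w (hFun s)).trace =
      w * ∫ l : ℝ, ((l : ℂ) - w ^ 2)⁻¹ ∂(nu R (ratio M L N)) := by
    rw [(nu_spec ha hb hM hL hN0 hV hR hla hlb).2.2 _ hz, Matrix.one_mul, hS, Fintype.card_fin]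
    have h4 := TMat_spectral ha hb hM hL hN0 hV hR hla hlb hz
    rw [hT] at h4
    have h5 := congrArg Matrix.trace h4
    rw [Matrix.trace_smul, Matrix.mul_assoc, Matrix.trace_mul_comm, Matrix.mul_assoc,
      mul_eq_one_comm.1 hV, Matrix.mul_one, Matrix.trace_diagonal, smul_eq_mul] at h5
    rw [← h5]
    field_simp
  rw [htr] at h3
  refine le_trans ?_ h3
  have h6 := integrable_linStat_bigQ (N := N) hL S 1 him (N + 2 * L - 1)
  have h7 := norm_integral_le_integral_norm (μ := gaussianField (N + 2 * L - 1) (Fin M))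
    fun Ξ => linStat 1 (bigQ L N (coloredField S Ξ) w) -
      w * ∫ l : ℝ, ((l : ℂ) - w ^ 2)⁻¹ ∂(nu R (ratio M L N))
  rw [integral_sub h6 (integrable_const _), integral_const] at h7
  simpa using h7

section

variable {Ω : Type*} [MeasurableSpace Ω] {P : Measure Ω} [IsProbabilityMeasure P]
    {L : ℕ} {M : ℕ → ℕ} {cstar : ℝ} {a b : ℝ}
    {R : (N : ℕ) → Matrix (Fin (M N)) (Fin (M N)) ℂ}
    {ξ : (N : ℕ) → ℕ → Fin (M N) → Ω → ℂ}

/-- The deviation probabilities are summable, so the first Borel–Cantelli lemma applies; it requires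
nothing about the joint law for different N. -/
theorem ae_eventually_norm_sub_lt (hL : 0 < L) (hM : ∀ N, 1 ≤ N → 0 < M N) (hcstar : 0 < cstar)
    (hregime : Tendsto (fun N => ratio (M N) L N) atTop (𝓝 cstar))
    (hξ : ∀ N, 1 ≤ N → IsStdComplexGaussianFamily P (fun k : ℕ × Fin (M N) => ξ N k.1 k.2))
    (S : (N : ℕ) → Matrix (Fin (M N)) (Fin (M N)) ℂ) {w : ℂ} (hw : 0 < w.im) {ε : ℝ}
    (hε : 0 < ε) :
    ∀ᵐ ω ∂P, ∀ᶠ N in atTop,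
      ‖linStat 1 (bigQ L N (coloredField (S N) fun (n : Fin (N + 2 * L - 1)) j => ξ N n j ω) w) -
        ∫ Ξ, linStat 1 (bigQ L N (coloredField (S N) Ξ) w)
          ∂(gaussianField (N + 2 * L - 1) (Fin (M N)))‖ < ε := by
  have hL' : (0 : ℝ) < L := by exact_mod_cast hL
  obtain ⟨A, hA⟩ : ∃ A : ℝ, A = 128 * L ^ 4 * w.im⁻¹ ^ 2 / (cstar / 2) ^ 2 := ⟨_, rfl⟩
  have hA0 : 0 < A := by rw [hA]; positivity
  -- With σ² = A/N the Gaussian tail is exactly 4qᴺ.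
  obtain ⟨q, hq⟩ : ∃ q : ℝ, q = Real.exp (-((ε / 2) ^ 2 / (2 * A))) := ⟨_, rfl⟩
  have hq0 : 0 ≤ q := by rw [hq]; positivity
  have hq1 : q < 1 := by
    rw [hq, Real.exp_lt_one_iff]
    have : 0 < (ε / 2) ^ 2 / (2 * A) := by positivity
    linarith
  have hev : ∀ᶠ N in atTop, cstar / 2 ≤ ratio (M N) L N ∧ 2 * L ≤ N ∧ 1 ≤ N :=
    (hregime.eventually (le_mem_nhds (half_lt_self hcstar))).and
      ((eventually_ge_atTop _).and (eventually_ge_atTop _))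
  obtain ⟨N₁, hN₁⟩ := eventually_atTop.1 hev
  obtain ⟨s, hs⟩ : ∃ s : (N : ℕ) → Set (Fin (N + 2 * L - 1) → Fin (M N) → ℂ), s = fun N =>
      {Ξ | ε ≤ ‖linStat 1 (bigQ L N (coloredField (S N) Ξ) w) -
        ∫ Ξ, linStat 1 (bigQ L N (coloredField (S N) Ξ) w)
          ∂(gaussianField (N + 2 * L - 1) (Fin (M N)))‖} := ⟨_, rfl⟩
  have hmeas : ∀ N, MeasurableSet (s N) := fun N => by
    rw [hs]
    exact measurableSet_le measurable_const
      (((continuous_linStat _).comp (continuous_bigQ_coloredField (S N) hw)).sub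
        continuous_const).norm.measurable
  have hbound : ∀ N, N₁ ≤ N →
      P ((fun ω (n : Fin (N + 2 * L - 1)) j => ξ N n j ω) ⁻¹' s N) ≤ ENNReal.ofReal (4 * q ^ N) := by
    intro N hN
    obtain ⟨h1, h2, h3⟩ := hN₁ N hN
    have hN' : (0 : ℝ) < N := by exact_mod_cast h3
    have : Nonempty (Fin (M N)) := ⟨⟨0, hM N h3⟩⟩
    obtain ⟨hX, hmap⟩ := (hξ N h3).map_eq (N + 2 * L - 1)
    rw [← Measure.map_apply_of_aemeasurable hX (hmeas N), hmap, ← ofReal_measureReal]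
    refine ENNReal.ofReal_le_ofReal ?_
    have hσ : 0 < √(A / N) := Real.sqrt_pos.2 (by positivity)
    have h4 := linStat_tail (m := Fin (M N)) hL hw (S N) hε.le hσ (by
      rw [Real.sq_sqrt (by positivity), Fintype.card_fin]
      refine (sum_bound_le h3 (hM N h3) (half_pos hcstar) hw h1 h2).trans (le_of_eq ?_)
      rw [hA, div_div])
    rw [hs]
    refine h4.trans (le_of_eq ?_)
    rw [Real.sq_sqrt (by positivity), hq, ← Real.exp_nat_mul]
    congr 2
    field_simp
  -- The geometric bound is available only from N₁ on, hence the shift of the index.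
  have hsum : ∑' N, P ((fun ω (n : Fin ((N + N₁) + 2 * L - 1)) j => ξ (N + N₁) n j ω) ⁻¹'
      s (N + N₁)) ≠ ⊤ := by
    refine ne_top_of_le_ne_top ?_ (ENNReal.tsum_le_tsum fun N => hbound (N + N₁) (by omega))
    refine Summable.tsum_ofReal_ne_top ?_
    exact ((summable_nat_add_iff N₁).2 (summable_geometric_of_lt_one hq0 hq1)).mul_left 4
  filter_upwards [ae_eventually_notMem hsum] with ω hω
  obtain ⟨N₂, hN₂⟩ := eventually_atTop.1 hω
  refine eventually_atTop.2 ⟨N₂ + N₁, fun N hN => ?_⟩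
  obtain ⟨K, rfl⟩ : ∃ K, N = K + N₁ := ⟨N - N₁, by omega⟩
  have h := hN₂ K (by omega)
  rw [hs] at h
  exact not_le.1 h

theorem ae_tendsto_stieltjes_sub (hL : 0 < L) (hM : ∀ N, 1 ≤ N → 0 < M N) (hcstar : 0 < cstar)
    (hregime : Tendsto (fun N => ratio (M N) L N) atTop (𝓝 cstar)) (ha : 0 < a) (hb : 0 < b)
    (hRa : ∀ N, 1 ≤ N → (R N - (a : ℂ) • (1 : Matrix (Fin (M N)) (Fin (M N)) ℂ)).PosSemidef)
    (hRb : ∀ N, 1 ≤ N → ((b : ℂ) • (1 : Matrix (Fin (M N)) (Fin (M N)) ℂ) - R N).PosSemidef)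
    (hξ : ∀ N, 1 ≤ N → IsStdComplexGaussianFamily P (fun k : ℕ × Fin (M N) => ξ N k.1 k.2))
    {z : ℂ} (hz : 0 < z.im) :
    ∀ᵐ ω ∂P, Tendsto (fun N =>
      (∫ x : ℝ, ((x : ℂ) - z)⁻¹ ∂(nuHat L N fun n => colored (R N) fun m => ξ N n m ω)) -
        ∫ x : ℝ, ((x : ℂ) - z)⁻¹ ∂(nu (R N) (ratio (M N) L N))) atTop (𝓝 0) := by
  obtain ⟨w, rfl, hre, him⟩ := exists_sq_eq_quadrant hz
  have hw : w ≠ 0 := fun h => by simp [h] at hre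
  have hwn : 0 < ‖w‖ := norm_pos_iff.2 hw
  -- At N = 0 nothing is assumed on R, and S takes a dummy value there.
  have hSex : ∀ N, ∃ S : Matrix (Fin (M N)) (Fin (M N)) ℂ,
      1 ≤ N → S * Sᴴ = R N ∧ ∀ ξ, colored (R N) ξ = S *ᵥ ξ := by
    intro N
    by_cases hN : 1 ≤ N
    · have hps : (R N).PosSemidef := by
        have h1 := (hRa N hN).add (Matrix.PosSemidef.one.smul
          (Complex.zero_le_real.2 ha.le) : ((a : ℂ) • (1 : Matrix (Fin (M N)) _ ℂ)).PosSemidef)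
        rwa [sub_add_cancel] at h1
      obtain ⟨S, hS⟩ := exists_colored_eq hps
      exact ⟨S, fun _ => hS⟩
    · exact ⟨0, fun h => absurd h hN⟩
  choose S hS using hSex
  -- Countably many tolerances 1/(l + 1) keep the exceptional set null.
  have h1 := fun l : ℕ => ae_eventually_norm_sub_lt (P := P) hL hM hcstar hregime hξ S him
    (ε := 1 / ((l : ℝ) + 1)) (by positivity)
  filter_upwards [ae_all_iff.2 h1] with ω hω
  rw [Metric.tendsto_nhds]
  intro ε hε
  obtain ⟨l, hl⟩ := exists_nat_one_div_lt (show 0 < ε * ‖w‖ / 2 by positivity)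
  obtain ⟨N₀, hN₀⟩ := norm_integral_linStat_sub_le hL ha hb (half_pos hcstar)
    (c₂ := 2 * cstar) (by positivity) hre him (ε := ε * ‖w‖ / 2) (by positivity)
  filter_upwards [hω l, eventually_ge_atTop N₀, eventually_ge_atTop 1,
    hregime.eventually (le_mem_nhds (half_lt_self hcstar)),
    hregime.eventually (ge_mem_nhds (show cstar < 2 * cstar by linarith))] with N e1 e2 e3 e4 e5
  have h2 := hN₀ N e2 e3 (hM N e3) (hRa N e3) (hRb N e3) (hS N e3).1 e4 e5
  rw [linStat_bigQ_colored (hS N e3).2 L N (fun n j => ξ N n j ω) hre him] at e1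
  have h3 := norm_sub_le_norm_sub_add_norm_sub
    (w * ∫ l : ℝ, ((l : ℂ) - w ^ 2)⁻¹ ∂(nuHat L N fun n => colored (R N) fun m => ξ N n m ω))
    (∫ Ξ, linStat 1 (bigQ L N (coloredField (S N) Ξ) w)
          ∂(gaussianField (N + 2 * L - 1) (Fin (M N))))
    (w * ∫ l : ℝ, ((l : ℂ) - w ^ 2)⁻¹ ∂(nu (R N) (ratio (M N) L N)))
  rw [← mul_sub, norm_mul] at h3
  rw [dist_zero_right]
  have h4 : ‖w‖ * ‖(∫ l : ℝ, ((l : ℂ) - w ^ 2)⁻¹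
      ∂(nuHat L N fun n => colored (R N) fun m => ξ N n m ω)) -
      ∫ l : ℝ, ((l : ℂ) - w ^ 2)⁻¹ ∂(nu (R N) (ratio (M N) L N))‖ < ‖w‖ * ε := by
    linarith
  exact lt_of_mul_lt_mul_left h4 hwn.le

end

/-- Pointwise convergence of differences of Stieltjes transforms on a dense set implies
convergence everywhere. -/
theorem tendsto_stieltjes_sub_of_dense (μ ν : ℕ → Measure ℝ) [∀ n, IsProbabilityMeasure (μ n)]
    [∀ n, IsProbabilityMeasure (ν n)] {D : Set {z : ℂ // 0 < z.im}} (hD : Dense D)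
    (h : ∀ z ∈ D, Tendsto (fun n => (∫ x : ℝ, ((x : ℂ) - z)⁻¹ ∂(μ n)) -
      ∫ x : ℝ, ((x : ℂ) - z)⁻¹ ∂(ν n)) atTop (𝓝 0)) {z : ℂ} (hz : 0 < z.im) :
    Tendsto (fun n => (∫ x : ℝ, ((x : ℂ) - z)⁻¹ ∂(μ n)) -
      ∫ x : ℝ, ((x : ℂ) - z)⁻¹ ∂(ν n)) atTop (𝓝 0) := by
  rw [Metric.tendsto_nhds]
  intro ε hε
  have hc : ContinuousAt (fun z' : {z : ℂ // 0 < z.im} =>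
      ‖z - z'.1‖ * (z.im⁻¹ * z'.1.im⁻¹)) ⟨z, hz⟩ := by
    refine ContinuousAt.mul (by fun_prop) (ContinuousAt.mul continuousAt_const ?_)
    exact ContinuousAt.inv₀ (by fun_prop) hz.ne'
  have hev : ∀ᶠ z' in 𝓝 (⟨z, hz⟩ : {z : ℂ // 0 < z.im}),
      ‖z - z'.1‖ * (z.im⁻¹ * z'.1.im⁻¹) < ε / 3 := by
    refine hc.eventually_lt continuousAt_const ?_
    simpa using hε
  -- A point z' of D so close to z that each of the two transforms varies by less than ε/3, by the
  -- Lipschitz bound common to all probability measures.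
  obtain ⟨z', hz'D, hz'⟩ := (mem_closure_iff_frequently.1 (hD ⟨z, hz⟩)).and_eventually hev |>.exists
  filter_upwards [Metric.tendsto_nhds.1 (h z' hz'D) (ε / 3) (by positivity)] with n hn
  rw [dist_zero_right] at hn ⊢
  have h1 := norm_stieltjes_sub_le (μ n) hz z'.2
  have h2 := norm_stieltjes_sub_le (ν n) hz z'.2
  have e : (∫ x : ℝ, ((x : ℂ) - z)⁻¹ ∂(μ n)) - ∫ x : ℝ, ((x : ℂ) - z)⁻¹ ∂(ν n) =
      ((∫ x : ℝ, ((x : ℂ) - z)⁻¹ ∂(μ n)) - ∫ x : ℝ, ((x : ℂ) - z')⁻¹ ∂(μ n)) +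
      ((∫ x : ℝ, ((x : ℂ) - z')⁻¹ ∂(μ n)) - ∫ x : ℝ, ((x : ℂ) - z')⁻¹ ∂(ν n)) -
      ((∫ x : ℝ, ((x : ℂ) - z)⁻¹ ∂(ν n)) - ∫ x : ℝ, ((x : ℂ) - z')⁻¹ ∂(ν n)) := by ring
  rw [e]
  refine (norm_sub_le _ _).trans_lt ?_
  have h3 := norm_add_le ((∫ x : ℝ, ((x : ℂ) - z)⁻¹ ∂(μ n)) - ∫ x : ℝ, ((x : ℂ) - z')⁻¹ ∂(μ n))
    ((∫ x : ℝ, ((x : ℂ) - z')⁻¹ ∂(μ n)) - ∫ x : ℝ, ((x : ℂ) - z')⁻¹ ∂(ν n))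
  linarith

end

end PastFuture

/-! ### The main theorem -/

theorem mainTheorem1 {Ω : Type*} [MeasurableSpace Ω] (P : Measure Ω) [IsProbabilityMeasure P]
    (L : ℕ) (hL : 0 < L) (M : ℕ → ℕ) (hM : ∀ N, 1 ≤ N → 0 < M N)
    (cstar : ℝ) (hcstar : 0 < cstar)
    (hregime : Tendsto (fun N => PastFuture.ratio (M N) L N) atTop (𝓝 cstar))
    (a b : ℝ) (ha : 0 < a) (hb : 0 < b)
    (R : (N : ℕ) → Matrix (Fin (M N)) (Fin (M N)) ℂ)
    (hRa : ∀ N, 1 ≤ N → (R N - (a : ℂ) • (1 : Matrix (Fin (M N)) (Fin (M N)) ℂ)).PosSemidef)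
    (hRb : ∀ N, 1 ≤ N → ((b : ℂ) • (1 : Matrix (Fin (M N)) (Fin (M N)) ℂ) - R N).PosDef)
    (ξ : (N : ℕ) → ℕ → Fin (M N) → Ω → ℂ)
    (hξ : ∀ N, 1 ≤ N →
      PastFuture.IsStdComplexGaussianFamily P (fun k : ℕ × Fin (M N) => ξ N k.1 k.2)) :
    -- the deterministic measures `ν_N` are well defined, and are probability measures
    (∀ N, 1 ≤ N →
      (∀ z : ℂ, 0 < z.im →
        ∃! t : ℂ, PastFuture.IsCanonicalSolution (R N) (PastFuture.ratio (M N) L N) z t) ∧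
      (∃! μ : PastFuture.PosMatrixMeasure (M N),
        μ.HasStieltjesTransform (PastFuture.TMat (R N) (PastFuture.ratio (M N) L N))) ∧
      IsProbabilityMeasure (PastFuture.nu (R N) (PastFuture.ratio (M N) L N))) ∧
    -- almost surely, `ν̂_N - ν_N → 0` weakly
    ∀ᵐ ω ∂P, ∀ f : ℝ →ᵇ ℝ,
      Tendsto (fun N =>
        (∫ x, f x ∂(PastFuture.nuHat L N
            (fun n => PastFuture.colored (R N) (fun m => ξ N n m ω)))) -
          ∫ x, f x ∂(PastFuture.nu (R N) (PastFuture.ratio (M N) L N)))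
        atTop (𝓝 0) := by
  have hb' := fun N hN => (hRb N hN).posSemidef
  have hspec := fun N (hN : 1 ≤ N) => PastFuture.exists_spectral_bounds (hRa N hN) (hb' N hN)
  refine ⟨fun N hN => ?_, ?_⟩
  · obtain ⟨V, lam, hV, hR, hla, hlb⟩ := hspec N hN
    have h := PastFuture.nu_spec ha hb (hM N hN) hL hN hV hR hla hlb
    exact ⟨fun z hz => PastFuture.existsUnique_isCanonicalSolution ha hb (hM N hN) hL hN hV hR
      hla hlb hz, h.1, h.2.1⟩
  · obtain ⟨D, hDc, hD⟩ := TopologicalSpace.exists_countable_dense {z : ℂ // 0 < z.im}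
    have hae : ∀ᵐ ω ∂P, ∀ z ∈ D, Tendsto (fun N =>
        (∫ x : ℝ, ((x : ℂ) - z)⁻¹ ∂(PastFuture.nuHat L N
          fun n => PastFuture.colored (R N) fun m => ξ N n m ω)) -
        ∫ x : ℝ, ((x : ℂ) - z)⁻¹ ∂(PastFuture.nu (R N) (PastFuture.ratio (M N) L N)))
        atTop (𝓝 0) :=
      (ae_ball_iff hDc).2 fun z _ => PastFuture.ae_tendsto_stieltjes_sub hL hM hcstar hregime
        ha hb hRa hb' hξ z.2
    filter_upwards [hae] with ω hω f
    -- The index is shifted because the measures need not be probability measures at N = 0.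
    rw [← tendsto_add_atTop_iff_nat 1]
    have hμ : ∀ N, IsProbabilityMeasure (PastFuture.nuHat L (N + 1)
        fun n => PastFuture.colored (R (N + 1)) fun m => ξ (N + 1) n m ω) := fun N => by
      have : Nonempty (Fin L × Fin (M (N + 1))) := ⟨⟨0, hL⟩, ⟨0, hM _ N.succ_pos⟩⟩
      exact PastFuture.isProbabilityMeasure_empiricalEigDist _
    have hν : ∀ N, IsProbabilityMeasure (PastFuture.nu (R (N + 1))
        (PastFuture.ratio (M (N + 1)) L (N + 1))) := fun N => by
      obtain ⟨V, lam, hV, hR, hla, hlb⟩ := hspec (N + 1) N.succ_pos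
      exact (PastFuture.nu_spec ha hb (hM _ N.succ_pos) hL N.succ_pos hV hR hla hlb).2.1
    refine PastFuture.tendsto_integral_sub_of_stieltjes
      (fun N => PastFuture.nuHat L (N + 1)
        fun n => PastFuture.colored (R (N + 1)) fun m => ξ (N + 1) n m ω)
      (fun N => PastFuture.nu (R (N + 1)) (PastFuture.ratio (M (N + 1)) L (N + 1))) ?_ ?_ f
    -- Tightness of ν_N: its transform is the average of the scalar ones, so the uniform estimate
    -- with C = 2c_* passes to it as soon as c_N ≤ 2c_*.
    · intro ε hε
      obtain ⟨y, hy, h⟩ := PastFuture.exists_norm_one_add_le hb (C := 2 * cstar) (by positivity) hε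
      refine ⟨y, hy, ?_⟩
      have hle := ((tendsto_add_atTop_iff_nat 1).2 hregime).eventually
        (ge_mem_nhds (show cstar < 2 * cstar by linarith))
      filter_upwards [hle] with N hN
      obtain ⟨V, lam, hV, hR, hla, hlb⟩ := hspec (N + 1) N.succ_pos
      have hM0 := hM _ N.succ_pos
      have hMR : (0 : ℝ) < M (N + 1) := by exact_mod_cast hM0
      have hMC : (M (N + 1) : ℂ) ≠ 0 := by exact_mod_cast hM0.ne'
      rw [(PastFuture.nu_spec ha hb hM0 hL N.succ_pos hV hR hla hlb).2.2 _ (by simpa using hy)]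
      have e : ∀ g : Fin (M (N + 1)) → ℂ, 1 + Complex.I * y * ((M (N + 1) : ℂ)⁻¹ * ∑ j, g j) =
          (M (N + 1) : ℂ)⁻¹ * ∑ j, (1 + Complex.I * y * g j) := by
        intro g
        rw [Finset.sum_add_distrib, ← Finset.mul_sum, mul_add]
        simp only [Finset.sum_const, Finset.card_univ, Fintype.card_fin, nsmul_eq_mul, mul_one]
        rw [inv_mul_cancel₀ hMC]
        ring
      rw [e, norm_mul, norm_inv, Complex.norm_natCast, inv_mul_le_iff₀ hMR]
      refine (norm_sum_le_of_le _ fun j _ =>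
        h ha hM0 hL N.succ_pos hV hR hla hlb hN j).trans (by simp)
    · intro z hz
      exact PastFuture.tendsto_stieltjes_sub_of_dense _ _ hD
        (fun z hz => (tendsto_add_atTop_iff_nat 1).2 (hω z hz)) hz
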